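/- A multi-knotoid diagram $K$ in the oriented sphere $S^2$ is a generic immersion into $S^2$ of one oriented segment (running from its leg to its head) and of $m\ge 0$ oriented circles, whose only singularities are transversal double points (crossings), distinct from the endpoints of the segment and endowed with over/undercrossing data; for $m=0$ it is a knotoid diagram. Let $w(K)$ be the sum of the signs of the crossings. A shortcut for $K$ is an embedded arc $a\subset S^2$ from the leg to the head which otherwise meets $K$ transversely in a finite set of points distinct from the crossings. A state $s\in S(K)$ assigns $\pm1$ to each crossing; $\sigma_s$ is the sum of its values, $K_s$ is the $1$-manifold obtained from $K$ by $A$-smoothing the crossings with value $+1$ and $B$-smoothing those with value $-1$, $|s|$ is the number of components of $K_s$, and $k_s$ is its segment component, oriented from the leg to the head. Let $k_s\cdot a$ be the number of times $k_s$ crosses $a$ from right to left minus the number of times it crosses $a$ from left to right (endpoints not counted), and define $K\cdot a$ similarly, using all components of $K$. Set $$\langle\langle K\rangle\rangle_\circ=(-A^3)^{-w(K)}\,u^{-K\cdot a}\sum_{s\in S(K)}A^{\sigma_s}u^{k_s\cdot a}(-A^2-A^{-2})^{|s|-1}\in\mathbb Z[A^{\pm1},u^{\pm1}].$$ **Lemma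 7.1.** The polynomial $\langle\langle K\rangle\rangle_\circ$ does not depend on the choice of the shortcut $a$, and it is invariant under the Reidemeister moves $\Omega_1,\Omega_2,\Omega_3$ on $K$ (performed in closed disks in $S^2$ disjoint from the endpoints of the segment). Consequently it is an invariant of knotoids and multi-knotoids: if two multi-knotoid diagrams in $S^2$ are related by a finite sequence of ambient isotopies of $S^2$, Reidemeister moves and their inverses, then their polynomials, computed with any shortcuts, are equal. -/

import Mathlib

open scoped ContDiff

noncomputable section

namespace Knotoid

/-! ## The sphere, parameters, and double points of a family of curves -/

/-- Euclidean 3-space; `S²` is its unit sphere. -/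
abbrev E3 : Type := EuclideanSpace ℝ (Fin 3)

/-- The determinant of three vectors. At a point `x` of the unit sphere, oriented as the boundary
of the unit ball, a pair of tangent vectors `(v, w)` is a positive basis iff `0 < det3 x v w`;
so `w` points to the left of `v` iff `0 < det3 x v w`. -/
def det3 (x v w : E3) : ℝ :=
  Matrix.det !![x 0, x 1, x 2; v 0, v 1, v 2; w 0, w 1, w 2]

/-- A point on the source of a multi-knotoid diagram with `m` circle components.
`(none, t)`, `0 ≤ t ≤ 1`, is a point of the segment, running from the leg (`t = 0`) to the
head (`t = 1`); `(some i, t)`, `t ∈ ℝ`, is a point of the `i`-th circle `ℝ/ℤ`. -/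
abbrev Param (m : ℕ) : Type := Option (Fin m) × ℝ

/-- Parameters that are really in use: the segment is parametrized by `[0,1]`. -/
def Dom {m : ℕ} (p : Param m) : Prop := p.1 = none → p.2 ∈ Set.Icc (0 : ℝ) 1

/-- Two parameters describe the same point of the source (`[0,1]` or `ℝ/ℤ`). -/
def SamePoint {m : ℕ} (p q : Param m) : Prop :=
  p.1 = q.1 ∧ (p.2 = q.2 ∨ (p.1 ≠ none ∧ ∃ n : ℤ, q.2 = p.2 + n))

/-- The velocity vector of a family of curves. -/
def vel {m : ℕ} (γ : Param m → E3) (p : Param m) : E3 := deriv (fun t => γ (p.1, t)) p.2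

/-- Two different points `p`, `q` of the source with the same image. -/
def Meet {m : ℕ} (γ : Param m → E3) (p q : Param m) : Prop :=
  Dom p ∧ Dom q ∧ ¬ SamePoint p q ∧ γ p = γ q

/-! ## Multi-knotoid diagrams in `S²` -/

/-- A multi-knotoid diagram in `S²` with one oriented segment and `m` oriented circles: a generic
smooth immersion into `S²` whose only singularities are transversal double points, different from
the endpoints of the segment, with over/under-crossing data. For `m = 0` this is a knotoid
diagram. Only the restriction of `γ` to parameters satisfying `Dom` is meaningful. -/
structure Diagram (m : ℕ) where
  /-- the immersion -/
  γ : Param m → E3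
  /-- the over/under data: at a double point, exactly one of the two parameters is `isOver` -/
  isOver : Param m → Prop
  smooth : ∀ i, ContDiff ℝ ∞ (fun t : ℝ => γ (i, t))
  periodic : ∀ (i : Fin m) (t : ℝ), γ (some i, t + 1) = γ (some i, t)
  mem_sphere : ∀ p, Dom p → ‖γ p‖ = 1
  immersed : ∀ p, Dom p → vel γ p ≠ 0
  transverse : ∀ p q, Meet γ p q → det3 (γ p) (vel γ p) (vel γ q) ≠ 0
  no_triple : ∀ p q r, Meet γ p q → Meet γ p r → SamePoint q r
  endpoints : ∀ p q, Meet γ p q → p ≠ (none, 0) ∧ p ≠ (none, 1)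
  /-- there are finitely many crossings (automatic by compactness) -/
  finite_crossings : {x : E3 | ∃ p q, Meet γ p q ∧ γ p = x}.Finite
  over_periodic : ∀ (i : Fin m) (t : ℝ), isOver (some i, t + 1) ↔ isOver (some i, t)
  over_iff : ∀ p q, Meet γ p q → (isOver p ↔ ¬ isOver q)

namespace Diagram

variable {m : ℕ} (K : Diagram m)

/-- The leg of the diagram. -/
def leg : E3 := K.γ (none, 0)

/-- The head of the diagram. -/
def head : E3 := K.γ (none, 1)

/-- `p` is one of the two points of the source over a crossing. -/
def Double (p : Param m) : Prop := ∃ q, Meet K.γ p q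

/-- `p` is a point of the source that does not lie over a crossing. -/
def Regular (p : Param m) : Prop := Dom p ∧ ¬ K.Double p

/-- The crossings (double points in `S²`) of the diagram. -/
def Crossing : Type := {x : E3 // ∃ p q, Meet K.γ p q ∧ K.γ p = x}

instance : Finite K.Crossing := K.finite_crossings.to_subtype

instance : Fintype K.Crossing := Fintype.ofFinite _

instance : DecidableEq K.Crossing := Classical.decEq _

open Classical in
/-- The sign of a crossing: `+1` iff (overpassing direction, underpassing direction) is a positive
basis of the tangent plane. -/
def sign (c : K.Crossing) : ℤˣ :=
  if ∃ p q, Meet K.γ p q ∧ K.γ p = c.1 ∧ K.isOver p ∧ 0 < det3 (K.γ p) (vel K.γ p) (vel K.γ q)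
  then 1 else -1

/-- The writhe: the sum of the signs of the crossings. -/
def writhe : ℤ := ∑ c, (K.sign c : ℤ)

/-! ## States and smoothings -/

/-- A state: a map from the set of crossings to `{-1, +1}`. -/
abbrev State : Type := K.Crossing → ℤˣ

/-- `σ_s`, the sum of the values of the state `s`. -/
def sigma (s : K.State) : ℤ := ∑ c, (s c : ℤ)

/-- The regular point `p'` of the source, moving in the direction `ε` (`1`: along the orientation
of the diagram, `-1`: against it) runs into the double parameter `p` before meeting any other
crossing. Equivalently, `p` left in the direction `-ε` leads to `p'`. -/
def Approach (p' : Param m) (ε : ℤˣ) (p : Param m) : Prop :=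
  K.Regular p' ∧ p'.1 = p.1 ∧ 0 < ((ε : ℤ) : ℝ) * (p.2 - p'.2) ∧
    ∀ t ∈ Set.uIcc p'.2 p.2, t ≠ p.2 → ¬ K.Double (p.1, t)

/-- Motion of an oriented point along the smoothed 1-manifold `K_s`. The 1-manifold `K_s` consists
of the arcs of the diagram between crossings, joined at every crossing according to the state:
an `A`-smoothing at crossings with `s c = 1` and a `B`-smoothing at crossings with `s c = -1`.
(The `A`-smoothing merges the two regions swept when the overpassing branch is rotated
counterclockwise to the underpassing one.)
At a positive crossing the `A`-smoothing is the one that respects the orientation of the diagram,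
at a negative crossing the `B`-smoothing is. So the smoothing
respects the orientation iff `s c = sign c`, that is, iff `s c * sign c = 1`: a point that arrives
along one branch then leaves along the other branch in the same sense with respect to the
orientation of the diagram; if `s c * sign c = -1` it leaves along the other branch in the
opposite sense. -/
inductive Step (s : K.State) : Param m × ℤˣ → Param m × ℤˣ → Prop
  /-- moving along an arc of the diagram without meeting a crossing -/
  | along (i : Option (Fin m)) (t t' : ℝ) (ε : ℤˣ) :
      0 ≤ ((ε : ℤ) : ℝ) * (t' - t) → (∀ r ∈ Set.uIcc t t', K.Regular (i, r)) →
      Step s ((i, t), ε) ((i, t'), ε)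
  /-- two parameters of the same point of a circle -/
  | same (p q : Param m) (ε : ℤˣ) : K.Regular p → SamePoint p q → Step s (p, ε) (q, ε)
  /-- passing by the smoothed crossing `c` -/
  | smoothing (c : K.Crossing) (p q p' q' : Param m) (ε δ : ℤˣ) :
      Meet K.γ p q → K.γ p = c.1 → δ = ε * (s c * K.sign c) →
      K.Approach p' ε p → K.Approach q' (-δ) q → Step s (p', ε) (q', δ)

/-- `|s|`: the number of connected components of `K_s`. -/
def numComponents (s : K.State) : ℕ :=
  Nat.card (Quot (fun p q : {p : Param m // K.Regular p} =>
    ∃ ε δ : ℤˣ, K.Step s (p.1, ε) (q.1, δ)))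

/-- The segment component `k_s` of `K_s`, oriented from the leg to the head, passes through the
point `p`, in the direction `ε` with respect to the orientation of the diagram. -/
def SegmentPasses (s : K.State) (p : Param m) (ε : ℤˣ) : Prop :=
  Relation.ReflTransGen (K.Step s) ((none, 0), 1) (p, ε)

/-! ## Shortcuts and intersection numbers -/

/-- A shortcut: an embedded arc in `S²` from the leg to the head which otherwise meets the diagram
transversely at a finite set of points, distinct from the crossings. -/
structure Shortcut where
  a : ℝ → E3
  smooth : ContDiff ℝ ∞ a
  mem_sphere : ∀ t ∈ Set.Icc (0 : ℝ) 1, ‖a t‖ = 1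
  immersed : ∀ t ∈ Set.Icc (0 : ℝ) 1, deriv a t ≠ 0
  injective : Set.InjOn a (Set.Icc (0 : ℝ) 1)
  start : a 0 = K.leg
  finish : a 1 = K.head
  transverse : ∀ t ∈ Set.Ioo (0 : ℝ) 1, ∀ p, Dom p → a t = K.γ p →
    ¬ K.Double p ∧ det3 (a t) (deriv a t) (vel K.γ p) ≠ 0
  finite : {t ∈ Set.Ioo (0 : ℝ) 1 | ∃ p, Dom p ∧ a t = K.γ p}.Finite

variable {K}

/-- For a 1-manifold made of arcs of the diagram and passing through the point `p` in the direction
`ε` iff `T p ε`: the number of times it crosses the shortcut from the right to the left minus the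
number of times it crosses the shortcut from the left to the right. The endpoints are not
counted. -/
def Shortcut.inter (a : K.Shortcut) (T : Param m → ℤˣ → Prop) : ℤ :=
  ({t ∈ Set.Ioo (0 : ℝ) 1 | ∃ p ε, Dom p ∧ a.a t = K.γ p ∧ T p ε ∧
      0 < ((ε : ℤ) : ℝ) * det3 (a.a t) (deriv a.a t) (vel K.γ p)}.ncard : ℤ) -
  ({t ∈ Set.Ioo (0 : ℝ) 1 | ∃ p ε, Dom p ∧ a.a t = K.γ p ∧ T p ε ∧
      ((ε : ℤ) : ℝ) * det3 (a.a t) (deriv a.a t) (vel K.γ p) < 0}.ncard : ℤ)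

/-- `K · a`: all components of the diagram, with their orientations. -/
def Shortcut.diagramInter (a : K.Shortcut) : ℤ := a.inter (fun _ ε => ε = 1)

/-- `k_s · a`. -/
def Shortcut.stateInter (a : K.Shortcut) (s : K.State) : ℤ := a.inter (K.SegmentPasses s)

end Diagram

/-! ## The extended bracket polynomial -/

/-- The Laurent polynomial ring `ℤ[A^{±1}, u^{±1}]`; `single (i, j) n` is `n A^i u^j`. -/
abbrev LaurentAU : Type := AddMonoidAlgebra ℤ (ℤ × ℤ)

/-- The invertible element `A^i u^j`. -/
def monomialAU (i j : ℤ) : LaurentAUˣ where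
  val := AddMonoidAlgebra.single (i, j) 1
  inv := AddMonoidAlgebra.single (-i, -j) 1
  val_inv := by simp [AddMonoidAlgebra.single_mul_single, AddMonoidAlgebra.one_def, Prod.mk_zero_zero]
  inv_val := by simp [AddMonoidAlgebra.single_mul_single, AddMonoidAlgebra.one_def, Prod.mk_zero_zero]

/-- The variable `A`. -/
def A : LaurentAUˣ := monomialAU 1 0

/-- The variable `u`. -/
def u : LaurentAUˣ := monomialAU 0 1

/-- The two-variable extended bracket of the diagram `K`, computed with the shortcut `a`:
`(-A³)^{-w(K)} u^{-K·a} ∑_s A^{σ_s} u^{k_s·a} (-A² - A⁻²)^{|s|-1}`.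
(One always has `|s| ≥ 1`, because of the segment component.) -/
def extendedBracket {m : ℕ} (K : Diagram m) (a : K.Shortcut) : LaurentAU :=
  (((-(A ^ 3)) ^ (-K.writhe) * u ^ (-a.diagramInter) : LaurentAUˣ) : LaurentAU) *
    ∑ s : K.State, ((A ^ K.sigma s * u ^ a.stateInter s : LaurentAUˣ) : LaurentAU) *
      (-((A ^ (2 : ℤ) : LaurentAUˣ) : LaurentAU) - ((A ^ (-2 : ℤ) : LaurentAUˣ) : LaurentAU)) ^
        (K.numComponents s - 1)

/-! ## Ambient isotopy -/

/-- The diagram `L` is the image of the diagram `K` under a smooth ambient isotopy of `S²`, up to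
orientation preserving reparametrization of the components and numbering of the circles.
The isotopy `H t`, `t ∈ [0,1]`, consists of diffeomorphisms of `S²` with inverses `G t` and starts
with the identity; `H` and `G` are written as restrictions of smooth maps on `ℝ × ℝ³`. -/
def Isotopic {m : ℕ} (K L : Diagram m) : Prop :=
  ∃ (H G : ℝ → E3 → E3) (π : Equiv.Perm (Fin m)) (ρ : Option (Fin m) → ℝ → ℝ),
    ContDiff ℝ ∞ (fun z : ℝ × E3 => H z.1 z.2) ∧
    ContDiff ℝ ∞ (fun z : ℝ × E3 => G z.1 z.2) ∧
    (∀ t ∈ Set.Icc (0 : ℝ) 1, ∀ x : E3, ‖x‖ = 1 →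
      ‖H t x‖ = 1 ∧ ‖G t x‖ = 1 ∧ G t (H t x) = x ∧ H t (G t x) = x) ∧
    (∀ x : E3, ‖x‖ = 1 → H 0 x = x) ∧
    (∀ i, ContDiff ℝ ∞ (ρ i)) ∧
    (∀ i t, 0 < deriv (ρ i) t) ∧
    ρ none 0 = 0 ∧ ρ none 1 = 1 ∧
    (∀ (i : Fin m) (t : ℝ), ρ (some i) (t + 1) = ρ (some i) t + 1) ∧
    (∀ i t, Dom (i, t) → L.γ (i, t) = H 1 (K.γ (i.map π, ρ i t))) ∧
    (∀ i t, L.Double (i, t) → (L.isOver (i, t) ↔ K.isOver (i.map π, ρ i t)))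

/-! ## Reidemeister moves -/

/-- An arc `{(i, t) : α ≤ t ≤ β}` in the source of a diagram. -/
structure Arc (m : ℕ) where
  i : Option (Fin m)
  α : ℝ
  β : ℝ
  lt : α < β
  /-- on the segment the arc is contained in `[0,1]` -/
  dom_left : Dom (i, α)
  dom_right : Dom (i, β)
  /-- on a circle the arc is not the whole circle -/
  proper : i ≠ none → β < α + 1

/-- `p` is a point of the arc `J`. -/
def Arc.Mem {m : ℕ} (J : Arc m) (p : Param m) : Prop :=
  ∃ t ∈ Set.Icc J.α J.β, SamePoint (J.i, t) p

/-- `p` is a point of the arc `J` different from the ends of `J`. -/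
def Arc.MemInt {m : ℕ} (J : Arc m) (p : Param m) : Prop :=
  ∃ t ∈ Set.Ioo J.α J.β, SamePoint (J.i, t) p

/-- The unit sphere `S²` as a topological space. -/
abbrev S2 : Type := Metric.sphere (0 : E3) 1

/-- The closed disk in `S²` which is the image of a closed hemisphere under the homeomorphism `φ`.
(Every closed disk embedded in `S²` is of this form.) -/
def disk (φ : S2 ≃ₜ S2) : Set E3 := {y | ∃ x : S2, 0 ≤ (x : E3) 2 ∧ ((φ x : S2) : E3) = y}

/-- The interior of the disk `disk φ` in `S²`. -/
def openDisk (φ : S2 ≃ₜ S2) : Set E3 := {y | ∃ x : S2, 0 < (x : E3) 2 ∧ ((φ x : S2) : E3) = y}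

/-- The diagrams `K` and `L` coincide outside a closed disk in `S²` disjoint from their endpoints,
and each of them meets this disk exactly along the images of the `n` disjoint arcs `J j`, which
are properly placed in the disk (their interiors go to the interior of the disk). -/
structure CoincideOutside {m : ℕ} (K L : Diagram m) {n : ℕ} (J : Fin n → Arc m)
    (φ : S2 ≃ₜ S2) : Prop where
  disjoint : ∀ j j' p, (J j).Mem p → (J j').Mem p → j = j'
  leg_notMem : K.leg ∉ disk φ
  head_notMem : K.head ∉ disk φ
  left_mem : ∀ p, Dom p → (K.γ p ∈ disk φ ↔ ∃ j, (J j).Mem p)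
  right_mem : ∀ p, Dom p → (L.γ p ∈ disk φ ↔ ∃ j, (J j).Mem p)
  left_mem_int : ∀ p, Dom p → (K.γ p ∈ openDisk φ ↔ ∃ j, (J j).MemInt p)
  right_mem_int : ∀ p, Dom p → (L.γ p ∈ openDisk φ ↔ ∃ j, (J j).MemInt p)
  eq_outside : ∀ p, Dom p → (¬ ∃ j, (J j).MemInt p) → K.γ p = L.γ p
  over_outside : ∀ p, (¬ ∃ j, (J j).Mem p) → K.Double p → (K.isOver p ↔ L.isOver p)

/-- The first Reidemeister move (all versions). Inside the disk, `K` is an arc without crossings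
and `L` is an arc with exactly one self-crossing (a curl, of any sign). -/
def Omega1 {m : ℕ} (K L : Diagram m) : Prop :=
  ∃ (J : Fin 1 → Arc m) (φ : S2 ≃ₜ S2), CoincideOutside K L J φ ∧
    (∀ p, (J 0).Mem p → ¬ K.Double p) ∧
    ∃ x y : ℝ, x ∈ Set.Ioo (J 0).α (J 0).β ∧ y ∈ Set.Ioo (J 0).α (J 0).β ∧ x < y ∧
      Meet L.γ ((J 0).i, x) ((J 0).i, y) ∧
      ∀ p, (J 0).Mem p → L.Double p →
        SamePoint ((J 0).i, x) p ∨ SamePoint ((J 0).i, y) p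

/-- The second Reidemeister move (all versions). Inside the disk, `K` consists of two arcs without
crossings, and `L` consists of two arcs, the first one passing over the second one at exactly two
crossings, which are not met by the arcs otherwise. The two crossings have opposite signs; the arcs
may run in parallel or in opposite directions. -/
def Omega2 {m : ℕ} (K L : Diagram m) : Prop :=
  ∃ (J : Fin 2 → Arc m) (φ : S2 ≃ₜ S2), CoincideOutside K L J φ ∧
    (∀ j p, (J j).Mem p → ¬ K.Double p) ∧
    ∃ x y : Fin 2 → ℝ,
      (∀ j, x j ∈ Set.Ioo (J j).α (J j).β ∧ y j ∈ Set.Ioo (J j).α (J j).β ∧ x j ≠ y j) ∧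
      Meet L.γ ((J 0).i, x 0) ((J 1).i, x 1) ∧ Meet L.γ ((J 0).i, y 0) ((J 1).i, y 1) ∧
      (∀ j p, (J j).Mem p → L.Double p →
        SamePoint ((J j).i, x j) p ∨ SamePoint ((J j).i, y j) p) ∧
      L.isOver ((J 0).i, x 0) ∧ L.isOver ((J 0).i, y 0) ∧
      det3 (L.γ ((J 0).i, x 0)) (vel L.γ ((J 0).i, x 0)) (vel L.γ ((J 1).i, x 1)) *
        det3 (L.γ ((J 0).i, y 0)) (vel L.γ ((J 0).i, y 0)) (vel L.γ ((J 1).i, y 1)) < 0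

/-- Three arcs of a diagram (`J 0` at the top, `J 1` in the middle, `J 2` at the bottom) meet each
other pairwise in exactly one crossing and have no other crossings; `x j k` is the parameter on the
arc `J j` of its crossing with `J k` (the values `x j j` are irrelevant). -/
structure TripleOfArcs {m : ℕ} (K : Diagram m) (J : Fin 3 → Arc m) (x : Fin 3 → Fin 3 → ℝ) :
    Prop where
  mem : ∀ j k, j ≠ k → x j k ∈ Set.Ioo (J j).α (J j).β
  meet : ∀ j k, j ≠ k → Meet K.γ ((J j).i, x j k) ((J k).i, x k j)
  only : ∀ j p, (J j).Mem p → K.Double p → ∃ k, k ≠ j ∧ SamePoint ((J j).i, x j k) p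
  isOver : ∀ j k, j < k → K.isOver ((J j).i, x j k)

/-- For a triple of arcs, the quantity whose sign tells whether the closed path running through the
crossings `jk`, `jl`, `lk` along the sides of the triangle formed by the three arcs turns to the
left (`+`) or to the right (`-`) when it passes, at the crossing `jl`, from the arc `J j` to the
arc `J l`. -/
def turn {m : ℕ} (K : Diagram m) (J : Fin 3 → Arc m) (x : Fin 3 → Fin 3 → ℝ) (j k l : Fin 3) : ℝ :=
  (x j l - x j k) * (x l k - x l j) *
    det3 (K.γ ((J j).i, x j l)) (vel K.γ ((J j).i, x j l)) (vel K.γ ((J l).i, x l j))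

/-- The third Reidemeister move (all versions). Inside the disk, both `K` and `L` consist of three
arcs, one at the top, one in the middle, one at the bottom, which meet pairwise in exactly one
crossing. The crossings of the same two arcs have the same sign in `K` and in `L`, and each arc
meets the two other arcs in opposite orders in `K` and in `L`. The triangle formed by the arcs is an
ordinary one: a point running along its boundary turns to the same side at all corners (stated for
`K`; it then follows for `L`, where all orders are reversed and all signs are the same).
(The requirements on signs and turns hold automatically for arcs in a disk; they
are part of the usual picture of the move.) -/
def Omega3 {m : ℕ} (K L : Diagram m) : Prop :=
  ∃ (J : Fin 3 → Arc m) (φ : S2 ≃ₜ S2), CoincideOutside K L J φ ∧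
    ∃ x y : Fin 3 → Fin 3 → ℝ, TripleOfArcs K J x ∧ TripleOfArcs L J y ∧
      (∀ j k l, j ≠ k → k ≠ l → l ≠ j → (x j k < x j l ↔ y j l < y j k)) ∧
      (∀ j k, j ≠ k → 0 <
        det3 (K.γ ((J j).i, x j k)) (vel K.γ ((J j).i, x j k)) (vel K.γ ((J k).i, x k j)) *
        det3 (L.γ ((J j).i, y j k)) (vel L.γ ((J j).i, y j k)) (vel L.γ ((J k).i, y k j))) ∧
      0 < turn K J x 0 1 2 * turn K J x 2 0 1 ∧ 0 < turn K J x 0 1 2 * turn K J x 1 2 0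

/-- `L` is obtained from `K` by one of the Reidemeister moves `Ω₁`, `Ω₂`, `Ω₃` (away from the
endpoints); the inverse moves are obtained by exchanging `K` and `L`. -/
def ReidemeisterMove {m : ℕ} (K L : Diagram m) : Prop :=
  Omega1 K L ∨ Omega2 K L ∨ Omega3 K L

/-- Two diagrams represent the same (multi-)knotoid: the equivalence relation generated by ambient
isotopy and the Reidemeister moves. -/
def Equivalent {m : ℕ} (K L : Diagram m) : Prop :=
  Relation.EqvGen (fun K L : Diagram m => Isotopic K L ∨ ReidemeisterMove K L) K L

end Knotoid

end

open Set Filter Topology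

noncomputable section

namespace Knotoid

section

variable {m : ℕ}

/-! ## Parameters and double points -/

/-! For a fixed state the difference `K - k_s` is a 1-cycle: the edges of the diagram carry integer
coefficients that satisfy Kirchhoff's rule at every crossing (`coef_kirchhoff`) and vanish at the
leg and at the head (`coef_leg`, `coef_head`). In a stereographic chart missing the diagram, the
integral over this cycle of `d arg ((z - Q) / (z - P))`, where `P` is the leg and `Q` the head, is a
number `winding s C` in whose definition no shortcut occurs. A shortcut `a` supplies a primitive of
this form off `a`, namely `Im ∫_a dw / (w - z)`, which jumps by `±2π` across `a`. A Stokes formula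
for cycles on the diagram therefore gives `winding s C = 2π (K·a - k_s·a)` (`winding_eq`). The
bracket contains only the differences `k_s·a - K·a`, so it does not depend on `a`.

A Reidemeister move changes the diagram only inside a disk, where it consists of a few arcs. A
smoothing of such a tangle acts on the rest only through the way `out` in which it joins the ends of
the arcs, and through the presence of a closed component. The components that meet the outside, and
the edges passed by `k_s` there, are determined by the state outside and by `out`. So is `k_s·a -
K·a`: the leg and the head lie outside the disk, hence `log ((z - Q) / (z - P))` exists on it, and
the arcs in the disk contribute to the winding number only through their ends
(`CoincideOutside.winding_eq`, `CoincideOutside.stateInter_eq`). Two diagrams related by a move thus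
have the same bracket as soon as the state sums of their tangles, with an arbitrary weight `v`
depending on `out`, agree after multiplication by the writhe factors
(`CoincideOutside.extendedBracket_eq`).

What remains is Kauffman's computation. The arcs receive auxiliary directions in which they meet the
crossings in a standard order, so that one picture covers all versions of a move: a curl multiplies
by `(-A³)^{±1}`, a clasp by `1`, and the two triangles have equal sums (`stateSum_curl`,
`stateSum_clasp`, `stateSum_triangle`). Closed paths and joined ends are found by evaluation.

An ambient isotopy preserves all combinatorial data: a determinant that never vanishes cannot change
sign along the isotopy (`det3_spaceD_pos_iff`), and the shortcut is carried along. Chains of moves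
require a shortcut on each intermediate diagram; a circular arc in a generic plane through the leg
and the head is one (`nonempty_shortcut`). -/

theorem samePoint_iff {p q : Param m} :
    SamePoint p q ↔ ∃ n : ℤ, (p.1 = none → n = 0) ∧ q = (p.1, p.2 + n) := by
  constructor
  · rintro ⟨h1, h2 | ⟨h2, n, hn⟩⟩
    · exact ⟨0, fun _ => rfl, Prod.ext h1.symm (by simp [h2])⟩
    · exact ⟨n, fun h => absurd h h2, Prod.ext h1.symm hn⟩
  · rintro ⟨n, hn, rfl⟩
    refine ⟨rfl, ?_⟩
    by_cases h : p.1 = none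
    · left; simp [hn h]
    · right; exact ⟨h, n, rfl⟩

theorem SamePoint.refl (p : Param m) : SamePoint p p := ⟨rfl, Or.inl rfl⟩

theorem SamePoint.symm {p q : Param m} (h : SamePoint p q) : SamePoint q p := by
  obtain ⟨n, hn, rfl⟩ := samePoint_iff.1 h
  exact samePoint_iff.2 ⟨-n, fun h => by simp [hn h], by simp⟩

theorem SamePoint.trans {p q r : Param m} (h : SamePoint p q) (h' : SamePoint q r) :
    SamePoint p r := by
  obtain ⟨n, hn, rfl⟩ := samePoint_iff.1 h
  obtain ⟨k, hk, rfl⟩ := samePoint_iff.1 h'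
  refine samePoint_iff.2 ⟨n + k, fun h => by simp [hn h, hk h], by simp; ring⟩

theorem samePoint_shift (i : Option (Fin m)) (t : ℝ) (n : ℤ) (hn : i = none → n = 0) :
    SamePoint (i, t) (i, t + n) := samePoint_iff.2 ⟨n, hn, rfl⟩

theorem SamePoint.dom {p q : Param m} (h : SamePoint p q) (hp : Dom p) : Dom q := by
  obtain ⟨n, hn, rfl⟩ := samePoint_iff.1 h
  intro hi
  have h0 := hn hi
  subst h0
  simpa using hp hi

theorem dom_some (i : Fin m) (t : ℝ) : Dom ((some i, t) : Param m) := fun h => by simp at h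

theorem dom_of_mem_uIcc {i : Option (Fin m)} {a b r : ℝ} (ha : Dom (i, a)) (hb : Dom (i, b))
    (hr : r ∈ uIcc a b) : Dom (i, r) := by
  intro hi
  have h1 := ha hi
  have h2 := hb hi
  exact (convex_Icc (0 : ℝ) 1).ordConnected.uIcc_subset h1 h2 hr

namespace Diagram

variable {K : Diagram m}

theorem γ_add_int (K : Diagram m) (i : Fin m) (t : ℝ) (n : ℤ) :
    K.γ (some i, t + n) = K.γ (some i, t) := by
  have h : Function.Periodic (fun t => K.γ (some i, t)) 1 := K.periodic i
  simpa using (h.int_mul n) t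

theorem γ_eq {p q : Param m} (h : SamePoint p q) : K.γ p = K.γ q := by
  obtain ⟨n, hn, rfl⟩ := samePoint_iff.1 h
  obtain ⟨_ | i, t⟩ := p
  · simp [hn rfl]
  · exact (K.γ_add_int i t n).symm

theorem vel_eq {p q : Param m} (h : SamePoint p q) : vel K.γ p = vel K.γ q := by
  obtain ⟨n, hn, rfl⟩ := samePoint_iff.1 h
  obtain ⟨_ | i, t⟩ := p
  · simp [hn rfl]
  · have h : (fun t => K.γ (some i, t)) = fun t => K.γ (some i, t + n) := by
      funext t; exact (K.γ_add_int i t n).symm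
    simp only [vel]
    conv_lhs => rw [h]
    rw [deriv_comp_add_const (fun t => K.γ (some i, t)) (n : ℝ) t]

theorem isOver_iff {p q : Param m} (h : SamePoint p q) : K.isOver p ↔ K.isOver q := by
  obtain ⟨n, hn, rfl⟩ := samePoint_iff.1 h
  obtain ⟨_ | i, t⟩ := p
  · simp [hn rfl]
  · have h : Function.Periodic (fun t => K.isOver (some i, t)) 1 :=
      fun t => propext (K.over_periodic i t)
    have := (h.int_mul n) t
    simp only [mul_one] at this
    simp [this]

theorem meet_symm {p q : Param m} (h : Meet K.γ p q) : Meet K.γ q p :=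
  ⟨h.2.1, h.1, fun h' => h.2.2.1 h'.symm, h.2.2.2.symm⟩

theorem meet_congr {p q p' q' : Param m} (h : Meet K.γ p q) (hp : SamePoint p p')
    (hq : SamePoint q q') : Meet K.γ p' q' :=
  ⟨hp.dom h.1, hq.dom h.2.1, fun h' => h.2.2.1 ((hp.trans h').trans hq.symm),
    by rw [← γ_eq hp, ← γ_eq hq, h.2.2.2]⟩

theorem double_congr {p q : Param m} (h : SamePoint p q) : K.Double p ↔ K.Double q :=
  ⟨fun ⟨r, hr⟩ => ⟨r, meet_congr hr h (.refl _)⟩, fun ⟨r, hr⟩ => ⟨r, meet_congr hr h.symm (.refl _)⟩⟩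

theorem regular_congr {p q : Param m} (h : SamePoint p q) : K.Regular p ↔ K.Regular q :=
  ⟨fun hp => ⟨h.dom hp.1, fun hd => hp.2 ((double_congr h).2 hd)⟩,
   fun hp => ⟨h.symm.dom hp.1, fun hd => hp.2 ((double_congr h).1 hd)⟩⟩

theorem Double.dom {p : Param m} (h : K.Double p) : Dom p := h.choose_spec.1

theorem Double.mem_Ioo {t : ℝ} (h : K.Double (none, t)) : t ∈ Ioo (0 : ℝ) 1 := by
  obtain ⟨q, hq⟩ := h
  have h1 := hq.1 rfl
  have h2 := K.endpoints _ _ hq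
  simp only [ne_eq, Prod.mk.injEq, true_and] at h2
  exact ⟨lt_of_le_of_ne h1.1 (Ne.symm h2.1), lt_of_le_of_ne h1.2 h2.2⟩

theorem regular_leg (K : Diagram m) : K.Regular (none, 0) :=
  ⟨fun _ => by simp, fun h => by simpa using h.mem_Ioo.1⟩

theorem regular_head (K : Diagram m) : K.Regular (none, 1) :=
  ⟨fun _ => by simp, fun h => by simpa using h.mem_Ioo.2⟩

theorem samePoint_or_of_γ_eq {p q r : Param m} (h : Meet K.γ p q) (hr : Dom r)
    (e : K.γ r = K.γ p) : SamePoint p r ∨ SamePoint q r := by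
  by_cases h1 : SamePoint p r
  · exact Or.inl h1
  · exact Or.inr (K.no_triple p q r h ⟨h.1, hr, h1, e.symm⟩)

theorem finite_samePoint (p : Param m) (i : Option (Fin m)) (a b : ℝ) :
    {t | t ∈ Icc a b ∧ SamePoint p (i, t)}.Finite := by
  refine ((Set.finite_Icc ⌊a - p.2⌋ ⌈b - p.2⌉).image (fun n : ℤ => p.2 + n)).subset ?_
  rintro t ⟨ht, hs⟩
  obtain ⟨n, -, h⟩ := samePoint_iff.1 hs
  have h2 : t = p.2 + n := congrArg Prod.snd h
  refine ⟨n, ⟨?_, ?_⟩, h2.symm⟩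
  · have : ((⌊a - p.2⌋ : ℤ) : ℝ) ≤ n := (Int.floor_le _).trans (by linarith [ht.1])
    exact_mod_cast this
  · have : (n : ℝ) ≤ ((⌈b - p.2⌉ : ℤ) : ℝ) := le_trans (by linarith [ht.2]) (Int.le_ceil _)
    exact_mod_cast this

/-- There are finitely many crossings, two points of the source lie over each of them, and each of
these has finitely many parameters in a bounded interval. -/
theorem finite_double (K : Diagram m) (i : Option (Fin m)) (a b : ℝ) :
    {t | t ∈ Icc a b ∧ K.Double (i, t)}.Finite := by
  have h : {t | t ∈ Icc a b ∧ K.Double (i, t)} ⊆ ⋃ x ∈ {x : E3 | ∃ p q, Meet K.γ p q ∧ K.γ p = x},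
      {t | t ∈ Icc a b ∧ K.Double (i, t) ∧ K.γ (i, t) = x} := by
    rintro t ⟨ht, hd⟩
    obtain ⟨q, hq⟩ := hd
    exact mem_biUnion (x := K.γ (i, t)) ⟨_, q, hq, rfl⟩ ⟨ht, ⟨q, hq⟩, rfl⟩
  refine (K.finite_crossings.biUnion ?_).subset h
  rintro x ⟨p, q, hpq, rfl⟩
  refine ((finite_samePoint p i a b).union (finite_samePoint q i a b)).subset ?_
  rintro t ⟨ht, hd, e⟩
  rcases samePoint_or_of_γ_eq hpq hd.dom e with h | h
  · exact Or.inl ⟨ht, h⟩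
  · exact Or.inr ⟨ht, h⟩

theorem eventually_not_double (K : Diagram m) (i : Option (Fin m)) (t : ℝ) :
    ∀ᶠ r in 𝓝[≠] t, ¬ K.Double (i, r) := by
  have hf := (K.finite_double i (t - 1) (t + 1)).subset (sdiff_subset (t := {t}))
  have h1 : ∀ᶠ r in 𝓝 t, r ∈ ({r | r ∈ Icc (t-1) (t+1) ∧ K.Double (i, r)} \ {t})ᶜ :=
    hf.isClosed.isOpen_compl.mem_nhds (by simp)
  have h2 : ∀ᶠ r in 𝓝 t, r ∈ Icc (t - 1) (t + 1) := Icc_mem_nhds (by linarith) (by linarith)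
  filter_upwards [nhdsWithin_le_nhds h1, nhdsWithin_le_nhds h2, self_mem_nhdsWithin] with r h1 h2 h3 hd
  exact h1 ⟨⟨h2, hd⟩, h3⟩

/-! ## Edges -/

/-- `p` and `q` lie on the same edge: they are connected by an arc without double points. -/
def SameEdge (K : Diagram m) (p q : Param m) : Prop :=
  ∃ t, SamePoint q (p.1, t) ∧ ∀ r ∈ uIcc p.2 t, K.Regular (p.1, r)

theorem SameEdge.right {p q : Param m} (h : K.SameEdge p q) : K.Regular q := by
  obtain ⟨t, hs, h⟩ := h
  exact (regular_congr hs).2 (h _ right_mem_uIcc)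

theorem SameEdge.refl {p : Param m} (h : K.Regular p) : K.SameEdge p p :=
  ⟨p.2, .refl _, fun r hr => by
    rw [uIcc_self, mem_singleton_iff] at hr; subst hr; exact h⟩

theorem sameEdge_of_samePoint {p q : Param m} (h : SamePoint p q) (hp : K.Regular p) :
    K.SameEdge p q :=
  ⟨p.2, h.symm, fun r hr => by
    rw [uIcc_self, mem_singleton_iff] at hr; subst hr; exact hp⟩

theorem mem_uIcc_add {a b c r : ℝ} : r + c ∈ uIcc (a + c) (b + c) ↔ r ∈ uIcc a b := by
  simp only [mem_uIcc, add_le_add_iff_right]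

theorem regular_shift {i : Option (Fin m)} {r : ℝ} {n : ℤ} (hn : i = none → n = 0) :
    K.Regular (i, r + n) ↔ K.Regular (i, r) :=
  (regular_congr (samePoint_shift i r n hn)).symm

theorem double_shift {i : Option (Fin m)} {r : ℝ} {n : ℤ} (hn : i = none → n = 0) :
    K.Double (i, r + n) ↔ K.Double (i, r) :=
  (double_congr (samePoint_shift i r n hn)).symm

theorem SameEdge.symm {p q : Param m} (h : K.SameEdge p q) : K.SameEdge q p := by
  obtain ⟨t, hs, h⟩ := h
  obtain ⟨n, hn, e⟩ := samePoint_iff.1 hs.symm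
  simp only at hn e
  subst e
  refine ⟨p.2 + n, samePoint_shift p.1 p.2 n hn, fun r hr => ?_⟩
  have := h (r - n) (by
    have : r - n + n ∈ uIcc (t + n) (p.2 + n) := by simpa using hr
    rw [mem_uIcc_add, uIcc_comm] at this; exact this)
  rw [← regular_shift (n := n) hn] at this
  simpa using this

theorem SameEdge.trans {p q r : Param m} (h : K.SameEdge p q) (h' : K.SameEdge q r) :
    K.SameEdge p r := by
  obtain ⟨t, hs, h⟩ := h
  obtain ⟨t', hs', h'⟩ := h'
  obtain ⟨n, hn, e⟩ := samePoint_iff.1 hs.symm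
  simp only at hn e
  subst e
  simp only at hs' h'
  refine ⟨t' - n, hs'.trans (by
    have := (samePoint_shift p.1 (t' - n) n hn).symm
    simpa using this), fun x hx => ?_⟩
  rcases uIcc_subset_uIcc_union_uIcc (b := t) hx with hx | hx
  · exact h x hx
  · rw [← regular_shift (n := n) hn]
    apply h'
    have : x + n ∈ uIcc (t + n) (t' - n + n) := mem_uIcc_add.2 hx
    simpa using this

theorem SameEdge.of_uIcc {i : Option (Fin m)} {t t' : ℝ}
    (h : ∀ r ∈ uIcc t t', K.Regular (i, r)) : K.SameEdge (i, t) (i, t') :=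
  ⟨t', .refl _, h⟩

theorem approach_pos {p p' : Param m} : K.Approach p' 1 p ↔ K.Regular p' ∧ p'.1 = p.1 ∧
    p'.2 < p.2 ∧ ∀ t ∈ Ico p'.2 p.2, ¬ K.Double (p.1, t) := by
  unfold Approach
  refine and_congr Iff.rfl (and_congr Iff.rfl ?_)
  simp only [Units.val_one, Int.cast_one, one_mul, sub_pos]
  refine and_congr_right fun h => ?_
  rw [uIcc_of_le h.le]
  exact ⟨fun H t ht => H t ⟨ht.1, ht.2.le⟩ ht.2.ne,
    fun H t ht hne => H t ⟨ht.1, lt_of_le_of_ne ht.2 hne⟩⟩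

theorem approach_neg {p p' : Param m} : K.Approach p' (-1) p ↔ K.Regular p' ∧ p'.1 = p.1 ∧
    p.2 < p'.2 ∧ ∀ t ∈ Ioc p.2 p'.2, ¬ K.Double (p.1, t) := by
  unfold Approach
  refine and_congr Iff.rfl (and_congr Iff.rfl ?_)
  simp only [Units.val_neg, Units.val_one, Int.cast_neg, Int.cast_one, neg_mul, one_mul, neg_sub,
    sub_pos]
  refine and_congr_right fun h => ?_
  rw [uIcc_of_ge h.le]
  exact ⟨fun H t ht => H t ⟨ht.1.le, ht.2⟩ ht.1.ne',
    fun H t ht hne => H t ⟨lt_of_le_of_ne ht.1 hne.symm, ht.2⟩⟩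

theorem Approach.shift {p p' : Param m} {ε : ℤˣ} {n : ℤ} (h : K.Approach p' ε p)
    (hn : p.1 = none → n = 0) : K.Approach (p'.1, p'.2 + n) ε (p.1, p.2 + n) := by
  obtain ⟨h1, h2, h3, h4⟩ := h
  refine ⟨(regular_shift (h2 ▸ hn)).2 h1, h2, by simpa using h3, fun t ht hne hd => ?_⟩
  have ht' : t - n ∈ uIcc p'.2 p.2 := by
    rw [← mem_uIcc_add (c := (n : ℝ))]; simpa using ht
  refine h4 _ ht' (fun e => hne (by simp only; linarith)) ?_
  rw [← double_shift hn]
  simpa using hd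

theorem Approach.congr_right {p p' q : Param m} {ε : ℤˣ} (h : K.Approach p' ε p)
    (hs : SamePoint p q) : ∃ q', SamePoint p' q' ∧ K.Approach q' ε q := by
  obtain ⟨n, hn, rfl⟩ := samePoint_iff.1 hs
  exact ⟨_, samePoint_shift p'.1 p'.2 n (h.2.1 ▸ hn), h.shift hn⟩

theorem Approach.sameEdge {p p' q' : Param m} {ε : ℤˣ} (h : K.Approach p' ε p)
    (h' : K.Approach q' ε p) : K.SameEdge p' q' := by
  obtain ⟨i, a⟩ := p
  obtain ⟨i', a'⟩ := p'
  obtain ⟨i'', a''⟩ := q'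
  obtain rfl : i' = i := h.2.1
  obtain rfl : i'' = i' := h'.2.1
  refine SameEdge.of_uIcc fun r hr => ⟨dom_of_mem_uIcc h.1.1 h'.1.1 hr, ?_⟩
  rcases Int.units_eq_one_or ε with rfl | rfl
  · rw [approach_pos] at h h'
    simp only at h h'
    rcases mem_uIcc.1 hr with hr | hr
    · exact h.2.2.2 r ⟨hr.1, hr.2.trans_lt h'.2.2.1⟩
    · exact h'.2.2.2 r ⟨hr.1, hr.2.trans_lt h.2.2.1⟩
  · rw [approach_neg] at h h'
    simp only at h h'
    rcases mem_uIcc.1 hr with hr | hr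
    · exact h'.2.2.2 r ⟨h.2.2.1.trans_le hr.1, hr.2⟩
    · exact h.2.2.2 r ⟨h'.2.2.1.trans_le hr.1, hr.2⟩

/-- Of two double points ahead on the same component, the nearer one would block the way to the
other. -/
theorem Approach.unique {p p' q : Param m} {ε : ℤˣ} (h : K.Approach p' ε p)
    (h' : K.Approach p' ε q) (hp : K.Double p) (hq : K.Double q) : p = q := by
  obtain ⟨i, a⟩ := p
  obtain ⟨i', a'⟩ := p'
  obtain ⟨i'', a''⟩ := q
  obtain rfl : i' = i := h.2.1
  obtain rfl : i' = i'' := h'.2.1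
  congr 1
  rcases Int.units_eq_one_or ε with rfl | rfl
  · rw [approach_pos] at h h'
    simp only at h h'
    by_contra hne
    rcases lt_or_gt_of_ne hne with hl | hl
    · exact h'.2.2.2 a ⟨h.2.2.1.le, hl⟩ hp
    · exact h.2.2.2 a'' ⟨h'.2.2.1.le, hl⟩ hq
  · rw [approach_neg] at h h'
    simp only at h h'
    by_contra hne
    rcases lt_or_gt_of_ne hne with hl | hl
    · exact h.2.2.2 a'' ⟨hl, h'.2.2.1.le⟩ hq
    · exact h'.2.2.2 a ⟨hl, h.2.2.1.le⟩ hp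

theorem Approach.of_uIcc {i : Option (Fin m)} {t t' : ℝ} {p : Param m} {ε : ℤˣ}
    (h : K.Approach (i, t) ε p) (hp : K.Double p) (ht : ∀ r ∈ uIcc t t', K.Regular (i, r)) :
    K.Approach (i, t') ε p := by
  obtain ⟨j, a⟩ := p
  obtain rfl : i = j := h.2.1
  have ha : a ∉ uIcc t t' := fun ha => (ht a ha).2 hp
  rcases Int.units_eq_one_or ε with rfl | rfl
  · rw [approach_pos] at h ⊢
    simp only at h ⊢
    have hlt : t' < a := by
      by_contra hle
      exact ha (mem_uIcc.2 (Or.inl ⟨h.2.2.1.le, not_lt.1 hle⟩))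
    refine ⟨ht _ right_mem_uIcc, trivial, hlt, fun r hr => ?_⟩
    rcases le_total t r with h1 | h1
    · exact h.2.2.2 r ⟨h1, hr.2⟩
    · exact (ht r (mem_uIcc.2 (Or.inr ⟨hr.1, h1⟩))).2
  · rw [approach_neg] at h ⊢
    simp only at h ⊢
    have hlt : a < t' := by
      by_contra hle
      exact ha (mem_uIcc.2 (Or.inr ⟨not_lt.1 hle, h.2.2.1.le⟩))
    refine ⟨ht _ right_mem_uIcc, trivial, hlt, fun r hr => ?_⟩
    rcases le_total r t with h1 | h1
    · exact h.2.2.2 r ⟨hr.1, h1⟩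
    · exact (ht r (mem_uIcc.2 (Or.inl ⟨h1, hr.2⟩))).2

theorem Approach.of_sameEdge {p p' q' : Param m} {ε : ℤˣ} (h : K.Approach p' ε p)
    (hp : K.Double p) (he : K.SameEdge p' q') : ∃ q, SamePoint p q ∧ K.Approach q' ε q := by
  obtain ⟨t, hs, ht⟩ := he
  have h1 : K.Approach (p'.1, t) ε p := Approach.of_uIcc (t := p'.2) h hp ht
  obtain ⟨n, hn, e⟩ := samePoint_iff.1 hs.symm
  simp only at hn e
  subst e
  have hn' : p.1 = none → n = 0 := h.2.1 ▸ hn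
  exact ⟨_, samePoint_shift p.1 p.2 n hn', h1.shift hn'⟩

/-- Points on the same edge run in the same direction into the same double point. -/
theorem Approach.samePoint {p p' q q' : Param m} {ε : ℤˣ} (h : K.Approach p' ε p)
    (hp : K.Double p) (he : K.SameEdge p' q') (h' : K.Approach q' ε q) (hq : K.Double q) :
    SamePoint p q := by
  obtain ⟨r, hr, h2⟩ := h.of_sameEdge hp he
  rwa [← h2.unique h' ((double_congr hr).1 hp) hq]

theorem eventually_approach_pos {p : Param m} (hp : K.Double p) :
    ∀ᶠ r in 𝓝[<] p.2, K.Approach (p.1, r) 1 p := by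
  have h1 : ∀ᶠ r in 𝓝[<] p.2, ¬ K.Double (p.1, r) :=
    nhdsWithin_mono _ (fun x hx => ne_of_lt hx) (K.eventually_not_double p.1 p.2)
  obtain ⟨l, hl, hl'⟩ := (mem_nhdsLT_iff_exists_Ioo_subset).1 h1
  have h3 : ∀ᶠ r in 𝓝[<] p.2, Dom (p.1, r) := by
    obtain ⟨_ | i, t⟩ := p
    · have := hp.mem_Ioo
      filter_upwards [nhdsWithin_le_nhds (Ioo_mem_nhds this.1 this.2)] with r hr _
      exact ⟨hr.1.le, hr.2.le⟩
    · exact Eventually.of_forall fun r => dom_some i r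
  have h2 : ∀ᶠ r in 𝓝[<] p.2, r ∈ Ioo l p.2 := Ioo_mem_nhdsLT hl
  filter_upwards [h2, h3] with r hr hd
  rw [approach_pos]
  exact ⟨⟨hd, hl' hr⟩, rfl, hr.2, fun t ht => hl' ⟨hr.1.trans_le ht.1, ht.2⟩⟩

theorem eventually_approach_neg {p : Param m} (hp : K.Double p) :
    ∀ᶠ r in 𝓝[>] p.2, K.Approach (p.1, r) (-1) p := by
  have h1 : ∀ᶠ r in 𝓝[>] p.2, ¬ K.Double (p.1, r) :=
    nhdsWithin_mono _ (fun x hx => ne_of_gt hx) (K.eventually_not_double p.1 p.2)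
  obtain ⟨l, hl, hl'⟩ := (mem_nhdsGT_iff_exists_Ioo_subset).1 h1
  have h3 : ∀ᶠ r in 𝓝[>] p.2, Dom (p.1, r) := by
    obtain ⟨_ | i, t⟩ := p
    · have := hp.mem_Ioo
      filter_upwards [nhdsWithin_le_nhds (Ioo_mem_nhds this.1 this.2)] with r hr _
      exact ⟨hr.1.le, hr.2.le⟩
    · exact Eventually.of_forall fun r => dom_some i r
  have h2 : ∀ᶠ r in 𝓝[>] p.2, r ∈ Ioo p.2 l := Ioo_mem_nhdsGT hl
  filter_upwards [h2, h3] with r hr hd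
  rw [approach_neg]
  exact ⟨⟨hd, hl' hr⟩, rfl, hr.1, fun t ht => hl' ⟨ht.1, ht.2.trans_lt hr.2⟩⟩

theorem exists_approach {p : Param m} (hp : K.Double p) (ε : ℤˣ) : ∃ p', K.Approach p' ε p := by
  rcases Int.units_eq_one_or ε with rfl | rfl
  · obtain ⟨r, hr⟩ := (eventually_approach_pos hp).exists
    exact ⟨_, hr⟩
  · obtain ⟨r, hr⟩ := (eventually_approach_neg hp).exists
    exact ⟨_, hr⟩

end Diagram

end

section

variable {m : ℕ}

namespace Diagram
variable {K : Diagram m}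

/-! ## Passing by smoothed crossings -/

/-- The move past a smoothed crossing. -/
def Cross (s : K.State) (x y : Param m × ℤˣ) : Prop :=
  ∃ (c : K.Crossing) (p q : Param m), Meet K.γ p q ∧ K.γ p = c.1 ∧
    y.2 = x.2 * (s c * K.sign c) ∧ K.Approach x.1 x.2 p ∧ K.Approach y.1 (-y.2) q

/-- Two oriented points on the same edge with the same direction, or a move past a smoothed
crossing. -/
def EStep (s : K.State) (x y : Param m × ℤˣ) : Prop :=
  (x.2 = y.2 ∧ K.SameEdge x.1 y.1) ∨ K.Cross s x y

/-- Reversal of an oriented point. -/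
def rev (x : Param m × ℤˣ) : Param m × ℤˣ := (x.1, -x.2)

theorem meet_double {p q : Param m} (h : Meet K.γ p q) : K.Double p := ⟨q, h⟩

theorem meet_double' {p q : Param m} (h : Meet K.γ p q) : K.Double q := ⟨p, meet_symm h⟩

variable {s : K.State}

/-- An edge runs in a given direction into at most one double point, up to the period, so the
passage does not depend on the points chosen on the two edges. -/
theorem Cross.congr {x y x' y' : Param m × ℤˣ} (h : K.Cross s x y) (hx : x.2 = x'.2)
    (hx' : K.SameEdge x.1 x'.1) (hy : y.2 = y'.2) (hy' : K.SameEdge y.1 y'.1) :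
    K.Cross s x' y' := by
  obtain ⟨c, p, q, hm, hc, he, h1, h2⟩ := h
  obtain ⟨p1, hp1, h1'⟩ := h1.of_sameEdge (meet_double hm) hx'
  obtain ⟨q1, hq1, h2'⟩ := h2.of_sameEdge (meet_double' hm) hy'
  exact ⟨c, p1, q1, meet_congr hm hp1 hq1, by rw [← γ_eq hp1, hc], by rw [← hy, ← hx, he],
    hx ▸ h1', hy ▸ h2'⟩

theorem Cross.reverse {x y : Param m × ℤˣ} (h : K.Cross s x y) : K.Cross s (rev y) (rev x) := by
  obtain ⟨c, p, q, hm, hc, he, h1, h2⟩ := h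
  refine ⟨c, q, p, meet_symm hm, by rw [← hm.2.2.2, hc], ?_, h2, by simpa [rev] using h1⟩
  simp only [rev, he]
  rcases Int.units_eq_one_or (s c) with h | h <;> rcases Int.units_eq_one_or (K.sign c) with h' | h' <;>
    simp [h, h']

theorem Cross.regular_left {x y : Param m × ℤˣ} (h : K.Cross s x y) : K.Regular x.1 := by
  obtain ⟨c, p, q, hm, hc, he, h1, h2⟩ := h
  exact h1.1

theorem Cross.regular_right {x y : Param m × ℤˣ} (h : K.Cross s x y) : K.Regular y.1 := by
  obtain ⟨c, p, q, hm, hc, he, h1, h2⟩ := h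
  exact h2.1

/-- The point `y` determines the double point that it leaves; the absence of triple points
determines the partner of that double point, hence the crossing, and the twist `s c * K.sign c = ±1`
determines the direction of arrival. -/
theorem Cross.left_unique {x x' y : Param m × ℤˣ} (h : K.Cross s x y) (h' : K.Cross s x' y) :
    x.2 = x'.2 ∧ K.SameEdge x.1 x'.1 := by
  obtain ⟨c, p, q, hm, hc, he, h1, h2⟩ := h
  obtain ⟨c', p', q', hm', hc', he', h1', h2'⟩ := h'
  obtain rfl := h2.unique h2' (meet_double' hm) (meet_double' hm')
  have hpp := K.no_triple _ _ _ (meet_symm hm) (meet_symm hm')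
  obtain rfl : c = c' := Subtype.ext (by rw [← hc, ← hc', γ_eq hpp])
  have hx : x.2 = x'.2 := mul_right_cancel (he.symm.trans he')
  refine ⟨hx, ?_⟩
  obtain ⟨x1, hx1, h3⟩ := h1.congr_right hpp
  exact (sameEdge_of_samePoint hx1 h1.1).trans (h3.sameEdge (hx ▸ h1'))

/-- Otherwise the edge would run in one direction into both points over the crossing, which would
then be the same point of the source. -/
theorem Cross.not_rev {x y : Param m × ℤˣ} (h : K.Cross s x y) (hy : y.2 = -x.2) :
    ¬ K.SameEdge x.1 y.1 := by
  intro he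
  obtain ⟨c, p, q, hm, hc, -, h1, h2⟩ := h
  have h3 : K.Approach y.1 x.2 q := by rw [hy] at h2; simpa using h2
  exact hm.2.2.1 (h1.samePoint (meet_double hm) he h3 (meet_double' hm))

theorem SameEdge.of_step {x y : Param m × ℤˣ} (h : K.Step s x y) : K.EStep s x y := by
  cases h with
  | along i t t' ε h1 h2 => exact Or.inl ⟨rfl, SameEdge.of_uIcc h2⟩
  | same p q ε h1 h2 => exact Or.inl ⟨rfl, sameEdge_of_samePoint h2 h1⟩
  | smoothing c p q p' q' ε δ h1 h2 h3 h4 h5 => exact Or.inr ⟨c, p, q, h1, h2, h3, h4, h5⟩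

theorem Cross.step {x y : Param m × ℤˣ} (h : K.Cross s x y) : K.Step s x y := by
  obtain ⟨c, p, q, hm, hc, he, h1, h2⟩ := h
  exact Step.smoothing c p q x.1 y.1 x.2 y.2 hm hc he h1 h2

/-- `Step.along` only moves forward, so points lying behind need an argument: the last passage of a
crossing may end anywhere on the new edge, and if no crossing has been passed the edge begins at the
leg. -/
theorem SegmentPasses.sameEdge {x : Param m × ℤˣ} {q : Param m}
    (h : Relation.ReflTransGen (K.Step s) ((none, 0), 1) x) (hq : K.SameEdge x.1 q) :
    Relation.ReflTransGen (K.Step s) ((none, 0), 1) (q, x.2) := by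
  induction h generalizing q with
  | refl =>
    obtain ⟨t, ht, ht'⟩ := hq
    obtain ⟨n, hn, e⟩ := samePoint_iff.1 ht.symm
    simp only at hn e
    have := hn trivial
    subst this
    simp only [Int.cast_zero, add_zero] at e
    subst e
    refine .single (Step.along none 0 t 1 ?_ ht')
    have := (ht' t right_mem_uIcc).1 rfl
    simpa using this.1
  | @tail x y hx hxy ih =>
    rcases hxy with ⟨i, t, t', ε, h1, h2⟩ | ⟨p, p', ε, h1, h2⟩ | ⟨c, p, r, p', q', ε, δ, h1, h2, h3, h4, h5⟩
    · exact ih ((SameEdge.of_uIcc h2).trans hq)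
    · exact ih ((sameEdge_of_samePoint h2 h1).trans hq)
    · have : K.Cross s (p', ε) (q', δ) := ⟨c, p, r, h1, h2, h3, h4, h5⟩
      refine hx.tail ?_
      exact (this.congr (x' := (p', ε)) (y' := (q, δ)) rfl (.refl h4.1) rfl hq).step

theorem SegmentPasses.eStep {x y : Param m × ℤˣ} (h : K.SegmentPasses s x.1 x.2)
    (hxy : K.EStep s x y) : K.SegmentPasses s y.1 y.2 := by
  rcases hxy with ⟨h1, h2⟩ | h1
  · rw [← h1]; exact SegmentPasses.sameEdge h h2
  · exact Relation.ReflTransGen.tail h h1.step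

/-- To leave a crossing forward onto the edge of the leg, one would need a double point with a
negative parameter. -/
theorem not_cross_leg {x y : Param m × ℤˣ} (hy : y.2 = 1) (hy' : K.SameEdge (none, 0) y.1) :
    ¬ K.Cross s x y := by
  intro h
  have h' := h.congr (x' := x) (y' := ((none, 0), 1)) rfl (.refl h.regular_left) hy hy'.symm
  obtain ⟨c, p, q, hm, hc, -, h1, h2⟩ := h'
  rw [approach_neg] at h2
  have := hm.2.1 h2.2.1.symm
  linarith [this.1, h2.2.2.1]

/-- Closure under backward moves: the previous passage is unique by `Cross.left_unique`, and nothing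
arrives at the leg. Hence the directed reachability from the leg is a full equivalence class of
moves. -/
theorem SegmentPasses.eStep_symm {x y : Param m × ℤˣ} (h : K.SegmentPasses s y.1 y.2)
    (hxy : K.EStep s x y) : K.SegmentPasses s x.1 x.2 := by
  rcases hxy with ⟨h1, h2⟩ | hxy
  · rw [h1]; exact SegmentPasses.sameEdge h h2.symm
  have key : ∀ y : Param m × ℤˣ, Relation.ReflTransGen (K.Step s) ((none, 0), 1) y →
      ∀ x, K.Cross s x y → K.SegmentPasses s x.1 x.2 := by
    intro y hy
    induction hy with
    | refl => exact fun x hx => (not_cross_leg rfl (.refl K.regular_leg) hx).elim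
    | @tail z y hz hzy ih =>
      intro x hx
      rcases SameEdge.of_step hzy with ⟨h1, h2⟩ | h1
      · exact ih x (hx.congr rfl (.refl hx.regular_left) h1.symm h2.symm)
      · obtain ⟨h2, h3⟩ := h1.left_unique hx
        exact SegmentPasses.eStep (x := z) hz (Or.inl ⟨h2, h3⟩)
  exact key y h x hxy

theorem segmentPasses_iff_of_eqvGen {x y : Param m × ℤˣ} (h : Relation.EqvGen (K.EStep s) x y) :
    K.SegmentPasses s x.1 x.2 ↔ K.SegmentPasses s y.1 y.2 := by
  induction h with
  | rel x y h => exact ⟨fun h' => h'.eStep h, fun h' => h'.eStep_symm h⟩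
  | refl x => exact Iff.rfl
  | symm x y _ ih => exact ih.symm
  | trans x y z _ _ ih1 ih2 => exact ih1.trans ih2

theorem segmentPasses_leg (s : K.State) : K.SegmentPasses s (none, 0) 1 :=
  Relation.ReflTransGen.refl

/-- `CrossPath s k x y`: there is a path from `x` to `y` that passes `k` crossings. -/
inductive CrossPath (s : K.State) : ℕ → Param m × ℤˣ → Param m × ℤˣ → Prop
  | edge (x y : Param m × ℤˣ) : x.2 = y.2 → K.SameEdge x.1 y.1 → CrossPath s 0 x y
  | cross (k : ℕ) (x y z : Param m × ℤˣ) : K.Cross s x y → CrossPath s k y z →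
      CrossPath s (k + 1) x z

theorem CrossPath.congr_left {k : ℕ} {x x' y : Param m × ℤˣ} (h : CrossPath s k x y)
    (hx : x.2 = x'.2) (hx' : K.SameEdge x.1 x'.1) : CrossPath s k x' y := by
  cases h with
  | edge _ _ h1 h2 => exact .edge _ _ (hx ▸ h1) (hx'.symm.trans h2)
  | cross k _ z _ h1 h2 => exact .cross k _ z _ (h1.congr hx hx' rfl (.refl h1.regular_right)) h2

theorem CrossPath.congr_right {k : ℕ} {x y y' : Param m × ℤˣ} (h : CrossPath s k x y)
    (hy : y.2 = y'.2) (hy' : K.SameEdge y.1 y'.1) : CrossPath s k x y' := by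
  induction h with
  | edge _ _ h1 h2 => exact .edge _ _ (h1.trans hy) (h2.trans hy')
  | cross k _ z _ h1 h2 ih => exact .cross k _ z _ h1 (ih hy hy')

theorem CrossPath.exists_last {k : ℕ} {x y : Param m × ℤˣ} (h : CrossPath s (k + 1) x y) :
    ∃ z, CrossPath s k x z ∧ K.Cross s z y := by
  induction k generalizing x with
  | zero =>
    cases h with
    | cross _ _ z _ h1 h2 =>
      cases h2 with
      | edge _ _ h3 h4 =>
        exact ⟨x, .edge _ _ rfl (.refl h1.regular_left),
          h1.congr rfl (.refl h1.regular_left) h3 h4⟩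
  | succ k ih =>
    cases h with
    | cross _ _ z _ h1 h2 =>
      obtain ⟨w, hw, hw'⟩ := ih h2
      exact ⟨w, .cross _ _ _ _ h1 hw, hw'⟩

/-- A path never meets its own reversal. -/
theorem not_crossPath_rev (k : ℕ) (x : Param m × ℤˣ) : ¬ CrossPath s k x (rev x) := by
  induction k using Nat.strong_induction_on generalizing x with
  | _ k ih =>
    intro h
    cases h with
    | edge _ _ h1 h2 =>
      have h1 : x.2 = -x.2 := h1
      rcases Int.units_eq_one_or x.2 with h | h <;> rw [h] at h1 <;> exact absurd h1 (by decide)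
    | cross k _ y _ h1 h2 =>
      cases k with
      | zero =>
        cases h2 with
        | edge _ _ h3 h4 => exact h1.not_rev h3 h4.symm
      | succ k =>
        -- The last passage `w → rev x` and the reversed first passage `rev y → rev x` have the same
        -- end, so `w` and `rev y` agree up to an edge. This leaves a path from `y` to `rev y` with
        -- two crossings less.
        obtain ⟨w, hw, hw'⟩ := h2.exists_last
        obtain ⟨h3, h4⟩ := hw'.left_unique h1.reverse
        exact ih k (by omega) y (hw.congr_right h3 h4)

theorem SegmentPasses.crossPath {x : Param m × ℤˣ}
    (h : Relation.ReflTransGen (K.Step s) ((none, 0), 1) x) :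
    ∃ k, CrossPath s k ((none, 0), 1) x := by
  have key : ∀ {k} {x y z : Param m × ℤˣ}, CrossPath s k x y → K.Cross s y z →
      CrossPath s (k + 1) x z := by
    intro k x y z h hz
    induction h with
    | edge x y h1 h2 =>
      exact .cross 0 _ z _ (hz.congr h1.symm h2.symm rfl (.refl hz.regular_right))
        (.edge _ _ rfl (.refl hz.regular_right))
    | cross k x w y h1 h2 ih => exact .cross _ _ _ _ h1 (ih hz)
  induction h with
  | refl => exact ⟨0, .edge _ _ rfl (.refl K.regular_leg)⟩
  | tail _ h ih =>
    obtain ⟨k, hk⟩ := ih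
    rcases SameEdge.of_step h with ⟨h1, h2⟩ | h1
    · exact ⟨k, hk.congr_right h1 h2⟩
    · exact ⟨k + 1, key hk h1⟩

theorem not_segmentPasses_leg (s : K.State) : ¬ K.SegmentPasses s (none, 0) (-1) := by
  intro h
  obtain ⟨k, hk⟩ := SegmentPasses.crossPath h
  exact not_crossPath_rev k _ hk

/-! ## The coefficients of the 1-cycle `K - k_s` -/

open Classical in
/-- The indicator of a proposition. -/
def ind (P : Prop) : ℤ := if P then 1 else 0

/-- The coefficient at `p` of the 1-chain formed by an oriented 1-manifold given by `T`. -/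
def mult (T : Param m → ℤˣ → Prop) (p : Param m) : ℤ :=
  ind (T p 1) - ind (T p (-1))

/-- The coefficient at `p` of the 1-chain `K - k_s`. -/
def coef (s : K.State) (p : Param m) : ℤ := 1 - mult (K.SegmentPasses s) p

theorem mult_eq_of_sameEdge {p q : Param m} (h : K.SameEdge p q) :
    mult (K.SegmentPasses s) p = mult (K.SegmentPasses s) q := by
  have h' : ∀ ε, K.SegmentPasses s p ε ↔ K.SegmentPasses s q ε := fun ε =>
    segmentPasses_iff_of_eqvGen (x := (p, ε)) (y := (q, ε)) (.rel _ _ (Or.inl ⟨rfl, h⟩))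
  simp only [mult, h']

theorem coef_eq_of_sameEdge {p q : Param m} (h : K.SameEdge p q) :
    K.coef s p = K.coef s q := by rw [coef, coef, mult_eq_of_sameEdge h]

theorem coef_leg (s : K.State) : K.coef s (none, 0) = 0 := by
  simp [coef, mult, ind, segmentPasses_leg, not_segmentPasses_leg]

theorem mult_rev_of_segmentPasses {p q : Param m}
    (h1 : K.SegmentPasses s p 1 ↔ K.SegmentPasses s q (-1))
    (h2 : K.SegmentPasses s p (-1) ↔ K.SegmentPasses s q 1) :
    mult (K.SegmentPasses s) p = - mult (K.SegmentPasses s) q := by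
  simp only [mult, h1, h2]; ring

/-- At a crossing the chain `K - k_s` has no boundary. -/
theorem coef_kirchhoff {p q p₁ p₂ q₁ q₂ : Param m} (h : Meet K.γ p q)
    (hp₁ : K.Approach p₁ 1 p) (hp₂ : K.Approach p₂ (-1) p) (hq₁ : K.Approach q₁ 1 q)
    (hq₂ : K.Approach q₂ (-1) q) :
    (K.coef s p₂ - K.coef s p₁) + (K.coef s q₂ - K.coef s q₁) = 0 := by
  have key : ∀ x y, K.Cross s x y → (K.SegmentPasses s x.1 x.2 ↔ K.SegmentPasses s y.1 y.2) :=
    fun x y h => segmentPasses_iff_of_eqvGen (.rel _ _ (Or.inr h))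
  set c : K.Crossing := ⟨K.γ p, p, q, h, rfl⟩ with hc
  -- If the smoothing respects the orientation, each incoming edge is joined to the outgoing edge of
  -- the other branch, with equal multiplicities. Otherwise the two incoming edges are joined to
  -- each other, and so are the outgoing ones, with opposite multiplicities. The constants `1`
  -- coming from `K` cancel in both cases.
  rcases Int.units_eq_one_or (s c * K.sign c) with ht | ht
  · have e1 : mult (K.SegmentPasses s) p₁ = mult (K.SegmentPasses s) q₂ := by
      have a := key (p₁, 1) (q₂, 1) ⟨c, p, q, h, rfl, by simp [ht], hp₁, hq₂⟩
      have b := key (q₂, -1) (p₁, -1) ⟨c, q, p, meet_symm h, h.2.2.2.symm, by simp [ht], hq₂,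
        by simpa using hp₁⟩
      simp only at a b
      simp only [mult, a, b]
    have e2 : mult (K.SegmentPasses s) q₁ = mult (K.SegmentPasses s) p₂ := by
      have a := key (q₁, 1) (p₂, 1) ⟨c, q, p, meet_symm h, h.2.2.2.symm, by simp [ht], hq₁, hp₂⟩
      have b := key (p₂, -1) (q₁, -1) ⟨c, p, q, h, rfl, by simp [ht], hp₂, by simpa using hq₁⟩
      simp only at a b
      simp only [mult, a, b]
    simp only [coef, e1, e2]; ring
  · have e1 : mult (K.SegmentPasses s) p₁ = - mult (K.SegmentPasses s) q₁ := by
      apply mult_rev_of_segmentPasses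
      · exact key (p₁, 1) (q₁, -1) ⟨c, p, q, h, rfl, by simp [ht], hp₁, by simpa using hq₁⟩
      · exact (key (q₁, 1) (p₁, -1) ⟨c, q, p, meet_symm h, h.2.2.2.symm, by simp [ht], hq₁,
          by simpa using hp₁⟩).symm
    have e2 : mult (K.SegmentPasses s) p₂ = - mult (K.SegmentPasses s) q₂ := by
      apply mult_rev_of_segmentPasses
      · exact (key (q₂, -1) (p₂, 1) ⟨c, q, p, meet_symm h, h.2.2.2.symm, by simp [ht], hq₂,
          hp₂⟩).symm
      · exact key (p₂, -1) (q₂, 1) ⟨c, p, q, h, rfl, by simp [ht], hp₂, hq₂⟩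
    simp only [coef, e1, e2]; ring

/-! ## Components -/

/-- Regular points of the source with a direction. -/
abbrev RPoint (K : Diagram m) : Type := {x : Param m × ℤˣ // K.Regular x.1}

/-- Moves on oriented regular points; for `b = true` the reversal of the direction is allowed. -/
def Move (b : Bool) (s : K.State) (x y : K.RPoint) : Prop :=
  K.EStep s x.1 y.1 ∨ (b = true ∧ x.1.1 = y.1.1)

/-- Allowing the reversal of the direction identifies the two orientations of every point, so
unoriented components can be counted by means of oriented moves. -/
theorem numComponents_eq (s : K.State) :
    K.numComponents s = Nat.card (Quot (Move true s)) := by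
  refine Nat.card_congr ⟨Quot.lift (fun p => Quot.mk _ ⟨(p.1, 1), p.2⟩) ?_,
    Quot.lift (fun x => Quot.mk _ ⟨x.1.1, x.2⟩) ?_, ?_, ?_⟩
  · rintro p q ⟨ε, δ, h⟩
    have h1 : Quot.mk (Move true s) ⟨(p.1, 1), p.2⟩ = Quot.mk _ ⟨(p.1, ε), p.2⟩ :=
      Quot.sound (Or.inr ⟨rfl, rfl⟩)
    have h2 : Quot.mk (Move true s) ⟨(q.1, 1), q.2⟩ = Quot.mk _ ⟨(q.1, δ), q.2⟩ :=
      Quot.sound (Or.inr ⟨rfl, rfl⟩)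
    rw [h1, h2]
    exact Quot.sound (Or.inl (SameEdge.of_step h))
  · rintro ⟨⟨p, ε⟩, hp⟩ ⟨⟨q, δ⟩, hq⟩ (h | h)
    · rcases h with ⟨h1, t, h2, h3⟩ | h
      · simp only at h1 h2 h3
        have e1 : Quot.mk (fun p q : {p : Param m // K.Regular p} =>
            ∃ ε δ : ℤˣ, K.Step s (p.1, ε) (q.1, δ)) ⟨(p.1, t), h3 t right_mem_uIcc⟩ =
              Quot.mk _ ⟨q, hq⟩ :=
          Quot.sound ⟨1, 1, Step.same _ _ _ (h3 t right_mem_uIcc) h2.symm⟩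
        refine Eq.trans ?_ e1
        rcases le_total p.2 t with hl | hl
        · exact Quot.sound ⟨1, 1, Step.along p.1 p.2 t 1 (by simpa using hl) h3⟩
        · exact Quot.sound ⟨-1, -1, Step.along p.1 p.2 t (-1) (by simpa using hl) h3⟩
      · exact Quot.sound ⟨ε, δ, h.step⟩
    · have : p = q := h.2
      subst this
      rfl
  · rintro ⟨p⟩; rfl
  · rintro ⟨⟨⟨p, ε⟩, hp⟩⟩
    exact Quot.sound (Or.inr ⟨rfl, rfl⟩)

end Diagram

end

/-! ## Functions with jumps -/

theorem eq_of_eventuallyEq_nhds {κ : ℝ → ℝ} {a b : ℝ} (hab : a ≤ b)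
    (h : ∀ t ∈ Icc a b, ∀ᶠ r in 𝓝 t, κ r = κ t) : κ b = κ a := by
  have hd : ∀ t ∈ Icc a b, HasDerivAt κ 0 t := fun t ht =>
    (hasDerivAt_const t (κ t)).congr_of_eventuallyEq (h t ht)
  exact constant_of_has_deriv_right_zero (fun t ht => (hd t ht).continuousAt.continuousWithinAt)
    (fun t ht => (hd t ⟨ht.1, ht.2.le⟩).hasDerivWithinAt) b ⟨hab, le_rfl⟩

/-- The increment of a function that is locally constant outside a finite set is the sum of its
jumps. -/
theorem sub_eq_sum_jumps {κ J : ℝ → ℝ} {a : ℝ} (S : Finset ℝ) {b : ℝ} (hab : a ≤ b)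
    (hS : ∀ t ∈ S, t ∈ Ioo a b) (h : ∀ t ∈ Icc a b, t ∉ S → ∀ᶠ r in 𝓝 t, κ r = κ t)
    (hJ : ∀ t ∈ S, Tendsto (fun τ => κ (t + τ) - κ (t - τ)) (𝓝[>] 0) (𝓝 (J t))) :
    κ b - κ a = ∑ t ∈ S, J t := by
  classical
  -- Induction on the largest jump `c`: the induction hypothesis applies up to `c - τ`, the function
  -- is constant from `c + τ` on, and `τ` tends to `0`.
  induction S using Finset.induction_on_max generalizing b with
  | empty => simp [eq_of_eventuallyEq_nhds hab fun t ht => h t ht (by simp)]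
  | insert c S hc ih =>
    have hcab := hS c (Finset.mem_insert_self _ _)
    have hcS : c ∉ S := fun hcS => lt_irrefl _ (hc c hcS)
    rw [Finset.sum_insert hcS]
    have key : ∀ᶠ τ in 𝓝[>] (0 : ℝ), κ (c + τ) - κ (c - τ) = κ b - κ a - ∑ t ∈ S, J t := by
      have h1 : ∀ᶠ τ in 𝓝[>] (0 : ℝ), ∀ t ∈ S, t < c - τ := by
        refine (Finset.eventually_all S).2 fun t ht => ?_
        filter_upwards [Ioo_mem_nhdsGT (sub_pos.2 (hc t ht))] with τ hτ
        linarith [hτ.2]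
      filter_upwards [h1, Ioo_mem_nhdsGT (sub_pos.2 hcab.1), Ioo_mem_nhdsGT (sub_pos.2 hcab.2)]
        with τ h1 h2 h3
      have e1 : κ (c - τ) - κ a = ∑ t ∈ S, J t := by
        refine ih (b := c - τ) (by linarith [h2.2]) (fun t ht => ⟨(hS t (by simp [ht])).1, h1 t ht⟩)
          (fun t ht hts => h t ⟨ht.1, by linarith [ht.2, h2.1, hcab.2]⟩ ?_)
          (fun t ht => hJ t (by simp [ht]))
        simp only [Finset.mem_insert, hts, or_false]
        intro e; linarith [ht.2, h2.1]
      have e2 : κ b = κ (c + τ) := by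
        refine eq_of_eventuallyEq_nhds (by linarith [h3.2]) fun t ht =>
          h t ⟨by linarith [ht.1, h3.1, hcab.1], ht.2⟩ ?_
        simp only [Finset.mem_insert, not_or]
        exact ⟨fun e => by linarith [ht.1, h3.1], fun hts => by linarith [hc t hts, ht.1, h3.1]⟩
      linarith
    have := tendsto_nhds_unique (hJ c (by simp)) ((tendsto_congr' key).2 tendsto_const_nhds)
    linarith

/-! ## The logarithm along an arc -/

theorem hasDerivAt_primitive {E : Type*} [NormedAddCommGroup E] [NormedSpace ℝ E] [CompleteSpace E]
    {h : ℝ → E} {a b : ℝ} (hc : ContinuousOn h (Icc a b)) {t : ℝ}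
    (ht : t ∈ Ioo a b) : HasDerivAt (fun t => ∫ x in a..t, h x) (h t) t := by
  have hsub : Icc a t ⊆ Icc a b := Icc_subset_Icc_right ht.2.le
  refine intervalIntegral.integral_hasDerivAt_right ?_ ?_ ?_
  · exact (hc.mono (by rw [uIcc_of_le ht.1.le]; exact hsub)).intervalIntegrable
  · exact (hc.mono Ioo_subset_Icc_self).stronglyMeasurableAtFilter isOpen_Ioo t ht
  · exact hc.continuousAt (Icc_mem_nhds ht.1 ht.2)

theorem continuousOn_primitive {E : Type*} [NormedAddCommGroup E] [NormedSpace ℝ E]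
    {h : ℝ → E} {a b : ℝ} (hab : a ≤ b) (hc : ContinuousOn h (Icc a b)) :
    ContinuousOn (fun t => ∫ x in a..t, h x) (Icc a b) := by
  have := intervalIntegral.continuousOn_primitive_interval (μ := MeasureTheory.volume) (f := h)
    (a := a) (b := b) (by rw [uIcc_of_le hab]; exact hc.integrableOn_Icc)
  rwa [uIcc_of_le hab] at this

/-- The product of `f` with `exp (-∫ f' / f)` has derivative zero. -/
theorem exp_integral_logDeriv {f f' : ℝ → ℂ} {a b : ℝ} (hab : a ≤ b) (hf : ContinuousOn f (Icc a b))
    (hd : ∀ t ∈ Ioo a b, HasDerivAt f (f' t) t) (hf' : ContinuousOn f' (Icc a b))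
    (h0 : ∀ t ∈ Icc a b, f t ≠ 0) :
    Complex.exp (∫ t in a..b, f' t / f t) * f a = f b := by
  have hc : ContinuousOn (fun t => f' t / f t) (Icc a b) := hf'.div hf h0
  set E : ℝ → ℂ := fun t => ∫ x in a..t, f' x / f x with hE
  have hEc := continuousOn_primitive hab hc
  have h1 : ContinuousOn (fun t => Complex.exp (-E t) * f t) (Icc a b) :=
    ((Complex.continuous_exp.comp_continuousOn hEc.neg)).mul hf
  have h2 : ∀ t ∈ Ioo a b, HasDerivWithinAt (fun t => Complex.exp (-E t) * f t) 0 (Ioi t) t := by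
    intro t ht
    have := ((hasDerivAt_primitive hc ht).neg.cexp).mul (hd t ht)
    refine (this.congr_deriv ?_).hasDerivWithinAt
    have := h0 t ⟨ht.1.le, ht.2.le⟩
    simp only [Pi.neg_apply]
    field_simp
    ring
  have h3 := intervalIntegral.integral_eq_sub_of_hasDeriv_right_of_le hab h1 h2 (by simp)
  simp only [intervalIntegral.integral_zero, hE, intervalIntegral.integral_same, neg_zero,
    Complex.exp_zero, one_mul] at h3
  have h4 := sub_eq_zero.1 h3.symm
  rw [← h4, ← mul_assoc, ← Complex.exp_add]
  simp

/-- `∫ dw / (w - z)` along the arc `α`, restricted to `[a, b]`; `α'` is the derivative of `α`. -/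
def arcLog (α α' : ℝ → ℂ) (a b : ℝ) (z : ℂ) : ℂ := ∫ t in a..b, α' t / (α t - z)

section arcLog

variable {α α' : ℝ → ℂ} {a b : ℝ}

/-- Differentiation under the integral sign gives `∫ α' / (α - z)²`, and the integrand is the
derivative of `-(α - z)⁻¹`; only the ends of the arc survive. -/
theorem hasDerivAt_arcLog (hab : a ≤ b) (hα : ∀ t ∈ Icc a b, HasDerivAt α (α' t) t)
    (hα' : ContinuousOn α' (Icc a b)) {z : ℂ} (hz : ∀ t ∈ Icc a b, α t ≠ z) :
    HasDerivAt (arcLog α α' a b) (1 / (α a - z) - 1 / (α b - z)) z := by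
  have hc : ContinuousOn α (Icc a b) := fun t ht => (hα t ht).continuousAt.continuousWithinAt
  -- `δ` is the distance from `z` to the arc. On the ball of radius `δ / 2` all denominators are at
  -- least `δ / 2`, which yields the dominating constant.
  obtain ⟨δ, hδ, hδ'⟩ : ∃ δ > 0, ∀ t ∈ Icc a b, δ ≤ ‖α t - z‖ := by
    obtain ⟨t0, ht0, h⟩ := isCompact_Icc.exists_isMinOn (nonempty_Icc.2 hab)
      (hc.sub continuousOn_const : ContinuousOn (fun t => α t - z) (Icc a b)).norm
    exact ⟨‖α t0 - z‖, norm_pos_iff.2 (sub_ne_zero.2 (hz t0 ht0)), fun t ht => h ht⟩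
  obtain ⟨C, hC⟩ := isCompact_Icc.exists_bound_of_continuousOn hα'
  have hball : ∀ t ∈ Icc a b, ∀ x ∈ Metric.ball z (δ / 2), δ / 2 ≤ ‖α t - x‖ := by
    intro t ht x hx
    have h1 := hδ' t ht
    have h2 : ‖α t - z‖ ≤ ‖α t - x‖ + ‖x - z‖ := by
      simpa using norm_add_le (α t - x) (x - z)
    rw [Metric.mem_ball, dist_eq_norm] at hx
    linarith
  have hne : ∀ t ∈ Icc a b, ∀ x ∈ Metric.ball z (δ / 2), α t - x ≠ 0 := fun t ht x hx =>
    norm_pos_iff.1 (lt_of_lt_of_le (by linarith) (hball t ht x hx))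
  have hmeas : ∀ x ∈ Metric.ball z (δ / 2), ContinuousOn (fun t => α' t / (α t - x)) (Icc a b) :=
    fun x hx => hα'.div (hc.sub continuousOn_const) fun t ht => hne t ht x hx
  have hzb : z ∈ Metric.ball z (δ / 2) := Metric.mem_ball_self (by linarith)
  have hcd : ContinuousOn (fun t => α' t / (α t - z) ^ 2) (Icc a b) :=
    hα'.div ((hc.sub continuousOn_const).pow 2) fun t ht => pow_ne_zero 2 (hne t ht z hzb)
  have hI : uIoc a b ⊆ Icc a b := by rw [uIoc_of_le hab]; exact Ioc_subset_Icc_self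
  have main := intervalIntegral.hasDerivAt_integral_of_dominated_loc_of_deriv_le
    (μ := MeasureTheory.volume) (F := fun x t => α' t / (α t - x))
    (F' := fun x t => α' t / (α t - x) ^ 2) (x₀ := z) (a := a) (b := b)
    (s := Metric.ball z (δ / 2)) (bound := fun _ => C / (δ / 2) ^ 2)
    (Metric.ball_mem_nhds _ (by linarith)) ?_ ?_ ?_ ?_ ?_ ?_
  · refine main.2.congr_deriv ?_
    have h1 : ∀ t ∈ Ioo a b, HasDerivAt (fun t => - (α t - z)⁻¹) (α' t / (α t - z) ^ 2) t := by
      intro t ht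
      have ht' : t ∈ Icc a b := ⟨ht.1.le, ht.2.le⟩
      have := (((hα t ht').sub_const z).fun_inv (hne t ht' z hzb)).neg
      refine this.congr_deriv ?_
      ring
    have h2 := intervalIntegral.integral_eq_sub_of_hasDerivAt_of_le hab
      (((hc.sub continuousOn_const).inv₀ fun t ht => hne t ht z hzb).neg) h1
      (hcd.intervalIntegrable_of_Icc hab)
    rw [h2]
    simp only [one_div, Pi.neg_apply, Pi.inv_apply, Pi.sub_apply]
    ring
  · filter_upwards [Metric.ball_mem_nhds z (ε := δ / 2) (by linarith)] with x hx
    exact ((hmeas x hx).mono hI).aestronglyMeasurable measurableSet_uIoc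
  · exact (hmeas z hzb).intervalIntegrable_of_Icc hab
  · exact (hcd.mono hI).aestronglyMeasurable measurableSet_uIoc
  · refine Eventually.of_forall fun t ht x hx => ?_
    rw [norm_div, norm_pow]
    have h1 := hball t (hI ht) x hx
    have h2 := hC t (hI ht)
    have h3 : 0 ≤ C := (norm_nonneg _).trans h2
    gcongr
  · simp
  · refine Eventually.of_forall fun t ht x hx => ?_
    have := ((hasDerivAt_const x (α' t)).div ((hasDerivAt_const x (α t)).sub (hasDerivAt_id x))
      (hne t (hI ht) x hx))
    refine this.congr_deriv ?_
    simp

/-- Half of the jump: the integral over a short arc, seen from one side. -/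
theorem tendsto_arcLog_near {c : ℝ → ℂ} {t₀ : ℝ} {v ε : ℂ} (hv : v ≠ 0) (hε : ε ≠ 0)
    (hab : a ≤ b) (hα : ∀ t ∈ Icc a b, HasDerivAt α (α' t) t) (hα' : ContinuousOn α' (Icc a b))
    {l : Filter ℝ} (hc : Tendsto c l (𝓝 (α t₀)))
    (hs : ∀ᶠ τ in l, ∀ t ∈ Icc a b, ε * ((α t - c τ) / v) ∈ Complex.slitPlane)
    (ha : ε * ((α a - α t₀) / v) ∈ Complex.slitPlane)
    (hb : ε * ((α b - α t₀) / v) ∈ Complex.slitPlane) :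
    Tendsto (fun τ => arcLog α α' a b (c τ)) l
      (𝓝 (Complex.log (ε * ((α b - α t₀) / v)) - Complex.log (ε * ((α a - α t₀) / v)))) := by
  have h1 : ∀ t, Tendsto (fun τ => ε * ((α t - c τ) / v)) l (𝓝 (ε * ((α t - α t₀) / v))) :=
    fun t => ((tendsto_const_nhds.sub hc).div_const v).const_mul ε
  have h2 : Tendsto (fun τ => Complex.log (ε * ((α b - c τ) / v)) -
      Complex.log (ε * ((α a - c τ) / v))) l
      (𝓝 (Complex.log (ε * ((α b - α t₀) / v)) - Complex.log (ε * ((α a - α t₀) / v)))) :=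
    ((h1 b).clog hb).sub ((h1 a).clog ha)
  refine (tendsto_congr' ?_).1 h2
  filter_upwards [hs] with τ hτ
  -- The constants `ε` and `v` only rotate and scale the picture so that the values stay off the
  -- branch cut; they cancel in the logarithmic derivative.
  have hd : ∀ t ∈ Icc a b, HasDerivAt (fun t => Complex.log (ε * ((α t - c τ) / v)))
      (α' t / (α t - c τ)) t := by
    intro t ht
    have := ((((hα t ht).sub_const (c τ)).div_const v).const_mul ε).clog_real (hτ t ht)
    refine this.congr_deriv ?_
    have h0 : α t - c τ ≠ 0 := by
      intro h; have := hτ t ht; simp [h] at this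
    field_simp
  have hint : IntervalIntegrable (fun t => α' t / (α t - c τ)) MeasureTheory.volume a b := by
    refine (hα'.div (fun t ht => ((hα t ht).continuousAt.sub continuousAt_const).continuousWithinAt)
      fun t ht h => ?_).intervalIntegrable_of_Icc hab
    have := hτ t ht
    have h : α t - c τ = 0 := h
    simp [h] at this
  have := intervalIntegral.integral_eq_sub_of_hasDerivAt
    (f := fun t => Complex.log (ε * ((α t - c τ) / v))) (f' := fun t => α' t / (α t - c τ))
    (a := a) (b := b) (by rw [uIcc_of_le hab]; exact hd) hint
  rw [arcLog, this]

/-- In coordinates where the arc is tangent to the real axis, `ξ` on the arc lies in a thin cone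
about the axis and `w` on the crossing curve lies in a thin cone about the direction `p + q i`, `q >
0`. If the cones are thin enough, the arc is below the curve over the same real part. -/
theorem cone_estimate {p q κ τ s : ℝ} {ξ w : ℂ} (hκ : 0 < κ) (hκ' : κ ≤ 1 / 2)
    (hκq : κ * (4 + 4 * |p|) ≤ q) (hτ : 0 < τ) (hξ : ‖ξ - s‖ ≤ κ * |s|)
    (hw : ‖w - (p + q * Complex.I) * τ‖ ≤ κ * τ) (he : ξ.re = w.re) : ξ.im < w.im := by
  have h1 : |ξ.re - s| ≤ κ * |s| := by
    have := (Complex.abs_re_le_norm (ξ - s)).trans hξ; simpa using this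
  have h2 : |ξ.im| ≤ κ * |s| := by
    have := (Complex.abs_im_le_norm (ξ - s)).trans hξ; simpa using this
  have h3 : |w.re - p * τ| ≤ κ * τ := by
    have := (Complex.abs_re_le_norm _).trans hw; simpa using this
  have h4 : |w.im - q * τ| ≤ κ * τ := by
    have := (Complex.abs_im_le_norm _).trans hw; simpa using this
  have h5 : |s| ≤ 2 * (|p| + κ) * τ := by
    have e1 : |s| ≤ |ξ.re| + |ξ.re - s| := by
      have := abs_sub_abs_le_abs_sub s ξ.re
      rw [abs_sub_comm] at this; linarith
    have e2 : |w.re| ≤ |p| * τ + κ * τ := by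
      have := abs_sub_abs_le_abs_sub w.re (p * τ)
      rw [abs_mul, abs_of_pos hτ] at this; linarith
    have e3 : κ * |s| ≤ 1 / 2 * |s| := mul_le_mul_of_nonneg_right hκ' (abs_nonneg s)
    rw [he] at e1
    rw [he] at h1
    linarith
  have h6 := abs_le.1 h2
  have h7 := abs_le.1 h4
  have h8 : κ * |s| ≤ κ * (2 * (|p| + κ) * τ) := mul_le_mul_of_nonneg_left h5 hκ.le
  have h9 : κ * (4 + 4 * |p|) * τ ≤ q * τ := mul_le_mul_of_nonneg_right hκq hτ.le
  have h10 : κ * κ * τ ≤ κ * (1 / 2) * τ := by gcongr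
  have h11 : 0 < κ * τ := mul_pos hκ hτ
  have h12 : 0 ≤ κ * |p| * τ := by positivity
  nlinarith

/-- The distant parts of the arc contribute continuously. For the part near the crossing point the
integral is a difference of logarithms; seen from the left the values avoid the cut after
multiplication by `I`, seen from the right after multiplication by `-I`. The change of branch costs
`π` at each of the two ends, in opposite senses. -/
theorem tendsto_arcLog_jump_aux {c : ℝ → ℂ} {c' : ℂ} {t₀ s₀ : ℝ}
    (hα : ∀ t ∈ Icc a b, HasDerivAt α (α' t) t) (hα' : ContinuousOn α' (Icc a b))
    (ht₀ : t₀ ∈ Ioo a b) (hinj : ∀ t ∈ Icc a b, α t = α t₀ → t = t₀) (hc : HasDerivAt c c' s₀)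
    (he : c s₀ = α t₀) (hpos : 0 < (c' / α' t₀).im) :
    Tendsto (fun τ => (arcLog α α' a b (c (s₀ + τ))).im - (arcLog α α' a b (c (s₀ - τ))).im)
      (𝓝[>] 0) (𝓝 (2 * Real.pi)) := by
  set v := α' t₀ with hv
  have hv0 : v ≠ 0 := by rintro h; simp [h] at hpos
  set p := (c' / v).re with hp
  set q := (c' / v).im with hq
  have hpq : (p : ℂ) + q * Complex.I = c' / v := Complex.re_add_im _
  -- The opening of the two cones, chosen to satisfy the hypotheses of `cone_estimate`.
  set κ : ℝ := min (1 / 2) (q / (4 + 4 * |p|)) with hκ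
  have hden : 0 < 4 + 4 * |p| := by positivity
  have hκ0 : 0 < κ := lt_min (by norm_num) (by positivity)
  have hκ1 : κ ≤ 1 / 2 := min_le_left _ _
  have hκ2 : κ * (4 + 4 * |p|) ≤ q := (le_div_iff₀ hden).1 (min_le_right _ _)
  -- the estimates near the crossing point
  have hα0 := hα t₀ ⟨ht₀.1.le, ht₀.2.le⟩
  have hξ : ∀ᶠ t in 𝓝 t₀, ‖(α t - α t₀) / v - ((t - t₀ : ℝ) : ℂ)‖ ≤ κ * |t - t₀| := by
    have h1 : HasDerivAt (fun t => α t / v) 1 t₀ := by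
      have := hα0.div_const v
      rwa [← hv, div_self hv0] at this
    filter_upwards [h1.isLittleO.bound hκ0] with t ht
    simpa [div_sub_div_same] using ht
  have hw : ∀ᶠ s in 𝓝 s₀, ‖(c s - α t₀) / v - (p + q * Complex.I) * ((s - s₀ : ℝ) : ℂ)‖ ≤
      κ * |s - s₀| := by
    have h1 := hc.div_const v
    filter_upwards [h1.isLittleO.bound hκ0] with s hs
    rw [hpq, ← he, sub_div, mul_comm]
    simpa using hs
  obtain ⟨η, hη, hη'⟩ := Metric.eventually_nhds_iff.1 hξ
  -- Half of each bound, so that the short arc `[t₀ - η₁, t₀ + η₁]` lies inside the region of the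
  -- estimate and inside the open interval `(a, b)`.
  set η₁ : ℝ := min (η / 2) (min ((t₀ - a) / 2) ((b - t₀) / 2)) with hη₁
  have e1 : 0 < η₁ := lt_min (by linarith) (lt_min (by linarith [ht₀.1]) (by linarith [ht₀.2]))
  have e2 : η₁ ≤ η / 2 := min_le_left _ _
  have e3 : η₁ ≤ (t₀ - a) / 2 := (min_le_right _ _).trans (min_le_left _ _)
  have e4 : η₁ ≤ (b - t₀) / 2 := (min_le_right _ _).trans (min_le_right _ _)
  set a₁ := t₀ - η₁
  set b₁ := t₀ + η₁
  have haa : a < a₁ := by simp only [a₁]; linarith [ht₀.1]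
  have hbb : b₁ < b := by simp only [b₁]; linarith [ht₀.2]
  have hab1 : a₁ < b₁ := by simp only [a₁, b₁]; linarith
  have hsub : Icc a₁ b₁ ⊆ Icc a b := Icc_subset_Icc haa.le hbb.le
  have hsubl : Icc a a₁ ⊆ Icc a b := Icc_subset_Icc_right (hab1.trans hbb).le
  have hsubr : Icc b₁ b ⊆ Icc a b := Icc_subset_Icc_left (haa.trans hab1).le
  have hest : ∀ t ∈ Icc a₁ b₁, ‖(α t - α t₀) / v - ((t - t₀ : ℝ) : ℂ)‖ ≤ κ * |t - t₀| := by
    intro t ht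
    apply hη'
    rw [Real.dist_eq, abs_lt]
    constructor <;> [linarith [ht.1]; linarith [ht.2]]
  have hre : ∀ t ∈ Icc a₁ b₁, |((α t - α t₀) / v).re - (t - t₀)| ≤ 1 / 2 * |t - t₀| := by
    intro t ht
    have := (Complex.abs_re_le_norm _).trans (hest t ht)
    rw [Complex.sub_re, Complex.ofReal_re] at this
    exact this.trans (mul_le_mul_of_nonneg_right hκ1 (abs_nonneg _))
  set ξa := (α a₁ - α t₀) / v with hξa
  set ξb := (α b₁ - α t₀) / v with hξb
  have hra : ξa.re < 0 := by
    have := hre a₁ ⟨le_rfl, hab1.le⟩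
    have h2 : a₁ - t₀ = -η₁ := by simp [a₁]
    rw [h2, abs_neg, abs_of_pos e1] at this
    linarith [(abs_le.1 this).2]
  have hrb : 0 < ξb.re := by
    have := hre b₁ ⟨hab1.le, le_rfl⟩
    have h2 : b₁ - t₀ = η₁ := by simp [b₁]
    rw [h2, abs_of_pos e1] at this
    linarith [(abs_le.1 this).1]
  -- the near part, from both sides
  have hcc : Tendsto c (𝓝 s₀) (𝓝 (α t₀)) := he ▸ hc.continuousAt.tendsto
  have hplus : Tendsto (fun τ : ℝ => s₀ + τ) (𝓝[>] 0) (𝓝 s₀) := by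
    have : Tendsto (fun τ : ℝ => s₀ + τ) (𝓝 0) (𝓝 (s₀ + 0)) := tendsto_const_nhds.add tendsto_id
    rw [add_zero] at this
    exact this.mono_left nhdsWithin_le_nhds
  have hminus : Tendsto (fun τ : ℝ => s₀ - τ) (𝓝[>] 0) (𝓝 s₀) := by
    have : Tendsto (fun τ : ℝ => s₀ - τ) (𝓝 0) (𝓝 (s₀ - 0)) := tendsto_const_nhds.sub tendsto_id
    rw [sub_zero] at this
    exact this.mono_left nhdsWithin_le_nhds
  have hab' : a ≤ b := (ht₀.1.trans ht₀.2).le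
  have near1 := tendsto_arcLog_near (c := fun τ => c (s₀ + τ)) (l := 𝓝[>] 0) (t₀ := t₀) hv0
    Complex.I_ne_zero hab1.le (fun t ht => hα t (hsub ht)) (hα'.mono hsub) (hcc.comp hplus)
    (by
      filter_upwards [hplus.eventually hw, self_mem_nhdsWithin] with τ hτ hτ0 t ht
      have hτ0 : 0 < τ := hτ0
      rw [Complex.mem_slitPlane_iff_not_le_zero]
      by_contra hcon
      have hcon := Complex.le_def.1 hcon
      have e : α t - c (s₀ + τ) = (α t - α t₀) - (c (s₀ + τ) - α t₀) := by ring
      rw [e, sub_div] at hcon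
      simp only [Complex.mul_re, Complex.I_re, zero_mul, Complex.sub_im, Complex.I_im, one_mul,
        Complex.zero_re, Complex.mul_im, Complex.zero_im, Complex.sub_re, zero_add, zero_sub,
        neg_sub] at hcon
      have := cone_estimate hκ0 hκ1 hκ2 hτ0 (hest t ht)
        (by simpa [abs_of_pos hτ0] using hτ) (by linarith [hcon.2])
      linarith [hcon.1])
    (by rw [Complex.mem_slitPlane_iff]; right; simpa using hra.ne)
    (by rw [Complex.mem_slitPlane_iff]; right; simpa using hrb.ne')
  have near2 := tendsto_arcLog_near (c := fun τ => c (s₀ - τ)) (l := 𝓝[>] 0) (t₀ := t₀) hv0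
    (neg_ne_zero.2 Complex.I_ne_zero) hab1.le (fun t ht => hα t (hsub ht)) (hα'.mono hsub)
    (hcc.comp hminus)
    (by
      filter_upwards [hminus.eventually hw, self_mem_nhdsWithin] with τ hτ hτ0 t ht
      have hτ0 : 0 < τ := hτ0
      rw [Complex.mem_slitPlane_iff_not_le_zero]
      by_contra hcon
      have hcon := Complex.le_def.1 hcon
      have e : α t - c (s₀ - τ) = (α t - α t₀) - (c (s₀ - τ) - α t₀) := by ring
      rw [e, sub_div] at hcon
      simp only [Complex.mul_re, Complex.neg_re, Complex.I_re, zero_mul, Complex.sub_im,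
        Complex.neg_im, Complex.I_im, neg_mul, one_mul, Complex.zero_re, Complex.mul_im,
        Complex.zero_im, Complex.sub_re, zero_add, zero_sub, neg_sub] at hcon
      have h1 := hest t ht
      rw [← norm_neg] at h1
      have := cone_estimate (ξ := -((α t - α t₀) / v)) (w := -((c (s₀ - τ) - α t₀) / v))
        (s := -(t - t₀)) hκ0 hκ1 hκ2 hτ0
        (by rw [abs_neg, Complex.ofReal_neg]; exact le_of_eq_of_le (congrArg norm (by ring)) h1)
        (by
          have h2 := hτ
          rw [← norm_neg] at h2
          rw [show s₀ - τ - s₀ = -τ by ring, abs_neg, abs_of_pos hτ0] at h2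
          exact le_of_eq_of_le (congrArg norm (by push_cast; ring)) h2)
        (by simp only [Complex.neg_re]; linarith [hcon.2])
      simp only [Complex.neg_im] at this
      linarith [hcon.1])
    (by rw [Complex.mem_slitPlane_iff]; right; simpa using hra.ne)
    (by rw [Complex.mem_slitPlane_iff]; right; simpa using hrb.ne')
  -- the far parts
  have far1 : ContinuousAt (arcLog α α' a a₁) (α t₀) :=
    (hasDerivAt_arcLog haa.le (fun t ht => hα t (hsubl ht)) (hα'.mono hsubl) fun t ht h => by
      have := hinj t (hsubl ht) h
      have h2 : a₁ < t₀ := by simp only [a₁]; linarith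
      linarith [ht.2]).continuousAt
  have far2 : ContinuousAt (arcLog α α' b₁ b) (α t₀) :=
    (hasDerivAt_arcLog hbb.le (fun t ht => hα t (hsubr ht)) (hα'.mono hsubr) fun t ht h => by
      have := hinj t (hsubr ht) h
      have h2 : t₀ < b₁ := by simp only [b₁]; linarith
      linarith [ht.1]).continuousAt
  -- A common point of the curve and the short arc would lie in both cones, and `cone_estimate`
  -- would make its imaginary part (or the negative of it) smaller than itself.
  have hne : ∀ᶠ s in 𝓝[≠] s₀, ∀ t ∈ Icc a₁ b₁, α t ≠ c s := by
    filter_upwards [nhdsWithin_le_nhds hw, self_mem_nhdsWithin] with s hs hs0 t ht hcon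
    have hs0 : s ≠ s₀ := hs0
    have h1 := hest t ht
    rw [hcon] at h1
    rcases lt_or_gt_of_ne hs0 with hlt | hlt
    · rw [← norm_neg] at h1 hs
      have := cone_estimate (ξ := -((c s - α t₀) / v)) (w := -((c s - α t₀) / v))
        (s := -(t - t₀)) (τ := s₀ - s) hκ0 hκ1 hκ2 (by linarith)
        (by rw [abs_neg, Complex.ofReal_neg]; exact le_of_eq_of_le (congrArg norm (by ring)) h1)
        (by
          rw [abs_of_neg (by linarith)] at hs
          convert hs using 1
          · congr 1; push_cast; ring
          · ring) rfl
      exact lt_irrefl _ this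
    · have := cone_estimate (τ := s - s₀) hκ0 hκ1 hκ2 (by linarith) h1
        (by rwa [abs_of_pos (by linarith)] at hs) rfl
      exact lt_irrefl _ this
  have hsplit : ∀ᶠ s in 𝓝[≠] s₀, arcLog α α' a b (c s) =
      arcLog α α' a a₁ (c s) + arcLog α α' a₁ b₁ (c s) + arcLog α α' b₁ b (c s) := by
    have hl : ∀ᶠ z in 𝓝 (α t₀), ∀ t ∈ Icc a a₁ ∪ Icc b₁ b, α t ≠ z := by
      have hcomp : IsCompact (α '' (Icc a a₁ ∪ Icc b₁ b)) := by
        refine (isCompact_Icc.union isCompact_Icc).image_of_continuousOn fun t ht => ?_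
        exact (hα t (ht.elim (fun h => hsubl h) fun h => hsubr h)).continuousAt.continuousWithinAt
      have : α t₀ ∉ α '' (Icc a a₁ ∪ Icc b₁ b) := by
        rintro ⟨t, ht, h⟩
        have h1 := hinj t (ht.elim (fun h => hsubl h) fun h => hsubr h) h
        have h2 : t₀ < b₁ := by simp only [b₁]; linarith
        have h3 : a₁ < t₀ := by simp only [a₁]; linarith
        rcases ht with ht | ht
        · linarith [ht.2]
        · linarith [ht.1]
      filter_upwards [hcomp.isClosed.isOpen_compl.mem_nhds this] with z hz t ht h
      exact hz ⟨t, ht, h⟩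
    filter_upwards [hne, nhdsWithin_le_nhds (hcc.eventually hl)] with s h1 h2
    have hall : ∀ t ∈ Icc a b, α t - c s ≠ 0 := by
      intro t ht
      rw [sub_ne_zero]
      by_cases h3 : t ≤ a₁
      · exact h2 t (Or.inl ⟨ht.1, h3⟩)
      by_cases h4 : b₁ ≤ t
      · exact h2 t (Or.inr ⟨h4, ht.2⟩)
      · exact h1 t ⟨(not_le.1 h3).le, (not_le.1 h4).le⟩
    have hcont : ContinuousOn (fun t => α' t / (α t - c s)) (Icc a b) :=
      hα'.div (fun t ht => ((hα t ht).continuousAt.sub continuousAt_const).continuousWithinAt) hall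
    have i1 := (hcont.mono hsubl).intervalIntegrable_of_Icc (μ := MeasureTheory.volume) haa.le
    have i2 := (hcont.mono hsub).intervalIntegrable_of_Icc (μ := MeasureTheory.volume) hab1.le
    have i3 := (hcont.mono hsubr).intervalIntegrable_of_Icc (μ := MeasureTheory.volume) hbb.le
    simp only [arcLog]
    rw [intervalIntegral.integral_add_adjacent_intervals i1 i2,
      intervalIntegral.integral_add_adjacent_intervals (i1.trans i2) i3]
  have hplus' : Tendsto (fun τ : ℝ => s₀ + τ) (𝓝[>] 0) (𝓝[≠] s₀) :=
    tendsto_nhdsWithin_iff.2 ⟨hplus, by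
      filter_upwards [self_mem_nhdsWithin] with τ hτ
      have : (0 : ℝ) < τ := hτ
      simp [this.ne']⟩
  have hminus' : Tendsto (fun τ : ℝ => s₀ - τ) (𝓝[>] 0) (𝓝[≠] s₀) :=
    tendsto_nhdsWithin_iff.2 ⟨hminus, by
      filter_upwards [self_mem_nhdsWithin] with τ hτ
      have : (0 : ℝ) < τ := hτ
      simp [this.ne']⟩
  have t1 := ((far1.tendsto.comp (hcc.comp hplus)).add near1).add (far2.tendsto.comp (hcc.comp hplus))
  have t2 := ((far1.tendsto.comp (hcc.comp hminus)).add near2).add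
    (far2.tendsto.comp (hcc.comp hminus))
  have t3 := (Complex.continuous_im.continuousAt.tendsto.comp t1).sub
    (Complex.continuous_im.continuousAt.tendsto.comp t2)
  -- `ξb` lies in the right half plane and `ξa` in the left one, so replacing the factor `I` by `-I`
  -- changes their arguments by `-π` and `+π`.
  have hlim : 2 * Real.pi = (arcLog α α' a a₁ (α t₀) + (Complex.log (Complex.I * ξb) -
      Complex.log (Complex.I * ξa)) + arcLog α α' b₁ b (α t₀)).im -
      (arcLog α α' a a₁ (α t₀) + (Complex.log (-Complex.I * ξb) -
      Complex.log (-Complex.I * ξa)) + arcLog α α' b₁ b (α t₀)).im := by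
    have hb1 : Complex.arg (-Complex.I * ξb) = Complex.arg (Complex.I * ξb) - Real.pi := by
      rw [neg_mul]; exact Complex.arg_neg_eq_arg_sub_pi_of_im_pos (by simpa using hrb)
    have ha1 : Complex.arg (-Complex.I * ξa) = Complex.arg (Complex.I * ξa) + Real.pi := by
      rw [neg_mul]; exact Complex.arg_neg_eq_arg_add_pi_of_im_neg (by simpa using hra)
    simp only [Complex.add_im, Complex.sub_im, Complex.log_im, ha1, hb1]
    ring
  rw [hlim]
  refine (tendsto_congr' ?_).1 t3
  filter_upwards [hplus'.eventually hsplit, hminus'.eventually hsplit] with τ h1 h2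
  simp only [Function.comp_apply, h1, h2]

theorem im_conj_mul (v w : ℂ) (hv : v ≠ 0) :
    ((starRingEnd ℂ) v * w).im = Complex.normSq v * (w / v).im := by
  have h : Complex.normSq v ≠ 0 := by simpa using hv
  rw [Complex.div_im]
  simp only [Complex.mul_im, Complex.conj_re, Complex.conj_im]
  field_simp
  ring

/-- The jump of the argument when an arc is crossed from the right to the left. -/
theorem tendsto_arcLog_jump {c : ℝ → ℂ} {c' : ℂ} {t₀ s₀ : ℝ}
    (hα : ∀ t ∈ Icc a b, HasDerivAt α (α' t) t) (hα' : ContinuousOn α' (Icc a b))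
    (ht₀ : t₀ ∈ Ioo a b) (hinj : ∀ t ∈ Icc a b, α t = α t₀ → t = t₀) (hc : HasDerivAt c c' s₀)
    (he : c s₀ = α t₀) (hne : ((starRingEnd ℂ) (α' t₀) * c').im ≠ 0) :
    Tendsto (fun τ => (arcLog α α' a b (c (s₀ + τ))).im - (arcLog α α' a b (c (s₀ - τ))).im)
      (𝓝[>] 0) (𝓝 (2 * Real.pi * SignType.sign ((starRingEnd ℂ) (α' t₀) * c').im)) := by
  have hv : α' t₀ ≠ 0 := by rintro h; simp [h] at hne
  have hn : 0 < Complex.normSq (α' t₀) := Complex.normSq_pos.2 hv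
  rcases lt_or_gt_of_ne hne with h | h
  · have h1 : 0 < (-c' / α' t₀).im := by
      rw [im_conj_mul _ _ hv] at h
      rw [neg_div, Complex.neg_im]
      nlinarith
    -- Time reversal turns a crossing from the left to the right into the case already treated and
    -- changes the sign of the jump.
    have hc2 : HasDerivAt (fun s => c (-s)) (-c') (-s₀) := by
      have h0 : HasDerivAt (fun s : ℝ => -s) (-1) (-s₀) := (hasDerivAt_id _).neg
      have hc' : HasDerivAt c c' (-(-s₀)) := by simpa using hc
      simpa [Function.comp_def] using hc'.scomp (-s₀) h0
    have := (tendsto_arcLog_jump_aux hα hα' ht₀ hinj hc2 (by simpa using he) h1).neg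
    rw [sign_neg h]
    convert this using 2
    · rename_i τ
      rw [show -(-s₀ + τ) = s₀ - τ by ring, show -(-s₀ - τ) = s₀ + τ by ring]
      ring
    · simp
  · have h1 : 0 < (c' / α' t₀).im := by
      rw [im_conj_mul _ _ hv] at h
      exact (pos_iff_pos_of_mul_pos h).1 hn
    rw [sign_pos h]
    simpa using tendsto_arcLog_jump_aux hα hα' ht₀ hinj hc he h1

end arcLog

/-! ## Vectors in 3-space -/

/-- The scalar product in coordinates. -/
def dot3 (x y : E3) : ℝ := x 0 * y 0 + x 1 * y 1 + x 2 * y 2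

theorem det3_eq (x v w : E3) : det3 x v w =
    x 0 * (v 1 * w 2 - v 2 * w 1) + x 1 * (v 2 * w 0 - v 0 * w 2) +
      x 2 * (v 0 * w 1 - v 1 * w 0) := by
  simp only [det3, Matrix.det_fin_three, Matrix.of_apply, Matrix.cons_val', Matrix.cons_val_zero,
    Matrix.cons_val_one, Matrix.cons_val, Matrix.cons_val_fin_one]
  ring

theorem norm_eq_one_iff (x : E3) : ‖x‖ = 1 ↔ dot3 x x = 1 := by
  rw [EuclideanSpace.norm_eq, Real.sqrt_eq_one, Fin.sum_univ_three]
  simp only [dot3, Real.norm_eq_abs, sq_abs]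
  constructor <;> intro h <;> linarith

theorem dot3_comm (x y : E3) : dot3 x y = dot3 y x := by simp only [dot3]; ring

/-- For tangent vectors `v`, `w` of the unit sphere at `x`, the cross product of `v` and `w` is
a multiple of `x`. -/
theorem cross_eq {x v w : E3} (hx : dot3 x x = 1) (hv : dot3 x v = 0) (hw : dot3 x w = 0) :
    v 1 * w 2 - v 2 * w 1 = det3 x v w * x 0 ∧ v 2 * w 0 - v 0 * w 2 = det3 x v w * x 1 ∧
      v 0 * w 1 - v 1 * w 0 = det3 x v w * x 2 := by
  rw [det3_eq]
  simp only [dot3] at hx hv hw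
  refine ⟨?_, ?_, ?_⟩
  · linear_combination (-(v 1 * w 2 - v 2 * w 1)) * hx +
      (x 1 * w 2 - x 2 * w 1) * hv - (x 1 * v 2 - x 2 * v 1) * hw
  · linear_combination (-(v 2 * w 0 - v 0 * w 2)) * hx +
      (x 2 * w 0 - x 0 * w 2) * hv - (x 2 * v 0 - x 0 * v 2) * hw
  · linear_combination (-(v 0 * w 1 - v 1 * w 0)) * hx +
      (x 0 * w 1 - x 1 * w 0) * hv - (x 0 * v 1 - x 1 * v 0) * hw

theorem hasDerivAt_coord {γ : ℝ → E3} {v : E3} {t : ℝ} (h : HasDerivAt γ v t) (k : Fin 3) :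
    HasDerivAt (fun t => γ t k) (v k) t :=
  ((EuclideanSpace.proj k : E3 →L[ℝ] ℝ).hasFDerivAt.comp_hasDerivAt t h)

theorem hasDerivAt_dot3 {γ : ℝ → E3} {v : E3} {t : ℝ} (e : E3) (h : HasDerivAt γ v t) :
    HasDerivAt (fun t => dot3 e (γ t)) (dot3 e v) t := by
  have := (((hasDerivAt_coord h 0).const_mul (e 0)).add ((hasDerivAt_coord h 1).const_mul (e 1))).add
    ((hasDerivAt_coord h 2).const_mul (e 2))
  exact this

/-- The curve is known to lie on the sphere only over `[a, b]`, so the derivative of its squared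
norm is taken within this interval, where derivatives are unique even at the ends. -/
theorem dot3_eq_zero_of_sphere {γ : ℝ → E3} {v : E3} {a b t : ℝ} (hab : a < b) (ht : t ∈ Icc a b)
    (h : HasDerivAt γ v t) (hs : ∀ r ∈ Icc a b, ‖γ r‖ = 1) : dot3 (γ t) v = 0 := by
  have h1 : HasDerivAt (fun r => dot3 (γ r) (γ r)) (2 * dot3 (γ t) v) t := by
    have h0 := hasDerivAt_coord h 0
    have h1 := hasDerivAt_coord h 1
    have h2 := hasDerivAt_coord h 2
    have := ((h0.mul h0).add (h1.mul h1)).add (h2.mul h2)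
    refine this.congr_deriv ?_
    simp only [dot3]; ring
  have h2 : HasDerivWithinAt (fun r => dot3 (γ r) (γ r)) 0 (Icc a b) t := by
    refine (hasDerivWithinAt_const t (Icc a b) (1 : ℝ)).congr (fun r hr => ?_) ?_
    · exact (norm_eq_one_iff _).1 (hs r hr)
    · exact (norm_eq_one_iff _).1 (hs t ht)
  have := (uniqueDiffOn_Icc hab t ht).eq_deriv _ h1.hasDerivWithinAt h2
  linarith

/-! ## Stereographic charts -/

/-- A stereographic projection of the sphere from the point `N`; `e` is a unit vector orthogonal
to `N`. -/
structure Chart where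
  N : E3
  e : E3
  f : E3
  hN : dot3 N N = 1
  he : dot3 e e = 1
  hNe : dot3 N e = 0
  f0 : f 0 = N 1 * e 2 - N 2 * e 1
  f1 : f 1 = N 2 * e 0 - N 0 * e 2
  f2 : f 2 = N 0 * e 1 - N 1 * e 0

theorem exists_chart {N : E3} (hN : ‖N‖ = 1) : ∃ C : Chart, C.N = N := by
  rw [norm_eq_one_iff] at hN
  have : ∃ e : E3, dot3 e e = 1 ∧ dot3 N e = 0 := by
    -- If `N` lies on the third axis, the first basis vector is orthogonal to it; otherwise a
    -- quarter turn of the horizontal part of `N`, normalized, is.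
    by_cases h : N 0 ^ 2 + N 1 ^ 2 = 0
    · have h0 : N 0 = 0 := by nlinarith [sq_nonneg (N 0), sq_nonneg (N 1)]
      refine ⟨!₂[1, 0, 0], ?_, ?_⟩ <;> simp [dot3, h0]
    · set r := Real.sqrt (N 0 ^ 2 + N 1 ^ 2) with hr
      have hr2 : r ^ 2 = N 0 ^ 2 + N 1 ^ 2 := Real.sq_sqrt (by positivity)
      have hr0 : r ≠ 0 := by rintro h'; rw [h'] at hr2; exact h (by linarith)
      refine ⟨!₂[-N 1 / r, N 0 / r, 0], ?_, ?_⟩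
      · simp [dot3]; field_simp; linarith
      · simp [dot3]; field_simp; ring
  obtain ⟨e, he, hNe⟩ := this
  exact ⟨⟨N, e, !₂[N 1 * e 2 - N 2 * e 1, N 2 * e 0 - N 0 * e 2, N 0 * e 1 - N 1 * e 0], hN, he,
    hNe, by simp, by simp, by simp⟩, rfl⟩

namespace Chart

variable (C : Chart)

/-- The stereographic projection. -/
def st (x : E3) : ℂ := (dot3 C.e x + dot3 C.f x * Complex.I) / ((1 - dot3 C.N x : ℝ) : ℂ)

/-- The derivative of the stereographic projection at `x` in the direction `v`. -/
def stD (x v : E3) : ℂ := ((dot3 C.e v + dot3 C.f v * Complex.I) * ((1 - dot3 C.N x : ℝ) : ℂ) +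
  (dot3 C.e x + dot3 C.f x * Complex.I) * (dot3 C.N v : ℝ)) / ((1 - dot3 C.N x : ℝ) : ℂ) ^ 2

theorem hasDerivAt_st {γ : ℝ → E3} {v : E3} {t : ℝ} (h : HasDerivAt γ v t)
    (h0 : 1 - dot3 C.N (γ t) ≠ 0) : HasDerivAt (fun t => C.st (γ t)) (C.stD (γ t) v) t := by
  have h1 := (hasDerivAt_dot3 C.e h).ofReal_comp
  have h2 := (hasDerivAt_dot3 C.f h).ofReal_comp
  have h3 := ((hasDerivAt_const t (1 : ℝ)).sub (hasDerivAt_dot3 C.N h)).ofReal_comp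
  have := (h1.add (h2.mul_const Complex.I)).div h3 (by exact_mod_cast h0)
  refine this.congr_deriv ?_
  simp only [stD, Pi.add_apply, Pi.sub_apply]
  push_cast
  ring

theorem cross_e_f : C.e 1 * C.f 2 - C.e 2 * C.f 1 = C.N 0 ∧ C.e 2 * C.f 0 - C.e 0 * C.f 2 = C.N 1 ∧
    C.e 0 * C.f 1 - C.e 1 * C.f 0 = C.N 2 := by
  have he := C.he
  have hNe := C.hNe
  simp only [dot3] at he hNe
  rw [C.f0, C.f1, C.f2]
  refine ⟨?_, ?_, ?_⟩
  · linear_combination C.N 0 * he - C.e 0 * hNe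
  · linear_combination C.N 1 * he - C.e 1 * hNe
  · linear_combination C.N 2 * he - C.e 2 * hNe

theorem cross_f_N : C.f 1 * C.N 2 - C.f 2 * C.N 1 = C.e 0 ∧ C.f 2 * C.N 0 - C.f 0 * C.N 2 = C.e 1 ∧
    C.f 0 * C.N 1 - C.f 1 * C.N 0 = C.e 2 := by
  have hN := C.hN
  have hNe := C.hNe
  simp only [dot3] at hN hNe
  rw [C.f0, C.f1, C.f2]
  refine ⟨?_, ?_, ?_⟩
  · linear_combination C.e 0 * hN - C.N 0 * hNe
  · linear_combination C.e 1 * hN - C.N 1 * hNe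
  · linear_combination C.e 2 * hN - C.N 2 * hNe

theorem dot_e_f : dot3 C.e C.f = 0 := by
  simp only [dot3, C.f0, C.f1, C.f2]; ring

theorem dot_N_f : dot3 C.N C.f = 0 := by
  simp only [dot3, C.f0, C.f1, C.f2]; ring

theorem dot_f_f : dot3 C.f C.f = 1 := by
  have hN := C.hN
  have he := C.he
  have hNe := C.hNe
  simp only [dot3] at hN he hNe
  simp only [dot3, C.f0, C.f1, C.f2]
  linear_combination (C.e 0 ^ 2 + C.e 1 ^ 2 + C.e 2 ^ 2) * hN + he -
    (C.N 0 * C.e 0 + C.N 1 * C.e 1 + C.N 2 * C.e 2) * hNe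

/-- Coordinates with respect to the frame `e`, `f`, `N`. -/
theorem expand (x : E3) (k : Fin 3) :
    x k = dot3 C.e x * C.e k + dot3 C.f x * C.f k + dot3 C.N x * C.N k := by
  set M : Matrix (Fin 3) (Fin 3) ℝ := !![C.e 0, C.e 1, C.e 2; C.f 0, C.f 1, C.f 2;
    C.N 0, C.N 1, C.N 2] with hM
  have h1 : M * M.transpose = 1 := by
    have a1 := C.hN
    have a2 := C.he
    have a3 := C.hNe
    have a4 := C.dot_e_f
    have a5 := C.dot_N_f
    have a6 := C.dot_f_f
    simp only [dot3] at a1 a2 a3 a4 a5 a6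
    ext i j
    fin_cases i <;> fin_cases j <;>
      simp [hM, Matrix.mul_apply, Fin.sum_univ_three] <;> linarith
  have h2 : M.transpose * M = 1 := mul_eq_one_comm.1 h1
  have h3 : ∀ j, C.e k * C.e j + C.f k * C.f j + C.N k * C.N j = if k = j then 1 else 0 := by
    intro j
    have := congrFun (congrFun h2 k) j
    rw [Matrix.mul_apply, Fin.sum_univ_three, Matrix.one_apply] at this
    rw [← this]
    fin_cases k <;> fin_cases j <;> simp [hM]
  have h4 : x k = ∑ j, (if k = j then 1 else 0) * x j := by simp
  rw [h4, Fin.sum_univ_three, ← h3 0, ← h3 1, ← h3 2]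
  simp only [dot3]; ring

theorem norm_expand (x : E3) : dot3 C.e x ^ 2 + dot3 C.f x ^ 2 + dot3 C.N x ^ 2 = dot3 x x := by
  have h0 := C.expand x 0
  have h1 := C.expand x 1
  have h2 := C.expand x 2
  have : dot3 x x = x 0 * (dot3 C.e x * C.e 0 + dot3 C.f x * C.f 0 + dot3 C.N x * C.N 0) +
    x 1 * (dot3 C.e x * C.e 1 + dot3 C.f x * C.f 1 + dot3 C.N x * C.N 1) +
    x 2 * (dot3 C.e x * C.e 2 + dot3 C.f x * C.f 2 + dot3 C.N x * C.N 2) := by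
    rw [← h0, ← h1, ← h2]; rfl
  rw [this]
  simp only [dot3]; ring

theorem denom_pos {x : E3} (hx : ‖x‖ = 1) (hN : x ≠ C.N) : 0 < 1 - dot3 C.N x := by
  rw [norm_eq_one_iff] at hx
  have h := C.norm_expand x
  by_contra hle
  have hle : 1 ≤ dot3 C.N x := by linarith
  have e1 : dot3 C.e x = 0 := by nlinarith [sq_nonneg (dot3 C.e x), sq_nonneg (dot3 C.f x)]
  have e2 : dot3 C.f x = 0 := by nlinarith [sq_nonneg (dot3 C.e x), sq_nonneg (dot3 C.f x)]
  have e3 : dot3 C.N x = 1 := by nlinarith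
  apply hN
  ext k
  rw [C.expand x k, e1, e2, e3]; ring

theorem st_injOn {x y : E3} (hx : ‖x‖ = 1) (hxN : x ≠ C.N) (hy : ‖y‖ = 1) (hyN : y ≠ C.N)
    (h : C.st x = C.st y) : x = y := by
  have dx := C.denom_pos hx hxN
  have dy := C.denom_pos hy hyN
  have nx := C.norm_expand x
  have ny := C.norm_expand y
  rw [(norm_eq_one_iff x).1 hx] at nx
  rw [(norm_eq_one_iff y).1 hy] at ny
  have hxc : ((1 - dot3 C.N x : ℝ) : ℂ) ≠ 0 := by exact_mod_cast dx.ne'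
  have hyc : ((1 - dot3 C.N y : ℝ) : ℂ) ≠ 0 := by exact_mod_cast dy.ne'
  have h' := (div_eq_div_iff hxc hyc).1 h
  have hre := congrArg Complex.re h'
  have him := congrArg Complex.im h'
  simp only [Complex.mul_re, Complex.add_re, Complex.ofReal_re, Complex.I_re, mul_zero,
    Complex.ofReal_im, Complex.I_im, mul_one, sub_self, add_zero, Complex.add_im, Complex.mul_im,
    zero_add, sub_zero] at hre him
  set a := dot3 C.e x
  set b := dot3 C.f x
  set c := dot3 C.N x
  set a' := dot3 C.e y
  set b' := dot3 C.f y
  set c' := dot3 C.N y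
  -- On the sphere `|st x|² = (1 + c) / (1 - c)`, so equal projections force equal heights over the
  -- equator of the chart.
  have hc : c = c' := by
    have e1 : (a ^ 2 + b ^ 2) * (1 - c') ^ 2 = (a' ^ 2 + b' ^ 2) * (1 - c) ^ 2 := by
      linear_combination (a * (1 - c') + a' * (1 - c)) * hre + (b * (1 - c') + b' * (1 - c)) * him
    have e2 : (1 - c) * (1 - c') * ((1 + c) * (1 - c') - (1 + c') * (1 - c)) = 0 := by
      linear_combination e1 - (1 - c') ^ 2 * nx + (1 - c) ^ 2 * ny
    have e3 := (mul_eq_zero.1 e2).resolve_left (mul_pos dx dy).ne'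
    linarith
  have ha : a = a' := by
    rw [hc] at hre
    exact mul_right_cancel₀ dy.ne' (by linarith)
  have hb : b = b' := by
    rw [hc] at him
    exact mul_right_cancel₀ dy.ne' (by linarith)
  ext k
  have e1 := C.expand x k
  have e2 := C.expand y k
  rw [e1, e2]
  simp only [a, b, c, a', b', c'] at ha hb hc
  rw [ha, hb, hc]

/-- The stereographic projection from the north pole reverses the orientation of the sphere. -/
theorem im_conj_stD {x v w : E3} (hx : ‖x‖ = 1) (hxN : x ≠ C.N) (hv : dot3 x v = 0)
    (hw : dot3 x w = 0) : ((starRingEnd ℂ) (C.stD x v) * C.stD x w).im =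
      -(det3 x v w) / (1 - dot3 C.N x) ^ 2 := by
  have hD := (C.denom_pos hx hxN).ne'
  rw [norm_eq_one_iff] at hx
  obtain ⟨c0, c1, c2⟩ := cross_eq hx hv hw
  obtain ⟨n0, n1, n2⟩ := C.cross_e_f
  obtain ⟨e0, e1, e2⟩ := C.cross_f_N
  have nx := C.norm_expand x
  rw [hx] at nx
  have f0 := C.f0
  have f1 := C.f1
  have f2 := C.f2
  set l := det3 x v w with hl
  -- The three minors are the coordinates, in the frame `e`, `f`, `N`, of the cross product of `v`
  -- and `w`, which is the multiple `l x` of the base point by `cross_eq`.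
  have P12 : dot3 C.e v * dot3 C.f w - dot3 C.e w * dot3 C.f v = l * dot3 C.N x := by
    have : dot3 C.e v * dot3 C.f w - dot3 C.e w * dot3 C.f v =
      (C.e 1 * C.f 2 - C.e 2 * C.f 1) * (v 1 * w 2 - v 2 * w 1) +
      (C.e 2 * C.f 0 - C.e 0 * C.f 2) * (v 2 * w 0 - v 0 * w 2) +
      (C.e 0 * C.f 1 - C.e 1 * C.f 0) * (v 0 * w 1 - v 1 * w 0) := by
      simp only [dot3]; ring
    rw [this, n0, n1, n2, c0, c1, c2]
    simp only [dot3]; ring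
  have P23 : dot3 C.f v * dot3 C.N w - dot3 C.f w * dot3 C.N v = l * dot3 C.e x := by
    have : dot3 C.f v * dot3 C.N w - dot3 C.f w * dot3 C.N v =
      (C.f 1 * C.N 2 - C.f 2 * C.N 1) * (v 1 * w 2 - v 2 * w 1) +
      (C.f 2 * C.N 0 - C.f 0 * C.N 2) * (v 2 * w 0 - v 0 * w 2) +
      (C.f 0 * C.N 1 - C.f 1 * C.N 0) * (v 0 * w 1 - v 1 * w 0) := by
      simp only [dot3]; ring
    rw [this, e0, e1, e2, c0, c1, c2]
    simp only [dot3]; ring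
  have P31 : dot3 C.N v * dot3 C.e w - dot3 C.N w * dot3 C.e v = l * dot3 C.f x := by
    have : dot3 C.N v * dot3 C.e w - dot3 C.N w * dot3 C.e v =
      (C.N 1 * C.e 2 - C.N 2 * C.e 1) * (v 1 * w 2 - v 2 * w 1) +
      (C.N 2 * C.e 0 - C.N 0 * C.e 2) * (v 2 * w 0 - v 0 * w 2) +
      (C.N 0 * C.e 1 - C.N 1 * C.e 0) * (v 0 * w 1 - v 1 * w 0) := by
      simp only [dot3]; ring
    rw [this, ← f0, ← f1, ← f2, c0, c1, c2]
    simp only [dot3]; ring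
  have key : ∀ a b c a' b' c' X Y D : ℝ, D ≠ 0 →
      ((starRingEnd ℂ) (((a + b * Complex.I) * (D : ℂ) + (X + Y * Complex.I) * (c : ℂ)) / (D : ℂ) ^ 2) *
        (((a' + b' * Complex.I) * (D : ℂ) + (X + Y * Complex.I) * (c' : ℂ)) / (D : ℂ) ^ 2)).im =
      ((a * D + X * c) * (b' * D + Y * c') - (b * D + Y * c) * (a' * D + X * c')) / D ^ 4 := by
    intro a b c a' b' c' X Y D hD
    have e : ∀ a b c : ℝ, ((a + b * Complex.I) * (D : ℂ) + (X + Y * Complex.I) * (c : ℂ)) / (D : ℂ) ^ 2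
        = (((a * D + X * c) / D ^ 2 : ℝ) : ℂ) + (((b * D + Y * c) / D ^ 2 : ℝ) : ℂ) * Complex.I := by
      intro a b c; push_cast; ring
    rw [e, e]
    simp only [map_add, map_mul, Complex.conj_ofReal, Complex.conj_I, Complex.mul_im, Complex.add_re,
      Complex.ofReal_re, Complex.mul_re, Complex.neg_re, Complex.I_re, Complex.ofReal_im,
      Complex.neg_im, Complex.I_im, Complex.add_im]
    field_simp
    ring
  rw [stD, stD, key _ _ _ _ _ _ _ _ _ hD]
  field_simp
  set D := 1 - dot3 C.N x with hDD
  have hcN : dot3 C.N x = 1 - D := by rw [hDD]; ring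
  rw [hcN] at P12 nx
  linear_combination D ^ 2 * P12 - D * dot3 C.e x * P23 - D * dot3 C.f x * P31 -
    D * l * nx

end Chart

/-! ## Choosing a point of the sphere outside finitely many curves -/

/-- The cones over the curves are images of the plane under smooth maps, so their Hausdorff
dimension is at most 2 and their complement is dense in space. A point of this complement close to
the ray of `x`, projected radially, lies on none of the curves. -/
theorem exists_point_avoiding {ι : Type*} [Finite ι] (c : ι → ℝ → E3)
    (hc : ∀ i, ContDiff ℝ ∞ (c i)) {U : Set E3} (hU : IsOpen U) {x : E3} (hx : ‖x‖ = 1)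
    (hxU : x ∈ U) : ∃ N : E3, ‖N‖ = 1 ∧ N ∈ U ∧ ∀ i t, c i t ≠ N := by
  have hdim : dimH (⋃ i, range fun z : ℝ × ℝ => z.1 • c i z.2) < Module.finrank ℝ E3 := by
    refine lt_of_le_of_lt (b := (2 : ENNReal)) ?_ ?_
    · rw [dimH_iUnion]
      refine iSup_le fun i => ?_
      have h1 : ContDiff ℝ 1 fun z : ℝ × ℝ => z.1 • c i z.2 :=
        contDiff_fst.smul (((hc i).of_le (by exact_mod_cast le_top)).comp contDiff_snd)
      refine h1.dimH_range_le.trans ?_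
      simp
    · simp; norm_num
  have hdense := dense_compl_of_dimH_lt_finrank hdim
  have hV : IsOpen {y : E3 | y ≠ 0 ∧ ‖y‖⁻¹ • y ∈ U} := by
    have hco : ContinuousOn (fun y : E3 => ‖y‖⁻¹ • y) {0}ᶜ :=
      (continuousOn_id.norm.inv₀ fun y hy => norm_ne_zero_iff.2 hy).smul continuousOn_id
    exact hco.isOpen_inter_preimage isOpen_compl_singleton hU
  have hx0 : x ≠ 0 := by rintro rfl; simp at hx
  obtain ⟨y, hy, hyV⟩ := hdense.exists_mem_open hV ⟨x, hx0, by simpa [hx] using hxU⟩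
  have hy0 : ‖y‖ ≠ 0 := norm_ne_zero_iff.2 hyV.1
  refine ⟨‖y‖⁻¹ • y, by rw [norm_smul, norm_inv, norm_norm, inv_mul_cancel₀ hy0], hyV.2, ?_⟩
  intro i t h
  refine hy (mem_iUnion.2 ⟨i, (‖y‖, t), ?_⟩)
  simp only
  rw [h, smul_smul, mul_inv_cancel₀ hy0, one_smul]

section

variable {m : ℕ}

namespace Diagram
variable {K : Diagram m} {s : K.State}

/-! ## The cycle `K - k_s` and a Stokes formula -/

theorem eventually_sameEdge {p : Param m} (hp : K.Regular p)
    (hd : ∀ᶠ r in 𝓝 p.2, Dom (p.1, r)) : ∀ᶠ r in 𝓝 p.2, K.SameEdge p (p.1, r) := by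
  have h1 : ∀ᶠ r in 𝓝 p.2, ¬ K.Double (p.1, r) := by
    have := K.eventually_not_double p.1 p.2
    rw [eventually_nhdsWithin_iff] at this
    filter_upwards [this] with r hr
    by_cases h : r = p.2
    · subst h; exact hp.2
    · exact hr h
  obtain ⟨δ, hδ, h⟩ := Metric.eventually_nhds_iff_ball.1 (h1.and hd)
  filter_upwards [Metric.ball_mem_nhds _ hδ] with r hr
  refine SameEdge.of_uIcc (i := p.1) (t := p.2) fun x hx => ?_
  have := (convex_ball p.2 δ).ordConnected.uIcc_subset (Metric.mem_ball_self hδ) hr hx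
  exact ⟨(h x this).2, (h x this).1⟩

theorem eventually_coef_eq {p : Param m} (hp : K.Regular p)
    (hd : ∀ᶠ r in 𝓝 p.2, Dom (p.1, r)) : ∀ᶠ r in 𝓝 p.2, K.coef s (p.1, r) = K.coef s p := by
  filter_upwards [eventually_sameEdge hp hd] with r hr
  exact (coef_eq_of_sameEdge hr).symm

theorem ind_mem (P : Prop) : 0 ≤ ind P ∧ ind P ≤ 1 := by
  unfold ind; split_ifs <;> simp

theorem abs_coef_le (s : K.State) (p : Param m) : |(K.coef s p : ℝ)| ≤ 2 := by
  have h1 := ind_mem (K.SegmentPasses s p 1)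
  have h2 := ind_mem (K.SegmentPasses s p (-1))
  have : |K.coef s p| ≤ 2 := by
    rw [coef, mult, abs_le]; constructor <;> linarith
  exact_mod_cast this

/-- The coefficient is bounded by 2 and locally constant outside a finite set of double points,
which is negligible. -/
theorem intervalIntegrable_coef_mul (s : K.State) {i : Option (Fin m)} {a b : ℝ} {η : ℝ → ℝ}
    (hd : ∀ t ∈ uIcc a b, Dom (i, t)) (hη : ContinuousOn η (uIcc a b)) :
    IntervalIntegrable (fun t => (K.coef s (i, t) : ℝ) * η t) MeasureTheory.volume a b := by
  rw [intervalIntegrable_iff]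
  set D := {t | t ∈ Icc (min a b) (max a b) ∧ K.Double (i, t)} with hD
  have hDf : D.Finite := K.finite_double i _ _
  set V := Ioo (min a b) (max a b) \ D with hV
  have hVm : MeasurableSet V := measurableSet_Ioo.diff hDf.measurableSet
  have hc : ContinuousOn (fun t => (K.coef s (i, t) : ℝ)) V := by
    intro t ht
    have htI : t ∈ Icc (min a b) (max a b) := ⟨ht.1.1.le, ht.1.2.le⟩
    have hreg : K.Regular (i, t) := ⟨hd t htI, fun h => ht.2 ⟨htI, h⟩⟩
    have hdm : ∀ᶠ r in 𝓝 t, Dom (i, r) := by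
      filter_upwards [Ioo_mem_nhds ht.1.1 ht.1.2] with r hr
      exact hd r ⟨hr.1.le, hr.2.le⟩
    refine ContinuousAt.continuousWithinAt ?_
    refine (continuousAt_const (y := (K.coef s (i, t) : ℝ))).congr ?_
    filter_upwards [eventually_coef_eq (s := s) (p := (i, t)) hreg hdm] with r hr
    rw [hr]
  have hae : (V : Set ℝ) =ᵐ[MeasureTheory.volume] uIoc a b := by
    have h1 : (V : Set ℝ) =ᵐ[MeasureTheory.volume] Ioo (min a b) (max a b) :=
      MeasureTheory.sdiff_null_ae_eq_self (hDf.measure_zero _)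
    exact h1.trans MeasureTheory.Ioo_ae_eq_Ioc
  have hint : MeasureTheory.IntegrableOn η (uIoc a b) MeasureTheory.volume :=
    intervalIntegrable_iff.1 hη.intervalIntegrable
  refine (hint.bdd_mul (c := 2) ?_ ?_)
  · rw [← MeasureTheory.Measure.restrict_congr_set hae]
    exact hc.aestronglyMeasurable hVm
  · exact Eventually.of_forall fun t => abs_coef_le s _

open Classical in
/-- The jump of the coefficient of `K - k_s` at a double point. -/
def coefJump (s : K.State) (p : Param m) : ℤ :=
  if h : K.Double p then
    K.coef s (exists_approach h (-1)).choose - K.coef s (exists_approach h 1).choose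
  else 0

theorem coefJump_add {p q : Param m} (h : Meet K.γ p q) : coefJump s p + coefJump s q = 0 := by
  rw [coefJump, coefJump, dif_pos (meet_double h), dif_pos (meet_double' h)]
  exact coef_kirchhoff h (exists_approach (meet_double h) 1).choose_spec
    (exists_approach (meet_double h) (-1)).choose_spec
    (exists_approach (meet_double' h) 1).choose_spec
    (exists_approach (meet_double' h) (-1)).choose_spec

theorem eventually_coefJump {p : Param m} (hp : K.Double p) : ∀ᶠ τ in 𝓝[>] (0 : ℝ),
    K.coef s (p.1, p.2 + τ) = K.coef s (exists_approach hp (-1)).choose ∧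
    K.coef s (p.1, p.2 - τ) = K.coef s (exists_approach hp 1).choose := by
  have h1 : Tendsto (fun τ : ℝ => p.2 + τ) (𝓝[>] 0) (𝓝[>] p.2) := by
    refine tendsto_nhdsWithin_iff.2 ⟨?_, ?_⟩
    · have : Tendsto (fun τ : ℝ => p.2 + τ) (𝓝 0) (𝓝 (p.2 + 0)) := tendsto_const_nhds.add tendsto_id
      rw [add_zero] at this
      exact this.mono_left nhdsWithin_le_nhds
    · filter_upwards [self_mem_nhdsWithin] with τ hτ
      have : (0 : ℝ) < τ := hτ
      simpa using this
  have h2 : Tendsto (fun τ : ℝ => p.2 - τ) (𝓝[>] 0) (𝓝[<] p.2) := by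
    refine tendsto_nhdsWithin_iff.2 ⟨?_, ?_⟩
    · have : Tendsto (fun τ : ℝ => p.2 - τ) (𝓝 0) (𝓝 (p.2 - 0)) := tendsto_const_nhds.sub tendsto_id
      rw [sub_zero] at this
      exact this.mono_left nhdsWithin_le_nhds
    · filter_upwards [self_mem_nhdsWithin] with τ hτ
      have : (0 : ℝ) < τ := hτ
      simpa using this
  have a1 := (exists_approach hp (-1)).choose_spec
  have a2 := (exists_approach hp 1).choose_spec
  filter_upwards [h1.eventually (eventually_approach_neg hp),
    h2.eventually (eventually_approach_pos hp)] with τ e1 e2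
  exact ⟨coef_eq_of_sameEdge (e1.sameEdge a1), coef_eq_of_sameEdge (e2.sameEdge a2)⟩

theorem eventually_eq_of_eventually_hasDerivAt_zero {κ : ℝ → ℝ} {t : ℝ}
    (h : ∀ᶠ r in 𝓝 t, HasDerivAt κ 0 r) : ∀ᶠ r in 𝓝 t, κ r = κ t := by
  obtain ⟨δ, hδ, h⟩ := Metric.eventually_nhds_iff_ball.1 h
  filter_upwards [Metric.ball_mem_nhds _ hδ] with r hr
  exact (convex_ball t δ).is_const_of_fderivWithin_eq_zero (𝕜 := ℝ)
    (fun x hx => (h x hx).differentiableAt.differentiableWithinAt)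
    (fun x hx => by
      rw [fderivWithin_of_isOpen Metric.isOpen_ball hx]
      have := (h x hx).hasFDerivAt.fderiv
      rw [this]; ext; simp) hr (Metric.mem_ball_self hδ)

/-- Stokes' formula for the cycle `K - k_s` on a family of intervals closed under crossings, and a
function `Ψ` with jumps `J` in a finite set of points. -/
theorem stokes {ι : Type*} [Fintype ι] (s : K.State) (I : ι → Option (Fin m)) (lo hi : ι → ℝ)
    (U : ι → Set ℝ) (A : ι → Finset ℝ) (Ψ : ι → ℝ → ℝ) (η : Param m → ℝ) (J : ι → ℝ → ℝ)
    (hlt : ∀ k, lo k < hi k)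
    (hU : ∀ k, IsOpen (U k)) (hUc : ∀ k, (U k).OrdConnected) (hIU : ∀ k, Icc (lo k) (hi k) ⊆ U k)
    (hdom : ∀ k, ∀ t ∈ U k, Dom (I k, t))
    (hlo : ∀ k, K.Regular (I k, lo k)) (hhi : ∀ k, K.Regular (I k, hi k))
    (hcl : ∀ k, ∀ t ∈ Ioo (lo k) (hi k), ∀ q, Meet K.γ (I k, t) q →
      ∃ k', ∃ t' ∈ Ioo (lo k') (hi k'), SamePoint q (I k', t'))
    (hinj : ∀ k, ∀ t ∈ Ioo (lo k) (hi k), ∀ k', ∀ t' ∈ Ioo (lo k') (hi k'),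
      SamePoint (I k, t) (I k', t') → k = k' ∧ t = t')
    (hA : ∀ k, ∀ t ∈ A k, t ∈ Ioo (lo k) (hi k) ∧ K.Regular (I k, t))
    (hη : ∀ k, ContinuousOn (fun t => η (I k, t)) (U k))
    (hΨ : ∀ k, ∀ t ∈ Icc (lo k) (hi k), t ∉ A k →
      ∀ᶠ r in 𝓝 t, HasDerivAt (Ψ k) (η (I k, r)) r)
    (hΨγ : ∀ k, ∀ t ∈ Ioo (lo k) (hi k), ∀ k', ∀ t' ∈ Ioo (lo k') (hi k'),
      Meet K.γ (I k, t) (I k', t') → Ψ k t = Ψ k' t')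
    (hJ : ∀ k, ∀ t ∈ A k,
      Tendsto (fun τ => Ψ k (t + τ) - Ψ k (t - τ)) (𝓝[>] 0) (𝓝 (J k t))) :
    ∑ k, (K.coef s (I k, hi k) * Ψ k (hi k) - K.coef s (I k, lo k) * Ψ k (lo k) -
      ∫ t in (lo k)..(hi k), (K.coef s (I k, t) : ℝ) * η (I k, t)) =
    ∑ k, ∑ t ∈ A k, (K.coef s (I k, t) : ℝ) * J k t := by
  classical
  set D : ι → Finset ℝ := fun k => (K.finite_double (I k) (lo k) (hi k)).toFinset with hD
  have hDmem : ∀ k t, t ∈ D k ↔ t ∈ Ioo (lo k) (hi k) ∧ K.Double (I k, t) := by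
    intro k t
    simp only [hD, Finite.mem_toFinset, mem_ofPred_eq]
    refine ⟨fun h => ⟨⟨lt_of_le_of_ne h.1.1 ?_, lt_of_le_of_ne h.1.2 ?_⟩, h.2⟩,
      fun h => ⟨⟨h.1.1.le, h.1.2.le⟩, h.2⟩⟩
    · intro e; exact (hlo k).2 (e ▸ h.2)
    · intro e; exact (hhi k).2 (e ▸ h.2)
  have hdisj : ∀ k, Disjoint (D k) (A k) := fun k => Finset.disjoint_left.2 fun t h1 h2 =>
    (hA k t h2).2.2 ((hDmem k t).1 h1).2
  have hint : ∀ k, ∀ t ∈ U k, ∀ t' ∈ U k, IntervalIntegrable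
      (fun t => (K.coef s (I k, t) : ℝ) * η (I k, t)) MeasureTheory.volume t t' := fun k t ht t' ht' =>
    intervalIntegrable_coef_mul s (fun r hr => hdom k r ((hUc k).uIcc_subset ht ht' hr))
      ((hη k).mono ((hUc k).uIcc_subset ht ht'))
  have hloU : ∀ k, lo k ∈ U k := fun k => hIU k ⟨le_rfl, (hlt k).le⟩
  have hprim : ∀ k, ∀ t ∈ U k, ContinuousAt
      (fun t => ∫ r in (lo k)..t, (K.coef s (I k, r) : ℝ) * η (I k, r)) t := by
    intro k t ht
    obtain ⟨δ, hδ, h⟩ := Metric.isOpen_iff.1 (hU k) t ht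
    have hl : t - δ / 2 ∈ U k := h (by simp [abs_of_pos hδ, hδ])
    have hr : t + δ / 2 ∈ U k := h (by simp [abs_of_pos hδ, hδ])
    have h1 := intervalIntegral.continuousOn_primitive_interval'
      (hint k _ hl _ hr) (a := t) (mem_uIcc.2 (Or.inl ⟨by linarith, by linarith⟩))
    have h2 : ContinuousAt (fun x => ∫ r in t..x, (K.coef s (I k, r) : ℝ) * η (I k, r)) t :=
      h1.continuousAt (by rw [uIcc_of_le (by linarith)]; exact Icc_mem_nhds (by linarith) (by linarith))
    have h3 := (continuousAt_const (y := ∫ r in (lo k)..t, (K.coef s (I k, r) : ℝ) * η (I k, r))).add h2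
    refine h3.congr ?_
    filter_upwards [(hU k).mem_nhds ht] with x hx
    exact intervalIntegral.integral_add_adjacent_intervals (hint k _ (hloU k) _ ht) (hint k _ ht _ hx)
  have key : ∀ k, K.coef s (I k, hi k) * Ψ k (hi k) - K.coef s (I k, lo k) * Ψ k (lo k) -
      ∫ t in (lo k)..(hi k), (K.coef s (I k, t) : ℝ) * η (I k, t) =
      ∑ t ∈ D k, (coefJump s (I k, t) : ℝ) * Ψ k t +
      ∑ t ∈ A k, (K.coef s (I k, t) : ℝ) * J k t := by
    intro k
    -- This function is locally constant except at double points, where the coefficient jumps and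
    -- `Ψ` is continuous, and at the points of `A k`, where `Ψ` jumps and the coefficient is locally
    -- constant.
    set κ : ℝ → ℝ := fun t => K.coef s (I k, t) * Ψ k t -
      ∫ r in (lo k)..t, (K.coef s (I k, r) : ℝ) * η (I k, r) with hκ
    set Jκ : ℝ → ℝ := fun t => if t ∈ A k then (K.coef s (I k, t) : ℝ) * J k t else
      (coefJump s (I k, t) : ℝ) * Ψ k t with hJκ
    have hdomE : ∀ t ∈ U k, ∀ᶠ r in 𝓝 t, Dom (I k, r) := fun t ht => by
      filter_upwards [(hU k).mem_nhds ht] with r hr using hdom k r hr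
    have main := sub_eq_sum_jumps (κ := κ) (J := Jκ) (D k ∪ A k) (hlt k).le ?_ ?_ ?_
    · rw [Finset.sum_union (hdisj k)] at main
      have e1 : ∑ t ∈ D k, Jκ t = ∑ t ∈ D k, (coefJump s (I k, t) : ℝ) * Ψ k t :=
        Finset.sum_congr rfl fun t ht => if_neg (Finset.disjoint_left.1 (hdisj k) ht)
      have e2 : ∑ t ∈ A k, Jκ t = ∑ t ∈ A k, (K.coef s (I k, t) : ℝ) * J k t :=
        Finset.sum_congr rfl fun t ht => if_pos ht
      rw [e1, e2] at main
      rw [← main]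
      simp only [hκ, intervalIntegral.integral_same]
      ring
    · intro t ht
      rcases Finset.mem_union.1 ht with h | h
      · exact ((hDmem k t).1 h).1
      · exact (hA k t h).1
    · intro t ht hnot
      rw [Finset.mem_union, not_or] at hnot
      have htU := hIU k ht
      have hreg : K.Regular (I k, t) := by
        rcases eq_or_lt_of_le ht.1 with h | h1
        · exact h ▸ hlo k
        rcases eq_or_lt_of_le ht.2 with h | h2
        · exact h ▸ hhi k
        exact ⟨hdom k t htU, fun h => hnot.1 ((hDmem k t).2 ⟨⟨h1, h2⟩, h⟩)⟩
      apply eventually_eq_of_eventually_hasDerivAt_zero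
      have hc := eventually_coef_eq (s := s) hreg (hdomE t htU)
      simp only at hc
      filter_upwards [hc.eventually_nhds, (hΨ k t ht hnot.2), (hU k).mem_nhds htU] with r h1 h2 hr
      have e1 : HasDerivAt (fun t => (K.coef s (I k, t) : ℝ) * Ψ k t)
          (K.coef s (I k, r) * η (I k, r)) r := by
        have hcr := h1.self_of_nhds
        refine ((h2.const_mul (K.coef s (I k, t) : ℝ)).congr_of_eventuallyEq ?_).congr_deriv ?_
        · filter_upwards [h1] with x hx
          rw [hx]
        · rw [hcr]
      have e2 : HasDerivAt (fun t => ∫ r in (lo k)..t, (K.coef s (I k, r) : ℝ) * η (I k, r))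
          (K.coef s (I k, r) * η (I k, r)) r := by
        obtain ⟨δ, hδ, hB⟩ := Metric.eventually_nhds_iff_ball.1 (h1.and ((hU k).mem_nhds hr))
        have hcont : ContinuousOn (fun t => (K.coef s (I k, t) : ℝ) * η (I k, t)) (Metric.ball r δ) := by
          refine ((continuousOn_const (c := (K.coef s (I k, t) : ℝ))).mul
            ((hη k).mono fun x hx => (hB x hx).2)).congr fun x hx => ?_
          simp only [(hB x hx).1, Pi.mul_apply]
        exact intervalIntegral.integral_hasDerivAt_right (hint k _ (hloU k) _ hr)
          (hcont.stronglyMeasurableAtFilter Metric.isOpen_ball r (Metric.mem_ball_self hδ))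
          (hcont.continuousAt (Metric.ball_mem_nhds _ hδ))
      exact (e1.sub e2).congr_deriv (sub_self _)
    · intro t ht
      have htI : t ∈ Ioo (lo k) (hi k) := by
        rcases Finset.mem_union.1 ht with h | h
        · exact ((hDmem k t).1 h).1
        · exact (hA k t h).1
      have htU := hIU k ⟨htI.1.le, htI.2.le⟩
      have lim1 : Tendsto (fun τ : ℝ => t + τ) (𝓝[>] 0) (𝓝 t) := by
        have : Tendsto (fun τ : ℝ => t + τ) (𝓝 0) (𝓝 (t + 0)) := tendsto_const_nhds.add tendsto_id
        rw [add_zero] at this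
        exact this.mono_left nhdsWithin_le_nhds
      have lim2 : Tendsto (fun τ : ℝ => t - τ) (𝓝[>] 0) (𝓝 t) := by
        have : Tendsto (fun τ : ℝ => t - τ) (𝓝 0) (𝓝 (t - 0)) := tendsto_const_nhds.sub tendsto_id
        rw [sub_zero] at this
        exact this.mono_left nhdsWithin_le_nhds
      have hH := ((hprim k t htU).tendsto.comp lim1).sub ((hprim k t htU).tendsto.comp lim2)
      rw [sub_self] at hH
      by_cases hAt : t ∈ A k
      · simp only [hJκ, if_pos hAt]
        have hc := eventually_coef_eq (s := s) (hA k t hAt).2 (hdomE t htU)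
        simp only at hc
        have h1 := ((hJ k t hAt).const_mul (K.coef s (I k, t) : ℝ)).sub hH
        rw [sub_zero] at h1
        refine (tendsto_congr' ?_).1 h1
        filter_upwards [lim1.eventually hc, lim2.eventually hc] with τ e1 e2
        simp only [hκ, Function.comp_apply, e1, e2]
        ring
      · have htD := ((hDmem k t).1 ((Finset.mem_union.1 ht).resolve_right hAt)).2
        simp only [hJκ, if_neg hAt]
        have hcont : ContinuousAt (Ψ k) t :=
          (hΨ k t ⟨htI.1.le, htI.2.le⟩ hAt).self_of_nhds.continuousAt
        set c₂ := K.coef s (exists_approach htD (-1)).choose with hc₂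
        set c₁ := K.coef s (exists_approach htD 1).choose with hc₁
        have hj : coefJump s (I k, t) = c₂ - c₁ := by rw [coefJump, dif_pos htD]
        have h1 := (((hcont.tendsto.comp lim1).const_mul (c₂ : ℝ)).sub
          ((hcont.tendsto.comp lim2).const_mul (c₁ : ℝ))).sub hH
        rw [sub_zero, ← sub_mul] at h1
        rw [hj]
        push_cast
        refine (tendsto_congr' ?_).1 h1
        filter_upwards [eventually_coefJump (s := s) htD] with τ h3
        have e3 : K.coef s (I k, t + τ) = c₂ := h3.1
        have e4 : K.coef s (I k, t - τ) = c₁ := h3.2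
        simp only [hκ, Function.comp_apply, e3, e4]
        ring
  rw [Finset.sum_congr rfl fun k _ => key k, Finset.sum_add_distrib]
  rw [add_eq_right, Finset.sum_sigma']
  -- The jumps at double points cancel in pairs: by `hcl` the partner of a double point belongs to
  -- the family as well, `Ψ` has the same value there, and the jumps of the coefficient are
  -- opposite.
  have hpart : ∀ x : Σ _ : ι, ℝ, x ∈ Finset.univ.sigma D → ∃ y : Σ _ : ι, ℝ,
      y ∈ Finset.univ.sigma D ∧ Meet K.γ (I x.1, x.2) (I y.1, y.2) := by
    rintro ⟨k, t⟩ hx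
    simp only [Finset.mem_sigma, Finset.mem_univ, true_and] at hx
    obtain ⟨h1, q, hq⟩ := (hDmem k t).1 hx
    obtain ⟨k', t', ht', hs⟩ := hcl k t h1 q hq
    have hm : Meet K.γ (I k, t) (I k', t') := meet_congr hq (.refl _) hs
    exact ⟨⟨k', t'⟩, by simpa using (hDmem k' t').2 ⟨ht', meet_double' hm⟩, hm⟩
  choose g hg1 hg2 using hpart
  have hI : ∀ x : Σ _ : ι, ℝ, x ∈ Finset.univ.sigma D → x.2 ∈ Ioo (lo x.1) (hi x.1) := fun x hx =>
    ((hDmem x.1 x.2).1 (Finset.mem_sigma.1 hx).2).1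
  refine Finset.sum_involution g ?_ ?_ hg1 ?_
  · intro x hx
    rw [hΨγ _ _ (hI x hx) _ _ (hI _ (hg1 x hx)) (hg2 x hx), ← add_mul]
    have := coefJump_add (s := s) (hg2 x hx)
    have : (coefJump s (I x.1, x.2) : ℝ) + coefJump s (I (g x hx).1, (g x hx).2) = 0 := by
      exact_mod_cast this
    rw [this, zero_mul]
  · intro x hx _ h
    have := (hg2 x hx).2.2.1
    rw [h] at this
    exact this (.refl _)
  · intro x hx
    have h1 := hg2 _ (hg1 x hx)
    have h2 := meet_symm (hg2 x hx)
    have h3 := K.no_triple _ _ _ h1 h2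
    obtain ⟨h4, h5⟩ := hinj _ _ (hI _ (hg1 _ (hg1 x hx))) _ _ (hI x hx) h3
    exact Sigma.ext h4 (heq_of_eq h5)

end Diagram

end

section

variable {m : ℕ}

namespace Diagram
variable {K : Diagram m} {s : K.State}

/-! ## Cutting the circles of a diagram -/

/-- The parameters of the points of a component other than the leg and the head. -/
def openDom {m : ℕ} (i : Option (Fin m)) : Set ℝ := {t | i = none → t ∈ Ioo (0 : ℝ) 1}

theorem isOpen_openDom (i : Option (Fin m)) : IsOpen (openDom i) := by
  cases i with
  | none => rw [show openDom (none : Option (Fin m)) = Ioo 0 1 by ext; simp [openDom]]; exact isOpen_Ioo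
  | some i => simp [openDom]

theorem ordConnected_openDom (i : Option (Fin m)) : (openDom i).OrdConnected := by
  cases i with
  | none => rw [show openDom (none : Option (Fin m)) = Ioo 0 1 by ext; simp [openDom]]; exact ordConnected_Ioo
  | some i => simpa [openDom] using ordConnected_univ

theorem dom_of_openDom {i : Option (Fin m)} {t : ℝ} (h : t ∈ openDom i) : Dom (i, t) :=
  fun hi => Ioo_subset_Icc_self (h hi)

/-- Intervals containing the points with the property `B` once. -/
structure Cut (B : Param m → Prop) where
  lo : Option (Fin m) → ℝ
  hi : Option (Fin m) → ℝ
  lt : ∀ i, lo i < hi i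
  pos : 0 < lo none
  lt_one : hi none < 1
  mem : ∀ t ∈ Icc (0 : ℝ) 1, B (none, t) → t ∈ Ioo (lo none) (hi none)
  add_one : ∀ i : Fin m, hi (some i) = lo (some i) + 1
  lo_not : ∀ i : Fin m, ¬ B (some i, lo (some i))
  congr : ∀ p q, SamePoint p q → (B p ↔ B q)

/-- Only finitely many parameters in `[0, 1]` have the property, so a slightly shortened segment
contains all those of the segment, and every circle has a point without it at which it can be cut
open. -/
theorem exists_cut {B : Param m → Prop} (hB : ∀ i, {t | t ∈ Icc (0 : ℝ) 1 ∧ B (i, t)}.Finite)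
    (h0 : ¬ B (none, 0)) (h1 : ¬ B (none, 1)) (hc : ∀ p q, SamePoint p q → (B p ↔ B q)) :
    Nonempty (Cut B) := by
  have e1 : ∃ δ : ℝ, 0 < δ ∧ δ < 1 / 2 ∧ ∀ t ∈ Icc (0 : ℝ) 1, B (none, t) → t ∈ Ioo δ (1 - δ) := by
    have f1 : ∀ᶠ δ in 𝓝[>] (0 : ℝ), ∀ t ∈ (hB none).toFinset, t ∈ Ioo δ (1 - δ) := by
      refine (Finset.eventually_all _).2 fun t ht => ?_
      have ht := (hB none).mem_toFinset.1 ht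
      have ht0 : 0 < t := lt_of_le_of_ne ht.1.1 fun e => h0 (e ▸ ht.2)
      have ht1 : t < 1 := lt_of_le_of_ne ht.1.2 fun e => h1 (e ▸ ht.2)
      filter_upwards [Ioo_mem_nhdsGT ht0, Ioo_mem_nhdsGT (sub_pos.2 ht1)] with δ e1 e2
      exact ⟨e1.2, by linarith [e2.2]⟩
    obtain ⟨δ, h1, h2⟩ := (f1.and (Ioo_mem_nhdsGT (show (0 : ℝ) < 1 / 2 by norm_num))).exists
    exact ⟨δ, h2.1, h2.2, fun t ht hb => h1 t ((hB none).mem_toFinset.2 ⟨ht, hb⟩)⟩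
  have e2 : ∀ i : Fin m, ∃ t : ℝ, ¬ B (some i, t) := by
    intro i
    by_contra hcon
    push Not at hcon
    have : Icc (0 : ℝ) 1 ⊆ {t | t ∈ Icc (0 : ℝ) 1 ∧ B (some i, t)} := fun t ht => ⟨ht, hcon t⟩
    exact Icc_infinite (show (0 : ℝ) < 1 by norm_num) ((hB (some i)).subset this)
  obtain ⟨δ, d1, d2, d3⟩ := e1
  choose c hc' using e2
  refine ⟨⟨fun i => i.elim δ c, fun i => i.elim (1 - δ) (fun i => c i + 1), ?_, d1, ?_, d3,
    fun i => rfl, hc', hc⟩⟩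
  · rintro (_ | i)
    · simp only [Option.elim]; linarith
    · simp
  · simp only [Option.elim]; linarith

namespace Cut

variable {B : Param m → Prop} (c : Cut B)

theorem exists_rep {p : Param m} (hd : Dom p) (hp : B p) :
    ∃ i, ∃ t ∈ Ioo (c.lo i) (c.hi i), SamePoint p (i, t) := by
  obtain ⟨_ | i, t⟩ := p
  · exact ⟨none, t, c.mem t (hd rfl) hp, .refl _⟩
  · set n := ⌊t - c.lo (some i)⌋ with hn
    have h1 := Int.floor_le (t - c.lo (some i))
    have h2 := Int.lt_floor_add_one (t - c.lo (some i))
    have hs : SamePoint ((some i, t) : Param m) (some i, t - n) := by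
      have := samePoint_shift (m := m) (some i) t (-n) (by simp)
      simpa [sub_eq_add_neg] using this
    refine ⟨some i, t - n, ⟨lt_of_le_of_ne (by linarith) ?_, ?_⟩, hs⟩
    · intro e
      exact c.lo_not i (e ▸ (c.congr _ _ hs).1 hp)
    · rw [c.add_one]; linarith

theorem inj {i j : Option (Fin m)} {t t' : ℝ} (ht : t ∈ Ioo (c.lo i) (c.hi i))
    (ht' : t' ∈ Ioo (c.lo j) (c.hi j)) (h : SamePoint ((i, t) : Param m) (j, t')) :
    i = j ∧ t = t' := by
  obtain ⟨n, hn, e⟩ := samePoint_iff.1 h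
  simp only [Prod.mk.injEq] at e hn
  obtain ⟨rfl, rfl⟩ := e
  refine ⟨rfl, ?_⟩
  cases j with
  | none => simp [hn rfl]
  | some i =>
    rw [c.add_one] at ht ht'
    have h1 : (-1 : ℝ) < n := by linarith [ht.2, ht'.1]
    have h2 : (n : ℝ) < 1 := by linarith [ht.1, ht'.2]
    have h3 : -1 < n := by exact_mod_cast h1
    have h4 : n < 1 := by exact_mod_cast h2
    have : n = 0 := by omega
    simp [this]

theorem Icc_subset (i : Option (Fin m)) : Icc (c.lo i) (c.hi i) ⊆ openDom i := by
  intro t ht hi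
  subst hi
  exact ⟨c.pos.trans_le ht.1, ht.2.trans_lt c.lt_one⟩

theorem not_lo (i : Option (Fin m)) : ¬ B (i, c.lo i) := by
  cases i with
  | none =>
    intro h
    have := c.mem _ ⟨c.pos.le, ((c.lt none).trans c.lt_one).le⟩ h
    exact lt_irrefl _ this.1
  | some i => exact c.lo_not i

theorem not_hi (i : Option (Fin m)) : ¬ B (i, c.hi i) := by
  cases i with
  | none =>
    intro h
    have := c.mem _ ⟨(c.pos.trans (c.lt none)).le, c.lt_one.le⟩ h
    exact lt_irrefl _ this.2
  | some i =>
    rw [c.add_one]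
    have := samePoint_shift (m := m) (some i) (c.lo (some i)) 1 (by simp)
    rw [Int.cast_one] at this
    rw [← c.congr _ _ this]
    exact c.lo_not i

end Cut

theorem segmentPasses_regular {p : Param m} {ε : ℤˣ} (h : K.SegmentPasses s p ε) : K.Regular p := by
  have h : Relation.ReflTransGen (K.Step s) ((none, 0), 1) (p, ε) := h
  suffices ∀ x, Relation.ReflTransGen (K.Step s) ((none, 0), 1) x → K.Regular x.1 from this _ h
  intro x h
  induction h with
  | refl => exact K.regular_leg
  | tail _ h _ =>
    rcases SameEdge.of_step h with h | h
    · exact h.2.right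
    · exact h.regular_right

theorem coef_congr {p q : Param m} (h : SamePoint p q) : K.coef s p = K.coef s q := by
  by_cases hp : K.Regular p
  · exact coef_eq_of_sameEdge (sameEdge_of_samePoint h hp)
  · have hq : ¬ K.Regular q := fun hq => hp ((regular_congr h).2 hq)
    have h1 : ∀ ε, ¬ K.SegmentPasses s p ε := fun ε h => hp (segmentPasses_regular h)
    have h2 : ∀ ε, ¬ K.SegmentPasses s q ε := fun ε h => hq (segmentPasses_regular h)
    simp [coef, mult, h1, h2]

theorem ne_leg {p : Param m} (hd : Dom p) (hp : p ≠ (none, 0)) : K.γ p ≠ K.leg := by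
  intro h
  have hm : Meet K.γ (none, 0) p := by
    refine ⟨K.regular_leg.1, hd, fun hs => ?_, h.symm⟩
    obtain ⟨n, hn, e⟩ := samePoint_iff.1 hs
    simp only [hn rfl, Int.cast_zero, add_zero] at e
    exact hp e
  exact (K.endpoints _ _ hm).1 rfl

theorem ne_head {p : Param m} (hd : Dom p) (hp : p ≠ (none, 1)) : K.γ p ≠ K.head := by
  intro h
  have hm : Meet K.γ (none, 1) p := by
    refine ⟨K.regular_head.1, hd, fun hs => ?_, h.symm⟩
    obtain ⟨n, hn, e⟩ := samePoint_iff.1 hs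
    simp only [hn rfl, Int.cast_zero, add_zero] at e
    exact hp e
  exact (K.endpoints _ _ hm).2 rfl

theorem ne_leg_of_openDom {i : Option (Fin m)} {t : ℝ} (h : t ∈ openDom i) :
    K.γ (i, t) ≠ K.leg :=
  ne_leg (dom_of_openDom h) fun e => by
    simp only [Prod.mk.injEq] at e
    obtain ⟨rfl, rfl⟩ := e
    exact lt_irrefl _ (h rfl).1

theorem ne_head_of_openDom {i : Option (Fin m)} {t : ℝ} (h : t ∈ openDom i) :
    K.γ (i, t) ≠ K.head :=
  ne_head (dom_of_openDom h) fun e => by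
    simp only [Prod.mk.injEq] at e
    obtain ⟨rfl, rfl⟩ := e
    exact lt_irrefl _ (h rfl).2

theorem finite_double_Icc (K : Diagram m) (i : Option (Fin m)) :
    {t | t ∈ Icc (0 : ℝ) 1 ∧ K.Double (i, t)}.Finite := K.finite_double i 0 1

theorem coef_lo {B : Param m → Prop} (c : Cut B) (hB : ∀ p, K.Double p → B p) :
    K.coef s (none, c.lo none) = 0 := by
  rw [← coef_leg s]
  refine (coef_eq_of_sameEdge (SameEdge.of_uIcc fun r hr => ?_)).symm
  rw [uIcc_of_le c.pos.le] at hr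
  have hr1 : r ∈ Icc (0 : ℝ) 1 := ⟨hr.1, hr.2.trans ((c.lt none).trans c.lt_one).le⟩
  exact ⟨fun _ => hr1, fun h => not_lt.2 hr.2 (c.mem r hr1 (hB _ h)).1⟩

theorem regular_lo {B : Param m → Prop} (c : Cut B) (hB : ∀ p, K.Double p → B p)
    (i : Option (Fin m)) : K.Regular (i, c.lo i) :=
  ⟨dom_of_openDom (c.Icc_subset i ⟨le_rfl, (c.lt i).le⟩), fun h => c.not_lo i (hB _ h)⟩

theorem regular_hi {B : Param m → Prop} (c : Cut B) (hB : ∀ p, K.Double p → B p)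
    (i : Option (Fin m)) : K.Regular (i, c.hi i) :=
  ⟨dom_of_openDom (c.Icc_subset i ⟨(c.lt i).le, le_rfl⟩), fun h => c.not_hi i (hB _ h)⟩

/-- Stokes' formula for the whole diagram. -/
theorem stokes_cut {B : Param m → Prop} (c : Cut B) (hB : ∀ p, K.Double p → B p)
    (s : K.State) (A : Option (Fin m) → Finset ℝ) (Ψ η : Param m → ℝ)
    (J : Option (Fin m) → ℝ → ℝ)
    (hA : ∀ k, ∀ t ∈ A k, t ∈ Ioo (c.lo k) (c.hi k) ∧ K.Regular (k, t))
    (hη : ∀ k, ContinuousOn (fun t => η (k, t)) (openDom k))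
    (hΨ : ∀ k, ∀ t ∈ Icc (c.lo k) (c.hi k), t ∉ A k →
      ∀ᶠ r in 𝓝 t, HasDerivAt (fun t => Ψ (k, t)) (η (k, r)) r)
    (hΨγ : ∀ p q, K.γ p = K.γ q → Ψ p = Ψ q)
    (hJ : ∀ k, ∀ t ∈ A k,
      Tendsto (fun τ => Ψ (k, t + τ) - Ψ (k, t - τ)) (𝓝[>] 0) (𝓝 (J k t))) :
    K.coef s (none, c.hi none) * Ψ (none, c.hi none) -
      ∑ k, ∫ t in (c.lo k)..(c.hi k), (K.coef s (k, t) : ℝ) * η (k, t) =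
    ∑ k, ∑ t ∈ A k, (K.coef s (k, t) : ℝ) * J k t := by
  have main := stokes s id c.lo c.hi openDom A (fun k t => Ψ (k, t)) η J c.lt isOpen_openDom ordConnected_openDom c.Icc_subset
    (fun k t ht => dom_of_openDom ht) (regular_lo c hB) (regular_hi c hB)
    (fun k t ht q hq => c.exists_rep hq.2.1 (hB _ (meet_double' hq)))
    (fun k t ht k' t' ht' h => c.inj ht ht' h) hA hη hΨ
    (fun k t ht k' t' ht' h => hΨγ _ _ h.2.2.2) hJ
  simp only [id] at main
  rw [← main, Finset.sum_sub_distrib]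
  congr 1
  -- The two boundary terms of a circle cancel by periodicity, and the coefficient vanishes at the
  -- beginning of the segment; only the term at its far end remains.
  rw [Fintype.sum_option]
  rw [coef_lo c hB, Finset.sum_eq_zero]
  · simp
  · intro i _
    have h := samePoint_shift (m := m) (some i) (c.lo (some i)) 1 (by simp)
    rw [Int.cast_one, ← c.add_one] at h
    rw [coef_congr h, hΨγ _ _ (γ_eq h), sub_self]

/-- Stokes' formula with `Ψ = 1`: a chain without boundary at the crossings and at the leg has none
at the head. The path `k_s` need not be followed to its end. -/
theorem coef_hi {B : Param m → Prop} (c : Cut B) (hB : ∀ p, K.Double p → B p) :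
    K.coef s (none, c.hi none) = 0 := by
  have := stokes_cut c hB s (fun _ => ∅) (fun _ => 1) (fun _ => 0) (fun _ _ => 0) (by simp)
    (fun k => continuousOn_const) (fun k t _ _ => Eventually.of_forall fun r => hasDerivAt_const r _)
    (fun p q _ => rfl) (by simp)
  simpa using this

theorem coef_head (s : K.State) : K.coef s (none, 1) = 0 := by
  obtain ⟨c⟩ := exists_cut (B := K.Double) K.finite_double_Icc K.regular_leg.2 K.regular_head.2
    (fun p q => double_congr)
  rw [← coef_hi c (fun p h => h) (s := s)]
  refine (coef_eq_of_sameEdge (SameEdge.of_uIcc fun r hr => ?_)).symm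
  rw [uIcc_of_le c.lt_one.le] at hr
  have hr1 : r ∈ Icc (0 : ℝ) 1 := ⟨(c.pos.trans (c.lt none)).le.trans hr.1, hr.2⟩
  exact ⟨fun _ => hr1, fun h => not_lt.2 hr.1 (c.mem r hr1 h).2⟩

/-! ## The winding number of the cycle `K - k_s` around the endpoints -/

theorem hasDerivAt_γ (K : Diagram m) (i : Option (Fin m)) (t : ℝ) :
    HasDerivAt (fun t => K.γ (i, t)) (vel K.γ (i, t)) t :=
  ((K.smooth i).differentiable (by simp)).differentiableAt.hasDerivAt

theorem continuous_vel (K : Diagram m) (i : Option (Fin m)) :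
    Continuous fun t => vel K.γ (i, t) :=
  (K.smooth i).continuous_deriv (by simp)

theorem continuous_γ (K : Diagram m) (i : Option (Fin m)) : Continuous fun t => K.γ (i, t) :=
  (K.smooth i).continuous

theorem dot_vel {p : Param m} (hp : Dom p) : dot3 (K.γ p) (vel K.γ p) = 0 := by
  obtain ⟨_ | i, t⟩ := p
  · exact dot3_eq_zero_of_sphere (γ := fun t => K.γ (none, t)) zero_lt_one (hp rfl)
      (K.hasDerivAt_γ none t) fun r hr => K.mem_sphere _ fun _ => hr
  · exact dot3_eq_zero_of_sphere (γ := fun t => K.γ (some i, t)) (a := t) (b := t + 1) (by linarith)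
      (by simp) (K.hasDerivAt_γ (some i) t) fun r hr => K.mem_sphere _ (dom_some i r)

theorem continuous_dot3 {γ v : ℝ → E3} (hγ : Continuous γ) (hv : Continuous v) :
    Continuous fun t => dot3 (γ t) (v t) := by
  unfold dot3
  fun_prop

theorem continuousOn_stD (C : Chart) {γ v : ℝ → E3} {U : Set ℝ} (hγ : Continuous γ)
    (hv : Continuous v) (h0 : ∀ t ∈ U, 1 - dot3 C.N (γ t) ≠ 0) :
    ContinuousOn (fun t => C.stD (γ t) (v t)) U := by
  unfold Chart.stD
  have h1 : ∀ e : E3, Continuous fun t => ((dot3 e (γ t) : ℝ) : ℂ) := fun e =>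
    Complex.continuous_ofReal.comp (continuous_dot3 continuous_const hγ)
  have h2 : ∀ e : E3, Continuous fun t => ((dot3 e (v t) : ℝ) : ℂ) := fun e =>
    Complex.continuous_ofReal.comp (continuous_dot3 continuous_const hv)
  have hD : Continuous fun t => ((1 - dot3 C.N (γ t) : ℝ) : ℂ) := by
    push_cast
    exact continuous_const.sub (h1 _)
  refine ContinuousOn.div (Continuous.continuousOn ?_) (hD.pow 2).continuousOn fun t ht => ?_
  · exact (((h2 _).add ((h2 _).mul continuous_const)).mul hD).add
      (((h1 _).add ((h1 _).mul continuous_const)).mul (h2 _))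
  · exact pow_ne_zero 2 (by exact_mod_cast h0 t ht)

theorem continuousOn_st (C : Chart) {γ : ℝ → E3} {U : Set ℝ} (hγ : Continuous γ)
    (h0 : ∀ t ∈ U, 1 - dot3 C.N (γ t) ≠ 0) : ContinuousOn (fun t => C.st (γ t)) U := by
  unfold Chart.st
  have h1 : ∀ e : E3, Continuous fun t => ((dot3 e (γ t) : ℝ) : ℂ) := fun e =>
    Complex.continuous_ofReal.comp (continuous_dot3 continuous_const hγ)
  have hD : Continuous fun t => ((1 - dot3 C.N (γ t) : ℝ) : ℂ) := by
    push_cast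
    exact continuous_const.sub (h1 _)
  refine ContinuousOn.div (Continuous.continuousOn ?_) hD.continuousOn fun t ht => ?_
  · exact (h1 _).add ((h1 _).mul continuous_const)
  · exact_mod_cast h0 t ht

/-- The velocity of the argument of `(z - Q) / (z - P)` along the diagram, where `P` and `Q` are the
leg and the head in the chart `C`. -/
def ang (K : Diagram m) (C : Chart) (p : Param m) : ℝ :=
  ((1 / (C.st K.leg - C.st (K.γ p)) - 1 / (C.st K.head - C.st (K.γ p))) *
    C.stD (K.γ p) (vel K.γ p)).im

/-- The integral of the velocity of the argument over the cycle `K - k_s`. -/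
def winding (s : K.State) (C : Chart) : ℝ :=
  ∑ i, ∫ t in (0 : ℝ)..1, (K.coef s (i, t) : ℝ) * K.ang C (i, t)

/-- The chart `C` is defined on the whole diagram. -/
def Avoids (K : Diagram m) (C : Chart) : Prop := ∀ p, Dom p → K.γ p ≠ C.N

theorem Avoids.denom {C : Chart} (h : K.Avoids C) {p : Param m} (hp : Dom p) :
    1 - dot3 C.N (K.γ p) ≠ 0 := (C.denom_pos (K.mem_sphere p hp) (h p hp)).ne'

theorem Avoids.st_ne {C : Chart} (h : K.Avoids C) {p q : Param m} (hp : Dom p) (hq : Dom q)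
    (hne : K.γ p ≠ K.γ q) : C.st (K.γ p) ≠ C.st (K.γ q) := fun e =>
  hne (C.st_injOn (K.mem_sphere p hp) (h p hp) (K.mem_sphere q hq) (h q hq) e)

theorem continuousOn_ang {C : Chart} (h : K.Avoids C) (i : Option (Fin m)) :
    ContinuousOn (fun t => K.ang C (i, t)) (openDom i) := by
  have hD : ∀ t ∈ openDom i, 1 - dot3 C.N (K.γ (i, t)) ≠ 0 := fun t ht =>
    h.denom (dom_of_openDom ht)
  have h1 := continuousOn_stD C (K.continuous_γ i) (K.continuous_vel i) hD
  have h2 := continuousOn_st C (K.continuous_γ i) hD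
  refine Complex.continuous_im.comp_continuousOn (ContinuousOn.mul (ContinuousOn.sub ?_ ?_) h1)
  · refine continuousOn_const.div (continuousOn_const.sub h2) fun t ht => sub_ne_zero.2 ?_
    exact h.st_ne K.regular_leg.1 (dom_of_openDom ht) (ne_leg_of_openDom ht).symm
  · refine continuousOn_const.div (continuousOn_const.sub h2) fun t ht => sub_ne_zero.2 ?_
    exact h.st_ne K.regular_head.1 (dom_of_openDom ht) (ne_head_of_openDom ht).symm

theorem ang_congr {C : Chart} {p q : Param m} (h : SamePoint p q) : K.ang C p = K.ang C q := by
  rw [ang, ang, γ_eq h, vel_eq h]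

theorem coef_of_le_lo {B : Param m → Prop} (c : Cut B) (hB : ∀ p, K.Double p → B p) {t : ℝ}
    (ht : t ∈ Icc 0 (c.lo none)) : K.coef s (none, t) = 0 := by
  rw [← coef_leg s]
  refine (coef_eq_of_sameEdge (SameEdge.of_uIcc fun r hr => ?_)).symm
  rw [uIcc_of_le ht.1] at hr
  have hr1 : r ∈ Icc (0 : ℝ) 1 :=
    ⟨hr.1, (hr.2.trans ht.2).trans ((c.lt none).trans c.lt_one).le⟩
  exact ⟨fun _ => hr1, fun h => not_lt.2 (hr.2.trans ht.2) (c.mem r hr1 (hB _ h)).1⟩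

theorem coef_of_hi_le {B : Param m → Prop} (c : Cut B) (hB : ∀ p, K.Double p → B p) {t : ℝ}
    (ht : t ∈ Icc (c.hi none) 1) : K.coef s (none, t) = 0 := by
  rw [← coef_head s]
  refine (coef_eq_of_sameEdge (SameEdge.of_uIcc fun r hr => ?_))
  rw [uIcc_of_le ht.2] at hr
  have hr1 : r ∈ Icc (0 : ℝ) 1 :=
    ⟨(c.pos.trans (c.lt none)).le.trans (ht.1.trans hr.1), hr.2⟩
  exact ⟨fun _ => hr1, fun h => not_lt.2 (ht.1.trans hr.1) (c.mem r hr1 (hB _ h)).2⟩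

theorem winding_eq_cut {B : Param m → Prop} (c : Cut B) (hB : ∀ p, K.Double p → B p)
    (C : Chart) : winding s C =
      ∑ k, ∫ t in (c.lo k)..(c.hi k), (K.coef s (k, t) : ℝ) * K.ang C (k, t) := by
  refine Finset.sum_congr rfl fun k _ => ?_
  cases k with
  | none =>
    set f : ℝ → ℝ := fun t => (K.coef s (none, t) : ℝ) * K.ang C (none, t) with hf
    have z1 : ∀ t ∈ uIcc 0 (c.lo none), f t = 0 := fun t ht => by
      rw [uIcc_of_le c.pos.le] at ht
      simp [hf, coef_of_le_lo c hB ht]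
    have z2 : ∀ t ∈ uIcc (c.hi none) 1, f t = 0 := fun t ht => by
      rw [uIcc_of_le c.lt_one.le] at ht
      simp [hf, coef_of_hi_le c hB ht]
    -- The chart is not assumed to avoid the diagram. If the integrand is not integrable on the
    -- middle piece, both integrals have the default value `0`.
    by_cases hi : IntervalIntegrable f MeasureTheory.volume (c.lo none) (c.hi none)
    · have i1 : IntervalIntegrable f MeasureTheory.volume 0 (c.lo none) :=
        (intervalIntegrable_const (c := (0 : ℝ))).congr
          (fun t ht => (z1 t (uIoc_subset_uIcc ht)).symm)
      have i2 : IntervalIntegrable f MeasureTheory.volume (c.hi none) 1 :=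
        (intervalIntegrable_const (c := (0 : ℝ))).congr
          (fun t ht => (z2 t (uIoc_subset_uIcc ht)).symm)
      rw [← intervalIntegral.integral_add_adjacent_intervals (i1.trans hi) i2,
        ← intervalIntegral.integral_add_adjacent_intervals i1 hi,
        intervalIntegral.integral_congr (g := fun _ => 0) z1,
        intervalIntegral.integral_congr (g := fun _ => 0) z2]
      simp
    · rw [intervalIntegral.integral_undef hi, intervalIntegral.integral_undef]
      intro h
      refine hi (h.mono_set ?_)
      rw [uIcc_of_le (c.lt none).le, uIcc_of_le zero_le_one]
      exact Icc_subset_Icc c.pos.le c.lt_one.le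
  | some i =>
    have hper : Function.Periodic
        (fun t => (K.coef s (some i, t) : ℝ) * K.ang C (some i, t)) 1 := by
      intro t
      have h := samePoint_shift (m := m) (some i) t 1 (by simp)
      rw [Int.cast_one] at h
      simp only
      rw [← coef_congr h, ← ang_congr h]
    have := hper.intervalIntegral_add_eq 0 (c.lo (some i))
    rw [zero_add] at this
    rw [c.add_one, this]

end Diagram

end

section

variable {m : ℕ}

namespace Diagram
variable {K : Diagram m} {s : K.State}

/-! ## Intersection numbers with shortcuts -/

namespace Shortcut

variable (a : K.Shortcut)

/-- The point `p` of the diagram lies on the interior of the shortcut. -/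
def Hit (p : Param m) : Prop := Dom p ∧ ∃ t ∈ Ioo (0 : ℝ) 1, a.a t = K.γ p

variable {a}

theorem hit_congr {p q : Param m} (h : SamePoint p q) : a.Hit p ↔ a.Hit q := by
  unfold Hit
  rw [γ_eq h]
  exact and_congr_left' ⟨h.dom, h.symm.dom⟩

theorem Hit.not_double {p : Param m} (h : a.Hit p) : ¬ K.Double p := by
  obtain ⟨hd, t, ht, e⟩ := h
  exact (a.transverse t ht p hd e).1

theorem Hit.regular {p : Param m} (h : a.Hit p) : K.Regular p := ⟨h.1, h.not_double⟩

theorem not_hit_leg : ¬ a.Hit (none, 0) := by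
  rintro ⟨-, t, ht, e⟩
  have := a.injective ⟨ht.1.le, ht.2.le⟩ (left_mem_Icc.2 zero_le_one) (e.trans a.start.symm)
  exact ht.1.ne' this

theorem not_hit_head : ¬ a.Hit (none, 1) := by
  rintro ⟨-, t, ht, e⟩
  have := a.injective ⟨ht.1.le, ht.2.le⟩ (right_mem_Icc.2 zero_le_one) (e.trans a.finish.symm)
  exact ht.2.ne this

theorem Hit.samePoint {p q : Param m} (h : a.Hit p) (hq : Dom q) (e : K.γ p = K.γ q) :
    SamePoint p q := by
  by_contra hne
  exact h.not_double ⟨q, h.1, hq, hne, e⟩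

theorem finite_hit (a : K.Shortcut) (i : Option (Fin m)) (x y : ℝ) :
    {t | t ∈ Icc x y ∧ a.Hit (i, t)}.Finite := by
  have h : {t | t ∈ Icc x y ∧ a.Hit (i, t)} ⊆
      ⋃ τ ∈ {t ∈ Ioo (0 : ℝ) 1 | ∃ p, Dom p ∧ a.a t = K.γ p},
        {t | t ∈ Icc x y ∧ Dom (i, t) ∧ a.a τ = K.γ (i, t)} := by
    rintro t ⟨ht, hd, τ, hτ, e⟩
    exact mem_biUnion (x := τ) ⟨hτ, _, hd, e⟩ ⟨ht, hd, e⟩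
  refine (a.finite.biUnion ?_).subset h
  rintro τ ⟨hτ, p, hp, e⟩
  refine (finite_samePoint p i x y).subset ?_
  rintro t ⟨ht, hd, e'⟩
  exact ⟨ht, Hit.samePoint ⟨hp, τ, hτ, e⟩ hd (e.symm.trans e')⟩

open Classical in
/-- The parameter of a point of the diagram on the shortcut. -/
def time (a : K.Shortcut) (p : Param m) : ℝ := if h : a.Hit p then h.2.choose else 0

theorem time_mem {p : Param m} (h : a.Hit p) : a.time p ∈ Ioo (0 : ℝ) 1 := by
  rw [time, dif_pos h]; exact h.2.choose_spec.1

theorem a_time {p : Param m} (h : a.Hit p) : a.a (a.time p) = K.γ p := by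
  rw [time, dif_pos h]; exact h.2.choose_spec.2

theorem time_eq {p : Param m} {t : ℝ} (ht : t ∈ Ioo (0 : ℝ) 1) (hp : Dom p) (e : a.a t = K.γ p) :
    a.time p = t := by
  have h : a.Hit p := ⟨hp, t, ht, e⟩
  exact a.injective (Ioo_subset_Icc_self (time_mem h)) (Ioo_subset_Icc_self ht)
    ((a_time h).trans e.symm)

/-- The sign of the crossing of the diagram and the shortcut at `p`. -/
def crossSign (a : K.Shortcut) (p : Param m) : ℤ :=
  SignType.sign (det3 (K.γ p) (deriv a.a (a.time p)) (vel K.γ p))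

theorem det_ne_zero {p : Param m} (h : a.Hit p) :
    det3 (K.γ p) (deriv a.a (a.time p)) (vel K.γ p) ≠ 0 := by
  have := (a.transverse _ (time_mem h) p h.1 (a_time h)).2
  rwa [a_time h] at this

open Classical in
/-- The intersection number as a sum of signs. -/
theorem inter_eq (a : K.Shortcut) (T : Param m → ℤˣ → Prop)
    (hT : ∀ p q ε, SamePoint p q → (T p ε ↔ T q ε)) (P : ℝ → Param m)
    (hP : ∀ t ∈ a.finite.toFinset, Dom (P t) ∧ a.a t = K.γ (P t)) :
    a.inter T = ∑ t ∈ a.finite.toFinset, a.crossSign (P t) * mult T (P t) := by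
  have hmem : ∀ t, t ∈ a.finite.toFinset ↔ t ∈ Ioo (0 : ℝ) 1 ∧ ∃ p, Dom p ∧ a.a t = K.γ p := by
    intro t; simp
  -- A point of the shortcut comes from a single point of the source up to the period, so the
  -- quantifier over `p` can be evaluated at the chosen representative `P t`.
  have key : ∀ Q : ℤˣ → ℝ → Prop,
      {t ∈ Ioo (0 : ℝ) 1 | ∃ p ε, Dom p ∧ a.a t = K.γ p ∧ T p ε ∧
        Q ε (det3 (a.a t) (deriv a.a t) (vel K.γ p))} =
      ↑(a.finite.toFinset.filter fun t =>
        ∃ ε, T (P t) ε ∧ Q ε (det3 (a.a t) (deriv a.a t) (vel K.γ (P t)))) := by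
    intro Q
    ext t
    simp only [Finset.coe_filter, hmem, mem_ofPred_eq]
    constructor
    · rintro ⟨ht, p, ε, hd, e, h1, h2⟩
      have hm : t ∈ a.finite.toFinset := (hmem t).2 ⟨ht, p, hd, e⟩
      have hs : SamePoint p (P t) := Hit.samePoint (a := a) ⟨hd, t, ht, e⟩ (hP t hm).1
        (e.symm.trans (hP t hm).2)
      exact ⟨⟨ht, p, hd, e⟩, ε, (hT _ _ _ hs).1 h1, by rwa [← vel_eq hs]⟩
    · rintro ⟨⟨ht, p, hd, e⟩, ε, h1, h2⟩
      have hm : t ∈ a.finite.toFinset := (hmem t).2 ⟨ht, p, hd, e⟩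
      exact ⟨ht, P t, ε, (hP t hm).1, (hP t hm).2, h1, h2⟩
  have k1 := key fun ε d => 0 < ((ε : ℤ) : ℝ) * d
  have k2 := key fun ε d => ((ε : ℤ) : ℝ) * d < 0
  rw [inter, k1, k2, ncard_coe_finset, ncard_coe_finset, Finset.card_filter, Finset.card_filter]
  push_cast
  rw [← Finset.sum_sub_distrib]
  refine Finset.sum_congr rfl fun t ht => ?_
  have hh : a.Hit (P t) := ⟨(hP t ht).1, t, ((hmem t).1 ht).1, (hP t ht).2⟩
  have htime : a.time (P t) = t := time_eq ((hmem t).1 ht).1 (hP t ht).1 (hP t ht).2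
  have hne := det_ne_zero hh
  rw [crossSign, htime] at *
  rw [(hP t ht).2]
  set d := det3 (K.γ (P t)) (deriv a.a t) (vel K.γ (P t)) with hd
  have hex : ∀ R : ℤˣ → Prop, (∃ ε, R ε) ↔ R 1 ∨ R (-1) := by
    intro R
    constructor
    · rintro ⟨ε, h⟩
      rcases Int.units_eq_one_or ε with rfl | rfl
      · exact Or.inl h
      · exact Or.inr h
    · rintro (h | h) <;> exact ⟨_, h⟩
  simp only [hex, mult, ind]
  rcases lt_or_gt_of_ne hne with h | h
  · rw [sign_neg h]
    by_cases h1 : T (P t) 1 <;> by_cases h2 : T (P t) (-1) <;> simp [h1, h2, h, h.le]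
  · rw [sign_pos h]
    by_cases h1 : T (P t) 1 <;> by_cases h2 : T (P t) (-1) <;> simp [h1, h2, h, h.le]

theorem exists_cut (a : K.Shortcut) : Nonempty (Cut fun p => K.Double p ∨ a.Hit p) := by
  refine Diagram.exists_cut ?_ ?_ ?_ ?_
  · intro i
    refine ((K.finite_double_Icc i).union (a.finite_hit i 0 1)).subset ?_
    rintro t ⟨ht, h | h⟩
    · exact Or.inl ⟨ht, h⟩
    · exact Or.inr ⟨ht, h⟩
  · rintro (h | h)
    · exact K.regular_leg.2 h
    · exact not_hit_leg h
  · rintro (h | h)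
    · exact K.regular_head.2 h
    · exact not_hit_head h
  · intro p q h
    rw [double_congr h, hit_congr h]

theorem segmentPasses_congr {p q : Param m} {ε : ℤˣ} (h : SamePoint p q) :
    K.SegmentPasses s p ε ↔ K.SegmentPasses s q ε := by
  constructor
  · intro h1
    exact SegmentPasses.sameEdge (x := (p, ε)) h1 (sameEdge_of_samePoint h (segmentPasses_regular h1))
  · intro h1
    exact SegmentPasses.sameEdge (x := (q, ε)) h1
      (sameEdge_of_samePoint h.symm (segmentPasses_regular h1))

/-- `K · a - k_s · a` as a sum over the points of the diagram on the shortcut. -/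
theorem diagramInter_sub_stateInter (a : K.Shortcut) (c : Cut fun p => K.Double p ∨ a.Hit p)
    (s : K.State) (A : Option (Fin m) → Finset ℝ)
    (hA : ∀ i t, t ∈ A i ↔ t ∈ Ioo (c.lo i) (c.hi i) ∧ a.Hit (i, t)) :
    a.diagramInter - a.stateInter s =
      ∑ i, ∑ t ∈ A i, K.coef s (i, t) * a.crossSign (i, t) := by
  classical
  have hex : ∀ t ∈ a.finite.toFinset, ∃ x : Σ _ : Option (Fin m), ℝ,
      x ∈ Finset.univ.sigma A ∧ a.a t = K.γ (x.1, x.2) := by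
    intro t ht
    obtain ⟨h1, p, hp, e⟩ := a.finite.mem_toFinset.1 ht
    have hh : a.Hit p := ⟨hp, t, h1, e⟩
    obtain ⟨i, r, hr, hs⟩ := c.exists_rep hp (Or.inr hh)
    exact ⟨⟨i, r⟩, by simpa using (hA i r).2 ⟨hr, (hit_congr hs).1 hh⟩, by rw [e, γ_eq hs]⟩
  choose! x hx1 hx2 using hex
  have hxh : ∀ t ∈ a.finite.toFinset, (x t).2 ∈ Ioo (c.lo (x t).1) (c.hi (x t).1) ∧
      a.Hit ((x t).1, (x t).2) := fun t ht =>
    (hA _ _).1 (Finset.mem_sigma.1 (hx1 t ht)).2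
  have hP : ∀ t ∈ a.finite.toFinset, Dom ((x t).1, (x t).2) ∧ a.a t = K.γ ((x t).1, (x t).2) :=
    fun t ht => ⟨(hxh t ht).2.1, hx2 t ht⟩
  rw [diagramInter, stateInter, inter_eq a _ (by simp) (fun t => ((x t).1, (x t).2)) hP,
    inter_eq a (K.SegmentPasses s) (fun p q ε h => segmentPasses_congr h) (fun t => ((x t).1, (x t).2)) hP,
    ← Finset.sum_sub_distrib, Finset.sum_sigma']
  refine Finset.sum_bij (fun t _ => x t) hx1 ?_ ?_ ?_
  · intro t ht t' ht' h
    have h1 := hx2 t ht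
    have h2 := hx2 t' ht'
    rw [h, ← h2] at h1
    exact a.injective (Ioo_subset_Icc_self (a.finite.mem_toFinset.1 ht).1)
      (Ioo_subset_Icc_self (a.finite.mem_toFinset.1 ht').1) h1
  · rintro ⟨i, r⟩ hy
    obtain ⟨h1, h2⟩ := (hA i r).1 (Finset.mem_sigma.1 hy).2
    have ht : a.time (i, r) ∈ a.finite.toFinset :=
      a.finite.mem_toFinset.2 ⟨time_mem h2, _, h2.1, a_time h2⟩
    refine ⟨a.time (i, r), ht, ?_⟩
    have h3 := hxh _ ht
    have hs : SamePoint (i, r) ((x (a.time (i, r))).1, (x (a.time (i, r))).2) :=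
      Hit.samePoint h2 h3.2.1 ((a_time h2).symm.trans (hx2 _ ht))
    obtain ⟨e1, e2⟩ := c.inj h1 h3.1 hs
    exact (Sigma.ext (β := fun _ : Option (Fin m) => ℝ) e1 (heq_of_eq e2)).symm
  · intro t ht
    rw [coef]
    simp only [mult, ind]
    simp
    ring

end Shortcut

theorem hasDerivAt_deriv_shortcut (a : K.Shortcut) (t : ℝ) : HasDerivAt a.a (deriv a.a t) t :=
  ((a.smooth).differentiable (by simp)).differentiableAt.hasDerivAt

/-- The winding number of the cycle `K - k_s` computed with a shortcut. -/
theorem winding_eq (a : K.Shortcut) (s : K.State) {C : Chart} (hC : K.Avoids C)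
    (ha : ∀ t ∈ Icc (0 : ℝ) 1, a.a t ≠ C.N) :
    winding s C = 2 * Real.pi * ((a.diagramInter - a.stateInter s : ℤ) : ℝ) := by
  classical
  obtain ⟨c⟩ := a.exists_cut
  have hB : ∀ p, K.Double p → K.Double p ∨ a.Hit p := fun p h => Or.inl h
  set F : Option (Fin m) → Finset ℝ := fun i => (a.finite_hit i (c.lo i) (c.hi i)).toFinset with hF
  have hFm : ∀ i t, t ∈ F i ↔ t ∈ Ioo (c.lo i) (c.hi i) ∧ a.Hit (i, t) := by
    intro i t
    simp only [hF, Finite.mem_toFinset, mem_ofPred_eq]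
    refine and_congr_left fun h => ⟨fun ht => ⟨lt_of_le_of_ne ht.1 ?_, lt_of_le_of_ne ht.2 ?_⟩,
      fun ht => ⟨ht.1.le, ht.2.le⟩⟩
    · rintro rfl; exact c.not_lo i (Or.inr h)
    · rintro rfl; exact c.not_hi i (Or.inr h)
  have hda : ∀ t, HasDerivAt a.a (deriv a.a t) t := hasDerivAt_deriv_shortcut a
  have hden : ∀ t ∈ Icc (0 : ℝ) 1, 1 - dot3 C.N (a.a t) ≠ 0 := fun t ht =>
    (C.denom_pos (a.mem_sphere t ht) (ha t ht)).ne'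
  set α : ℝ → ℂ := fun t => C.st (a.a t) with hα
  set α' : ℝ → ℂ := fun t => C.stD (a.a t) (deriv a.a t) with hα'
  have hαd : ∀ t ∈ Icc (0 : ℝ) 1, HasDerivAt α (α' t) t := fun t ht =>
    C.hasDerivAt_st (hda t) (hden t ht)
  have hαc : ContinuousOn α' (Icc 0 1) :=
    continuousOn_stD C a.smooth.continuous (a.smooth.continuous_deriv (by simp)) hden
  have hst : ∀ t ∈ Icc (0 : ℝ) 1, ∀ p, Dom p → α t = C.st (K.γ p) → a.a t = K.γ p :=
    fun t ht p hp e => C.st_injOn (a.mem_sphere t ht) (ha t ht) (K.mem_sphere p hp) (hC p hp) e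
  -- Off the shortcut, the imaginary part of `arcLog` is a single-valued primitive of `ang`. Its
  -- jump carries a minus sign because the stereographic projection reverses the orientation.
  have key := stokes_cut c hB s F (fun p => (arcLog α α' 0 1 (C.st (K.γ p))).im) (K.ang C)
    (fun k t => -(2 * Real.pi * a.crossSign (k, t)))
    (fun k t ht => ⟨((hFm k t).1 ht).1, ((hFm k t).1 ht).2.regular⟩)
    (fun k => continuousOn_ang hC k) ?_ (fun p q h => by rw [h]) ?_
  · rw [coef_hi c hB, ← winding_eq_cut c hB C, Int.cast_zero, zero_mul, zero_sub] at key
    rw [Shortcut.diagramInter_sub_stateInter a c s F hFm]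
    rw [← neg_neg (winding s C), key]
    push_cast
    simp only [Finset.mul_sum]
    simp only [← Finset.sum_neg_distrib]
    refine Finset.sum_congr rfl fun k _ => Finset.sum_congr rfl fun t _ => ?_
    ring
  · intro k t ht htF
    have hnot : ∀ᶠ r in 𝓝 t, K.γ (k, r) ∈ (a.a '' Icc 0 1)ᶜ := by
      refine (K.continuous_γ k).continuousAt.eventually_mem
        ((isCompact_Icc.image a.smooth.continuous).isClosed.isOpen_compl.mem_nhds ?_)
      rintro ⟨τ, hτ, e⟩
      have ho := c.Icc_subset k ht
      rcases eq_or_ne τ 0 with rfl | h0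
      · exact ne_leg_of_openDom ho (e.symm.trans a.start)
      rcases eq_or_ne τ 1 with rfl | h1
      · exact ne_head_of_openDom ho (e.symm.trans a.finish)
      have hh : a.Hit (k, t) := ⟨dom_of_openDom ho, τ, ⟨lt_of_le_of_ne hτ.1 h0.symm,
        lt_of_le_of_ne hτ.2 h1⟩, e⟩
      refine htF ((hFm k t).2 ⟨⟨lt_of_le_of_ne ht.1 ?_, lt_of_le_of_ne ht.2 ?_⟩, hh⟩)
      · rintro rfl; exact c.not_lo k (Or.inr hh)
      · rintro rfl; exact c.not_hi k (Or.inr hh)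
    filter_upwards [hnot, (isOpen_openDom k).mem_nhds (c.Icc_subset k ht)] with r hr hro
    have hd : Dom (k, r) := dom_of_openDom hro
    have h1 := hasDerivAt_arcLog zero_le_one hαd hαc (z := C.st (K.γ (k, r)))
      fun τ hτ e => hr ⟨τ, hτ, hst τ hτ _ hd e⟩
    have h2 := C.hasDerivAt_st (K.hasDerivAt_γ k r) (hC.denom hd)
    have h3 := HasDerivAt.comp r h1 h2
    have h4 := Complex.imCLM.hasFDerivAt.comp_hasDerivAt r h3
    rw [show α 0 = C.st K.leg by simp [hα, a.start], show α 1 = C.st K.head by simp [hα, a.finish]]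
      at h4
    exact h4
  · intro k t ht
    obtain ⟨ht1, hh⟩ := (hFm k t).1 ht
    set τ := a.time (k, t) with hτ
    have hτm : τ ∈ Ioo (0 : ℝ) 1 := Shortcut.time_mem hh
    have hτe : a.a τ = K.γ (k, t) := Shortcut.a_time hh
    have hτi := Ioo_subset_Icc_self hτm
    have hdot : dot3 (a.a τ) (deriv a.a τ) = 0 :=
      dot3_eq_zero_of_sphere zero_lt_one hτi (hda τ) a.mem_sphere
    have hdet := Shortcut.det_ne_zero hh
    have him : ((starRingEnd ℂ) (α' τ) * C.stD (K.γ (k, t)) (vel K.γ (k, t))).im =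
        -(det3 (K.γ (k, t)) (deriv a.a τ) (vel K.γ (k, t))) / (1 - dot3 C.N (K.γ (k, t))) ^ 2 := by
      rw [hτe] at hdot
      simp only [hα', hτe]
      exact C.im_conj_stD (K.mem_sphere _ hh.1) (hC _ hh.1) hdot (dot_vel hh.1)
    have hD2 : 0 < (1 - dot3 C.N (K.γ (k, t))) ^ 2 := by
      have := hC.denom hh.1
      positivity
    have := tendsto_arcLog_jump (c := fun r => C.st (K.γ (k, r))) hαd hαc hτm
      (fun r hr e => a.injective hr hτi (by
        rw [hτe]; exact hst r hr _ hh.1 (by rw [← hτe]; exact e)))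
      (C.hasDerivAt_st (K.hasDerivAt_γ k t) (hC.denom hh.1)) (by simp [hα, hτe])
      (by rw [him]; exact div_ne_zero (neg_ne_zero.2 hdet) hD2.ne')
    convert this using 2
    rw [him, Shortcut.crossSign, ← hτ]
    set d := det3 (K.γ (k, t)) (deriv a.a τ) (vel K.γ (k, t)) with hd
    rcases lt_or_gt_of_ne hdet with h | h
    · rw [sign_neg h, sign_pos (div_pos (neg_pos.2 h) hD2)]; simp
    · rw [sign_pos h, sign_neg (div_neg_of_neg_of_pos (neg_lt_zero.2 h) hD2)]; simp

/-- A chart that is defined on a diagram and on finitely many shortcuts. -/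
theorem exists_chart_avoiding (K : Diagram m) (a b : K.Shortcut) : ∃ C : Chart, K.Avoids C ∧
    (∀ t, a.a t ≠ C.N) ∧ ∀ t, b.a t ≠ C.N := by
  obtain ⟨N, hN, -, h⟩ := exists_point_avoiding
    (fun i : Option (Fin m) ⊕ Bool => Sum.elim (fun i t => K.γ (i, t))
      (fun β => if β then a.a else b.a) i)
    (by rintro (i | β)
        · exact K.smooth i
        · cases β
          · exact b.smooth
          · exact a.smooth) isOpen_univ (K.mem_sphere _ K.regular_leg.1) (mem_univ _)
  obtain ⟨C, rfl⟩ := exists_chart hN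
  exact ⟨C, fun p _ => h (Sum.inl p.1) p.2, h (Sum.inr true), h (Sum.inr false)⟩

/-- Both sides are determined by the winding number, which makes no reference to a shortcut, in a
chart missing the diagram and both shortcuts. -/
theorem inter_sub_inter_eq (a b : K.Shortcut) (s : K.State) :
    a.stateInter s - a.diagramInter = b.stateInter s - b.diagramInter := by
  obtain ⟨C, hC, ha, hb⟩ := exists_chart_avoiding K a b
  have h := (winding_eq a s hC fun t _ => ha t).symm.trans (winding_eq b s hC fun t _ => hb t)
  have h := mul_left_cancel₀ Real.two_pi_pos.ne' h
  have : a.diagramInter - a.stateInter s = b.diagramInter - b.stateInter s := by exact_mod_cast h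
  linarith

end Diagram

/-- The bracket with the powers of `u` collected. -/
theorem extendedBracket_eq (K : Diagram m) (a : K.Shortcut) : extendedBracket K a =
    (((-(A ^ 3)) ^ (-K.writhe) : LaurentAUˣ) : LaurentAU) *
    ∑ s : K.State, ((A ^ K.sigma s * u ^ (a.stateInter s - a.diagramInter) : LaurentAUˣ) : LaurentAU) *
      (-((A ^ (2 : ℤ) : LaurentAUˣ) : LaurentAU) - ((A ^ (-2 : ℤ) : LaurentAUˣ) : LaurentAU)) ^
        (K.numComponents s - 1) := by
  rw [extendedBracket, Units.val_mul, mul_assoc, Finset.mul_sum]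
  congr 1
  refine Finset.sum_congr rfl fun s _ => ?_
  rw [← mul_assoc, ← Units.val_mul]
  congr 2
  rw [sub_eq_neg_add, zpow_add]
  exact mul_left_comm _ _ _

/-- The bracket does not depend on the shortcut. -/
theorem extendedBracket_congr (K : Diagram m) (a b : K.Shortcut) :
    extendedBracket K a = extendedBracket K b := by
  rw [extendedBracket_eq, extendedBracket_eq]
  simp only [Diagram.inter_sub_inter_eq a b]

end

section

variable {m : ℕ}

/-! ## Existence of shortcuts -/

/-- The linear map `x ↦ x × E`. -/
def crossRight (E : E3) : E3 →L[ℝ] E3 :=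
  LinearMap.toContinuousLinearMap
    { toFun := fun x => !₂[x 1 * E 2 - x 2 * E 1, x 2 * E 0 - x 0 * E 2, x 0 * E 1 - x 1 * E 0]
      map_add' := by
        intro x y; ext k; fin_cases k <;> simp <;> ring
      map_smul' := by
        intro c y; ext k; fin_cases k <;> simp <;> ring }

@[simp] theorem crossRight_zero (E x : E3) : crossRight E x 0 = x 1 * E 2 - x 2 * E 1 := rfl
@[simp] theorem crossRight_one (E x : E3) : crossRight E x 1 = x 2 * E 0 - x 0 * E 2 := rfl
@[simp] theorem crossRight_two (E x : E3) : crossRight E x 2 = x 0 * E 1 - x 1 * E 0 := rfl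

theorem ext3 {x y : E3} (h0 : x 0 = y 0) (h1 : x 1 = y 1) (h2 : x 2 = y 2) : x = y := by
  ext k; fin_cases k <;> assumption

theorem dot3_self_pos {x : E3} (hx : x ≠ 0) : 0 < dot3 x x := by
  by_contra h
  have h : dot3 x x ≤ 0 := not_lt.1 h
  simp only [dot3] at h
  refine hx (ext3 ?_ ?_ ?_) <;>
    simp only [PiLp.zero_apply] <;>
    nlinarith [mul_self_nonneg (x 0), mul_self_nonneg (x 1), mul_self_nonneg (x 2)]

theorem dot3_add_smul (T x y : E3) (b : ℝ) : dot3 T (x + b • y) = dot3 T x + b * dot3 T y := by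
  simp only [dot3, PiLp.add_apply, PiLp.smul_apply, smul_eq_mul]; ring

theorem dot3_smul (T y : E3) (b : ℝ) : dot3 T (b • y) = b * dot3 T y := by
  simp only [dot3, PiLp.smul_apply, smul_eq_mul]; ring

theorem dot3_crossRight (E x : E3) : dot3 (crossRight E x) E = 0 := by
  simp only [dot3, crossRight_zero, crossRight_one, crossRight_two]; ring

/-- A vector `x` with `x × E = 0` is a multiple of `E`. -/
theorem eq_smul_of_crossRight_eq_zero {E x : E3} (hE : E ≠ 0) (h : crossRight E x = 0) :
    x = (dot3 x E / dot3 E E) • E := by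
  have hp := (dot3_self_pos hE).ne'
  have h0 := congrArg (fun v : E3 => v 0) h
  have h1 := congrArg (fun v : E3 => v 1) h
  have h2 := congrArg (fun v : E3 => v 2) h
  simp only [crossRight_zero, crossRight_one, crossRight_two, PiLp.zero_apply] at h0 h1 h2
  refine ext3 ?_ ?_ ?_ <;> simp only [PiLp.smul_apply, smul_eq_mul] <;>
    rw [div_mul_eq_mul_div, eq_div_iff hp] <;> simp only [dot3]
  · linear_combination E 1 * h2 - E 2 * h1
  · linear_combination E 2 * h0 - E 0 * h2
  · linear_combination E 0 * h1 - E 1 * h0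

/-- The expansion of a vector in the orthogonal basis `n`, `n × E`, `E`. -/
theorem orthogonal_expansion {n E : E3} (h : dot3 n E = 0) (T : E3) :
    (dot3 n n * dot3 E E) • T = (dot3 E E * dot3 T n) • n + (dot3 n n * dot3 T E) • E +
      dot3 T (crossRight E n) • crossRight E n := by
  simp only [dot3] at h
  refine ext3 ?_ ?_ ?_ <;>
    simp only [PiLp.smul_apply, PiLp.add_apply, smul_eq_mul, dot3, crossRight_zero, crossRight_one,
      crossRight_two]
  · linear_combination ((n 0 * E 0 + n 1 * E 1 + n 2 * E 2) * T 0
      - (T 0 * E 0 + T 1 * E 1 + T 2 * E 2) * n 0 - (T 0 * n 0 + T 1 * n 1 + T 2 * n 2) * E 0) * h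
  · linear_combination ((n 0 * E 0 + n 1 * E 1 + n 2 * E 2) * T 1
      - (T 0 * E 0 + T 1 * E 1 + T 2 * E 2) * n 1 - (T 0 * n 0 + T 1 * n 1 + T 2 * n 2) * E 1) * h
  · linear_combination ((n 0 * E 0 + n 1 * E 1 + n 2 * E 2) * T 2
      - (T 0 * E 0 + T 1 * E 1 + T 2 * E 2) * n 2 - (T 0 * n 0 + T 1 * n 1 + T 2 * n 2) * E 2) * h

/-- For almost every plane containing the line through `Q` with the direction `E`, the curve `c` is
transverse to the plane outside this line. -/
theorem ae_transverse_plane {c : ℝ → E3} (hc : ContDiff ℝ ∞ c) (Q : E3) {E : E3} (hE : E ≠ 0) :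
    ∀ᵐ T : E3, ∀ t, crossRight E (c t - Q) ≠ 0 → dot3 T (crossRight E (c t - Q)) = 0 →
      dot3 T (crossRight E (deriv c t)) = 0 → ∃ r : ℝ, T = r • E := by
  set S : ℝ → E3 := fun t => crossRight E (crossRight E (c t - Q)) with hS
  have hcd : ∀ t, HasDerivAt c (deriv c t) t := fun t =>
    (hc.differentiable (by simp)).differentiableAt.hasDerivAt
  have hSd : ∀ t, HasDerivAt S (crossRight E (crossRight E (deriv c t))) t := fun t =>
    (crossRight E).hasFDerivAt.comp_hasDerivAt t
      ((crossRight E).hasFDerivAt.comp_hasDerivAt t ((hcd t).sub_const Q))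
  -- `S t` spans, together with `E`, the plane containing `E` and `c t - Q`, whose normal is `n`. A
  -- tangency of the curve to such a plane makes `n'` a multiple of `n` and gives a critical point
  -- of `f`, so Sard's theorem in equal dimensions makes the exceptional vectors `T` a null set.
  set f : E3 → E3 := fun y => y 1 • S (y 0) + y 2 • E with hf
  have hp : ∀ (k : Fin 3) (y : E3), HasFDerivAt (fun y : E3 => y k) (EuclideanSpace.proj k : E3 →L[ℝ] ℝ) y :=
    fun k y => (EuclideanSpace.proj k : E3 →L[ℝ] ℝ).hasFDerivAt
  set f' : E3 → E3 →L[ℝ] E3 := fun y =>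
    (y 1 • (EuclideanSpace.proj 0 : E3 →L[ℝ] ℝ).smulRight (crossRight E (crossRight E (deriv c (y 0))))
      + (EuclideanSpace.proj 1 : E3 →L[ℝ] ℝ).smulRight (S (y 0))) +
      (EuclideanSpace.proj 2 : E3 →L[ℝ] ℝ).smulRight E with hf'
  have hfd : ∀ y, HasFDerivAt f (f' y) y := by
    intro y
    refine ((hp 1 y).smul ?_).add ((hp 2 y).smul_const E)
    have := (hSd (y 0)).hasFDerivAt.comp y (hp 0 y)
    refine this.congr_fderiv ?_
    ext v
    simp
  set B : Set E3 := {y | ∃ r : ℝ, crossRight E (deriv c (y 0)) = r • crossRight E (c (y 0) - Q)} with hB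
  have hdet : ∀ y ∈ B, (f' y).det = 0 := by
    rintro y ⟨r, hr⟩
    rw [ContinuousLinearMap.det, LinearMap.det_eq_zero_iff_ker_ne_bot]
    intro hbot
    -- If `n' = r n`, then `S' = r S`, and the two terms `y 1 • S'` and `-(r * y 1) • S` cancel.
    have hv : (!₂[1, -(r * y 1), 0] : E3) ∈ LinearMap.ker (f' y : E3 →ₗ[ℝ] E3) := by
      rw [LinearMap.mem_ker]
      simp only [hf', hS, hr, map_smul, ContinuousLinearMap.coe_coe, add_apply,
        smul_apply, ContinuousLinearMap.smulRight_apply]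
      simp [smul_smul, mul_comm]
    rw [hbot, Submodule.mem_bot] at hv
    have := congrArg (fun v : E3 => v 0) hv
    simp at this
  have hnull := MeasureTheory.addHaar_image_eq_zero_of_det_fderivWithin_eq_zero (s := B) (f := f) (f' := f')
    MeasureTheory.volume (fun y _ => (hfd y).hasFDerivWithinAt) hdet
  filter_upwards [MeasureTheory.measure_eq_zero_iff_ae_notMem.1 hnull] with T hT t hn0 h1 h2
  set n := crossRight E (c t - Q) with hn
  have hEp := (dot3_self_pos hE).ne'
  have hnp := (dot3_self_pos hn0).ne'
  have hnE : dot3 n E = 0 := dot3_crossRight E _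
  have e1 := orthogonal_expansion hnE T
  rw [h1, mul_zero, zero_smul, zero_add] at e1
  set w := crossRight E n with hw
  have e1' : T = (dot3 T w / (dot3 n n * dot3 E E)) • w + (dot3 T E / dot3 E E) • E := by
    have := congrArg (fun v : E3 => (dot3 n n * dot3 E E)⁻¹ • v) e1
    simp only [smul_smul, inv_mul_cancel₀ (mul_ne_zero hnp hEp), one_smul, smul_add] at this
    refine this.trans ?_
    rw [add_comm]
    congr 2 <;> field_simp
  by_contra hcon
  have hTw : dot3 T w ≠ 0 := by
    intro h0
    rw [h0, zero_div, zero_smul, zero_add] at e1'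
    exact hcon ⟨_, e1'⟩
  refine hT ⟨!₂[t, dot3 T w / (dot3 n n * dot3 E E), dot3 T E / dot3 E E], ?_, ?_⟩
  · set n' := crossRight E (deriv c t) with hn'
    have e2 := orthogonal_expansion hnE n'
    have h3 : dot3 T ((dot3 n n * dot3 E E) • n') = dot3 n' w * dot3 T w := by
      rw [e2, dot3_crossRight, mul_zero, zero_smul, add_zero, dot3_add_smul, dot3_smul, h1]
      ring
    rw [dot3_smul, h2, mul_zero] at h3
    have h4 : dot3 n' w = 0 := by
      rcases mul_eq_zero.1 h3.symm with h | h
      · exact h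
      · exact absurd h hTw
    rw [h4, dot3_crossRight, mul_zero, zero_smul, zero_smul, add_zero, add_zero] at e2
    refine ⟨dot3 n' n / dot3 n n, ?_⟩
    have := congrArg (fun v : E3 => (dot3 n n * dot3 E E)⁻¹ • v) e2
    simp only [smul_smul, inv_mul_cancel₀ (mul_ne_zero hnp hEp), one_smul] at this
    change n' = _ • n
    refine this.trans ?_
    congr 1
    field_simp
  · change (_ : ℝ) • w + (_ : ℝ) • E = T
    exact e1'.symm

theorem ae_dot3_ne_zero {v : E3} (hv : v ≠ 0) : ∀ᵐ T : E3, dot3 T v ≠ 0 := by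
  set W : Submodule ℝ E3 :=
    { carrier := {T | dot3 T v = 0}
      add_mem' := by
        intro x y hx hy
        simp only [mem_ofPred_eq, dot3, PiLp.add_apply] at *
        linarith
      zero_mem' := by simp [dot3]
      smul_mem' := by
        intro r x hx
        simp only [mem_ofPred_eq, dot3, PiLp.smul_apply, smul_eq_mul] at *
        linear_combination r * hx } with hW
  have := MeasureTheory.Measure.addHaar_submodule MeasureTheory.volume W fun h => by
    have h1 : v ∈ W := h ▸ Submodule.mem_top
    exact (dot3_self_pos hv).ne' h1
  exact MeasureTheory.measure_eq_zero_iff_ae_notMem.1 this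

/-- Finitely many simple zeros. -/
theorem finite_zeros_of_deriv_ne_zero {g g' : ℝ → ℝ} {a b : ℝ} (hg : ∀ t, HasDerivAt g (g' t) t)
    (h : ∀ t ∈ Icc a b, g t = 0 → g' t ≠ 0) : {t | t ∈ Icc a b ∧ g t = 0}.Finite := by
  by_contra hinf
  have hinf : {t | t ∈ Icc a b ∧ g t = 0}.Infinite := hinf
  -- An accumulation point of zeros is itself a zero, but a zero with nonvanishing derivative is
  -- isolated.
  obtain ⟨t, ht, hacc⟩ := hinf.exists_accPt_of_subset_isCompact isCompact_Icc fun t ht => ht.1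
  have hf : ∃ᶠ r in 𝓝[≠] t, g r = 0 := by
    rw [accPt_iff_frequently_nhdsNE] at hacc
    exact hacc.mono fun r hr => hr.2
  have hcont : ContinuousAt g t := (hg t).continuousAt
  have h0 : g t = 0 := by
    have hcl : t ∈ closure {r | g r = 0} := by
      rw [mem_closure_iff_frequently]
      exact hf.filter_mono nhdsWithin_le_nhds
    have : Continuous g := continuous_iff_continuousAt.2 fun r => (hg r).continuousAt
    have hclosed : IsClosed {r | g r = 0} := isClosed_eq this continuous_const
    rwa [hclosed.closure_eq] at hcl
  have := (hg t).eventually_ne (c := 0) (h t ht h0)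
  exact hf (this.mono fun r hr => hr)

/-! ### The circular shortcut in a generic plane through the leg and the head -/

namespace Diagram

variable (K : Diagram m)

theorem dot_leg_head_lt : dot3 K.leg K.head < 1 := by
  have hne : K.leg - K.head ≠ 0 := sub_ne_zero.2 (ne_head K.regular_leg.1 (by simp))
  have h := dot3_self_pos hne
  have h1 := (norm_eq_one_iff _).1 (K.mem_sphere _ K.regular_leg.1)
  have h2 := (norm_eq_one_iff _).1 (K.mem_sphere _ K.regular_head.1)
  simp only [dot3, PiLp.sub_apply, leg, head] at *
  nlinarith

/-- A line meets the sphere in at most two points, and the line through the leg and the head meets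
it in these two. -/
theorem crossRight_ne_zero {x : E3} (hx : ‖x‖ = 1) (h0 : x ≠ K.leg) (h1 : x ≠ K.head) :
    crossRight (K.leg - K.head) (x - K.head) ≠ 0 := by
  intro h
  have hlt := K.dot_leg_head_lt
  have hne : K.leg - K.head ≠ 0 := sub_ne_zero.2 (ne_head K.regular_leg.1 (by simp))
  have e := eq_smul_of_crossRight_eq_zero hne h
  set r := dot3 (x - K.head) (K.leg - K.head) / dot3 (K.leg - K.head) (K.leg - K.head) with hr
  have hx' := (norm_eq_one_iff _).1 hx
  have hP : dot3 K.leg K.leg = 1 := (norm_eq_one_iff _).1 (K.mem_sphere _ K.regular_leg.1)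
  have hQ : dot3 K.head K.head = 1 := (norm_eq_one_iff _).1 (K.mem_sphere _ K.regular_head.1)
  have e' : x = K.head + r • (K.leg - K.head) := by rw [← e]; abel
  have hmul : (r * (1 - r)) * (1 - dot3 K.leg K.head) = 0 := by
    rw [e'] at hx'
    simp only [dot3, PiLp.add_apply, PiLp.sub_apply, PiLp.smul_apply, smul_eq_mul] at *
    linear_combination (-1 / 2 : ℝ) * hx' + (r ^ 2 / 2) * hP + ((1 - r) ^ 2 / 2) * hQ
  rcases mul_eq_zero.1 hmul with h | h
  · rcases mul_eq_zero.1 h with h | h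
    · rw [h, zero_smul, add_zero] at e'; exact h1 e'
    · rw [← sub_eq_zero.1 h, one_smul] at e'; exact h0 (by rw [e']; abel)
  · linarith

/-- The velocity is tangent to the sphere, whereas a chord is not tangent at its end. -/
theorem crossRight_vel_leg : crossRight (K.leg - K.head) (vel K.γ (none, 0)) ≠ 0 := by
  intro h
  have hlt := K.dot_leg_head_lt
  have hne : K.leg - K.head ≠ 0 := sub_ne_zero.2 (ne_head K.regular_leg.1 (by simp))
  have e := eq_smul_of_crossRight_eq_zero hne h
  set r := dot3 (vel K.γ (none, 0)) (K.leg - K.head) / dot3 (K.leg - K.head) (K.leg - K.head)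
  have hP : dot3 K.leg K.leg = 1 := (norm_eq_one_iff _).1 (K.mem_sphere _ K.regular_leg.1)
  have hd : dot3 K.leg (vel K.γ (none, 0)) = 0 := K.dot_vel K.regular_leg.1
  rw [e, dot3_smul] at hd
  have : dot3 K.leg (K.leg - K.head) = 1 - dot3 K.leg K.head := by
    rw [← hP]; simp only [dot3, PiLp.sub_apply]; ring
  rw [this] at hd
  rcases mul_eq_zero.1 hd with h | h
  · rw [h, zero_smul] at e; exact K.immersed _ K.regular_leg.1 e
  · linarith

theorem crossRight_vel_head : crossRight (K.leg - K.head) (vel K.γ (none, 1)) ≠ 0 := by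
  intro h
  have hlt := K.dot_leg_head_lt
  have hne : K.leg - K.head ≠ 0 := sub_ne_zero.2 (ne_head K.regular_leg.1 (by simp))
  have e := eq_smul_of_crossRight_eq_zero hne h
  set r := dot3 (vel K.γ (none, 1)) (K.leg - K.head) / dot3 (K.leg - K.head) (K.leg - K.head)
  have hQ : dot3 K.head K.head = 1 := (norm_eq_one_iff _).1 (K.mem_sphere _ K.regular_head.1)
  have hd : dot3 K.head (vel K.γ (none, 1)) = 0 := K.dot_vel K.regular_head.1
  rw [e, dot3_smul] at hd
  have : dot3 K.head (K.leg - K.head) = dot3 K.leg K.head - 1 := by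
    rw [← hQ]; simp only [dot3, PiLp.sub_apply]; ring
  rw [this] at hd
  rcases mul_eq_zero.1 hd with h | h
  · rw [h, zero_smul] at e; exact K.immersed _ K.regular_head.1 e
  · linarith

/-- The plane through the line with the direction `E` and the point `Q` that is spanned by `E` and
`T` is transverse to the diagram and avoids the crossings. -/
theorem exists_transverse_plane : ∃ T : E3,
    (∀ r : ℝ, T ≠ r • (K.leg - K.head)) ∧
    ∀ p, Dom p → dot3 T (crossRight (K.leg - K.head) (K.γ p - K.head)) = 0 →
      dot3 T (crossRight (K.leg - K.head) (vel K.γ p)) ≠ 0 ∧ ¬ K.Double p := by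
  have hne : K.leg - K.head ≠ 0 := sub_ne_zero.2 (ne_head K.regular_leg.1 (by simp))
  have a1 : ∀ᵐ T : E3, ∀ i t, crossRight (K.leg - K.head) (K.γ (i, t) - K.head) ≠ 0 →
      dot3 T (crossRight (K.leg - K.head) (K.γ (i, t) - K.head)) = 0 →
      dot3 T (crossRight (K.leg - K.head) (vel K.γ (i, t))) = 0 →
        ∃ r : ℝ, T = r • (K.leg - K.head) :=
    MeasureTheory.ae_all_iff.2 fun i => ae_transverse_plane (K.smooth i) K.head hne
  have a2 : ∀ᵐ T : E3, ∀ x ∈ {x : E3 | ∃ p q, Meet K.γ p q ∧ K.γ p = x},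
      dot3 T (crossRight (K.leg - K.head) (x - K.head)) ≠ 0 := by
    rw [eventually_all_finite K.finite_crossings]
    rintro x ⟨p, q, h, rfl⟩
    refine ae_dot3_ne_zero (K.crossRight_ne_zero (K.mem_sphere _ h.1) (ne_leg h.1 ?_) (ne_head h.1 ?_))
    · exact (K.endpoints _ _ h).1
    · exact (K.endpoints _ _ h).2
  -- The normal vector vanishes at the leg and at the head, so `a1` says nothing there; the
  -- velocities at these two points are excluded separately.
  obtain ⟨T, h1, h2, h3, h4⟩ := (a1.and (a2.and ((ae_dot3_ne_zero K.crossRight_vel_leg).and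
    (ae_dot3_ne_zero K.crossRight_vel_head)))).exists
  have hT : ∀ r : ℝ, T ≠ r • (K.leg - K.head) := by
    rintro r rfl
    refine h3 ?_
    rw [dot3_comm, dot3_smul, dot3_crossRight, mul_zero]
  refine ⟨T, hT, fun p hp h0 => ?_⟩
  by_cases hl : p = (none, 0)
  · subst hl; exact ⟨h3, K.regular_leg.2⟩
  by_cases hh : p = (none, 1)
  · subst hh; exact ⟨h4, K.regular_head.2⟩
  refine ⟨fun h => ?_, fun ⟨q, hq⟩ => h2 _ ⟨p, q, hq, rfl⟩ h0⟩
  obtain ⟨r, hr⟩ := h1 p.1 p.2 (K.crossRight_ne_zero (K.mem_sphere _ hp) (ne_leg hp hl)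
    (ne_head hp hh)) h0 h
  exact hT r hr

/-- Every diagram has a shortcut. -/
theorem nonempty_shortcut : Nonempty K.Shortcut := by
  obtain ⟨T₀, hT₀, hT₁⟩ := K.exists_transverse_plane
  have hlt := K.dot_leg_head_lt
  have hP : dot3 K.leg K.leg = 1 := (norm_eq_one_iff _).1 (K.mem_sphere _ K.regular_leg.1)
  have hQ : dot3 K.head K.head = 1 := (norm_eq_one_iff _).1 (K.mem_sphere _ K.regular_head.1)
  set P := K.leg with hPdef
  set Q := K.head with hQdef
  set E := P - Q with hE
  have hQE : dot3 Q E = dot3 P Q - 1 := by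
    rw [← hQ]; simp only [dot3, hE, PiLp.sub_apply]; ring
  have hQE0 : dot3 Q E ≠ 0 := by rw [hQE]; linarith
  have hEE : dot3 E E = -2 * dot3 Q E := by
    rw [hQE]
    simp only [dot3, hE, PiLp.sub_apply] at *
    linear_combination hP + hQ
  -- Subtracting a multiple of `E` keeps the plane and makes `T` tangent to the sphere at the head
  -- `Q`.
  set T : E3 := T₀ + (-(dot3 Q T₀ / dot3 Q E)) • E with hT
  have hQT : dot3 Q T = 0 := by
    rw [hT, dot3_add_smul]; field_simp; ring
  have hT0 : T ≠ 0 := by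
    intro h
    refine hT₀ (dot3 Q T₀ / dot3 Q E) ?_
    rw [hT, neg_smul, ← sub_eq_add_neg] at h
    exact sub_eq_zero.1 h
  have hTcross : ∀ x, dot3 T (crossRight E x) = dot3 T₀ (crossRight E x) := by
    intro x
    rw [dot3_comm, hT, dot3_add_smul, dot3_crossRight, mul_zero, add_zero, dot3_comm]
  have hplane : ∀ α β : ℝ, dot3 T₀ (crossRight E (α • E + β • T)) = 0 := by
    intro α β
    rw [← hTcross]
    simp only [dot3, crossRight_zero, crossRight_one, crossRight_two, PiLp.add_apply, PiLp.smul_apply,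
      smul_eq_mul]
    ring
  have hindep : ∀ α β : ℝ, α • E + β • T = 0 → α = 0 ∧ β = 0 := by
    intro α β h
    have h1 : dot3 Q (α • E + β • T) = α * dot3 Q E := by
      rw [dot3_add_smul, dot3_smul, hQT]; ring
    have h2 : α = 0 := by
      rw [h] at h1
      have : dot3 Q 0 = 0 := by simp [dot3]
      rw [this] at h1
      exact (mul_eq_zero.1 h1.symm).resolve_right hQE0
    rw [h2, zero_smul, zero_add] at h
    exact ⟨h2, (smul_eq_zero.1 h).resolve_right hT0⟩
  -- The line through `Q` with the direction `D t` meets the sphere again at `Q + k t • D t`. The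
  -- direction `E` gives the leg, and the tangent direction `T` gives `Q` itself, so the circle in
  -- the plane is traced from the leg to the head.
  set D : ℝ → E3 := fun t => (1 - t) • E + t • T with hD
  have hD0 : ∀ t, D t ≠ 0 := by
    intro t h
    obtain ⟨h1, h2⟩ := hindep _ _ h
    linarith
  set dd : ℝ → ℝ := fun t => dot3 (D t) (D t) with hdd
  have hdd0 : ∀ t, 0 < dd t := fun t => dot3_self_pos (hD0 t)
  set k : ℝ → ℝ := fun t => dot3 E E * (1 - t) / dd t with hk
  have hE0 : 0 < dot3 E E := by rw [hEE, hQE]; linarith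
  have hDs : ContDiff ℝ ∞ D :=
    ((contDiff_const.sub contDiff_id).smul contDiff_const).add (contDiff_id.smul contDiff_const)
  have hc : ∀ i : Fin 3, ContDiff ℝ ∞ fun t => D t i := fun i =>
    (EuclideanSpace.proj i : E3 →L[ℝ] ℝ).contDiff.comp hDs
  have hdds : ContDiff ℝ ∞ dd :=
    (((hc 0).mul (hc 0)).add ((hc 1).mul (hc 1))).add ((hc 2).mul (hc 2))
  have hks : ContDiff ℝ ∞ k :=
    (contDiff_const.mul (contDiff_const.sub contDiff_id)).div hdds fun t => (hdd0 t).ne'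
  have hkd : ∀ t, HasDerivAt k (deriv k t) t := fun t =>
    (hks.differentiable (by simp)).differentiableAt.hasDerivAt
  have hddd : ∀ t, HasDerivAt dd (deriv dd t) t := fun t =>
    (hdds.differentiable (by simp)).differentiableAt.hasDerivAt
  have hDd : ∀ t, HasDerivAt D ((-1 : ℝ) • E + (1 : ℝ) • T) t := fun t =>
    (((hasDerivAt_id t).const_sub 1).smul_const E).add ((hasDerivAt_id t).smul_const T)
  set a : ℝ → E3 := fun t => Q + k t • D t with ha
  have had : ∀ t, deriv a t = (deriv k t * (1 - t) - k t) • E + (deriv k t * t + k t) • T := by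
    intro t
    have := (((hkd t).smul (hDd t)).const_add Q).deriv
    rw [show deriv a t = _ from this]
    simp only [hD]
    module
  have haE : ∀ t, a t - Q = (k t * (1 - t)) • E + (k t * t) • T := by
    intro t; simp only [ha, hD]; module
  have hsph : ∀ t, ‖a t‖ = 1 := by
    intro t
    rw [norm_eq_one_iff]
    have e1 : dot3 (a t) (a t) = dot3 Q Q + 2 * k t * dot3 Q (D t) + k t ^ 2 * dd t := by
      simp only [ha, dot3, hdd, PiLp.add_apply, PiLp.smul_apply, smul_eq_mul]; ring
    have e2 : dot3 Q (D t) = (1 - t) * dot3 Q E := by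
      simp only [hD]; rw [dot3_add_smul, dot3_smul, hQT]; ring
    have e3 : k t * dd t = dot3 E E * (1 - t) := div_mul_cancel₀ _ (hdd0 t).ne'
    rw [e1, e2, hQ]
    linear_combination k t * e3 + k t * (1 - t) * hEE
  have himm : ∀ t, deriv a t ≠ 0 := by
    intro t h
    rw [had] at h
    obtain ⟨h1, h2⟩ := hindep _ _ h
    have h3 : deriv k t = 0 := by linarith
    -- Since `E` and `T` are independent, a zero velocity forces `k` and its derivative to vanish
    -- together; but `k` has only a simple zero, at `t = 1`.
    have h4 : k t = 0 := by rw [h3] at h2; linarith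
    have h5 : t = 1 := by
      have := (div_eq_zero_iff.1 h4).resolve_right (hdd0 t).ne'
      have := (mul_eq_zero.1 this).resolve_left hE0.ne'
      linarith
    subst h5
    have h6 := (((hasDerivAt_id (1 : ℝ)).const_sub 1).const_mul (dot3 E E)).div (hddd 1) (hdd0 1).ne'
    have h7 := (hkd 1).unique h6
    rw [h3] at h7
    have := (div_eq_zero_iff.1 h7.symm).resolve_right (pow_ne_zero 2 (hdd0 1).ne')
    simp only [id, sub_self, mul_zero, zero_mul, sub_zero, mul_neg, mul_one, neg_mul, neg_eq_zero] at this
    exact (mul_pos hE0 (hdd0 1)).ne' this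
  have hinj : ∀ t t', a t = a t' → t = t' := by
    intro t t' h
    have h0 : (k t * (1 - t) - k t' * (1 - t')) • E + (k t * t - k t' * t') • T = 0 := by
      have := haE t
      rw [h, haE t'] at this
      have := sub_eq_zero.2 this.symm
      rw [← this]; module
    obtain ⟨h1, h2⟩ := hindep _ _ h0
    have h3 : k t = k t' := by linarith
    have hz : ∀ t, k t = 0 → t = 1 := by
      intro t h
      have := (div_eq_zero_iff.1 h).resolve_right (hdd0 t).ne'
      have := (mul_eq_zero.1 this).resolve_left hE0.ne'
      linarith
    by_cases h4 : k t = 0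
    · rw [hz t h4, hz t' (h3 ▸ h4)]
    · rw [← h3, ← mul_sub] at h2
      linarith [(mul_eq_zero.1 h2).resolve_left h4]
  have hzero : ∀ t p, a t = K.γ p → dot3 T₀ (crossRight E (K.γ p - Q)) = 0 := by
    intro t p h
    rw [← h, haE]; exact hplane _ _
  have hd0 : ∀ t, HasDerivAt a (deriv a t) t := fun t =>
    ((contDiff_const.add (hks.smul hDs)).differentiable (by simp : (∞ : WithTop ℕ∞) ≠ 0)).differentiableAt.hasDerivAt
  refine ⟨⟨a, contDiff_const.add (hks.smul hDs), fun t _ => hsph t, fun t _ => himm t,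
    fun t _ t' _ h => hinj t t' h, ?_, ?_, ?_, ?_⟩⟩
  · have h1 : dd 0 = dot3 E E := by simp [hdd, hD]
    have h2 : k 0 = 1 := by simp only [hk, h1, sub_zero, mul_one]; exact div_self hE0.ne'
    simp only [ha, h2, hD, hE]
    rw [← hPdef]
    module
  · simp only [ha, hk, sub_self, mul_zero, zero_div, zero_smul, add_zero]; exact hQdef
  · intro t ht p hp h
    obtain ⟨h1, h2⟩ := hT₁ p hp (hzero t p h)
    -- If the shortcut were tangent to the diagram, the velocity of the diagram would lie in the
    -- plane, contrary to the choice of the plane.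
    refine ⟨h2, fun hdet => h1 ?_⟩
    have hxv : dot3 (a t) (vel K.γ p) = 0 := by rw [h]; exact K.dot_vel hp
    have hxa : dot3 (a t) (deriv a t) = 0 :=
      dot3_eq_zero_of_sphere (a := t) (b := t + 1) (by linarith) (by simp) (hd0 t) fun r _ => hsph r
    obtain ⟨c0, c1, c2⟩ := cross_eq ((norm_eq_one_iff _).1 (hsph t)) hxa hxv
    rw [hdet, zero_mul] at c0 c1 c2
    have hz : crossRight (deriv a t) (vel K.γ p) = 0 := by
      refine ext3 ?_ ?_ ?_ <;> simp only [crossRight_zero, crossRight_one, crossRight_two, PiLp.zero_apply] <;>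
        linarith
    rw [eq_smul_of_crossRight_eq_zero (himm t) hz, had, smul_add, smul_smul, smul_smul]
    exact hplane _ _
  · set Z : Set E3 := ⋃ i, (fun r => K.γ (i, r)) ''
      {r | r ∈ Icc (0 : ℝ) 1 ∧ dot3 T₀ (crossRight E (K.γ (i, r) - Q)) = 0} with hZ
    have hZf : Z.Finite := by
      refine finite_iUnion fun i => Finite.image _ ?_
      refine finite_zeros_of_deriv_ne_zero (g' := fun r => dot3 T₀ (crossRight E (vel K.γ (i, r))))
        (fun r => hasDerivAt_dot3 T₀
          ((crossRight E).hasFDerivAt.comp_hasDerivAt r ((K.hasDerivAt_γ i r).sub_const Q))) ?_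
      exact fun r hr h0 => (hT₁ (i, r) (fun _ => hr) h0).1
    refine Finite.subset (hZf.preimage (f := a) fun t _ t' _ h => hinj t t' h) ?_
    rintro t ⟨-, p, hp, h⟩
    have h0 := hzero t p h
    obtain ⟨_ | i, r⟩ := p
    · exact mem_iUnion.2 ⟨none, r, ⟨hp rfl, h0⟩, h.symm⟩
    · have hs : K.γ (some i, r) = K.γ (some i, Int.fract r) := by
        have := samePoint_shift (m := m) (some i) r (-⌊r⌋) (by simp)
        rw [γ_eq this, Int.fract]
        push_cast
        rw [sub_eq_add_neg]
      rw [hs] at h h0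
      exact mem_iUnion.2 ⟨some i, _, ⟨⟨Int.fract_nonneg r, (Int.fract_lt_one r).le⟩, h0⟩, h.symm⟩

end Diagram

end

section

variable {m : ℕ}

/-! ## Diagrams with the same combinatorial structure -/

/-- A reparametrization of the source, increasing on every component. -/
structure Repar (m : ℕ) where
  π : Equiv.Perm (Fin m)
  ρ : Option (Fin m) → ℝ ≃o ℝ
  zero : ρ none 0 = 0
  one : ρ none 1 = 1
  add_one : ∀ (i : Fin m) (t : ℝ), ρ (some i) (t + 1) = ρ (some i) t + 1

namespace Repar

/-- The map on parameters. -/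
def map (f : Repar m) (p : Param m) : Param m := (p.1.map f.π, f.ρ p.1 p.2)

/-- The inverse reparametrization. -/
def symm (f : Repar m) : Repar m where
  π := f.π.symm
  ρ := fun i => (f.ρ (i.map f.π.symm)).symm
  zero := by
    rw [OrderIso.symm_apply_eq]; exact f.zero.symm
  one := by
    rw [OrderIso.symm_apply_eq]; exact f.one.symm
  add_one := by
    intro i t
    rw [OrderIso.symm_apply_eq]
    simp [f.add_one]

theorem symm_map_map (f : Repar m) (p : Param m) : f.symm.map (f.map p) = p := by
  obtain ⟨_ | i, t⟩ := p <;> simp [map, symm]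

theorem map_symm_map (f : Repar m) (p : Param m) : f.map (f.symm.map p) = p := by
  obtain ⟨_ | i, t⟩ := p <;> simp [map, symm]

variable (f : Repar m)

theorem dom {p : Param m} (h : Dom p) : Dom (f.map p) := by
  intro h0
  obtain ⟨_ | i, t⟩ := p
  · obtain ⟨h1, h2⟩ := h rfl
    simp only [map]
    exact ⟨f.zero ▸ (f.ρ none).monotone h1, (f.ρ none).monotone h2 |>.trans f.one.le⟩
  · simp [map] at h0

theorem dom_iff {p : Param m} : Dom (f.map p) ↔ Dom p :=
  ⟨fun h => f.symm_map_map p ▸ f.symm.dom h, f.dom⟩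

theorem add_int (i : Fin m) (t : ℝ) (n : ℤ) : f.ρ (some i) (t + n) = f.ρ (some i) t + n := by
  have hn : ∀ (k : ℕ) (t : ℝ), f.ρ (some i) (t + k) = f.ρ (some i) t + k := by
    intro k
    induction k with
    | zero => simp
    | succ k ih =>
      intro t
      push_cast
      rw [← add_assoc, f.add_one, ih, add_assoc]
  obtain ⟨k, rfl | rfl⟩ := n.eq_nat_or_neg
  · exact_mod_cast hn k t
  · have := hn k (t + ((-(k : ℤ) : ℤ) : ℝ))
    push_cast at this ⊢
    rw [neg_add_cancel_right] at this
    rw [this]; ring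

theorem samePoint {p q : Param m} (h : SamePoint p q) : SamePoint (f.map p) (f.map q) := by
  obtain ⟨n, hn, e⟩ := samePoint_iff.1 h
  subst e
  obtain ⟨_ | i, t⟩ := p
  · simp only [hn rfl, Int.cast_zero, add_zero]; exact .refl _
  · refine samePoint_iff.2 ⟨n, by simp [map], ?_⟩
    simp [map, f.add_int]

theorem samePoint_map_iff {p q : Param m} : SamePoint (f.map p) (f.map q) ↔ SamePoint p q :=
  ⟨fun h => by simpa only [symm_map_map] using f.symm.samePoint h, f.samePoint⟩

end Repar

/-- `f` identifies the diagram `L` with the diagram `K`, up to a homeomorphism of the sphere that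
preserves the orientation. -/
structure Diagram.Corr (K L : Diagram m) (f : Repar m) : Prop where
  γ_iff : ∀ p q, Dom p → Dom q → (L.γ p = L.γ q ↔ K.γ (f.map p) = K.γ (f.map q))
  det_iff : ∀ p q, Meet L.γ p q → (0 < det3 (L.γ p) (vel L.γ p) (vel L.γ q) ↔
    0 < det3 (K.γ (f.map p)) (vel K.γ (f.map p)) (vel K.γ (f.map q)))
  over_iff : ∀ p, L.Double p → (L.isOver p ↔ K.isOver (f.map p))

/-! ### Transport of the bracket along an identification of diagrams -/

namespace Diagram.Corr

variable {K L : Diagram m} {f : Repar m}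

theorem meet (h : Corr K L f) {p q : Param m} (hm : Meet L.γ p q) :
    Meet K.γ (f.map p) (f.map q) :=
  ⟨f.dom hm.1, f.dom hm.2.1, fun hs => hm.2.2.1 (f.samePoint_map_iff.1 hs),
    (h.γ_iff p q hm.1 hm.2.1).1 hm.2.2.2⟩

theorem meet_iff (h : Corr K L f) {p q : Param m} :
    Meet K.γ (f.map p) (f.map q) ↔ Meet L.γ p q := by
  refine ⟨fun hm => ?_, h.meet⟩
  have h1 := f.dom_iff.1 hm.1
  have h2 := f.dom_iff.1 hm.2.1
  exact ⟨h1, h2, fun hs => hm.2.2.1 (f.samePoint hs), (h.γ_iff p q h1 h2).2 hm.2.2.2⟩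

theorem double_iff (h : Corr K L f) {p : Param m} : K.Double (f.map p) ↔ L.Double p := by
  constructor
  · rintro ⟨q, hq⟩
    rw [← f.map_symm_map q] at hq
    exact ⟨_, h.meet_iff.1 hq⟩
  · rintro ⟨q, hq⟩
    exact ⟨_, h.meet hq⟩

theorem symm (h : Corr K L f) : Corr L K f.symm where
  γ_iff p q hp hq := by
    have := h.γ_iff (f.symm.map p) (f.symm.map q) (f.symm.dom hp) (f.symm.dom hq)
    rw [f.map_symm_map, f.map_symm_map] at this
    exact this.symm
  det_iff p q hm := by
    have := h.det_iff (f.symm.map p) (f.symm.map q)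
      (h.meet_iff.1 (by rwa [f.map_symm_map, f.map_symm_map]))
    rw [f.map_symm_map, f.map_symm_map] at this
    exact this.symm
  over_iff p hp := by
    have := h.over_iff (f.symm.map p) (h.double_iff.1 (by rwa [f.map_symm_map]))
    rw [f.map_symm_map] at this
    exact this.symm

theorem regular_iff (h : Corr K L f) {p : Param m} : K.Regular (f.map p) ↔ L.Regular p :=
  and_congr f.dom_iff (not_congr h.double_iff)

/-- The map between the sets of crossings. -/
def crossing (h : Corr K L f) (c : L.Crossing) : K.Crossing :=
  ⟨K.γ (f.map c.2.choose), _, _, h.meet c.2.choose_spec.choose_spec.1, rfl⟩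

theorem crossing_val (h : Corr K L f) (c : L.Crossing) {p : Param m} (hp : Dom p)
    (e : L.γ p = c.1) : (h.crossing c).1 = K.γ (f.map p) :=
  (h.γ_iff _ _ c.2.choose_spec.choose_spec.1.1 hp).1 (c.2.choose_spec.choose_spec.2.trans e.symm)

/-- The bijection between the sets of crossings. -/
def crossingEquiv (h : Corr K L f) : L.Crossing ≃ K.Crossing where
  toFun := h.crossing
  invFun := h.symm.crossing
  left_inv c := by
    obtain ⟨p, q, hm, e⟩ := c.2
    refine Subtype.ext ?_
    rw [h.symm.crossing_val _ (f.dom hm.1) (h.crossing_val c hm.1 e).symm, f.symm_map_map, e]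
  right_inv c := by
    obtain ⟨p, q, hm, e⟩ := c.2
    refine Subtype.ext ?_
    rw [h.crossing_val _ (f.symm.dom hm.1) (h.symm.crossing_val c hm.1 e).symm, f.map_symm_map, e]

theorem crossingEquiv_val (h : Corr K L f) (c : L.Crossing) {p : Param m} (hp : Dom p)
    (e : L.γ p = c.1) : K.γ (f.map p) = (h.crossingEquiv c).1 := (h.crossing_val c hp e).symm

theorem sign_eq (h : Corr K L f) (c : L.Crossing) : K.sign (h.crossingEquiv c) = L.sign c := by
  unfold sign
  congr 1
  refine propext ⟨?_, ?_⟩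
  · rintro ⟨p, q, hm, e, ho, hd⟩
    obtain ⟨p, rfl⟩ : ∃ p', p = f.map p' := ⟨_, (f.map_symm_map p).symm⟩
    obtain ⟨q, rfl⟩ : ∃ q', q = f.map q' := ⟨_, (f.map_symm_map q).symm⟩
    have hm' := h.meet_iff.1 hm
    obtain ⟨p', q', hm'', e'⟩ := c.2
    rw [← h.crossingEquiv_val c hm''.1 e'] at e
    refine ⟨_, _, hm', ((h.γ_iff _ _ hm'.1 hm''.1).2 e).trans e', (h.over_iff _ ⟨_, hm'⟩).2 ho,
      (h.det_iff _ _ hm').2 hd⟩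
  · rintro ⟨p, q, hm, e, ho, hd⟩
    exact ⟨_, _, h.meet hm, h.crossingEquiv_val c hm.1 e, (h.over_iff _ ⟨_, hm⟩).1 ho,
      (h.det_iff _ _ hm).1 hd⟩

theorem writhe_eq (h : Corr K L f) : K.writhe = L.writhe := by
  unfold writhe
  rw [← Equiv.sum_comp h.crossingEquiv]
  simp only [h.sign_eq]

theorem approach (h : Corr K L f) {p p' : Param m} {ε : ℤˣ} (ha : L.Approach p' ε p) :
    K.Approach (f.map p') ε (f.map p) := by
  obtain ⟨h1, h2, h3, h4⟩ := ha
  obtain ⟨i, t⟩ := p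
  obtain ⟨i', t'⟩ := p'
  obtain rfl : i' = i := h2
  refine ⟨h.regular_iff.2 h1, rfl, ?_, ?_⟩
  · simp only [Repar.map]
    rcases Int.units_eq_one_or ε with rfl | rfl
    · simp only [Units.val_one, Int.cast_one, one_mul, sub_pos] at h3 ⊢
      exact (f.ρ i').strictMono h3
    · simp only [Units.val_neg, Units.val_one, Int.cast_neg, Int.cast_one, neg_mul, one_mul,
        neg_sub, sub_pos] at h3 ⊢
      exact (f.ρ i').strictMono h3
  · intro r hr hne hd
    simp only [Repar.map] at hr hne hd
    have hr' : (f.ρ i').symm r ∈ uIcc t' t := by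
      rw [mem_uIcc] at hr ⊢
      simpa only [OrderIso.le_symm_apply, OrderIso.symm_apply_le] using hr
    refine h4 _ hr' (fun e => hne ((OrderIso.symm_apply_eq _).1 e)) (h.double_iff.1 ?_)
    simpa [Repar.map] using hd

theorem step (h : Corr K L f) {s : K.State} {x y : Param m × ℤˣ}
    (hs : L.Step (s ∘ h.crossingEquiv) x y) :
    K.Step s (f.map x.1, x.2) (f.map y.1, y.2) := by
  induction hs with
  | along i t t' ε h1 h2 =>
    refine .along _ _ _ _ ?_ ?_
    · rcases Int.units_eq_one_or ε with rfl | rfl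
      · simp only [Units.val_one, Int.cast_one, one_mul, sub_nonneg] at h1 ⊢
        exact (f.ρ i).monotone h1
      · simp only [Units.val_neg, Units.val_one, Int.cast_neg, Int.cast_one, neg_mul, one_mul,
          neg_sub, sub_nonneg] at h1 ⊢
        exact (f.ρ i).monotone h1
    · intro r hr
      have hr' : (f.ρ i).symm r ∈ uIcc t t' := by
        rw [mem_uIcc] at hr ⊢
        simpa only [OrderIso.le_symm_apply, OrderIso.symm_apply_le] using hr
      have := h.regular_iff.2 (h2 _ hr')
      simpa [Repar.map] using this
  | same p q ε h1 h2 => exact .same _ _ _ (h.regular_iff.2 h1) (f.samePoint h2)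
  | smoothing c p q p' q' ε δ hm e hδ h1 h2 =>
    refine .smoothing (h.crossingEquiv c) (f.map p) (f.map q) _ _ _ _ (h.meet hm)
      (h.crossingEquiv_val c hm.1 e) ?_ (h.approach h1) (h.approach h2)
    rw [hδ, h.sign_eq]; rfl

theorem step_iff (h : Corr K L f) {s : K.State} {x y : Param m × ℤˣ} :
    K.Step s (f.map x.1, x.2) (f.map y.1, y.2) ↔ L.Step (s ∘ h.crossingEquiv) x y := by
  refine ⟨fun hs => ?_, h.step⟩
  have e : s = (s ∘ h.crossingEquiv) ∘ h.symm.crossingEquiv := by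
    funext c
    exact congrArg s (h.crossingEquiv.apply_symm_apply c).symm
  rw [e] at hs
  have := h.symm.step hs
  simpa only [f.symm_map_map] using this

theorem segmentPasses_iff (h : Corr K L f) {s : K.State} {p : Param m} {ε : ℤˣ} :
    K.SegmentPasses s (f.map p) ε ↔ L.SegmentPasses (s ∘ h.crossingEquiv) p ε := by
  have h0 : ∀ f : Repar m, f.map (none, 0) = (none, 0) := fun f => by
    simp [Repar.map, f.zero]
  constructor
  · intro hs
    have := Relation.ReflTransGen.lift (p := L.Step (s ∘ h.crossingEquiv))
      (fun x : Param m × ℤˣ => (f.symm.map x.1, x.2)) (fun x y hxy => h.step_iff.1 (by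
        simpa only [f.map_symm_map] using hxy)) _ _ hs
    simp only [Function.onFun, f.symm_map_map, h0] at this
    exact this
  · intro hs
    have := Relation.ReflTransGen.lift (p := K.Step s) (fun x : Param m × ℤˣ => (f.map x.1, x.2))
      (fun x y hxy => h.step hxy) _ _ hs
    simp only [Function.onFun, h0] at this
    exact this

theorem numComponents_eq (h : Corr K L f) (s : K.State) :
    K.numComponents s = L.numComponents (s ∘ h.crossingEquiv) := by
  refine (Nat.card_congr (Quot.congr
    (⟨fun p => ⟨f.map p.1, h.regular_iff.2 p.2⟩,
      fun p => ⟨f.symm.map p.1, h.symm.regular_iff.2 p.2⟩, fun p => Subtype.ext (f.symm_map_map _),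
      fun p => Subtype.ext (f.map_symm_map _)⟩ : {p // L.Regular p} ≃ {p // K.Regular p}) ?_)).symm
  intro p q
  exact exists_congr fun ε => exists_congr fun δ => (h.step_iff (x := (p.1, ε)) (y := (q.1, δ))).symm

theorem sigma_eq (h : Corr K L f) (s : K.State) : L.sigma (s ∘ h.crossingEquiv) = K.sigma s := by
  unfold sigma
  rw [← Equiv.sum_comp h.crossingEquiv]
  rfl

/-- Shortcuts of the two diagrams that correspond to each other. -/
structure Matches (f : Repar m) (a : K.Shortcut) (b : L.Shortcut) : Prop where
  eq_iff : ∀ t ∈ Ioo (0 : ℝ) 1, ∀ p, Dom p → (b.a t = L.γ p ↔ a.a t = K.γ (f.map p))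
  det_iff : ∀ t ∈ Ioo (0 : ℝ) 1, ∀ p, Dom p → b.a t = L.γ p →
    (0 < det3 (b.a t) (deriv b.a t) (vel L.γ p) ↔
      0 < det3 (a.a t) (deriv a.a t) (vel K.γ (f.map p)))

theorem inter_eq {a : K.Shortcut} {b : L.Shortcut} (hab : Matches f a b)
    {T T' : Param m → ℤˣ → Prop} (hT : ∀ p ε, T' p ε ↔ T (f.map p) ε) :
    a.inter T = b.inter T' := by
  have hneg : ∀ t ∈ Ioo (0 : ℝ) 1, ∀ p, Dom p → b.a t = L.γ p →
      (det3 (b.a t) (deriv b.a t) (vel L.γ p) < 0 ↔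
        det3 (a.a t) (deriv a.a t) (vel K.γ (f.map p)) < 0) := by
    intro t ht p hp e
    have h1 := (b.transverse t ht p hp e).2
    have h2 := (a.transverse t ht _ (f.dom hp) ((hab.eq_iff t ht p hp).1 e)).2
    have h3 := hab.det_iff t ht p hp e
    rw [← not_iff_not, not_lt, not_lt, le_iff_lt_or_eq, le_iff_lt_or_eq, h3]
    simp [h1.symm, h2.symm]
  have key : ∀ (Q : ℤˣ → ℝ → Prop), (∀ t ∈ Ioo (0 : ℝ) 1, ∀ p ε, Dom p → b.a t = L.γ p →
      (Q ε (det3 (b.a t) (deriv b.a t) (vel L.γ p)) ↔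
        Q ε (det3 (a.a t) (deriv a.a t) (vel K.γ (f.map p))))) →
      {t ∈ Ioo (0 : ℝ) 1 | ∃ p ε, Dom p ∧ a.a t = K.γ p ∧ T p ε ∧
        Q ε (det3 (a.a t) (deriv a.a t) (vel K.γ p))} =
      {t ∈ Ioo (0 : ℝ) 1 | ∃ p ε, Dom p ∧ b.a t = L.γ p ∧ T' p ε ∧
        Q ε (det3 (b.a t) (deriv b.a t) (vel L.γ p))} := by
    intro Q hQ
    ext t
    refine and_congr_right fun ht => ⟨?_, ?_⟩
    · rintro ⟨p, ε, hp, e, h1, h2⟩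
      obtain ⟨p, rfl⟩ : ∃ p', p = f.map p' := ⟨_, (f.map_symm_map p).symm⟩
      have hp' := f.dom_iff.1 hp
      have e' := (hab.eq_iff t ht p hp').2 e
      exact ⟨p, ε, hp', e', (hT _ _).2 h1, (hQ t ht p ε hp' e').2 h2⟩
    · rintro ⟨p, ε, hp, e, h1, h2⟩
      exact ⟨_, ε, f.dom hp, (hab.eq_iff t ht p hp).1 e, (hT _ _).1 h1, (hQ t ht p ε hp e).1 h2⟩
  unfold Shortcut.inter
  rw [key (fun ε d => 0 < ((ε : ℤ) : ℝ) * d) ?_, key (fun ε d => ((ε : ℤ) : ℝ) * d < 0) ?_]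
  · intro t ht p ε hp e
    rcases Int.units_eq_one_or ε with rfl | rfl
    · simpa using hneg t ht p hp e
    · simpa using hab.det_iff t ht p hp e
  · intro t ht p ε hp e
    rcases Int.units_eq_one_or ε with rfl | rfl
    · simpa using hab.det_iff t ht p hp e
    · simpa using hneg t ht p hp e

theorem extendedBracket_eq (h : Corr K L f) {a : K.Shortcut} {b : L.Shortcut}
    (hab : Matches f a b) : extendedBracket K a = extendedBracket L b := by
  unfold extendedBracket
  have h1 : a.diagramInter = b.diagramInter := inter_eq hab fun p ε => Iff.rfl
  rw [h.writhe_eq, h1]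
  congr 1
  refine (Fintype.sum_equiv (Equiv.arrowCongr h.crossingEquiv (Equiv.refl ℤˣ)) _ _ fun s => ?_).symm
  obtain ⟨s, rfl⟩ := (Equiv.arrowCongr h.crossingEquiv (Equiv.refl ℤˣ)).symm.surjective s
  rw [Equiv.apply_symm_apply,
    show (Equiv.arrowCongr h.crossingEquiv (Equiv.refl ℤˣ)).symm s = s ∘ h.crossingEquiv from rfl,
    h.sigma_eq, h.numComponents_eq,
    show a.stateInter s = b.stateInter (s ∘ h.crossingEquiv) from
      inter_eq hab fun p ε => h.segmentPasses_iff.symm]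

end Diagram.Corr

/-! ## Ambient isotopies -/

/-- Every tangent vector of the sphere is the velocity of a curve on the sphere. -/
theorem exists_curve {x v : E3} (hx : ‖x‖ = 1) (hv : dot3 x v = 0) :
    ∃ c : ℝ → E3, c 0 = x ∧ HasDerivAt c v 0 ∧ ∀ t, ‖c t‖ = 1 := by
  have hx' := (norm_eq_one_iff _).1 hx
  have hD : ∀ t : ℝ, dot3 (x + t • v) (x + t • v) = 1 + t ^ 2 * dot3 v v := by
    intro t
    simp only [dot3, PiLp.add_apply, PiLp.smul_apply, smul_eq_mul] at *
    linear_combination hx' + 2 * t * hv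
  have hpos : ∀ t : ℝ, 0 < 1 + t ^ 2 * dot3 v v := by
    intro t
    have : 0 ≤ dot3 v v := by
      simp only [dot3]
      nlinarith [mul_self_nonneg (v 0), mul_self_nonneg (v 1), mul_self_nonneg (v 2)]
    positivity
  refine ⟨fun t => (Real.sqrt (1 + t ^ 2 * dot3 v v))⁻¹ • (x + t • v), by simp, ?_, ?_⟩
  · have h1 : HasDerivAt (fun t : ℝ => 1 + t ^ 2 * dot3 v v) 0 0 := by
      have := ((hasDerivAt_pow 2 (0 : ℝ)).mul_const (dot3 v v)).const_add 1
      simpa using this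
    have h2 := (h1.sqrt (hpos 0).ne').inv (by simp)
    have h3 : HasDerivAt (fun t : ℝ => x + t • v) ((1 : ℝ) • v) 0 :=
      ((hasDerivAt_id (0 : ℝ)).smul_const v).const_add x
    have := h2.smul h3
    refine this.congr_deriv ?_
    simp
  · intro t
    rw [norm_eq_one_iff]
    simp only
    rw [dot3_smul, dot3_comm _ (x + t • v), dot3_smul, hD]
    rw [← mul_assoc, ← mul_inv, Real.mul_self_sqrt (hpos t).le, inv_mul_cancel₀ (hpos t).ne']

/-! ### Derivatives of an isotopy and the orientation of the sphere -/

section Sphere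

variable {H G : ℝ → E3 → E3}

/-- The spatial derivative of a family of maps. -/
def spaceD (H : ℝ → E3 → E3) (t : ℝ) (x v : E3) : E3 :=
  fderiv ℝ (fun z : ℝ × E3 => H z.1 z.2) (t, x) (0, v)

theorem hasDerivAt_spaceD (hH : ContDiff ℝ ∞ fun z : ℝ × E3 => H z.1 z.2) {c : ℝ → E3} {v : E3}
    {r : ℝ} (t : ℝ) (hc : HasDerivAt c v r) :
    HasDerivAt (fun r => H t (c r)) (spaceD H t (c r) v) r := by
  have h1 : HasFDerivAt (fun z : ℝ × E3 => H z.1 z.2)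
      (fderiv ℝ (fun z : ℝ × E3 => H z.1 z.2) (t, c r)) (t, c r) :=
    (hH.differentiable (by simp)).differentiableAt.hasFDerivAt
  exact h1.comp_hasDerivAt (f := fun r => (t, c r)) r ((hasDerivAt_const r t).prodMk hc)

theorem continuous_spaceD (hH : ContDiff ℝ ∞ fun z : ℝ × E3 => H z.1 z.2) (x v : E3) :
    Continuous fun t => spaceD H t x v := by
  have h1 := hH.continuous_fderiv (by simp)
  exact (h1.comp (Continuous.prodMk_left x)).clm_apply continuous_const

theorem spaceD_smul (t : ℝ) (x v : E3) (r : ℝ) : spaceD H t x (r • v) = r • spaceD H t x v := by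
  unfold spaceD
  rw [← map_smul]
  simp

/-- `G t` inverts `H t` on the sphere only, so their derivatives are composed along curves on the
sphere. The derivative of `G t` then recovers `v` and `w`, which would be dependent if their images
were. -/
theorem det3_spaceD_ne_zero (hH : ContDiff ℝ ∞ fun z : ℝ × E3 => H z.1 z.2)
    (hG : ContDiff ℝ ∞ fun z : ℝ × E3 => G z.1 z.2) {t : ℝ}
    (hHG : ∀ x : E3, ‖x‖ = 1 → ‖H t x‖ = 1 ∧ ‖G t x‖ = 1 ∧ G t (H t x) = x ∧ H t (G t x) = x)
    {x v w : E3} (hx : ‖x‖ = 1) (hv : dot3 x v = 0) (hw : dot3 x w = 0) (hdet : det3 x v w ≠ 0) :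
    det3 (H t x) (spaceD H t x v) (spaceD H t x w) ≠ 0 := by
  have key : ∀ v, dot3 x v = 0 → dot3 (H t x) (spaceD H t x v) = 0 ∧
      spaceD G t (H t x) (spaceD H t x v) = v := by
    intro v hv
    obtain ⟨c, h0, h1, h2⟩ := exists_curve hx hv
    have h3 := hasDerivAt_spaceD hH t h1
    have h4 := hasDerivAt_spaceD hG t h3
    rw [h0] at h3 h4
    refine ⟨?_, ?_⟩
    · have := dot3_eq_zero_of_sphere (a := 0) (b := 1) zero_lt_one (by simp) h3
        fun r _ => (hHG _ (h2 r)).1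
      rwa [h0] at this
    · have h5 : (fun r => G t (H t (c r))) = c := by
        funext r; exact (hHG _ (h2 r)).2.2.1
      rw [h5] at h4
      exact h4.unique h1
  obtain ⟨v1, v2⟩ := key v hv
  obtain ⟨w1, w2⟩ := key w hw
  intro h
  obtain ⟨c0, c1, c2⟩ := cross_eq ((norm_eq_one_iff _).1 (hHG x hx).1) v1 w1
  rw [h, zero_mul] at c0 c1 c2
  have hz : crossRight (spaceD H t x v) (spaceD H t x w) = 0 := by
    refine ext3 ?_ ?_ ?_ <;> simp only [crossRight_zero, crossRight_one, crossRight_two, PiLp.zero_apply] <;>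
      linarith
  have hv0 : spaceD H t x v ≠ 0 := by
    intro h0
    rw [h0, show spaceD G t (H t x) 0 = 0 by
      have := spaceD_smul (H := G) t (H t x) 0 0
      rwa [zero_smul, zero_smul] at this] at v2
    rw [← v2] at hdet
    exact hdet (by simp [det3_eq])
  have h1 := eq_smul_of_crossRight_eq_zero hv0 hz
  rw [h1, spaceD_smul, v2] at w2
  rw [← w2] at hdet
  refine hdet ?_
  simp only [det3_eq, PiLp.smul_apply, smul_eq_mul]; ring

/-- The diffeomorphism at the end of an isotopy preserves the orientation. -/
theorem det3_spaceD_pos_iff (hH : ContDiff ℝ ∞ fun z : ℝ × E3 => H z.1 z.2)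
    (hG : ContDiff ℝ ∞ fun z : ℝ × E3 => G z.1 z.2)
    (hHG : ∀ t ∈ Icc (0 : ℝ) 1, ∀ x : E3, ‖x‖ = 1 →
      ‖H t x‖ = 1 ∧ ‖G t x‖ = 1 ∧ G t (H t x) = x ∧ H t (G t x) = x)
    (hid : ∀ x : E3, ‖x‖ = 1 → H 0 x = x)
    {x v w : E3} (hx : ‖x‖ = 1) (hv : dot3 x v = 0) (hw : dot3 x w = 0) (hdet : det3 x v w ≠ 0) :
    0 < det3 (H 1 x) (spaceD H 1 x v) (spaceD H 1 x w) ↔ 0 < det3 x v w := by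
  have key : ∀ v, dot3 x v = 0 → spaceD H 0 x v = v := by
    intro v hv
    obtain ⟨c, h0, h1, h2⟩ := exists_curve hx hv
    have h3 := hasDerivAt_spaceD hH 0 h1
    have h5 : (fun r => H 0 (c r)) = c := by funext r; exact hid _ (h2 r)
    rw [h0, h5] at h3
    exact h3.unique h1
  -- This determinant is continuous in the time of the isotopy, never zero, and equal to `det3 x v
  -- w` at time `0`; by the intermediate value theorem its sign is constant.
  set g : ℝ → ℝ := fun t => det3 (H t x) (spaceD H t x v) (spaceD H t x w) with hg
  have hgc : Continuous g := by
    have h1 : Continuous fun t => H t x := hH.continuous.comp (Continuous.prodMk_left x)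
    have h2 := continuous_spaceD hH x v
    have h3 := continuous_spaceD hH x w
    simp only [hg, det3_eq]
    fun_prop
  have hg0 : g 0 = det3 x v w := by
    simp only [hg, hid x hx, key v hv, key w hw]
  have hne : ∀ t ∈ Icc (0 : ℝ) 1, g t ≠ 0 := fun t ht => det3_spaceD_ne_zero hH hG (hHG t ht) hx hv hw hdet
  rw [← hg0]
  change 0 < g 1 ↔ 0 < g 0
  constructor
  · intro h1
    by_contra h0
    obtain ⟨t, ht, h⟩ := intermediate_value_Icc zero_le_one hgc.continuousOn
      (show (0 : ℝ) ∈ Icc (g 0) (g 1) from ⟨not_lt.1 h0, h1.le⟩)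
    exact hne t ht h
  · intro h0
    by_contra h1
    obtain ⟨t, ht, h⟩ := intermediate_value_Icc' zero_le_one hgc.continuousOn
      (show (0 : ℝ) ∈ Icc (g 1) (g 0) from ⟨not_lt.1 h1, h0.le⟩)
    exact hne t ht h

end Sphere

/-- The reparametrization of an isotopy. -/
theorem exists_repar (π : Equiv.Perm (Fin m)) {ρ : Option (Fin m) → ℝ → ℝ}
    (hρ : ∀ i, ContDiff ℝ ∞ (ρ i)) (hρ' : ∀ i t, 0 < deriv (ρ i) t) (h0 : ρ none 0 = 0)
    (h1 : ρ none 1 = 1) (hp : ∀ (i : Fin m) (t : ℝ), ρ (some i) (t + 1) = ρ (some i) t + 1) :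
    ∃ f : Repar m, ∀ p, Dom p → f.map p = (p.1.map π, ρ p.1 p.2) := by
  have hmono : ∀ i, StrictMono (ρ i) := fun i => strictMono_of_deriv_pos (hρ' i)
  have hsurj : ∀ i : Fin m, Function.Surjective (ρ (some i)) := by
    intro i y
    have hn : ∀ (n : ℕ) (t : ℝ), ρ (some i) (t + n) = ρ (some i) t + n := by
      intro k
      induction k with
      | zero => simp
      | succ k ih =>
        intro t
        push_cast
        rw [← add_assoc, hp, ih, add_assoc]
    obtain ⟨n, hn1⟩ := exists_nat_ge |y - ρ (some i) 0|
    have h2 := abs_le.1 hn1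
    have h3 := hn n 0
    have h4 := hn n (0 + -n)
    rw [zero_add] at h3 h4
    rw [neg_add_cancel] at h4
    obtain ⟨t, -, ht⟩ := intermediate_value_Icc (a := -(n : ℝ)) (b := n)
      (by linarith [(Nat.cast_nonneg n : (0 : ℝ) ≤ n)])
      (hρ (some i)).continuous.continuousOn (show y ∈ Icc _ _ from ⟨by linarith, by linarith⟩)
    exact ⟨t, ht⟩
  -- Only the values on `[0, 1]` matter for the segment, and the given map need not be onto `ℝ`; the
  -- identity outside `[0, 1]` completes it to an order isomorphism.
  set r : ℝ → ℝ := fun t => if t ∈ Icc (0 : ℝ) 1 then ρ none t else t with hr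
  have hin : ∀ t ∈ Icc (0 : ℝ) 1, ρ none t ∈ Icc (0 : ℝ) 1 := fun t ht =>
    ⟨h0 ▸ (hmono none).monotone ht.1, h1 ▸ (hmono none).monotone ht.2⟩
  have hrm : StrictMono r := by
    intro x y hxy
    by_cases hx : x ∈ Icc (0 : ℝ) 1 <;> by_cases hy : y ∈ Icc (0 : ℝ) 1 <;> simp only [hr, hx, hy, if_true, if_false]
    · exact hmono none hxy
    · have : 1 < y := by
        by_contra h
        exact hy ⟨hx.1.trans hxy.le, not_lt.1 h⟩
      exact (hin x hx).2.trans_lt this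
    · have : x < 0 := by
        by_contra h
        exact hx ⟨not_lt.1 h, hxy.le.trans hy.2⟩
      exact this.trans_le (hin y hy).1
    · exact hxy
  have hrs : Function.Surjective r := by
    intro y
    by_cases hy : y ∈ Icc (0 : ℝ) 1
    · obtain ⟨t, ht, e⟩ := intermediate_value_Icc zero_le_one (hρ none).continuous.continuousOn
        (show y ∈ Icc (ρ none 0) (ρ none 1) by rwa [h0, h1])
      exact ⟨t, by simp only [hr, ht, if_true, e]⟩
    · exact ⟨y, by simp only [hr, hy, if_false]⟩
  refine ⟨⟨π, fun i => i.casesOn (StrictMono.orderIsoOfSurjective r hrm hrs)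
    (fun i => StrictMono.orderIsoOfSurjective _ (hmono (some i)) (hsurj i)), ?_, ?_, ?_⟩, ?_⟩
  · simp [hr, h0]
  · simp [hr, h1]
  · intro i t; exact hp i t
  · rintro ⟨_ | i, t⟩ hd
    · have := hd rfl
      simp only [Repar.map, Prod.mk.injEq, true_and]
      change r t = _
      simp only [hr, this, if_true]
    · rfl

theorem det3_smul_smul (x v w : E3) (r s : ℝ) : det3 x (r • v) (s • w) = r * s * det3 x v w := by
  simp only [det3_eq, PiLp.smul_apply, smul_eq_mul]; ring

/-- The bracket is invariant under ambient isotopies. -/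
theorem extendedBracket_eq_of_isotopic {K L : Diagram m} (h : Isotopic K L) (a : K.Shortcut)
    (b : L.Shortcut) : extendedBracket K a = extendedBracket L b := by
  obtain ⟨H, G, π, ρ, hH, hG, hHG, hid, hρ, hρ', h0, h1, hp, hγ, ho⟩ := h
  obtain ⟨f, hf⟩ := exists_repar π hρ hρ' h0 h1 hp
  have one_mem : (1 : ℝ) ∈ Icc (0 : ℝ) 1 := by simp
  have hγ' : ∀ p, Dom p → L.γ p = H 1 (K.γ (f.map p)) := fun p hd => by
    rw [hf p hd]; exact hγ p.1 p.2 hd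
  have hsph : ∀ p, Dom p → ‖K.γ (f.map p)‖ = 1 := fun p hd => K.mem_sphere _ (f.dom hd)
  have hinj : ∀ x y : E3, ‖x‖ = 1 → ‖y‖ = 1 → (H 1 x = H 1 y ↔ x = y) := by
    refine fun x y hx hy => ⟨fun e => ?_, fun e => e ▸ rfl⟩
    rw [← (hHG 1 one_mem x hx).2.2.1, e, (hHG 1 one_mem y hy).2.2.1]
  -- At the ends of the segment the two parametrizations are only known to agree on one side, so the
  -- velocities are compared at interior parameters.
  have hvel : ∀ p, p.2 ∈ Diagram.openDom p.1 → ∃ r : ℝ, 0 < r ∧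
      vel L.γ p = r • spaceD H 1 (K.γ (f.map p)) (vel K.γ (f.map p)) := by
    rintro ⟨i, t⟩ ht
    have hd := Diagram.dom_of_openDom ht
    refine ⟨deriv (ρ i) t, hρ' i t, ?_⟩
    rw [hf _ hd]
    have e1 : HasDerivAt (fun t => K.γ (i.map π, ρ i t)) (deriv (ρ i) t • vel K.γ (i.map π, ρ i t)) t :=
      (K.hasDerivAt_γ (i.map π) (ρ i t)).scomp t
        (((hρ i).differentiable (by simp)).differentiableAt.hasDerivAt)
    have e2 := hasDerivAt_spaceD hH 1 e1
    rw [spaceD_smul] at e2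
    refine (e2.congr_of_eventuallyEq ?_).deriv
    filter_upwards [(Diagram.isOpen_openDom i).mem_nhds ht] with r hr
    exact hγ i r (Diagram.dom_of_openDom hr)
  have hopen : ∀ p : Param m, Dom p → p ≠ (none, 0) → p ≠ (none, 1) → p.2 ∈ Diagram.openDom p.1 := by
    rintro ⟨i, t⟩ hd n0 n1 hi
    simp only at hi
    subst hi
    exact ⟨lt_of_le_of_ne (hd rfl).1 fun e => n0 (Prod.ext rfl e.symm),
      lt_of_le_of_ne (hd rfl).2 fun e => n1 (Prod.ext rfl e)⟩
  have hmeet : ∀ p q, Meet L.γ p q → Meet K.γ (f.map p) (f.map q) := fun p q hm =>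
    ⟨f.dom hm.1, f.dom hm.2.1, fun hs => hm.2.2.1 (f.samePoint_map_iff.1 hs),
      (hinj _ _ (hsph p hm.1) (hsph q hm.2.1)).1
        ((hγ' p hm.1).symm.trans (hm.2.2.2.trans (hγ' q hm.2.1)))⟩
  have hC : Diagram.Corr K L f := by
    refine ⟨?_, ?_, ?_⟩
    · intro p q hp hq
      rw [hγ' p hp, hγ' q hq]
      exact hinj _ _ (hsph p hp) (hsph q hq)
    · intro p q hm
      have hm' := hmeet p q hm
      obtain ⟨r, hr, e1⟩ := hvel p (hopen p hm.1 (L.endpoints _ _ hm).1 (L.endpoints _ _ hm).2)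
      have hms := Diagram.meet_symm hm
      obtain ⟨r', hr', e2⟩ := hvel q (hopen q hm.2.1 (L.endpoints _ _ hms).1 (L.endpoints _ _ hms).2)
      have e3 : K.γ (f.map p) = K.γ (f.map q) := hm'.2.2.2
      rw [e1, e2, det3_smul_smul, mul_pos_iff_of_pos_left (mul_pos hr hr'), hγ' p hm.1, ← e3]
      refine det3_spaceD_pos_iff hH hG hHG hid (hsph p hm.1) (Diagram.dot_vel (f.dom hm.1)) ?_
        (K.transverse _ _ hm')
      rw [e3]; exact Diagram.dot_vel (f.dom hm.2.1)
    · intro p hp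
      have := ho p.1 p.2 hp
      rwa [← hf p hp.dom] at this
  have hdb : ∀ t ∈ Icc (0 : ℝ) 1, dot3 (a.a t) (deriv a.a t) = 0 := fun t ht =>
    dot3_eq_zero_of_sphere zero_lt_one ht (Diagram.hasDerivAt_deriv_shortcut a t) a.mem_sphere
  have hbd : ∀ t, HasDerivAt (fun t => H 1 (a.a t)) (spaceD H 1 (a.a t) (deriv a.a t)) t := fun t =>
    hasDerivAt_spaceD hH 1 (Diagram.hasDerivAt_deriv_shortcut a t)
  have heq : ∀ t ∈ Icc (0 : ℝ) 1, ∀ p, Dom p → (H 1 (a.a t) = L.γ p ↔ a.a t = K.γ (f.map p)) := by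
    intro t ht p hp
    rw [hγ' p hp]
    exact hinj _ _ (a.mem_sphere t ht) (hsph p hp)
  have hne : ∀ t ∈ Ioo (0 : ℝ) 1, ∀ p, Dom p → a.a t = K.γ (f.map p) → p.2 ∈ Diagram.openDom p.1 := by
    intro t ht p hp e
    refine hopen p hp ?_ ?_
    · rintro rfl
      have h2 : f.map (none, 0) = (none, 0) := by simp [Repar.map, f.zero]
      rw [h2] at e
      exact Diagram.Shortcut.not_hit_leg (a := a) ⟨hp, t, ht, e⟩
    · rintro rfl
      have h2 : f.map (none, 1) = (none, 1) := by simp [Repar.map, f.one]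
      rw [h2] at e
      exact Diagram.Shortcut.not_hit_head (a := a) ⟨hp, t, ht, e⟩
  have hdet : ∀ t ∈ Ioo (0 : ℝ) 1, ∀ p, Dom p → a.a t = K.γ (f.map p) → ∃ r : ℝ, 0 < r ∧
      det3 (H 1 (a.a t)) (spaceD H 1 (a.a t) (deriv a.a t)) (vel L.γ p) =
        r * det3 (H 1 (a.a t)) (spaceD H 1 (a.a t) (deriv a.a t))
          (spaceD H 1 (a.a t) (vel K.γ (f.map p))) := by
    intro t ht p hp e
    obtain ⟨r, hr, e1⟩ := hvel p (hne t ht p hp e)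
    refine ⟨r, hr, ?_⟩
    rw [e1, ← e, ← one_smul ℝ (spaceD H 1 (a.a t) (deriv a.a t)), det3_smul_smul, one_mul, one_smul]
  -- The image of `a` under the isotopy. It may replace `b`, because the bracket of `L` does not
  -- depend on the shortcut.
  let b' : L.Shortcut :=
    { a := fun t => H 1 (a.a t)
      smooth := hH.comp (contDiff_const.prodMk a.smooth)
      mem_sphere := fun t ht => (hHG 1 one_mem _ (a.mem_sphere t ht)).1
      immersed := by
        intro t ht e
        rw [(hbd t).deriv] at e
        have h2 := hasDerivAt_spaceD hG 1 (hbd t)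
        rw [e, show spaceD G 1 (H 1 (a.a t)) 0 = 0 by
          have := spaceD_smul (H := G) 1 (H 1 (a.a t)) 0 0
          rwa [zero_smul, zero_smul] at this] at h2
        have h3 : HasDerivWithinAt a.a 0 (Icc 0 1) t :=
          h2.hasDerivWithinAt.congr (fun r hr => (hHG 1 one_mem _ (a.mem_sphere r hr)).2.2.1.symm)
            (hHG 1 one_mem _ (a.mem_sphere t ht)).2.2.1.symm
        exact a.immersed t ht ((uniqueDiffOn_Icc zero_lt_one t ht).eq_deriv _
          (Diagram.hasDerivAt_deriv_shortcut a t).hasDerivWithinAt h3)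
      injective := fun t ht t' ht' e => a.injective ht ht'
        ((hinj _ _ (a.mem_sphere t ht) (a.mem_sphere t' ht')).1 e)
      start := by
        rw [a.start, Diagram.leg, Diagram.leg, hγ' _ L.regular_leg.1]
        simp [Repar.map, f.zero]
      finish := by
        rw [a.finish, Diagram.head, Diagram.head, hγ' _ L.regular_head.1]
        simp [Repar.map, f.one]
      transverse := by
        intro t ht p hp e
        have e' := (heq t (Ioo_subset_Icc_self ht) p hp).1 e
        obtain ⟨h2, h3⟩ := a.transverse t ht _ (f.dom hp) e'
        refine ⟨fun h => h2 (hC.double_iff.2 h), ?_⟩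
        obtain ⟨r, hr, e2⟩ := hdet t ht p hp e'
        rw [(hbd t).deriv, e2]
        refine mul_ne_zero hr.ne' (det3_spaceD_ne_zero hH hG (hHG 1 one_mem)
          (a.mem_sphere t (Ioo_subset_Icc_self ht)) (hdb t (Ioo_subset_Icc_self ht)) ?_ h3)
        rw [e']; exact Diagram.dot_vel (f.dom hp)
      finite := a.finite.subset fun t ⟨ht, p, hp, e⟩ =>
        ⟨ht, _, f.dom hp, (heq t (Ioo_subset_Icc_self ht) p hp).1 e⟩ }
  have hM : Diagram.Corr.Matches f a b' := by
    refine ⟨fun t ht p hp => heq t (Ioo_subset_Icc_self ht) p hp, fun t ht p hp e => ?_⟩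
    have e' := (heq t (Ioo_subset_Icc_self ht) p hp).1 e
    obtain ⟨h2, h3⟩ := a.transverse t ht _ (f.dom hp) e'
    obtain ⟨r, hr, e2⟩ := hdet t ht p hp e'
    change 0 < det3 (H 1 (a.a t)) (deriv (fun t => H 1 (a.a t)) t) (vel L.γ p) ↔ _
    rw [(hbd t).deriv, e2, mul_pos_iff_of_pos_left hr]
    refine det3_spaceD_pos_iff hH hG hHG hid (a.mem_sphere t (Ioo_subset_Icc_self ht))
      (hdb t (Ioo_subset_Icc_self ht)) ?_ h3
    rw [e']; exact Diagram.dot_vel (f.dom hp)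
  rw [hC.extendedBracket_eq hM]
  exact extendedBracket_congr L b' b

end

section

variable {m : ℕ}

/-! ## Families of arcs in the source -/

/-- A family of disjoint arcs `t ↦ (i j, o j * t)`, `lo j ≤ t ≤ hi j`, in the source of a diagram. -/
structure ArcFamily (m n : ℕ) where
  i : Fin n → Option (Fin m)
  o : Fin n → ℤˣ
  lo : Fin n → ℝ
  hi : Fin n → ℝ
  lt : ∀ j, lo j < hi j
  dom : ∀ j, ∀ t ∈ Icc (lo j) (hi j), Dom (i j, ((o j : ℤ) : ℝ) * t)
  inj : ∀ j j', ∀ t ∈ Icc (lo j) (hi j), ∀ t' ∈ Icc (lo j') (hi j'),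
    SamePoint (i j, ((o j : ℤ) : ℝ) * t) (i j', ((o j' : ℤ) : ℝ) * t') → j = j' ∧ t = t'

theorem unit_mul_self (ε : ℤˣ) : ((ε : ℤ) : ℝ) * ((ε : ℤ) : ℝ) = 1 := by
  rcases Int.units_eq_one_or ε with rfl | rfl <;> simp

theorem abs_unit (ε : ℤˣ) : |((ε : ℤ) : ℝ)| = 1 := by
  rcases Int.units_eq_one_or ε with rfl | rfl <;> simp

/-- A property that holds near a point holds on the intervals to the points near it. -/
theorem eventually_uIcc {P : ℝ → Prop} {t : ℝ} (h : ∀ᶠ r in 𝓝 t, P r) :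
    ∀ᶠ r in 𝓝 t, ∀ x ∈ uIcc t r, P x := by
  obtain ⟨δ, hδ, h⟩ := Metric.eventually_nhds_iff_ball.1 h
  filter_upwards [Metric.ball_mem_nhds _ hδ] with r hr x hx
  exact h x ((convex_ball t δ).ordConnected.uIcc_subset (Metric.mem_ball_self hδ) hr hx)

namespace ArcFamily

variable {n : ℕ} (F : ArcFamily m n)

/-- The points of the arcs (and of their prolongations). -/
def pt (j : Fin n) (t : ℝ) : Param m := (F.i j, ((F.o j : ℤ) : ℝ) * t)

/-- The point lies on one of the arcs. -/
def Mem (p : Param m) : Prop := ∃ j, ∃ t ∈ Icc (F.lo j) (F.hi j), SamePoint (F.pt j t) p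

/-- The point lies in the interior of one of the arcs. -/
def MemInt (p : Param m) : Prop := ∃ j, ∃ t ∈ Ioo (F.lo j) (F.hi j), SamePoint (F.pt j t) p

variable {F}

theorem MemInt.mem {p : Param m} (h : F.MemInt p) : F.Mem p := by
  obtain ⟨j, t, ht, hs⟩ := h
  exact ⟨j, t, Ioo_subset_Icc_self ht, hs⟩

theorem memInt_congr {p q : Param m} (h : SamePoint p q) : F.MemInt p ↔ F.MemInt q :=
  ⟨fun ⟨j, t, ht, hs⟩ => ⟨j, t, ht, hs.trans h⟩, fun ⟨j, t, ht, hs⟩ => ⟨j, t, ht, hs.trans h.symm⟩⟩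

theorem mem_congr {p q : Param m} (h : SamePoint p q) : F.Mem p ↔ F.Mem q :=
  ⟨fun ⟨j, t, ht, hs⟩ => ⟨j, t, ht, hs.trans h⟩, fun ⟨j, t, ht, hs⟩ => ⟨j, t, ht, hs.trans h.symm⟩⟩

theorem pt_move {j : Fin n} {t : ℝ} {p : Param m} (h : SamePoint (F.pt j t) p) (r : ℝ) :
    SamePoint (F.pt j (t + ((F.o j : ℤ) : ℝ) * (r - p.2))) (p.1, r) := by
  obtain ⟨k, hk, rfl⟩ := samePoint_iff.1 h
  refine samePoint_iff.2 ⟨k, hk, Prod.ext rfl ?_⟩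
  have := unit_mul_self (F.o j)
  simp only [pt]
  linear_combination (((F.o j : ℤ) : ℝ) * t + k - r) * this

open Pointwise in
-- The points sought form the preimage of the sum of a compact set and a closed set of integers,
-- which is closed.
theorem isClosed_samePoint (j j' : Fin n) {C : Set ℝ} (hC : IsCompact C) :
    IsClosed {t | ∃ t' ∈ C, SamePoint (F.pt j' t') (F.pt j t)} := by
  by_cases hi : F.i j' = F.i j
  · have hZ : IsClosed ((fun k : ℤ => (k : ℝ)) '' {k : ℤ | F.i j' = none → k = 0}) :=
      (Int.isClosedEmbedding_coe_real.isClosedMap _ (isClosed_discrete _))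
    have h1 : IsClosed ((fun t => ((F.o j' : ℤ) : ℝ) * t) '' C +
        (fun k : ℤ => (k : ℝ)) '' {k : ℤ | F.i j' = none → k = 0}) :=
      hZ.add_left_of_isCompact (hC.image (by fun_prop))
    convert h1.preimage (by fun_prop : Continuous fun t : ℝ => ((F.o j : ℤ) : ℝ) * t)
      using 1
    ext t
    simp only [mem_ofPred_eq, mem_preimage, Set.mem_add, mem_image, samePoint_iff, pt, Prod.mk.injEq]
    constructor
    · rintro ⟨t', ht', k, hk, -, e⟩
      exact ⟨_, ⟨t', ht', rfl⟩, _, ⟨k, hk, rfl⟩, e.symm⟩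
    · rintro ⟨_, ⟨t', ht', rfl⟩, _, ⟨k, hk, rfl⟩, e⟩
      exact ⟨t', ht', k, hk, hi.symm, e.symm⟩
  · convert isClosed_empty using 1
    ext t
    simp only [mem_ofPred_eq, mem_empty_iff_false, iff_false]
    rintro ⟨t', -, h⟩
    exact hi h.1

theorem isClosed_mem (j : Fin n) : IsClosed {t | F.Mem (F.pt j t)} := by
  have : {t | F.Mem (F.pt j t)} =
      ⋃ j', {t | ∃ t' ∈ Icc (F.lo j') (F.hi j'), SamePoint (F.pt j' t') (F.pt j t)} := by
    ext t; simp [Mem]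
  rw [this]
  exact isClosed_iUnion_of_finite fun j' => isClosed_samePoint j j' isCompact_Icc

theorem eventually_not_mem {p : Param m} (h : ¬ F.Mem p) : ∀ᶠ r in 𝓝 p.2, ¬ F.Mem (p.1, r) := by
  by_cases hj : ∃ j, F.i j = p.1
  · obtain ⟨j, hj⟩ := hj
    have hpt : ∀ r, F.pt j (((F.o j : ℤ) : ℝ) * r) = (p.1, r) := by
      intro r
      simp only [pt, hj, ← mul_assoc, unit_mul_self, one_mul]
    have h1 := (isClosed_mem (F := F) j).preimage
      (by fun_prop : Continuous fun r : ℝ => ((F.o j : ℤ) : ℝ) * r)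
    have h2 : p.2 ∈ ((fun r => ((F.o j : ℤ) : ℝ) * r) ⁻¹' {t | F.Mem (F.pt j t)})ᶜ := by
      simp only [mem_compl_iff, mem_preimage, mem_ofPred_eq, hpt]; exact h
    filter_upwards [h1.isOpen_compl.mem_nhds h2] with r hr
    simpa only [mem_compl_iff, mem_preimage, mem_ofPred_eq, hpt] using hr
  · refine Eventually.of_forall fun r ⟨j, t, ht, hs⟩ => hj ⟨j, hs.1⟩

/-- The other arcs, and the part of the same arc beyond `c`, give closed sets missing the end. The
part before `c` is less than `1 / 2` away, so a coincidence with a point just before the end cannot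
come from a nonzero integer shift and contradicts the order. -/
theorem eventually_not_mem_lo (F : ArcFamily m n) (j : Fin n) : ∀ᶠ t in 𝓝[<] (F.lo j), ¬ F.Mem (F.pt j t) := by
  have hlo : F.lo j ∈ Icc (F.lo j) (F.hi j) := left_mem_Icc.2 (F.lt j).le
  have h1 : ∀ j', j' ≠ j → ∀ᶠ t in 𝓝 (F.lo j),
      ¬ ∃ t' ∈ Icc (F.lo j') (F.hi j'), SamePoint (F.pt j' t') (F.pt j t) := by
    intro j' hj'
    refine (isClosed_samePoint j j' isCompact_Icc).isOpen_compl.mem_nhds ?_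
    rintro ⟨t', ht', hs⟩
    exact hj' (F.inj _ _ t' ht' _ hlo hs).1
  set c := min (F.hi j) (F.lo j + 1 / 2) with hc
  have hc0 : F.lo j < c := lt_min (F.lt j) (by linarith)
  have h2 : ∀ᶠ t in 𝓝 (F.lo j), ¬ ∃ t' ∈ Icc c (F.hi j), SamePoint (F.pt j t') (F.pt j t) := by
    refine (isClosed_samePoint j j isCompact_Icc).isOpen_compl.mem_nhds ?_
    rintro ⟨t', ht', hs⟩
    have := (F.inj _ _ t' ⟨hc0.le.trans ht'.1, ht'.2⟩ _ hlo hs).2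
    linarith [ht'.1]
  have h3 : ∀ᶠ t in 𝓝[<] (F.lo j), t ∈ Ioo (F.lo j - 1 / 2) (F.lo j) := Ioo_mem_nhdsLT (by linarith)
  have h1' : ∀ᶠ t in 𝓝 (F.lo j), ∀ j', j' ≠ j →
      ¬ ∃ t' ∈ Icc (F.lo j') (F.hi j'), SamePoint (F.pt j' t') (F.pt j t) := by
    rw [eventually_all]
    intro j'
    by_cases h : j' = j
    · exact Eventually.of_forall fun _ h' => absurd h h'
    · filter_upwards [h1 j' h] with t ht _ using ht
  filter_upwards [nhdsWithin_le_nhds h1', nhdsWithin_le_nhds h2, h3] with t e1 e2 e3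
  rintro ⟨j', t', ht', hs⟩
  by_cases hj : j' = j
  · subst hj
    by_cases hct : c ≤ t'
    · exact e2 ⟨t', ⟨hct, ht'.2⟩, hs⟩
    · obtain ⟨k, -, hk⟩ := samePoint_iff.1 hs
      simp only [pt, Prod.mk.injEq, true_and] at hk
      have hct' : t' < F.lo j' + 1 / 2 := (not_le.1 hct).trans_le (min_le_right _ _)
      have hlt : |(k : ℝ)| < 1 := by
        have : (k : ℝ) = ((F.o j' : ℤ) : ℝ) * (t - t') := by linarith
        rw [this, abs_mul, abs_unit, one_mul, abs_lt]
        constructor <;> linarith [e3.1, e3.2, ht'.1]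
      have hk0 : k = 0 := by
        rw [← Int.cast_abs] at hlt
        have : |k| < 1 := by exact_mod_cast hlt
        exact Int.abs_lt_one_iff.1 this
      rw [hk0, Int.cast_zero, add_zero] at hk
      have hne : ((F.o j' : ℤ) : ℝ) ≠ 0 := fun h => by
        have := unit_mul_self (F.o j'); rw [h] at this; simp at this
      have := mul_left_cancel₀ hne hk
      linarith [e3.2, ht'.1]
  · exact e1 j' hj ⟨t', ht', hs⟩

/-- The family with the directions of all arcs reversed. -/
def reverse (F : ArcFamily m n) : ArcFamily m n where
  i := F.i
  o := fun j => -F.o j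
  lo := fun j => -F.hi j
  hi := fun j => -F.lo j
  lt := fun j => neg_lt_neg (F.lt j)
  dom := by
    intro j t ht
    have := F.dom j (-t) ⟨by linarith [ht.2], by linarith [ht.1]⟩
    simpa using this
  inj := by
    intro j j' t ht t' ht' h
    have := F.inj j j' (-t) ⟨by linarith [ht.2], by linarith [ht.1]⟩ (-t')
      ⟨by linarith [ht'.2], by linarith [ht'.1]⟩ (by simpa using h)
    exact ⟨this.1, neg_injective this.2⟩

theorem pt_reverse (j : Fin n) (t : ℝ) : F.reverse.pt j t = F.pt j (-t) := by
  simp [reverse, pt]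

theorem mem_reverse {p : Param m} : F.reverse.Mem p ↔ F.Mem p := by
  constructor
  · rintro ⟨j, t, ht, hs⟩
    exact ⟨j, -t, ⟨by have := ht.2; simp only [reverse] at this; linarith,
      by have := ht.1; simp only [reverse] at this; linarith⟩, pt_reverse (F := F) j t ▸ hs⟩
  · rintro ⟨j, t, ht, hs⟩
    refine ⟨j, -t, ⟨neg_le_neg ht.2, neg_le_neg ht.1⟩, ?_⟩
    rwa [pt_reverse, neg_neg]

theorem eventually_not_mem_hi (F : ArcFamily m n) (j : Fin n) :
    ∀ᶠ t in 𝓝[>] (F.hi j), ¬ F.Mem (F.pt j t) := by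
  have h := F.reverse.eventually_not_mem_lo j
  have h2 : Tendsto (fun t : ℝ => -t) (𝓝[>] (F.hi j)) (𝓝[<] (F.reverse.lo j)) := by
    refine tendsto_nhdsWithin_iff.2 ⟨(continuous_neg.tendsto _).mono_left nhdsWithin_le_nhds, ?_⟩
    filter_upwards [self_mem_nhdsWithin] with t ht
    exact neg_lt_neg (mem_Ioi.1 ht)
  filter_upwards [h2.eventually h] with t ht
  rw [mem_reverse, pt_reverse, neg_neg] at ht
  exact ht

/-- The parameter of a point on an arc is unique. -/
theorem eq_of_samePoint {j j' : Fin n} {t t' : ℝ} {p : Param m} (ht : t ∈ Icc (F.lo j) (F.hi j))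
    (ht' : t' ∈ Icc (F.lo j') (F.hi j')) (h : SamePoint (F.pt j t) p)
    (h' : SamePoint (F.pt j' t') p) : j = j' ∧ t = t' :=
  F.inj _ _ _ ht _ ht' (h.trans h'.symm)

theorem not_memInt_lo (F : ArcFamily m n) (j : Fin n) : ¬ F.MemInt (F.pt j (F.lo j)) := by
  rintro ⟨j', t, ht, hs⟩
  obtain ⟨rfl, h⟩ := F.inj _ _ _ (Ioo_subset_Icc_self ht) _ (left_mem_Icc.2 (F.lt j).le) hs
  exact ht.1.ne' h

theorem not_memInt_hi (F : ArcFamily m n) (j : Fin n) : ¬ F.MemInt (F.pt j (F.hi j)) := by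
  rintro ⟨j', t, ht, hs⟩
  obtain ⟨rfl, h⟩ := F.inj _ _ _ (Ioo_subset_Icc_self ht) _ (right_mem_Icc.2 (F.lt j).le) hs
  exact ht.2.ne h

end ArcFamily

/-! ## Smoothed tangles -/

/-- The pieces of `n` arcs with `N` crossings each, with directions. -/
abbrev Node (n N : ℕ) : Type := Fin n × Fin (N + 1) × Bool

/-- The places of the crossings on `n` arcs with `N` crossings each. -/
abbrev Slot (n N : ℕ) : Type := Fin n × Fin N

/-- The ends of `n` arcs: `(j, true)` is the final point of the arc `j`. -/
abbrev TEnd (n : ℕ) : Type := Fin n × Bool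

/-- The direction as a sign. -/
def sg (e : Bool) : ℤˣ := if e then 1 else -1

namespace Node

variable {n N : ℕ}

/-- The same piece with the opposite direction. -/
def flip (x : Node n N) : Node n N := (x.1, x.2.1, !x.2.2)

/-- The piece from which one arrives at a place in a given direction. -/
def arrive (x : Slot n N) (e : Bool) : Node n N := (x.1, if e then x.2.castSucc else x.2.succ, e)

/-- The piece to which one leaves a place in a given direction. -/
def leave (x : Slot n N) (e : Bool) : Node n N := (x.1, if e then x.2.succ else x.2.castSucc, e)

/-- The piece at an end, directed outwards. -/
def out (a : TEnd n) : Node n N := (a.1, if a.2 then Fin.last N else 0, a.2)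

end Node

/-- The exits of the components of a smoothed tangle: `lab x` is the end where the path starting with
the oriented piece `x` leaves the tangle, and `none` if this path is closed. The places `x` and `π x`
belong to the same crossing, and the smoothing of this crossing respects the orientation iff `tw x`.
There is at most one closed component. -/
structure Exits {n N : ℕ} (π : Slot n N → Slot n N) (tw : Slot n N → Bool)
    (lab : Node n N → Option (TEnd n)) (out : TEnd n → TEnd n) : Prop where
  cross : ∀ x e, lab (.arrive x e) = lab (.leave (π x) (e == tw x))
  exit : ∀ a, lab (.out a) = some a
  flip : ∀ x a, lab x = some a → lab x.flip = some (out a)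
  path : ∀ x a, lab x = some a → Relation.EqvGen
    (fun y z => ∃ w e, y = .arrive w e ∧ z = .leave (π w) (e == tw w)) x (.out a)
  loop : ∀ x y, lab x = none → lab y = none → Relation.EqvGen
    (fun y z => (∃ w e, y = .arrive w e ∧ z = .leave (π w) (e == tw w)) ∨ z = y.flip) x y

/-- A tangle formed by a family of arcs with `N` crossings on each arc. -/
structure Tangle {n : ℕ} (F : ArcFamily m n) (K : Diagram m) (N : ℕ) where
  b : Fin n → Fin (N + 2) → ℝ
  mono : ∀ j, StrictMono (b j)
  b_zero : ∀ j, b j 0 = F.lo j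
  b_last : ∀ j, b j (Fin.last (N + 1)) = F.hi j
  π : Slot n N → Slot n N
  meet : ∀ x : Slot n N, Meet K.γ (F.pt x.1 (b x.1 x.2.succ.castSucc))
    (F.pt (π x).1 (b (π x).1 (π x).2.succ.castSucc))
  only : ∀ j, ∀ t ∈ Icc (F.lo j) (F.hi j), K.Double (F.pt j t) → ∃ k : Fin N, t = b j k.succ.castSucc

theorem exists_piece {M : ℕ} {b : Fin (M + 2) → ℝ} {t : ℝ}
    (ht : t ∈ Icc (b 0) (b (Fin.last (M + 1)))) :
    (∃ k, t = b k) ∨ ∃ k : Fin (M + 1), t ∈ Ioo (b k.castSucc) (b k.succ) := by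
  by_contra! h
  obtain ⟨h1, h2⟩ := h
  have key : ∀ k : Fin (M + 2), b k < t := by
    intro k
    induction k using Fin.induction with
    | zero => exact lt_of_le_of_ne ht.1 (h1 0).symm
    | succ k ih =>
      have := h2 k
      rw [mem_Ioo, not_and] at this
      exact lt_of_le_of_ne (not_lt.1 (this ih)) (h1 _).symm
  exact not_lt.2 ht.2 (key _)

theorem piece_unique {M : ℕ} {b : Fin (M + 2) → ℝ} (hb : StrictMono b) {t : ℝ} {k k' : Fin (M + 1)}
    (h : t ∈ Ioo (b k.castSucc) (b k.succ)) (h' : t ∈ Ioo (b k'.castSucc) (b k'.succ)) : k = k' := by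
  have h1 := hb.lt_iff_lt.1 (h.1.trans h'.2)
  have h2 := hb.lt_iff_lt.1 (h'.1.trans h.2)
  rw [Fin.lt_def] at h1 h2
  simp only [Fin.val_castSucc, Fin.val_succ] at h1 h2
  exact Fin.ext (by omega)

end

/-! ### Pieces of a tangle and moves outside it -/

section

variable {m : ℕ}

theorem sg_eq_iff {a b : Bool} : sg a = sg b ↔ a = b := by
  cases a <;> cases b <;> decide

theorem exists_sg (ε : ℤˣ) : ∃ e, ε = sg e := by
  rcases Int.units_eq_one_or ε with rfl | rfl
  · exact ⟨true, rfl⟩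
  · exact ⟨false, rfl⟩

theorem exists_sg_mul (ε o : ℤˣ) : ∃ e, ε = sg e * o := by
  obtain ⟨e, he⟩ := exists_sg (ε * o)
  exact ⟨e, by rw [← he, mul_assoc, Int.units_mul_self, mul_one]⟩

theorem sg_not (e : Bool) : sg (!e) = -sg e := by cases e <;> rfl

theorem sg_beq (e f : Bool) : sg (e == f) = sg e * sg f := by cases e <;> cases f <;> rfl

/-- Regular points with a direction outside the interiors of a family of arcs. -/
abbrev OutPoint {n : ℕ} (F : ArcFamily m n) (K : Diagram m) : Type :=
  {x : Param m × ℤˣ // K.Regular x.1 ∧ ¬ F.MemInt x.1}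

namespace ArcFamily

variable {n : ℕ} (F : ArcFamily m n)

/-- An end of an arc. -/
def endPt (a : TEnd n) : Param m := F.pt a.1 (if a.2 then F.hi a.1 else F.lo a.1)

/-- An end of an arc with the direction out of the arc. -/
def endOut (a : TEnd n) : Param m × ℤˣ := (F.endPt a, sg a.2 * F.o a.1)

/-- An end of an arc with the direction into the arc. -/
def endIn (a : TEnd n) : Param m × ℤˣ := (F.endPt a, -(sg a.2 * F.o a.1))

theorem not_memInt_endPt (a : TEnd n) : ¬ F.MemInt (F.endPt a) := by
  obtain ⟨j, _ | _⟩ := a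
  · exact F.not_memInt_lo j
  · exact F.not_memInt_hi j

end ArcFamily

open ArcFamily

section OutMove

variable {n : ℕ} (F : ArcFamily m n) {K : Diagram m}

/-- Points connected by an edge outside the interiors of the arcs. -/
def OutEdge (K : Diagram m) (p q : Param m) : Prop :=
  ∃ t, SamePoint q (p.1, t) ∧ ∀ r ∈ uIcc p.2 t, K.Regular (p.1, r) ∧ ¬ F.MemInt (p.1, r)

/-- Passing a smoothed crossing outside the arcs. -/
def OutCross (s : K.State) (x y : Param m × ℤˣ) : Prop :=
  ∃ (c : K.Crossing) (p q : Param m), Meet K.γ p q ∧ K.γ p = c.1 ∧ ¬ F.Mem p ∧ ¬ F.Mem q ∧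
    y.2 = x.2 * (s c * K.sign c) ∧ K.Approach x.1 x.2 p ∧ K.Approach y.1 (-y.2) q ∧
    (∀ r ∈ uIcc x.1.2 p.2, ¬ F.MemInt (p.1, r)) ∧ ∀ r ∈ uIcc y.1.2 q.2, ¬ F.MemInt (q.1, r)

/-- The moves of oriented points outside the arcs; inside the arcs they are replaced by the jumps from
the ends `a` to the ends `out a`. -/
def OutMove (s : K.State) (out : TEnd n → TEnd n) (b : Bool) (x y : OutPoint F K) : Prop :=
  (x.1.2 = y.1.2 ∧ OutEdge F K x.1.1 y.1.1) ∨ OutCross F s x.1 y.1 ∨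
    (b = true ∧ x.1.1 = y.1.1) ∨ ∃ a, x.1 = F.endIn a ∧ y.1 = F.endOut (out a)

end OutMove

namespace Tangle

variable {n N : ℕ} {F : ArcFamily m n} {K : Diagram m} (T : Tangle F K N)

/-- The parameter of a crossing on an arc. -/
def br (x : Slot n N) : ℝ := T.b x.1 x.2.succ.castSucc

/-- The crossing at a given place. -/
def crossing (x : Slot n N) : K.Crossing := ⟨K.γ (F.pt x.1 (T.br x)), _, _, T.meet x, rfl⟩

/-- The point `p` lies on the open piece `k` of the arc `j`. -/
def InPiece (j : Fin n) (k : Fin (N + 1)) (p : Param m) : Prop :=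
  ∃ t ∈ Ioo (T.b j k.castSucc) (T.b j k.succ), SamePoint (F.pt j t) p

variable {T}

theorem b_mem (j : Fin n) (k : Fin (N + 2)) : T.b j k ∈ Icc (F.lo j) (F.hi j) := by
  rw [← T.b_zero, ← T.b_last]
  exact ⟨(T.mono j).monotone (Fin.zero_le _), (T.mono j).monotone (Fin.le_last _)⟩

theorem Ioo_subset (j : Fin n) (k : Fin (N + 1)) :
    Ioo (T.b j k.castSucc) (T.b j k.succ) ⊆ Ioo (F.lo j) (F.hi j) := fun _ ht =>
  ⟨(b_mem j _).1.trans_lt ht.1, ht.2.trans_le (b_mem j _).2⟩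

theorem InPiece.congr {j : Fin n} {k : Fin (N + 1)} {p q : Param m} (h : T.InPiece j k p)
    (hs : SamePoint p q) : T.InPiece j k q := by
  obtain ⟨t, ht, h⟩ := h
  exact ⟨t, ht, h.trans hs⟩

theorem InPiece.memInt {j : Fin n} {k : Fin (N + 1)} {p : Param m} (h : T.InPiece j k p) :
    F.MemInt p := by
  obtain ⟨t, ht, h⟩ := h
  exact ⟨j, t, Ioo_subset j k ht, h⟩

theorem InPiece.unique {j j' : Fin n} {k k' : Fin (N + 1)} {p : Param m} (h : T.InPiece j k p)
    (h' : T.InPiece j' k' p) : j = j' ∧ k = k' := by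
  obtain ⟨t, ht, h⟩ := h
  obtain ⟨t', ht', h'⟩ := h'
  obtain ⟨rfl, rfl⟩ := eq_of_samePoint (Ioo_subset_Icc_self (Ioo_subset j k ht))
    (Ioo_subset_Icc_self (Ioo_subset j' k' ht')) h h'
  exact ⟨rfl, piece_unique (T.mono j) ht ht'⟩

theorem double_br (x : Slot n N) : K.Double (F.pt x.1 (T.br x)) := ⟨_, T.meet x⟩

theorem InPiece.regular {j : Fin n} {k : Fin (N + 1)} {p : Param m} (h : T.InPiece j k p) :
    K.Regular p := by
  obtain ⟨t, ht, h⟩ := h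
  have ht' := Ioo_subset_Icc_self (Ioo_subset j k ht)
  refine (Diagram.regular_congr h).1 ⟨F.dom j t ht', fun hd => ?_⟩
  obtain ⟨l, rfl⟩ := T.only j t ht' hd
  have h1 := (T.mono j).lt_iff_lt.1 ht.1
  have h2 := (T.mono j).lt_iff_lt.1 ht.2
  rw [Fin.lt_def] at h1 h2
  simp only [Fin.val_castSucc, Fin.val_succ] at h1 h2
  omega

theorem exists_inPiece {p : Param m} (hp : K.Regular p) (h : F.MemInt p) : ∃ j k, T.InPiece j k p := by
  obtain ⟨j, t, ht, hs⟩ := h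
  have ht' := Ioo_subset_Icc_self ht
  rw [← T.b_zero, ← T.b_last] at ht'
  rcases exists_piece ht' with ⟨k, rfl⟩ | ⟨k, hk⟩
  · exfalso
    refine Fin.cases ?_ (fun k => ?_) k (motive := fun k => T.b j k ∈ Ioo (F.lo j) (F.hi j) →
      SamePoint (F.pt j (T.b j k)) p → False) ht hs
    · intro h _; rw [T.b_zero] at h; exact lt_irrefl _ h.1
    · refine Fin.lastCases (fun h _ => ?_) (fun k _ hs => ?_) k
      · rw [Fin.succ_last, T.b_last] at h; exact lt_irrefl _ h.2
      · exact hp.2 ((Diagram.double_congr hs).1 (double_br (T := T) (j, k)))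
  · exact ⟨j, k, t, hk, hs⟩

theorem regular_endPt (T : Tangle F K N) (a : TEnd n) : K.Regular (F.endPt a) := by
  obtain ⟨j, e⟩ := a
  have hm : (if e then F.hi j else F.lo j) ∈ Icc (F.lo j) (F.hi j) := by
    cases e
    · exact left_mem_Icc.2 (F.lt j).le
    · exact right_mem_Icc.2 (F.lt j).le
  refine ⟨F.dom j _ hm, fun hd => ?_⟩
  obtain ⟨k, hk⟩ := T.only j _ hm hd
  cases e
  · simp only [Bool.false_eq_true, if_false] at hk
    rw [← T.b_zero] at hk
    have := (T.mono j).injective hk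
    simp [Fin.ext_iff] at this
  · simp only [if_true] at hk
    rw [← T.b_last] at hk
    have := (T.mono j).injective hk
    simp only [Fin.ext_iff, Fin.val_last, Fin.val_castSucc, Fin.val_succ] at this
    omega

/-- Oriented ends as points outside the arcs. -/
def outEnd (T : Tangle F K N) (a : TEnd n) : OutPoint F K :=
  ⟨F.endOut a, T.regular_endPt a, F.not_memInt_endPt a⟩

/-- Oriented ends as points outside the arcs. -/
def inEnd (T : Tangle F K N) (a : TEnd n) : OutPoint F K :=
  ⟨F.endIn a, T.regular_endPt a, F.not_memInt_endPt a⟩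

/-- A point on a piece with a direction. -/
def sample (T : Tangle F K N) (x : Node n N) : K.RPoint :=
  ⟨(F.pt x.1 ((T.b x.1 x.2.1.castSucc + T.b x.1 x.2.1.succ) / 2), sg x.2.2 * F.o x.1), by
    have h := T.mono x.1 (Fin.castSucc_lt_succ (i := x.2.1))
    exact InPiece.regular (T := T) (j := x.1) (k := x.2.1) ⟨_, ⟨by linarith, by linarith⟩, .refl _⟩⟩

theorem inPiece_sample (x : Node n N) : T.InPiece x.1 x.2.1 (T.sample x).1.1 := by
  have h := T.mono x.1 (Fin.castSucc_lt_succ (i := x.2.1))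
  exact ⟨_, ⟨by linarith, by linarith⟩, .refl _⟩

theorem mul_mem_uIcc {o : ℤˣ} {a b r : ℝ} : r ∈ uIcc (((o : ℤ) : ℝ) * a) (((o : ℤ) : ℝ) * b) ↔
    ((o : ℤ) : ℝ) * r ∈ uIcc a b := by
  rcases Int.units_eq_one_or o with rfl | rfl
  · simp
  · simp only [mem_uIcc, Units.val_neg, Units.val_one, Int.cast_neg, Int.cast_one, neg_mul, one_mul,
      neg_le, le_neg]
    tauto

theorem pt_unit_mul {j : Fin n} (r : ℝ) : F.pt j (((F.o j : ℤ) : ℝ) * r) = (F.i j, r) := by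
  simp only [pt, ← mul_assoc, unit_mul_self, one_mul]

theorem sameEdge_pt {j : Fin n} {t t' : ℝ} (h : ∀ r ∈ uIcc t t', K.Regular (F.pt j r)) :
    K.SameEdge (F.pt j t) (F.pt j t') := by
  refine Diagram.SameEdge.of_uIcc fun r hr => ?_
  have := h _ (mul_mem_uIcc.1 hr)
  rwa [pt_unit_mul] at this

theorem InPiece.sameEdge {j : Fin n} {k : Fin (N + 1)} {p q : Param m} (h : T.InPiece j k p)
    (h' : T.InPiece j k q) : K.SameEdge p q := by
  have hp := h.regular
  have hq := h'.regular
  obtain ⟨t, ht, h⟩ := h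
  obtain ⟨t', ht', h'⟩ := h'
  have hpt : K.Regular (F.pt j t) := (Diagram.regular_congr h).2 hp
  have hqt : K.Regular (F.pt j t') := (Diagram.regular_congr h').2 hq
  refine (Diagram.sameEdge_of_samePoint h.symm hp).trans
    (Diagram.SameEdge.trans (sameEdge_pt fun r hr => ?_) (Diagram.sameEdge_of_samePoint h' hqt))
  exact InPiece.regular (T := T) ⟨r, ordConnected_Ioo.uIcc_subset ht ht' hr, .refl _⟩

theorem approach_pt {j : Fin n} {t t' : ℝ} {e : Bool} (h : K.Regular (F.pt j t'))
    (hlt : 0 < ((sg e : ℤ) : ℝ) * (t - t'))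
    (hd : ∀ r ∈ uIcc t' t, r ≠ t → ¬ K.Double (F.pt j r)) :
    K.Approach (F.pt j t') (sg e * F.o j) (F.pt j t) := by
  refine ⟨h, rfl, ?_, ?_⟩
  · simp only [pt]
    push_cast
    have := unit_mul_self (F.o j)
    have e1 : ((sg e : ℤ) : ℝ) * ((F.o j : ℤ) : ℝ) * (((F.o j : ℤ) : ℝ) * t - ((F.o j : ℤ) : ℝ) * t') =
      ((sg e : ℤ) : ℝ) * (t - t') * (((F.o j : ℤ) : ℝ) * ((F.o j : ℤ) : ℝ)) := by ring
    rw [e1, this, mul_one]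
    exact hlt
  · intro r hr hne hdb
    refine hd _ (mul_mem_uIcc.1 hr) (fun e => hne ?_) (by rw [pt_unit_mul]; exact hdb)
    simp only [pt]
    rw [← e, ← mul_assoc, unit_mul_self, one_mul]

/-- A point on the piece next to a crossing approaches this crossing. -/
theorem approach_arrive (w : Slot n N) (e : Bool) :
    K.Approach (T.sample (.arrive w e)).1.1 (sg e * F.o w.1) (F.pt w.1 (T.br w)) := by
  obtain ⟨t, ht, hs⟩ := inPiece_sample (T := T) (.arrive w e)
  have h := T.mono w.1 (Fin.castSucc_lt_succ (i := (Node.arrive w e).2.1))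
  have hr := (T.sample (.arrive w e)).2
  have hsub : ∀ r ∈ Ioo (T.b w.1 (Node.arrive w e).2.1.castSucc) (T.b w.1 (Node.arrive w e).2.1.succ),
      K.Regular (F.pt w.1 r) := fun r hr =>
    InPiece.regular (T := T) (j := w.1) (k := (Node.arrive w e).2.1) ⟨r, hr, .refl _⟩
  refine approach_pt hr ?_ ?_
  · cases e
    · simp only [Node.arrive, sg, Bool.false_eq_true, if_false, br] at h ⊢
      push_cast
      linarith
    · simp only [Node.arrive, sg, if_true, br] at h ⊢
      rw [Fin.succ_castSucc] at *
      push_cast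
      linarith
  · intro r hr hne hd
    refine (hsub r ?_).2 hd
    cases e
    · simp only [Node.arrive, Bool.false_eq_true, if_false, br] at h hr hne ⊢
      rw [uIcc_of_ge (by linarith)] at hr
      exact ⟨lt_of_le_of_ne hr.1 hne.symm, by linarith [hr.2]⟩
    · simp only [Node.arrive, if_true, br] at h hr hne ⊢
      rw [Fin.succ_castSucc] at *
      rw [uIcc_of_le (by linarith)] at hr
      exact ⟨by linarith [hr.1], lt_of_le_of_ne hr.2 hne⟩

theorem flip_arrive (w : Slot n N) (e : Bool) : (Node.arrive w e).flip = Node.leave w (!e) := by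
  cases e <;> rfl

theorem sample_flip (x : Node n N) : (T.sample x.flip).1 = Diagram.rev (T.sample x).1 := by
  obtain ⟨j, k, e⟩ := x
  simp only [Node.flip, sample, Diagram.rev, sg_not, neg_mul]

theorem approach_leave (w : Slot n N) (e : Bool) :
    K.Approach (T.sample (.leave w e)).1.1 (-(sg e * F.o w.1)) (F.pt w.1 (T.br w)) := by
  have h := approach_arrive (T := T) w (!e)
  have h1 := flip_arrive w (!e)
  rw [Bool.not_not] at h1
  rw [← h1, sample_flip]
  rw [sg_not, neg_mul] at h
  exact h

theorem sameEdge_endPt (a : TEnd n) : K.SameEdge (F.endPt a) (T.sample (.out a)).1.1 := by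
  have hend := T.regular_endPt a
  obtain ⟨t, ht, hs⟩ := inPiece_sample (T := T) (.out a)
  refine Diagram.SameEdge.trans ?_ (Diagram.sameEdge_of_samePoint hs
    ((Diagram.regular_congr hs).2 (T.sample (.out a)).2))
  refine sameEdge_pt fun r hr => ?_
  have hsub : ∀ r ∈ Ioo (T.b a.1 (Node.out a : Node n N).2.1.castSucc)
      (T.b a.1 (Node.out a : Node n N).2.1.succ), K.Regular (F.pt a.1 r) := fun r hr =>
    InPiece.regular (T := T) (j := a.1) (k := (Node.out a).2.1) ⟨r, hr, .refl _⟩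
  obtain ⟨j, _ | _⟩ := a
  · simp only [Node.out, Bool.false_eq_true, if_false, Fin.castSucc_zero, T.b_zero, endPt] at *
    rw [uIcc_of_le ht.1.le] at hr
    rcases eq_or_lt_of_le hr.1 with h | h
    · rw [← h]; exact hend
    · exact hsub r ⟨h, hr.2.trans_lt ht.2⟩
  · simp only [Node.out, if_true, Fin.succ_last, T.b_last, endPt] at *
    rw [uIcc_of_ge ht.2.le] at hr
    rcases eq_or_lt_of_le hr.2 with h | h
    · rw [h]; exact hend
    · exact hsub r ⟨ht.1.trans_le hr.1, h⟩

end Tangle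

end

/-! ### Components of a smoothed diagram, seen from outside a tangle -/

section

variable {m : ℕ}
open ArcFamily Diagram

namespace Diagram

variable {K : Diagram m}

theorem exists_samePoint_Icc {p : Param m} (hp : Dom p) :
    ∃ t ∈ Icc (0 : ℝ) 1, SamePoint p (p.1, t) := by
  obtain ⟨_ | i, t⟩ := p
  · exact ⟨t, hp rfl, .refl _⟩
  · refine ⟨Int.fract t, ⟨Int.fract_nonneg t, (Int.fract_lt_one t).le⟩, ?_⟩
    exact samePoint_iff.2 ⟨-⌊t⌋, fun h => by simp at h, by simp [Int.fract, sub_eq_add_neg]⟩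

/-- An edge is determined by its component and by the number of double points before it in `[0, 1]`.
This number is bounded, and there are two directions. -/
instance finite_quot_move (s : K.State) (b : Bool) : Finite (Quot (Move b s)) := by
  set cnt : Option (Fin m) → ℝ → ℕ := fun i t => {r | r ∈ Icc (0 : ℝ) t ∧ K.Double (i, r)}.ncard
    with hcnt
  have hmono : ∀ i t t', t ≤ t' → cnt i t ≤ cnt i t' := fun i t t' h =>
    ncard_le_ncard (fun r hr => ⟨⟨hr.1.1, hr.1.2.trans h⟩, hr.2⟩) (K.finite_double i 0 t')
  obtain ⟨M, hM⟩ : ∃ M, ∀ i, cnt i 1 < M := by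
    obtain ⟨M, hM⟩ := (Set.finite_range fun i => cnt i 1).bddAbove
    exact ⟨M + 1, fun i => Nat.lt_succ_of_le (hM (mem_range_self (f := fun i => cnt i 1) i))⟩
  have key : ∀ i t t', t ≤ t' → t ∈ Icc (0 : ℝ) 1 → t' ∈ Icc (0 : ℝ) 1 → K.Regular (i, t) →
      K.Regular (i, t') → cnt i t = cnt i t' → K.SameEdge (i, t) (i, t') := by
    intro i t t' hle ht ht' hr hr' h
    have h2 := eq_of_subset_of_ncard_le (s := {r | r ∈ Icc (0 : ℝ) t ∧ K.Double (i, r)})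
      (t := {r | r ∈ Icc (0 : ℝ) t' ∧ K.Double (i, r)})
      (fun r hr => ⟨⟨hr.1.1, hr.1.2.trans hle⟩, hr.2⟩) h.ge (K.finite_double i 0 t')
    refine SameEdge.of_uIcc fun r hrr => ⟨dom_of_mem_uIcc hr.1 hr'.1 hrr, fun hd => ?_⟩
    rw [uIcc_of_le hle] at hrr
    have h3 : r ∈ {r | r ∈ Icc (0 : ℝ) t ∧ K.Double (i, r)} := by
      rw [h2]; exact ⟨⟨ht.1.trans hrr.1, hrr.2⟩, hd⟩
    have : r = t := le_antisymm h3.1.2 hrr.1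
    exact hr.2 (this ▸ hd)
  choose! f hf hf' using fun (p : Param m) (hp : Dom p) => exists_samePoint_Icc hp
  set g : K.RPoint → Option (Fin m) × Fin M × ℤˣ := fun x =>
    (x.1.1.1, ⟨cnt x.1.1.1 (f x.1.1), (hmono _ _ _ (hf _ x.2.1).2).trans_lt (hM _)⟩, x.1.2) with hg
  have hgg : ∀ x y, g x = g y → Quot.mk (Move b s) x = Quot.mk _ y := by
    intro x y h
    simp only [hg, Prod.mk.injEq, Fin.mk.injEq] at h
    obtain ⟨h1, h2, h3⟩ := h
    refine Quot.sound (Or.inl (Or.inl ⟨h3, ?_⟩))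
    have hx := sameEdge_of_samePoint (hf' _ x.2.1) x.2
    have hy := sameEdge_of_samePoint (hf' _ y.2.1) y.2
    refine hx.trans (SameEdge.trans ?_ hy.symm)
    rw [h1] at h2 hx ⊢
    rcases le_total (f x.1.1) (f y.1.1) with hle | hle
    · exact key _ _ _ hle (hf _ x.2.1) (hf _ y.2.1) hx.right hy.right h2
    · exact (key _ _ _ hle (hf _ y.2.1) (hf _ x.2.1) hy.right hx.right h2.symm).symm
  refine Finite.of_injective (fun q : Quot (Move b s) => g q.out) fun q q' h => ?_
  have := hgg _ _ h
  rwa [Quot.out_eq, Quot.out_eq] at this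

end Diagram

namespace Tangle

variable {n N : ℕ} {F : ArcFamily m n} {K : Diagram m} {T : Tangle F K N}

/-- The oriented point lies on the oriented piece. -/
def InNode (T : Tangle F K N) (x : Node n N) (y : Param m × ℤˣ) : Prop :=
  T.InPiece x.1 x.2.1 y.1 ∧ y.2 = sg x.2.2 * F.o x.1

theorem InNode.unique {x x' : Node n N} {y : Param m × ℤˣ} (h : T.InNode x y) (h' : T.InNode x' y) :
    x = x' := by
  obtain ⟨j, k, e⟩ := x
  obtain ⟨j', k', e'⟩ := x'
  obtain ⟨h1, h2⟩ := h
  obtain ⟨h1', h2'⟩ := h'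
  obtain ⟨rfl, rfl⟩ := h1.unique h1'
  have := sg_eq_iff.1 (mul_right_cancel (h2.symm.trans h2'))
  simp only at this
  rw [this]

theorem exists_inNode {y : Param m × ℤˣ} (hy : K.Regular y.1) (h : F.MemInt y.1) :
    ∃ x, T.InNode x y := by
  obtain ⟨j, k, hk⟩ := exists_inPiece (T := T) hy h
  obtain ⟨e, he⟩ := exists_sg_mul y.2 (F.o j)
  exact ⟨(j, k, e), hk, he⟩

theorem inNode_sample (x : Node n N) : T.InNode x (T.sample x).1 := ⟨inPiece_sample x, rfl⟩

theorem InNode.flip {x : Node n N} {y : Param m × ℤˣ} (h : T.InNode x y) :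
    T.InNode x.flip (y.1, -y.2) := ⟨h.1, by rw [h.2]; simp [Node.flip, sg_not]⟩

variable (T) (s : K.State) (lab : Node n N → Option (TEnd n)) (out : TEnd n → TEnd n) (b : Bool)

/-- The class of an oriented piece. -/
def nodeClass (x : Node n N) : Quot (OutMove F s out b) ⊕ Unit :=
  match lab x with
  | some a => .inl (Quot.mk _ (T.outEnd a))
  | none => .inr ()

open Classical in
/-- The class of an oriented point after the arcs have been replaced by jumps. -/
def pointClass (y : Param m × ℤˣ) : Quot (OutMove F s out b) ⊕ Unit :=
  if h : ∃ x, T.InNode x y then T.nodeClass s lab out b h.choose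
  else if h : K.Regular y.1 ∧ ¬ F.MemInt y.1 then .inl (Quot.mk _ ⟨y, h⟩) else .inr ()

variable {T s lab out b}

theorem pointClass_of_inNode {x : Node n N} {y : Param m × ℤˣ} (h : T.InNode x y) :
    T.pointClass s lab out b y = T.nodeClass s lab out b x := by
  have h' : ∃ x, T.InNode x y := ⟨x, h⟩
  rw [pointClass, dif_pos h', h'.choose_spec.unique h]

theorem pointClass_of_outPoint (y : OutPoint F K) :
    T.pointClass s lab out b y.1 = .inl (Quot.mk _ y) := by
  have h' : ¬ ∃ x, T.InNode x y.1 := fun ⟨x, h⟩ => y.2.2 h.1.memInt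
  rw [pointClass, dif_neg h', dif_pos y.2]

theorem nodeClass_of_eq_some {x : Node n N} {a : TEnd n} (h : lab x = some a) :
    T.nodeClass s lab out b x = .inl (Quot.mk _ (T.outEnd a)) := by simp [nodeClass, h]

variable {tw : Slot n N → Bool}

theorem nodeClass_arrive (hE : Exits T.π tw lab out) (w : Slot n N) (e : Bool) :
    T.nodeClass s lab out b (.arrive w e) =
      T.nodeClass s lab out b (.leave (T.π w) (e == tw w)) := by
  simp only [nodeClass, hE.cross w e]

theorem nodeClass_out (hE : Exits T.π tw lab out) (a : TEnd n) :
    T.nodeClass s lab out b (.out a) = .inl (Quot.mk _ (T.outEnd a)) :=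
  nodeClass_of_eq_some (hE.exit a)

/-- Entering the tangle at `a` leads to the exit `out a`, and the jump identifies this exit with the
entrance. -/
theorem nodeClass_out_flip (hE : Exits T.π tw lab out) (a : TEnd n) :
    T.nodeClass s lab out b (Node.flip (.out a)) = .inl (Quot.mk _ (T.inEnd a)) := by
  rw [nodeClass_of_eq_some (hE.flip _ _ (hE.exit a))]
  refine congrArg _ (Eq.symm ?_)
  exact Quot.sound (Or.inr (Or.inr (Or.inr ⟨a, rfl, rfl⟩)))

theorem nodeClass_flip (hE : Exits T.π tw lab out) (x : Node n N) :
    T.nodeClass s lab out true x.flip = T.nodeClass s lab out true x := by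
  cases h : lab x with
  | some a =>
    rw [nodeClass_of_eq_some h, nodeClass_of_eq_some (hE.flip _ _ h)]
    refine congrArg _ (Eq.trans (b := Quot.mk _ (T.inEnd a)) ?_ ?_)
    · refine Eq.symm ?_
      exact Quot.sound (Or.inr (Or.inr (Or.inr ⟨a, rfl, rfl⟩)))
    · exact Quot.sound (Or.inr (Or.inr (Or.inl ⟨rfl, rfl⟩)))
  | none =>
    have h' : lab x.flip = none := by
      cases h' : lab x.flip with
      | none => rfl
      | some a =>
        have := hE.flip _ _ h'
        simp only [Node.flip, Bool.not_not] at this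
        rw [h] at this
        exact absurd this (by simp)
    simp [nodeClass, h, h']

/-- The sign condition says that `t` lies beyond the end `a`, whichever of the two ends of the arc
it is; `eventually_inside` treats the other side. -/
theorem eventually_outside (F : ArcFamily m n) (a : TEnd n) :
    ∀ᶠ t in 𝓝 (if a.2 then F.hi a.1 else F.lo a.1),
      0 < ((sg a.2 : ℤ) : ℝ) * (t - if a.2 then F.hi a.1 else F.lo a.1) → ¬ F.Mem (F.pt a.1 t) := by
  obtain ⟨j, _ | _⟩ := a
  · filter_upwards [eventually_nhdsWithin_iff.1 (F.eventually_not_mem_lo j)] with t ht h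
    refine ht ?_
    simp [sg] at h
    exact h
  · filter_upwards [eventually_nhdsWithin_iff.1 (F.eventually_not_mem_hi j)] with t ht h
    refine ht ?_
    simp [sg] at h
    exact h

theorem eventually_inside (T : Tangle F K N) (a : TEnd n) :
    ∀ᶠ t in 𝓝 (if a.2 then F.hi a.1 else F.lo a.1),
      ((sg a.2 : ℤ) : ℝ) * (t - if a.2 then F.hi a.1 else F.lo a.1) < 0 →
        t ∈ Ioo (T.b a.1 (Node.out (N := N) a).2.1.castSucc) (T.b a.1 (Node.out (N := N) a).2.1.succ) := by
  obtain ⟨j, _ | _⟩ := a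
  · have h := T.mono j (Fin.castSucc_lt_succ (i := (0 : Fin (N + 1))))
    rw [Fin.castSucc_zero, T.b_zero] at h
    simp only [Bool.false_eq_true, if_false, Node.out]
    filter_upwards [Iio_mem_nhds h] with t ht h
    simp only [sg, Bool.false_eq_true, if_false, Units.val_neg, Units.val_one, Int.cast_neg,
      Int.cast_one, neg_mul, one_mul, neg_sub, sub_neg] at h
    rw [Fin.castSucc_zero, T.b_zero]
    exact ⟨h, ht⟩
  · have h := T.mono j (Fin.castSucc_lt_succ (i := Fin.last N))
    rw [Fin.succ_last, T.b_last] at h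
    simp only [if_true, Node.out]
    filter_upwards [Ioi_mem_nhds h] with t ht h
    simp only [sg, if_true, Units.val_one, Int.cast_one, one_mul, sub_neg] at h
    rw [Fin.succ_last, T.b_last]
    exact ⟨ht, h⟩

theorem pointClass_samePoint {p q : Param m} {ε : ℤˣ}
    (hp : K.Regular p) (hs : SamePoint p q) :
    T.pointClass s lab out b (p, ε) = T.pointClass s lab out b (q, ε) := by
  by_cases h : F.MemInt p
  · obtain ⟨x, hx⟩ := exists_inNode (T := T) (y := (p, ε)) hp h
    rw [pointClass_of_inNode hx, pointClass_of_inNode (x := x) (y := (q, ε)) ⟨hx.1.congr hs, hx.2⟩]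
  · have hq : K.Regular q ∧ ¬ F.MemInt q := ⟨(regular_congr hs).1 hp, fun h' => h ((memInt_congr hs).2 h')⟩
    rw [pointClass_of_outPoint ⟨(p, ε), hp, h⟩, pointClass_of_outPoint ⟨(q, ε), hq⟩]
    refine congrArg _ (Quot.sound (Or.inl ⟨rfl, p.2, hs.symm, fun r hr => ?_⟩))
    rw [uIcc_self, mem_singleton_iff] at hr
    subst hr
    exact ⟨hp, h⟩

theorem pointClass_outEdge {p q : Param m} {ε : ℤˣ} (hp : K.Regular p ∧ ¬ F.MemInt p)
    (hq : K.Regular q ∧ ¬ F.MemInt q) (h : OutEdge F K p q) :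
    T.pointClass s lab out b (p, ε) = T.pointClass s lab out b (q, ε) := by
  rw [pointClass_of_outPoint ⟨(p, ε), hp⟩, pointClass_of_outPoint ⟨(q, ε), hq⟩]
  exact congrArg _ (Quot.sound (Or.inl ⟨rfl, h⟩))

theorem exists_end {p : Param m} (h : F.Mem p) (h' : ¬ F.MemInt p) : ∃ a, SamePoint (F.endPt a) p := by
  obtain ⟨j, t, ht, hs⟩ := h
  rcases eq_or_lt_of_le ht.1 with e | e
  · exact ⟨(j, false), by simpa [endPt, e] using hs⟩
  rcases eq_or_lt_of_le ht.2 with e' | e'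
  · exact ⟨(j, true), by simpa [endPt, ← e'] using hs⟩
  exact absurd ⟨j, t, ⟨e, e'⟩, hs⟩ h'

/-- Away from the arcs and inside a piece the class is locally constant along an edge for trivial
reasons. At an end of an arc the points outside and the adjacent piece have the same class, by the
exit condition in the outward direction and by a jump in the inward one. -/
theorem eventually_pointClass (hE : Exits T.π tw lab out) {i : Option (Fin m)} {r : ℝ} {ε : ℤˣ}
    {S : Set ℝ} (hS : S.OrdConnected) (hr : r ∈ S) (hreg : ∀ r ∈ S, K.Regular (i, r)) :
    ∀ᶠ r' in 𝓝[S] r, T.pointClass s lab out b ((i, r), ε) = T.pointClass s lab out b ((i, r'), ε) := by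
  by_cases hm : F.Mem (i, r)
  swap
  · filter_upwards [nhdsWithin_le_nhds (eventually_uIcc (eventually_not_mem hm)), self_mem_nhdsWithin]
      with r' h1 h2
    have h3 : ∀ x ∈ uIcc r r', K.Regular (i, x) ∧ ¬ F.MemInt (i, x) := fun x hx =>
      ⟨hreg x (hS.uIcc_subset hr h2 hx), fun h => h1 x hx h.mem⟩
    exact pointClass_outEdge (h3 _ left_mem_uIcc) (h3 _ right_mem_uIcc) ⟨r', .refl _, h3⟩
  by_cases hmi : F.MemInt (i, r)
  · obtain ⟨x, hx⟩ := exists_inNode (T := T) (y := ((i, r), ε)) (hreg r hr) hmi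
    obtain ⟨⟨t, ht, hs⟩, he⟩ := hx
    have hc : Tendsto (fun r' => t + ((F.o x.1 : ℤ) : ℝ) * (r' - r)) (𝓝 r) (𝓝 t) := by
      have : Continuous fun r' => t + ((F.o x.1 : ℤ) : ℝ) * (r' - r) := by fun_prop
      simpa using this.tendsto r
    filter_upwards [nhdsWithin_le_nhds (hc.eventually (isOpen_Ioo.mem_nhds ht))] with r' h1
    rw [pointClass_of_inNode (x := x) (y := ((i, r), ε)) ⟨⟨t, ht, hs⟩, he⟩,
      pointClass_of_inNode (x := x) (y := ((i, r'), ε)) ⟨⟨_, h1, pt_move hs r'⟩, he⟩]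
  obtain ⟨a, ha⟩ := exists_end hm hmi
  set c := (if a.2 then F.hi a.1 else F.lo a.1) with hcdef
  have hs : SamePoint (F.pt a.1 c) (i, r) := ha
  have hc : Tendsto (fun r' => c + ((F.o a.1 : ℤ) : ℝ) * (r' - r)) (𝓝 r) (𝓝 c) := by
    have : Continuous fun r' => c + ((F.o a.1 : ℤ) : ℝ) * (r' - r) := by fun_prop
    simpa using this.tendsto r
  filter_upwards [nhdsWithin_le_nhds (eventually_uIcc (hc.eventually (eventually_outside F a))),
    nhdsWithin_le_nhds (hc.eventually (eventually_inside T a)), self_mem_nhdsWithin] with r' h1 h2 h3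
  rcases lt_or_ge (((sg a.2 : ℤ) : ℝ) * (((F.o a.1 : ℤ) : ℝ) * (r' - r))) 0 with hlt | hge
  · have h4 := h2 (by rw [← hcdef, add_sub_cancel_left]; exact hlt)
    have hp : T.InPiece a.1 (Node.out (N := N) a).2.1 (i, r') := ⟨_, h4, pt_move hs r'⟩
    rw [pointClass_samePoint (hreg r hr) hs.symm]
    obtain ⟨e, he⟩ := exists_sg_mul ε (F.o a.1)
    rcases eq_or_ne e a.2 with h5 | h5
    · rw [pointClass_of_inNode (x := Node.out a) (y := ((i, r'), ε)) ⟨hp, by rw [he, h5]; rfl⟩,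
        nodeClass_out hE, ← pointClass_of_outPoint (T := T) (lab := lab) (T.outEnd a), he, h5]
      rfl
    · have h6 : e = !a.2 := Bool.eq_not.2 h5
      rw [pointClass_of_inNode (x := Node.flip (Node.out a)) (y := ((i, r'), ε))
        ⟨hp, by rw [he, h6]; rfl⟩, nodeClass_out_flip hE,
        ← pointClass_of_outPoint (T := T) (lab := lab) (T.inEnd a), he, h6, sg_not, neg_mul]
      rfl
  · have h4 : ∀ x ∈ uIcc r r', K.Regular (i, x) ∧ ¬ F.MemInt (i, x) := by
      refine fun x hx => ⟨hreg x (hS.uIcc_subset hr h3 hx), ?_⟩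
      rcases eq_or_ne x r with rfl | hne
      · exact hmi
      have h5 := h1 x hx
      rw [add_sub_cancel_left] at h5
      have h6 : 0 < ((sg a.2 : ℤ) : ℝ) * (((F.o a.1 : ℤ) : ℝ) * (x - r)) := by
        rw [← mul_assoc] at hge ⊢
        have hu : ((sg a.2 : ℤ) : ℝ) * ((F.o a.1 : ℤ) : ℝ) = ((sg a.2 * F.o a.1 : ℤˣ) : ℤ) := by
          push_cast; rfl
        rw [hu] at hge ⊢
        rcases Int.units_eq_one_or (sg a.2 * F.o a.1) with h | h <;> rw [h] at hge ⊢
        · simp only [Units.val_one, Int.cast_one, one_mul, sub_nonneg] at hge ⊢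
          rw [uIcc_of_le hge] at hx
          exact sub_pos.2 (lt_of_le_of_ne hx.1 hne.symm)
        · simp only [Units.val_neg, Units.val_one, Int.cast_neg, Int.cast_one, neg_mul, one_mul, neg_sub,
            sub_nonneg] at hge ⊢
          rw [uIcc_of_ge hge] at hx
          exact sub_pos.2 (lt_of_le_of_ne hx.2 hne)
      intro h
      exact h5 h6 ((mem_congr (pt_move hs x)).2 h.mem)
    exact pointClass_outEdge (h4 _ left_mem_uIcc) (h4 _ right_mem_uIcc) ⟨r', .refl _, h4⟩

/-- A locally constant function on an interval is constant. -/
theorem pointClass_sameEdge (hE : Exits T.π tw lab out) {p q : Param m} {ε : ℤˣ}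
    (h : K.SameEdge p q) : T.pointClass s lab out b (p, ε) = T.pointClass s lab out b (q, ε) := by
  obtain ⟨t, hs, ht⟩ := h
  rw [← pointClass_samePoint (ht t right_mem_uIcc) hs.symm]
  exact isPreconnected_uIcc.induction₂ (s := uIcc p.2 t)
    (fun x y => T.pointClass s lab out b ((p.1, x), ε) = T.pointClass s lab out b ((p.1, y), ε))
    (fun x hx => eventually_pointClass hE ordConnected_uIcc hx ht)
    (fun _ _ _ _ _ _ h1 h2 => h1.trans h2) (fun _ _ _ _ h => h.symm) left_mem_uIcc right_mem_uIcc

theorem exists_slot {p q : Param m} (h : Meet K.γ p q) (hp : F.Mem p) :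
    ∃ w : Slot n N, SamePoint (F.pt w.1 (T.br w)) p ∧
      SamePoint (F.pt (T.π w).1 (T.br (T.π w))) q ∧ K.γ p = (T.crossing w).1 := by
  obtain ⟨j, t, ht, hs⟩ := hp
  obtain ⟨k, rfl⟩ := T.only j t ht ((double_congr hs).2 ⟨q, h⟩)
  exact ⟨(j, k), hs, K.no_triple _ _ _ (meet_congr (T.meet (j, k)) hs (.refl _)) h, (γ_eq hs).symm⟩

theorem mem_iff_of_meet (T : Tangle F K N) {p q : Param m} (h : Meet K.γ p q) : F.Mem p ↔ F.Mem q := by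
  have key : ∀ {p q}, Meet K.γ p q → F.Mem p → F.Mem q := by
    intro p q h hp
    obtain ⟨w, -, hw, -⟩ := exists_slot (T := T) h hp
    exact ⟨_, _, b_mem _ _, hw⟩
  exact ⟨key h, key (meet_symm h)⟩

theorem exists_approach_outside {p : Param m} (hd : K.Double p) (hp : ¬ F.Mem p) (ε : ℤˣ) :
    ∃ p', K.Approach p' ε p ∧ ∀ r ∈ uIcc p'.2 p.2, ¬ F.MemInt (p.1, r) := by
  have h := eventually_uIcc (eventually_not_mem hp)
  rcases Int.units_eq_one_or ε with rfl | rfl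
  · obtain ⟨r, h1, h2⟩ := ((eventually_approach_pos hd).and (nhdsWithin_le_nhds h)).exists
    exact ⟨_, h1, fun x hx hm => h2 x (uIcc_comm r p.2 ▸ hx) hm.mem⟩
  · obtain ⟨r, h1, h2⟩ := ((eventually_approach_neg hd).and (nhdsWithin_le_nhds h)).exists
    exact ⟨_, h1, fun x hx hm => h2 x (uIcc_comm r p.2 ▸ hx) hm.mem⟩

theorem Approach_not_memInt {p p' : Param m} {ε : ℤˣ} (h : K.Approach p' ε p)
    (h' : ∀ r ∈ uIcc p'.2 p.2, ¬ F.MemInt (p.1, r)) : ¬ F.MemInt p' := by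
  have := h' p'.2 left_mem_uIcc
  rwa [← h.2.1] at this

/-- The twists `tw` refer to the directions of the arcs, the smoothing rule to the orientation of
the diagram; the two conventions differ by the factors `F.o`, whose squares are `1`. -/
theorem sign_mul (htw : ∀ x, sg (tw x) = s (T.crossing x) * K.sign (T.crossing x) *
    (F.o x.1 * F.o (T.π x).1)) (w : Slot n N) (e : Bool) :
    sg (e == tw w) * F.o (T.π w).1 =
      sg e * F.o w.1 * (s (T.crossing w) * K.sign (T.crossing w)) := by
  rw [sg_beq, htw]
  have h1 := Int.units_mul_self (F.o (T.π w).1)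
  calc _ = sg e * F.o w.1 * (s (T.crossing w) * K.sign (T.crossing w)) *
      (F.o (T.π w).1 * F.o (T.π w).1) := by
        simp only [mul_assoc, mul_comm, mul_left_comm]
    _ = _ := by rw [h1, mul_one]

/-- A crossing has either both or none of its points on the arcs. In the former case the passage is
one between pieces and the labels agree by `Exits.cross`; in the latter the approaching points can
be moved so close to the crossing that the passage stays outside the arcs. -/
theorem pointClass_cross (hE : Exits T.π tw lab out)
    (htw : ∀ x, sg (tw x) = s (T.crossing x) * K.sign (T.crossing x) * (F.o x.1 * F.o (T.π x).1))
    {x y : Param m × ℤˣ} (h : K.Cross s x y) :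
    T.pointClass s lab out b x = T.pointClass s lab out b y := by
  obtain ⟨c, p, q, hm, hc, he, h1, h2⟩ := h
  by_cases hp : F.Mem p
  · obtain ⟨w, hw, hw', e1⟩ := exists_slot (T := T) hm hp
    obtain rfl : c = T.crossing w := Subtype.ext (hc.symm.trans e1)
    obtain ⟨e, hee⟩ := exists_sg_mul x.2 (F.o w.1)
    have key : ∀ {p p0 z z' : Param m} {ε : ℤˣ}, SamePoint p0 p → K.Approach z ε p →
        K.Approach z' ε p0 → K.SameEdge z z' := by
      intro p p0 z z' ε h3 h4 h5
      obtain ⟨z'', h6, h7⟩ := h5.congr_right h3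
      exact (h4.sameEdge h7).trans (sameEdge_of_samePoint h6.symm h7.1)
    have hδ : y.2 = sg (e == tw w) * F.o (T.π w).1 := by rw [sign_mul htw, ← hee, he]
    have e3 : K.SameEdge x.1 (T.sample (.arrive w e)).1.1 := by
      refine key hw h1 ?_
      rw [hee]
      exact approach_arrive w e
    have e4 : K.SameEdge y.1 (T.sample (.leave (T.π w) (e == tw w))).1.1 := by
      refine key hw' h2 ?_
      rw [hδ]
      exact approach_leave _ _
    have e5 : T.pointClass s lab out b x = T.nodeClass s lab out b (.arrive w e) := by
      rw [← pointClass_of_inNode (inNode_sample _)]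
      rw [show x = (x.1, x.2) from rfl, pointClass_sameEdge hE e3, hee]
      rfl
    have e6 : T.pointClass s lab out b y = T.nodeClass s lab out b (.leave (T.π w) (e == tw w)) := by
      rw [← pointClass_of_inNode (inNode_sample _)]
      rw [show y = (y.1, y.2) from rfl, pointClass_sameEdge hE e4, hδ]
      rfl
    rw [e5, e6, nodeClass_arrive hE]
  · have hq : ¬ F.Mem q := fun h => hp ((T.mem_iff_of_meet hm).2 h)
    obtain ⟨p', h3, h4⟩ := exists_approach_outside (meet_double hm) hp x.2
    obtain ⟨q', h5, h6⟩ := exists_approach_outside (meet_double' hm) hq (-y.2)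
    rw [show x = (x.1, x.2) from rfl, show y = (y.1, y.2) from rfl,
      pointClass_sameEdge hE (h1.sameEdge h3), pointClass_sameEdge hE (h2.sameEdge h5),
      pointClass_of_outPoint ⟨(p', x.2), h3.1, Approach_not_memInt h3 h4⟩,
      pointClass_of_outPoint ⟨(q', y.2), h5.1, Approach_not_memInt h5 h6⟩]
    exact congrArg _ (Quot.sound (Or.inr (Or.inl ⟨c, p, q, hm, hc, hp, hq, he, h3, h5, h4, h6⟩)))

theorem pointClass_flip (hE : Exits T.π tw lab out) {p : Param m} (hp : K.Regular p) (ε : ℤˣ) :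
    T.pointClass s lab out true (p, -ε) = T.pointClass s lab out true (p, ε) := by
  by_cases h : F.MemInt p
  · obtain ⟨x, hx⟩ := exists_inNode (T := T) (y := (p, ε)) hp h
    rw [pointClass_of_inNode hx, ← nodeClass_flip hE, pointClass_of_inNode hx.flip]
  · rw [pointClass_of_outPoint ⟨(p, ε), hp, h⟩, pointClass_of_outPoint ⟨(p, -ε), hp, h⟩]
    exact congrArg _ (Quot.sound (Or.inr (Or.inr (Or.inl ⟨rfl, rfl⟩))))

theorem pointClass_move (hE : Exits T.π tw lab out)
    (htw : ∀ x, sg (tw x) = s (T.crossing x) * K.sign (T.crossing x) * (F.o x.1 * F.o (T.π x).1))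
    {x y : K.RPoint} (h : Move b s x y) :
    T.pointClass s lab out b x.1 = T.pointClass s lab out b y.1 := by
  rcases h with (⟨h1, h2⟩ | h) | ⟨rfl, h⟩
  · rw [show x.1 = (x.1.1, x.1.2) from rfl, show y.1 = (y.1.1, y.1.2) from rfl, ← h1]
    exact pointClass_sameEdge hE h2
  · exact pointClass_cross hE htw h
  · rw [show x.1 = (x.1.1, x.1.2) from rfl, show y.1 = (y.1.1, y.1.2) from rfl, ← h]
    rcases eq_or_ne x.1.2 y.1.2 with e | e
    · rw [e]
    · rw [Int.units_ne_iff_eq_neg.1 e]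
      exact pointClass_flip hE x.2 _

/-- A point outside the arcs as a regular point. -/
def _root_.Knotoid.OutPoint.toRPoint (x : OutPoint F K) : K.RPoint := ⟨x.1, x.2.1⟩

theorem mk_sample_eq
    (htw : ∀ x, sg (tw x) = s (T.crossing x) * K.sign (T.crossing x) * (F.o x.1 * F.o (T.π x).1))
    (w : Slot n N) (e : Bool) : Quot.mk (Move b s) (T.sample (.arrive w e)) =
      Quot.mk _ (T.sample (.leave (T.π w) (e == tw w))) :=
  Quot.sound (Or.inl (Or.inr ⟨T.crossing w, _, _, T.meet w, rfl, sign_mul htw w e,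
    approach_arrive w e, approach_leave _ _⟩))

theorem mk_sample_of_eqvGen
    (htw : ∀ x, sg (tw x) = s (T.crossing x) * K.sign (T.crossing x) * (F.o x.1 * F.o (T.π x).1))
    {x y : Node n N} (h : Relation.EqvGen
      (fun y z => ∃ w e, y = .arrive w e ∧ z = .leave (T.π w) (e == tw w)) x y) :
    Quot.mk (Move b s) (T.sample x) = Quot.mk _ (T.sample y) := by
  induction h with
  | rel x y h =>
    obtain ⟨w, e, rfl, rfl⟩ := h
    exact mk_sample_eq htw w e
  | refl x => rfl
  | symm x y _ ih => exact ih.symm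
  | trans x y z _ _ ih1 ih2 => exact ih1.trans ih2

theorem mk_sample_of_eqvGen_flip
    (htw : ∀ x, sg (tw x) = s (T.crossing x) * K.sign (T.crossing x) * (F.o x.1 * F.o (T.π x).1))
    {x y : Node n N} (h : Relation.EqvGen
      (fun y z => (∃ w e, y = .arrive w e ∧ z = .leave (T.π w) (e == tw w)) ∨ z = y.flip) x y) :
    Quot.mk (Move true s) (T.sample x) = Quot.mk _ (T.sample y) := by
  induction h with
  | rel x y h =>
    rcases h with ⟨w, e, rfl, rfl⟩ | rfl
    · exact mk_sample_eq htw w e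
    · exact Quot.sound (Or.inr ⟨rfl, by rw [sample_flip]; rfl⟩)
  | refl x => rfl
  | symm x y _ ih => exact ih.symm
  | trans x y z _ _ ih1 ih2 => exact ih1.trans ih2

theorem mk_outEnd (a : TEnd n) : Quot.mk (Move b s) (T.outEnd a).toRPoint =
    Quot.mk _ (T.sample (.out a)) :=
  Quot.sound (Or.inl (Or.inl ⟨rfl, sameEdge_endPt a⟩))

theorem mk_inEnd (a : TEnd n) : Quot.mk (Move b s) (T.inEnd a).toRPoint =
    Quot.mk _ (T.sample (Node.flip (.out a))) :=
  Quot.sound (Or.inl (Or.inl ⟨by rw [sample_flip]; rfl, by rw [sample_flip]; exact sameEdge_endPt a⟩))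

theorem mk_of_outMove (hE : Exits T.π tw lab out)
    (htw : ∀ x, sg (tw x) = s (T.crossing x) * K.sign (T.crossing x) * (F.o x.1 * F.o (T.π x).1))
    {x y : OutPoint F K} (h : OutMove F s out b x y) :
    Quot.mk (Move b s) x.toRPoint = Quot.mk _ y.toRPoint := by
  rcases h with ⟨h1, t, h2, h3⟩ | ⟨c, p, q, h1, h2, -, -, h3, h4, h5, -, -⟩ | h | ⟨a, h1, h2⟩
  · exact Quot.sound (Or.inl (Or.inl ⟨h1, t, h2, fun r hr => (h3 r hr).1⟩))
  · exact Quot.sound (Or.inl (Or.inr ⟨c, p, q, h1, h2, h3, h4, h5⟩))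
  · exact Quot.sound (Or.inr h)
  · obtain rfl : x = T.inEnd a := Subtype.ext h1
    obtain rfl : y = T.outEnd (out a) := Subtype.ext h2
    rw [mk_inEnd, mk_outEnd]
    exact mk_sample_of_eqvGen htw (hE.path _ _ (hE.flip _ _ (hE.exit a)))

/-- On the points outside of the arcs, the components of the smoothed diagram are described by the
jumps. -/
theorem mk_move_eq_iff (hE : Exits T.π tw lab out)
    (htw : ∀ x, sg (tw x) = s (T.crossing x) * K.sign (T.crossing x) * (F.o x.1 * F.o (T.π x).1))
    (x y : OutPoint F K) : Quot.mk (Move b s) x.toRPoint = Quot.mk _ y.toRPoint ↔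
      Quot.mk (OutMove F s out b) x = Quot.mk _ y := by
  constructor
  · intro h
    -- `pointClass` is invariant under all moves and sends an outer point to its own outer class, so
    -- it recovers the outer class from the component.
    have := congrArg (Quot.lift (fun x : K.RPoint => T.pointClass s lab out b x.1)
      (fun x y h => pointClass_move hE htw h)) h
    have h2 : T.pointClass s lab out b x.1 = T.pointClass s lab out b y.1 := this
    rw [pointClass_of_outPoint, pointClass_of_outPoint] at h2
    exact Sum.inl_injective h2
  · intro h
    exact congrArg (Quot.lift (fun x : OutPoint F K => Quot.mk (Move b s) x.toRPoint)
      (fun x y h => mk_of_outMove hE htw h)) h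

theorem exists_rep (hE : Exits T.π tw lab out)
    (htw : ∀ x, sg (tw x) = s (T.crossing x) * K.sign (T.crossing x) * (F.o x.1 * F.o (T.π x).1))
    (x : K.RPoint) : (∃ y : OutPoint F K, Quot.mk (Move true s) x = Quot.mk _ y.toRPoint) ∨
      ∃ v, lab v = none ∧ Quot.mk (Move true s) x = Quot.mk _ (T.sample v) := by
  by_cases h : F.MemInt x.1.1
  · obtain ⟨v, hv⟩ := exists_inNode (T := T) (y := x.1) x.2 h
    have e : Quot.mk (Move true s) x = Quot.mk _ (T.sample v) :=
      Quot.sound (Or.inl (Or.inl ⟨hv.2, hv.1.sameEdge (inPiece_sample v)⟩))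
    cases h : lab v with
    | none => exact Or.inr ⟨v, h, e⟩
    | some a =>
      refine Or.inl ⟨T.outEnd a, ?_⟩
      rw [e, mk_outEnd]
      exact mk_sample_of_eqvGen htw (hE.path _ _ h)
  · exact Or.inl ⟨⟨x.1, x.2, h⟩, rfl⟩

theorem finite_quot_outMove (hE : Exits T.π tw lab out)
    (htw : ∀ x, sg (tw x) = s (T.crossing x) * K.sign (T.crossing x) * (F.o x.1 * F.o (T.π x).1)) :
    Finite (Quot (OutMove F s out b)) := by
  refine Finite.of_injective (Quot.lift (fun x : OutPoint F K => Quot.mk (Move b s) x.toRPoint)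
      (fun x y h => mk_of_outMove hE htw h)) ?_
  rintro ⟨x⟩ ⟨y⟩ h
  exact (mk_move_eq_iff hE htw x y).1 h

open Classical in
/-- The number of components of the smoothed diagram. -/
theorem card_quot_move (hE : Exits T.π tw lab out)
    (htw : ∀ x, sg (tw x) = s (T.crossing x) * K.sign (T.crossing x) * (F.o x.1 * F.o (T.π x).1)) :
    Nat.card (Quot (Move true s)) = Nat.card (Quot (OutMove F s out true)) +
      if ∃ v, lab v = none then 1 else 0 := by
  have := finite_quot_outMove (b := true) hE htw
  -- `f` embeds the components into the outer components together with one extra point. The extra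
  -- point is attained exactly when some piece has no exit, and all such pieces form a single
  -- component by `Exits.loop`.
  set f : Quot (Move true s) → Quot (OutMove F s out true) ⊕ Unit :=
    Quot.lift (fun x : K.RPoint => T.pointClass s lab out true x.1)
      (fun x y h => pointClass_move hE htw h) with hf
  have hfo : ∀ y : OutPoint F K, f (Quot.mk _ y.toRPoint) = .inl (Quot.mk _ y) := fun y =>
    pointClass_of_outPoint y
  have hfn : ∀ v, lab v = none → f (Quot.mk _ (T.sample v)) = .inr () := fun v hv => by
    have := pointClass_of_inNode (s := s) (lab := lab) (out := out) (b := true) (inNode_sample (T := T) v)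
    simp only [nodeClass, hv] at this
    exact this
  have hinj : Function.Injective f := by
    rintro ⟨x⟩ ⟨y⟩ h
    change f (Quot.mk _ x) = f (Quot.mk _ y) at h
    rcases exists_rep hE htw x with ⟨x', hx⟩ | ⟨v, hv, hx⟩ <;>
      rcases exists_rep hE htw y with ⟨y', hy⟩ | ⟨v', hv', hy⟩ <;> rw [hx, hy] at h ⊢
    · rw [hfo, hfo] at h
      exact (mk_move_eq_iff hE htw _ _).2 (Sum.inl_injective h)
    · rw [hfo, hfn _ hv'] at h; exact absurd h (by simp)
    · rw [hfo, hfn _ hv] at h; exact absurd h (by simp)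
    · exact mk_sample_of_eqvGen_flip htw (hE.loop _ _ hv hv')
  split_ifs with hv
  · obtain ⟨v, hv⟩ := hv
    have hsurj : Function.Surjective f := by
      rintro (⟨⟨y⟩⟩ | ⟨⟩)
      · exact ⟨Quot.mk _ y.toRPoint, hfo y⟩
      · exact ⟨Quot.mk _ (T.sample v), hfn v hv⟩
    rw [Nat.card_congr (Equiv.ofBijective f ⟨hinj, hsurj⟩), Nat.card_sum, Nat.card_unique (α := Unit)]
  · have hr : ∀ z : Quot (OutMove F s out true), ∃ x, f x = .inl z := by
      rintro ⟨y⟩; exact ⟨Quot.mk _ y.toRPoint, hfo y⟩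
    choose g hg using hr
    refine (Nat.card_congr (Equiv.ofBijective g ⟨fun z z' h => ?_, ?_⟩)).symm
    · have := hg z
      rw [h, hg] at this
      exact (Sum.inl_injective this).symm
    · rintro ⟨x⟩
      rcases exists_rep hE htw x with ⟨x', hx⟩ | ⟨v, hv', hx⟩
      · refine ⟨Quot.mk _ x', hinj ?_⟩
        rw [hg]
        rw [hx, hfo]
      · exact absurd ⟨v, hv'⟩ hv

end Tangle

end

section

variable {m : ℕ}

open Diagram

/-! ## Logarithms on disks -/

/-- The point of the closed upper hemisphere over a point of the unit disk. -/
def hemi (w : ℂ) : E3 := !₂[w.re, w.im, Real.sqrt (1 - (w.re ^ 2 + w.im ^ 2))]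

/-- The radial retraction of the plane onto the unit disk. -/
def retr (w : ℂ) : ℂ := w / ((max 1 ‖w‖ : ℝ) : ℂ)

theorem norm_retr (w : ℂ) : ‖retr w‖ ≤ 1 := by
  have h1 : (0 : ℝ) < max 1 ‖w‖ := lt_max_of_lt_left one_pos
  rw [retr, norm_div, Complex.norm_real, Real.norm_of_nonneg h1.le, div_le_one h1]
  exact le_max_right _ _

theorem retr_eq {w : ℂ} (h : ‖w‖ ≤ 1) : retr w = w := by simp [retr, max_eq_left h]

theorem sq_le_one_of_norm {w : ℂ} (h : ‖w‖ ≤ 1) : w.re ^ 2 + w.im ^ 2 ≤ 1 := by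
  have h1 := Complex.normSq_eq_norm_sq w
  rw [Complex.normSq_apply] at h1
  nlinarith [norm_nonneg w]

theorem norm_hemi {w : ℂ} (h : ‖w‖ ≤ 1) : ‖hemi w‖ = 1 := by
  have h1 := sq_le_one_of_norm h
  rw [norm_eq_one_iff]
  simp only [dot3, hemi]
  have := Real.mul_self_sqrt (sub_nonneg.2 h1)
  simp only [Matrix.cons_val_zero, Matrix.cons_val_one, Matrix.cons_val]
  rw [this]; ring

theorem continuous_retr : Continuous retr := by
  unfold retr
  refine continuous_id.div (by fun_prop) fun w => ?_
  have h1 : (0 : ℝ) < max 1 ‖w‖ := lt_max_of_lt_left one_pos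
  exact_mod_cast h1.ne'

theorem continuous_hemi : Continuous hemi := by
  unfold hemi
  refine (PiLp.continuous_toLp 2 _).comp ?_
  refine continuous_pi fun k => ?_
  fin_cases k
  · exact Complex.continuous_re
  · exact Complex.continuous_im
  · have h1 := Complex.continuous_re
    have h2 := Complex.continuous_im
    exact (continuous_const.sub ((h1.pow 2).add (h2.pow 2))).sqrt

/-- A nowhere vanishing continuous function on a disk has a continuous logarithm. -/
theorem exists_log_on_disk (φ : S2 ≃ₜ S2) {g : E3 → ℂ} (hg : ContinuousOn g (disk φ))
    (h0 : ∀ y ∈ disk φ, g y ≠ 0) :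
    ∃ l : E3 → ℂ, ContinuousOn l (disk φ) ∧ ∀ y ∈ disk φ, Complex.exp (l y) = g y := by
  -- The plane is retracted onto the unit disk and lifted to the hemisphere, so that the function on
  -- the disk becomes one on the simply connected space `ℂ`.
  set h : ℂ → S2 := fun w => ⟨hemi (retr w), by
    rw [mem_sphere_zero_iff_norm]; exact norm_hemi (norm_retr w)⟩ with hh
  have hhc : Continuous h := (continuous_hemi.comp continuous_retr).subtype_mk _
  have hmem : ∀ w, ((φ (h w) : S2) : E3) ∈ disk φ := fun w => by
    refine ⟨h w, ?_, rfl⟩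
    simp only [hh, hemi, PiLp.toLp_apply, Matrix.cons_val]
    exact Real.sqrt_nonneg _
  have hfc : Continuous fun w => g ((φ (h w) : S2) : E3) :=
    hg.comp_continuous (continuous_subtype_val.comp (φ.continuous.comp hhc)) hmem
  set f : C(ℂ, {z : ℂ // z ≠ 0}) := ⟨fun w => ⟨g ((φ (h w) : S2) : E3), h0 _ (hmem w)⟩,
    hfc.subtype_mk _⟩ with hf
  -- Lifting through the covering map `exp : ℂ → ℂ \ {0}`.
  obtain ⟨F, ⟨-, hF⟩, -⟩ := Complex.isCoveringMap_exp.existsUnique_continuousMap_lifts f 0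
    (Complex.log (f 0).1) (Subtype.ext (Complex.exp_log (f 0).2))
  have hF' : ∀ w, Complex.exp (F w) = g ((φ (h w) : S2) : E3) := fun w =>
    congrArg Subtype.val (congrFun hF w)
  set c : S2 → ℂ := fun x => ⟨(x : E3) 0, (x : E3) 1⟩ with hc
  have hcc : Continuous c := by
    have h1 : Continuous fun x : S2 => (x : E3) 0 := by fun_prop
    have h2 : Continuous fun x : S2 => (x : E3) 1 := by fun_prop
    have h3 : c = fun x : S2 => (((x : E3) 0 : ℝ) : ℂ) + (((x : E3) 1 : ℝ) : ℂ) * Complex.I := by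
      funext x; exact Complex.mk_eq_add_mul_I _ _
    rw [h3]
    fun_prop
  classical
  set l : E3 → ℂ := fun y => if hy : y ∈ Metric.sphere (0 : E3) 1 then F (c (φ.symm ⟨y, hy⟩)) else 0
    with hl
  refine ⟨l, ?_, ?_⟩
  · have hls : ContinuousOn l (Metric.sphere (0 : E3) 1) := by
      rw [continuousOn_iff_continuous_domRestrict]
      have : (Metric.sphere (0 : E3) 1).domRestrict l = fun y => F (c (φ.symm y)) := by
        funext y
        simp only [domRestrict_apply, hl, dif_pos y.2]
      rw [this]
      exact F.continuous.comp (hcc.comp φ.symm.continuous)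
    refine hls.mono ?_
    rintro _ ⟨x, -, rfl⟩
    exact (φ x).2
  · rintro _ ⟨x, hx, rfl⟩
    have e1 : l ((φ x : S2) : E3) = F (c x) := by
      have := (φ x).2
      simp only [hl, dif_pos this, Subtype.coe_eta, Homeomorph.symm_apply_apply]
    have hx1 : dot3 (x : E3) x = 1 := (norm_eq_one_iff _).1 (mem_sphere_zero_iff_norm.1 x.2)
    simp only [dot3] at hx1
    have hn : ‖c x‖ ≤ 1 := by
      rw [← abs_one, ← sq_le_sq₀ (norm_nonneg _) (abs_nonneg _), ← Complex.normSq_eq_norm_sq,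
        Complex.normSq_apply]
      simp only [hc, abs_one]
      nlinarith [mul_self_nonneg ((x : E3) 2)]
    have e2 : h (c x) = x := by
      apply Subtype.ext
      simp only [hh, retr_eq hn]
      ext k
      fin_cases k
      · rfl
      · rfl
      · simp only [hemi, hc, PiLp.toLp_apply]
        change Real.sqrt _ = (x : E3) 2
        have e2 : 1 - (((x : E3) 0) ^ 2 + ((x : E3) 1) ^ 2) = ((x : E3) 2) ^ 2 := by linarith
        rw [e2, Real.sqrt_sq hx]
    rw [e1, hF', e2]

/-- A continuous logarithm of a differentiable function is its logarithmic integral. -/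
theorem log_sub_log_eq_integral {f f' l : ℝ → ℂ} {a b : ℝ} (hf : ∀ t ∈ Icc a b, HasDerivAt f (f' t) t)
    (hf' : ContinuousOn f' (Icc a b)) (h0 : ∀ t ∈ Icc a b, f t ≠ 0) (hl : ContinuousOn l (Icc a b))
    (hle : ∀ t ∈ Icc a b, Complex.exp (l t) = f t) :
    ∀ t ∈ Icc a b, l t = l a + ∫ x in a..t, f' x / f x := by
  have hfc : ContinuousOn f (Icc a b) := fun t ht => (hf t ht).continuousAt.continuousWithinAt
  have hc : ContinuousOn (fun t => f' t / f t) (Icc a b) := hf'.div hfc h0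
  intro t ht
  have hab : a ≤ b := ht.1.trans ht.2
  -- This difference is continuous with values in `2πiℤ`, hence constant.
  set κ : ℝ → ℂ := fun t => l t - l a - ∫ x in a..t, f' x / f x with hκ
  have hκc : ContinuousOn κ (Icc a b) := (hl.sub continuousOn_const).sub (continuousOn_primitive hab hc)
  have hκe : ∀ t ∈ Icc a b, ∃ n : ℤ, κ t = n * (2 * Real.pi * Complex.I) := by
    intro t ht
    have hsub : Icc a t ⊆ Icc a b := Icc_subset_Icc_right ht.2
    have h1 := exp_integral_logDeriv ht.1 (hfc.mono hsub)
      (fun x hx => hf x (hsub (Ioo_subset_Icc_self hx))) (hf'.mono hsub) (fun x hx => h0 x (hsub hx))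
    rw [← Complex.exp_eq_one_iff]
    have ha : a ∈ Icc a b := left_mem_Icc.2 hab
    rw [Complex.exp_sub, Complex.exp_sub, hle t ht, hle a ha, ← h1]
    have := h0 a ha
    have := Complex.exp_ne_zero (∫ x in a..t, f' x / f x)
    field_simp
  have key : ∀ x ∈ Icc a b, ∀ᶠ y in 𝓝[Icc a b] x, κ x = κ y := by
    intro x hx
    have h2 := (hκc x hx).eventually (Metric.ball_mem_nhds (κ x) one_pos)
    filter_upwards [h2, self_mem_nhdsWithin] with y h3 hy
    obtain ⟨k, hk⟩ := hκe x hx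
    obtain ⟨k', hk'⟩ := hκe y hy
    have h3 : dist (κ y) (κ x) < 1 := h3
    rw [hk, hk'] at h3 ⊢
    rw [dist_eq_norm, ← sub_mul, norm_mul, ← Int.cast_sub, Complex.norm_intCast] at h3
    have h4 : ‖2 * (Real.pi : ℂ) * Complex.I‖ = 2 * Real.pi := by
      simp [abs_of_pos Real.pi_pos]
    rw [h4] at h3
    have h5 : |((k' - k : ℤ) : ℝ)| < 1 := by nlinarith [Real.pi_gt_three, abs_nonneg ((k' - k : ℤ) : ℝ)]
    rw [← Int.cast_abs] at h5
    have h6 : |k' - k| < 1 := by exact_mod_cast h5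
    have := Int.abs_lt_one_iff.1 h6
    rw [sub_eq_zero.1 this]
  have main := isPreconnected_Icc.induction₂ (s := Icc a b) (fun x y => κ x = κ y) key
    (fun _ _ _ _ _ _ h1 h2 => h1.trans h2) (fun _ _ _ _ h => h.symm) ht (left_mem_Icc.2 hab)
  simp only [hκ, intervalIntegral.integral_same, sub_self] at main
  linear_combination main

/-! ## Splitting integrals along arcs -/

namespace Arc

variable {J : Arc m}

theorem Mem.congr {p q : Param m} (h : J.Mem p) (hs : SamePoint p q) : J.Mem q := by
  obtain ⟨t, ht, h⟩ := h
  exact ⟨t, ht, h.trans hs⟩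

theorem dom_of_mem_Icc {t : ℝ} (ht : t ∈ Icc J.α J.β) : Dom (J.i, t) :=
  dom_of_mem_uIcc J.dom_left J.dom_right (by rwa [uIcc_of_le J.lt.le])

theorem mem_of_mem_Icc {t : ℝ} (ht : t ∈ Icc J.α J.β) : J.Mem (J.i, t) := ⟨t, ht, .refl _⟩

theorem MemInt.mem {p : Param m} (h : J.MemInt p) : J.Mem p := by
  obtain ⟨t, ht, hs⟩ := h
  exact ⟨t, Ioo_subset_Icc_self ht, hs⟩

theorem eq_of_samePoint {t t' : ℝ} (ht : t ∈ Icc J.α J.β) (ht' : t' ∈ Icc J.α J.β)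
    (hs : SamePoint (J.i, t) (J.i, t')) : t = t' := by
  obtain ⟨k, hk, e⟩ := samePoint_iff.1 hs
  replace e := congrArg Prod.snd e
  simp only at e hk
  by_cases hi : J.i = none
  · rw [e, hk hi]; simp
  · have hp := J.proper hi
    have e1 : (k : ℝ) < 1 := by linarith [ht'.2, ht.1]
    have e2 : (-1 : ℝ) < k := by linarith [ht'.1, ht.2]
    have e1 : k < 1 := by exact_mod_cast e1
    have e2 : -1 < k := by exact_mod_cast e2
    rw [e, show k = 0 by omega]; simp

theorem measurableSet_mem (J : Arc m) (i : Option (Fin m)) : MeasurableSet {t | J.Mem (i, t)} := by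
  have : {t | J.Mem (i, t)} = ⋃ k : ℤ, {t | (J.i = i ∧ (J.i = none → k = 0)) ∧
      t ∈ (fun t : ℝ => t - k) ⁻¹' Icc J.α J.β} := by
    ext t
    simp only [mem_ofPred_eq, mem_iUnion, Mem, samePoint_iff, Prod.mk.injEq, mem_preimage]
    constructor
    · rintro ⟨t', ht', k, hk, e1, e2⟩
      exact ⟨k, ⟨e1.symm, hk⟩, by rw [e2, add_sub_cancel_right]; exact ht'⟩
    · rintro ⟨k, ⟨e1, hk⟩, h⟩
      exact ⟨_, h, k, hk, e1.symm, by ring⟩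
  rw [this]
  refine MeasurableSet.iUnion fun k => ?_
  refine MeasurableSet.inter (MeasurableSet.const _) ?_
  exact (measurable_id.sub_const _) measurableSet_Icc

-- On the segment the arc lies in `[0, 1]`, and the integral splits into three parts. On a circle
-- the integrand is periodic, so the period may start at `α`; after `β` the arc does not return
-- before `α + 1`.
open Classical in
theorem integral_mem (J : Arc m) {f : Param m → ℝ} (hc : ∀ p q, SamePoint p q → f p = f q)
    (hint : ∀ i a b, Dom (i, a) → Dom (i, b) →
      IntervalIntegrable (fun t => f (i, t)) MeasureTheory.volume a b) :
    ∫ t in (0 : ℝ)..1, (if J.Mem (J.i, t) then f (J.i, t) else 0) = ∫ t in J.α..J.β, f (J.i, t) := by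
  set g : ℝ → ℝ := fun t => if J.Mem (J.i, t) then f (J.i, t) else 0 with hg
  have hgi : ∀ a b, Dom (J.i, a) → Dom (J.i, b) → IntervalIntegrable g MeasureTheory.volume a b := by
    intro a b ha hb
    have h := hint J.i a b ha hb
    rw [intervalIntegrable_iff] at h ⊢
    exact (h.indicator (J.measurableSet_mem J.i)).congr (Eventually.of_forall fun t => by
      simp only [indicator, hg, mem_ofPred_eq])
  have hin : ∫ t in J.α..J.β, g t = ∫ t in J.α..J.β, f (J.i, t) := by
    refine intervalIntegral.integral_congr fun t ht => ?_
    rw [uIcc_of_le J.lt.le] at ht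
    simp only [hg, if_pos (mem_of_mem_Icc ht)]
  have hz : ∀ a b, a ≤ b → (∀ t ∈ Ioo a b, ¬ J.Mem (J.i, t)) → ∫ t in a..b, g t = 0 := by
    intro a b hab h
    rw [intervalIntegral.integral_congr_Ioo_of_le (g := fun _ => 0) hab
      fun t ht => if_neg (h t ht), intervalIntegral.integral_zero]
  rw [← hin]
  obtain ⟨i, α, β, lt, hα, hβ, proper⟩ := J
  simp only at hin hgi hz ⊢
  cases i with
  | none =>
    have h0 := (hα rfl).1
    have h1 := (hβ rfl).2
    have d0 : Dom ((none, 0) : Param m) := fun _ => by simp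
    have d1 : Dom ((none, 1) : Param m) := fun _ => by simp
    have hmem : ∀ t, Arc.Mem ⟨none, α, β, lt, hα, hβ, proper⟩ (none, t) → t ∈ Icc α β := by
      rintro t ⟨t', ht', hs⟩
      obtain ⟨k, hk, e⟩ := samePoint_iff.1 hs
      simp only [Prod.mk.injEq, true_and] at e
      rw [hk rfl, Int.cast_zero, add_zero] at e
      rwa [e]
    rw [← intervalIntegral.integral_add_adjacent_intervals (hgi 0 α d0 hα) (hgi α 1 hα d1),
      ← intervalIntegral.integral_add_adjacent_intervals (hgi α β hα hβ) (hgi β 1 hβ d1),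
      hz 0 α h0 fun t ht h => not_le.2 ht.2 (hmem t h).1,
      hz β 1 h1 fun t ht h => not_le.2 ht.1 (hmem t h).2]
    simp
  | some i =>
    have hper : Function.Periodic g 1 := by
      intro t
      have hs := samePoint_shift (m := m) (some i) t 1 (by simp)
      rw [Int.cast_one] at hs
      have h1 : Arc.Mem ⟨some i, α, β, lt, hα, hβ, proper⟩ (some i, t + 1) ↔
          Arc.Mem ⟨some i, α, β, lt, hα, hβ, proper⟩ (some i, t) := ⟨fun h => h.congr hs.symm, fun h => h.congr hs⟩
      simp only [hg, h1, hc _ _ hs]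
    have h2 := hper.intervalIntegral_add_eq 0 α
    rw [zero_add] at h2
    have hp := proper (by simp)
    rw [h2, ← intervalIntegral.integral_add_adjacent_intervals (hgi α β hα hβ)
      (hgi β (α + 1) hβ (dom_some _ _)), hz β (α + 1) hp.le, add_zero]
    rintro t ht ⟨t', ht', hs⟩
    obtain ⟨k, -, e⟩ := samePoint_iff.1 hs
    simp only [Prod.mk.injEq, true_and] at e ht'
    have e1 : (k : ℝ) < 1 := by linarith [ht.2, ht'.1]
    have e2 : (0 : ℝ) < k := by linarith [ht.1, ht'.2]
    have e1 : k < 1 := by exact_mod_cast e1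
    have e2 : 0 < k := by exact_mod_cast e2
    omega

open Classical in
/-- An integral over the source as a sum of an integral outside disjoint arcs and the integrals over
the arcs. -/
theorem sum_integral_split {n : ℕ} (J : Fin n → Arc m)
    (hdisj : ∀ j j' p, (J j).Mem p → (J j').Mem p → j = j')
    {f : Param m → ℝ} (hc : ∀ p q, SamePoint p q → f p = f q)
    (hint : ∀ i a b, Dom (i, a) → Dom (i, b) →
      IntervalIntegrable (fun t => f (i, t)) MeasureTheory.volume a b) :
    ∑ i, ∫ t in (0 : ℝ)..1, f (i, t) =
      ∑ i, (∫ t in (0 : ℝ)..1, if ∃ j, (J j).Mem (i, t) then 0 else f (i, t)) +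
      ∑ j, ∫ t in (J j).α..(J j).β, f ((J j).i, t) := by
  have h01 : ∀ i : Option (Fin m), IntervalIntegrable (fun t => f (i, t)) MeasureTheory.volume 0 1 :=
    fun i => hint i 0 1 (fun _ => by simp) (fun _ => by simp)
  have hI : ∀ i j, IntervalIntegrable (fun t => if (J j).Mem (i, t) then f (i, t) else 0)
      MeasureTheory.volume 0 1 := by
    intro i j
    have h := h01 i
    rw [intervalIntegrable_iff] at h ⊢
    exact (h.indicator ((J j).measurableSet_mem i)).congr (Eventually.of_forall fun t => by
      simp only [indicator, mem_ofPred_eq])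
  have hpt : ∀ p, f p = (if ∃ j, (J j).Mem p then 0 else f p) +
      ∑ j, if (J j).Mem p then f p else 0 := by
    intro p
    by_cases h : ∃ j, (J j).Mem p
    · obtain ⟨j, hj⟩ := h
      rw [if_pos ⟨j, hj⟩, zero_add, Finset.sum_eq_single j, if_pos hj]
      · intro j' _ hne
        exact if_neg fun h => hne (hdisj _ _ _ h hj)
      · simp
    · rw [if_neg h, Finset.sum_eq_zero, add_zero]
      intro j _
      exact if_neg fun hj => h ⟨j, hj⟩
  have hO : ∀ i, IntervalIntegrable (fun t => if ∃ j, (J j).Mem (i, t) then 0 else f (i, t))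
      MeasureTheory.volume 0 1 := by
    intro i
    refine ((h01 i).sub (IntervalIntegrable.sum Finset.univ fun j _ => hI i j)).congr fun t _ => ?_
    simp only [Finset.sum_apply]
    have := hpt (i, t)
    linarith
  have e1 : ∀ i : Option (Fin m), ∫ t in (0 : ℝ)..1, f (i, t) =
      (∫ t in (0 : ℝ)..1, if ∃ j, (J j).Mem (i, t) then 0 else f (i, t)) +
      ∑ j, ∫ t in (0 : ℝ)..1, if (J j).Mem (i, t) then f (i, t) else 0 := by
    intro i
    rw [← intervalIntegral.integral_finsetSum fun j _ => hI i j,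
      ← intervalIntegral.integral_add (hO i) (by
        simpa only [Finset.sum_fn] using IntervalIntegrable.sum Finset.univ fun j _ => hI i j)]
    exact intervalIntegral.integral_congr fun t _ => hpt (i, t)
  rw [Finset.sum_congr rfl fun i _ => e1 i, Finset.sum_add_distrib]
  congr 1
  rw [Finset.sum_comm]
  refine Finset.sum_congr rfl fun j _ => ?_
  rw [Finset.sum_eq_single (J j).i, (J j).integral_mem hc hint]
  · intro i _ hne
    rw [intervalIntegral.integral_congr (g := fun _ => 0), intervalIntegral.integral_zero]
    intro t _
    exact if_neg fun ⟨t', _, hs⟩ => hne hs.1.symm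
  · simp

end Arc

namespace Diagram

/-- The velocity `ang` has poles at the leg and at the head, but the coefficient vanishes on the
edges next to them. -/
theorem intervalIntegrable_coef_mul_ang {K : Diagram m} (s : K.State) {C : Chart} (hC : K.Avoids C)
    {i : Option (Fin m)} {a b : ℝ} (ha : Dom (i, a)) (hb : Dom (i, b)) :
    IntervalIntegrable (fun t => (K.coef s (i, t) : ℝ) * K.ang C (i, t)) MeasureTheory.volume a b := by
  cases i with
  | none =>
    obtain ⟨c⟩ := exists_cut (B := K.Double) K.finite_double_Icc K.regular_leg.2 K.regular_head.2
      (fun p q => double_congr)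
    set f : ℝ → ℝ := fun t => (K.coef s (none, t) : ℝ) * K.ang C (none, t) with hf
    have z1 : ∀ t ∈ uIcc 0 (c.lo none), f t = 0 := fun t ht => by
      rw [uIcc_of_le c.pos.le] at ht
      simp [hf, coef_of_le_lo c (fun p h => h) ht]
    have z2 : ∀ t ∈ uIcc (c.hi none) 1, f t = 0 := fun t ht => by
      rw [uIcc_of_le c.lt_one.le] at ht
      simp [hf, coef_of_hi_le c (fun p h => h) ht]
    have i1 : IntervalIntegrable f MeasureTheory.volume 0 (c.lo none) :=
      (intervalIntegrable_const (c := (0 : ℝ))).congr fun t ht => (z1 t (uIoc_subset_uIcc ht)).symm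
    have i2 : IntervalIntegrable f MeasureTheory.volume (c.hi none) 1 :=
      (intervalIntegrable_const (c := (0 : ℝ))).congr fun t ht => (z2 t (uIoc_subset_uIcc ht)).symm
    have i3 : IntervalIntegrable f MeasureTheory.volume (c.lo none) (c.hi none) := by
      have hsub : uIcc (c.lo none) (c.hi none) ⊆ openDom (none : Option (Fin m)) := by
        rw [uIcc_of_le (c.lt none).le]; exact c.Icc_subset none
      exact intervalIntegrable_coef_mul s (fun t ht => dom_of_openDom (hsub ht))
        ((continuousOn_ang hC none).mono hsub)
    refine ((i1.trans i3).trans i2).mono_set ?_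
    rw [uIcc_of_le zero_le_one]
    exact uIcc_subset_Icc (ha rfl) (hb rfl)
  | some i =>
    exact intervalIntegrable_coef_mul s (fun t _ => dom_some i t)
      ((continuousOn_ang hC (some i)).mono fun t _ h => by simp at h)

end Diagram

/-! ## The winding number and diagrams that coincide outside a disk -/

namespace CoincideOutside

variable {K L : Diagram m} {n : ℕ} {J : Fin n → Arc m} {φ : S2 ≃ₜ S2}

theorem not_mem_leg (h : CoincideOutside K L J φ) : ¬ ∃ j, (J j).Mem (none, 0) := fun hm =>
  h.leg_notMem ((h.left_mem _ K.regular_leg.1).2 hm)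

theorem not_mem_head (h : CoincideOutside K L J φ) : ¬ ∃ j, (J j).Mem (none, 1) := fun hm =>
  h.head_notMem ((h.left_mem _ K.regular_head.1).2 hm)

theorem leg_eq (h : CoincideOutside K L J φ) : K.leg = L.leg :=
  h.eq_outside _ K.regular_leg.1 fun ⟨j, hj⟩ => h.not_mem_leg ⟨j, hj.mem⟩

theorem head_eq (h : CoincideOutside K L J φ) : K.head = L.head :=
  h.eq_outside _ K.regular_head.1 fun ⟨j, hj⟩ => h.not_mem_head ⟨j, hj.mem⟩

theorem not_memInt_of_not_mem {p : Param m} (h : ¬ ∃ j, (J j).Mem p) : ¬ ∃ j, (J j).MemInt p :=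
  fun ⟨j, hj⟩ => h ⟨j, hj.mem⟩

/-- Outside the arcs the diagrams have the same double points. -/
theorem meet_iff (h : CoincideOutside K L J φ) {p q : Param m} (hp : ¬ ∃ j, (J j).Mem p) :
    Meet K.γ p q ↔ Meet L.γ p q := by
  have key : ∀ hd : Dom p ∧ Dom q, (¬ ∃ j, (J j).Mem q) → (K.γ p = K.γ q ↔ L.γ p = L.γ q) :=
    fun hd hq => by
      rw [h.eq_outside p hd.1 (not_memInt_of_not_mem hp), h.eq_outside q hd.2 (not_memInt_of_not_mem hq)]
  constructor
  · rintro ⟨h1, h2, h3, h4⟩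
    refine ⟨h1, h2, h3, (key ⟨h1, h2⟩ fun hq => hp ?_).1 h4⟩
    rw [← h.left_mem p h1, h4, h.left_mem q h2]
    exact hq
  · rintro ⟨h1, h2, h3, h4⟩
    refine ⟨h1, h2, h3, (key ⟨h1, h2⟩ fun hq => hp ?_).2 h4⟩
    rw [← h.right_mem p h1, h4, h.right_mem q h2]
    exact hq

theorem symm (h : CoincideOutside K L J φ) : CoincideOutside L K J φ where
  disjoint := h.disjoint
  leg_notMem := h.leg_eq ▸ h.leg_notMem
  head_notMem := h.head_eq ▸ h.head_notMem
  left_mem := h.right_mem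
  right_mem := h.left_mem
  left_mem_int := h.right_mem_int
  right_mem_int := h.left_mem_int
  eq_outside p hp hm := (h.eq_outside p hp hm).symm
  over_outside p hp hd := by
    obtain ⟨q, hq⟩ := hd
    exact (h.over_outside p hp ⟨q, (h.meet_iff hp).2 hq⟩).symm

theorem mem_openDom (h : CoincideOutside K L J φ) {j : Fin n} {t : ℝ} (ht : t ∈ Icc (J j).α (J j).β) :
    t ∈ openDom (J j).i := by
  intro hi
  have hd := Arc.dom_of_mem_Icc ht hi
  have hm := Arc.mem_of_mem_Icc ht
  rw [hi] at hm
  refine ⟨lt_of_le_of_ne hd.1 ?_, lt_of_le_of_ne hd.2 ?_⟩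
  · rintro rfl; exact h.not_mem_leg ⟨j, hm⟩
  · rintro rfl; exact h.not_mem_head ⟨j, hm⟩

/-- The integral over the arcs inside the disk depends only on the ends of the arcs. -/
theorem sum_integral_arc (h : CoincideOutside K L J φ) (s : K.State) {C : Chart} (hC : K.Avoids C)
    {l : E3 → ℂ} (hlc : ContinuousOn l (disk φ))
    (hl : ∀ y ∈ disk φ, Complex.exp (l y) = (C.st y - C.st K.head) / (C.st y - C.st K.leg))
    (hα : ∀ j, K.Regular ((J j).i, (J j).α)) (hβ : ∀ j, K.Regular ((J j).i, (J j).β)) :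
    ∑ j, ∫ t in (J j).α..(J j).β, (K.coef s ((J j).i, t) : ℝ) * K.ang C ((J j).i, t) =
      ∑ j, (K.coef s ((J j).i, (J j).β) * (l (K.γ ((J j).i, (J j).β))).im -
        K.coef s ((J j).i, (J j).α) * (l (K.γ ((J j).i, (J j).α))).im) := by
  set ζ : Fin n → ℝ → ℂ := fun j t => C.st (K.γ ((J j).i, t)) with hζ
  set ζ' : Fin n → ℝ → ℂ := fun j t => C.stD (K.γ ((J j).i, t)) (vel K.γ ((J j).i, t)) with hζ'
  have hdisk : ∀ j, ∀ t ∈ Icc (J j).α (J j).β, K.γ ((J j).i, t) ∈ disk φ := fun j t ht =>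
    (h.left_mem _ (Arc.dom_of_mem_Icc ht)).2 ⟨j, Arc.mem_of_mem_Icc ht⟩
  have hU : ∀ j, ∀ t ∈ openDom (J j).i, HasDerivAt (ζ j) (ζ' j t) t ∧ ζ j t ≠ C.st K.leg ∧
      ζ j t ≠ C.st K.head := by
    intro j t ht
    have hd := dom_of_openDom ht
    exact ⟨C.hasDerivAt_st (K.hasDerivAt_γ _ _) (hC.denom hd),
      hC.st_ne hd K.regular_leg.1 (ne_leg_of_openDom ht),
      hC.st_ne hd K.regular_head.1 (ne_head_of_openDom ht)⟩
  -- The logarithm `l` is only continuous and only given on the disk. Its imaginary part along an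
  -- arc is therefore continued as an integral, which is differentiable also beyond the ends of the
  -- arc; on the arc the two agree, so that `Ψ` depends only on the image point there.
  set Ψ : Fin n → ℝ → ℝ := fun j t =>
    (l (K.γ ((J j).i, (J j).α))).im + ∫ x in (J j).α..t, K.ang C ((J j).i, x) with hΨ
  have hang := fun j => continuousOn_ang hC (J j).i
  have hαU : ∀ j, (J j).α ∈ openDom (J j).i := fun j => h.mem_openDom ⟨le_rfl, (J j).lt.le⟩
  have hΨd : ∀ j, ∀ t ∈ openDom (J j).i, HasDerivAt (Ψ j) (K.ang C ((J j).i, t)) t := by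
    intro j t ht
    refine HasDerivAt.const_add _ ?_
    refine intervalIntegral.integral_hasDerivAt_right ?_ ?_ ?_
    · exact ((hang j).mono ((ordConnected_openDom _).uIcc_subset (hαU j) ht)).intervalIntegrable
    · exact (hang j).stronglyMeasurableAtFilter (isOpen_openDom _) t ht
    · exact (hang j).continuousAt ((isOpen_openDom _).mem_nhds ht)
  have hΨl : ∀ j, ∀ t ∈ Icc (J j).α (J j).β, Ψ j t = (l (K.γ ((J j).i, t))).im := by
    intro j t ht
    have hsub : Icc (J j).α (J j).β ⊆ openDom (J j).i := fun t ht => h.mem_openDom ht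
    have hζc : ContinuousOn (ζ j) (Icc (J j).α (J j).β) := fun t ht =>
      (hU j t (hsub ht)).1.continuousAt.continuousWithinAt
    have hζc' : ContinuousOn (ζ' j) (Icc (J j).α (J j).β) :=
      continuousOn_stD C (K.continuous_γ _) (K.continuous_vel _) fun t ht =>
        hC.denom (dom_of_openDom (hsub ht))
    have hne : ∀ t ∈ Icc (J j).α (J j).β, ζ j t - C.st K.leg ≠ 0 ∧ ζ j t - C.st K.head ≠ 0 := fun t ht =>
      ⟨sub_ne_zero.2 (hU j t (hsub ht)).2.1, sub_ne_zero.2 (hU j t (hsub ht)).2.2⟩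
    have main := log_sub_log_eq_integral (a := (J j).α) (b := (J j).β)
      (f := fun t => (ζ j t - C.st K.head) / (ζ j t - C.st K.leg))
      (f' := fun t => (ζ' j t * (ζ j t - C.st K.leg) - (ζ j t - C.st K.head) * ζ' j t) /
        (ζ j t - C.st K.leg) ^ 2)
      (l := fun t => l (K.γ ((J j).i, t)))
      (fun t ht => ((hU j t (hsub ht)).1.sub_const _).div ((hU j t (hsub ht)).1.sub_const _) (hne t ht).1)
      (((hζc'.mul (hζc.sub continuousOn_const)).sub ((hζc.sub continuousOn_const).mul hζc')).div
        ((hζc.sub continuousOn_const).pow 2) fun t ht => pow_ne_zero 2 (hne t ht).1)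
      (fun t ht => div_ne_zero (hne t ht).2 (hne t ht).1)
      (hlc.comp (K.continuous_γ _).continuousOn (hdisk j)) (fun t ht => hl _ (hdisk j t ht)) t ht
    rw [main, Complex.add_im]
    have e0 : ∀ t ∈ Icc (J j).α (J j).β,
        (ζ' j t * (ζ j t - C.st K.leg) - (ζ j t - C.st K.head) * ζ' j t) /
        (ζ j t - C.st K.leg) ^ 2 / ((ζ j t - C.st K.head) / (ζ j t - C.st K.leg)) =
        (1 / (C.st K.leg - ζ j t) - 1 / (C.st K.head - ζ j t)) * ζ' j t := by
      intro t ht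
      obtain ⟨h1, h2⟩ := hne t ht
      rw [← neg_sub (ζ j t) (C.st K.leg), ← neg_sub (ζ j t) (C.st K.head)]
      field_simp
      ring
    have hcint : ContinuousOn (fun t => (1 / (C.st K.leg - ζ j t) - 1 / (C.st K.head - ζ j t)) * ζ' j t)
        (Icc (J j).α (J j).β) := by
      refine (ContinuousOn.sub ?_ ?_).mul hζc'
      · refine continuousOn_const.div (continuousOn_const.sub hζc) fun t ht => ?_
        rw [← neg_sub]; exact neg_ne_zero.2 (hne t ht).1
      · refine continuousOn_const.div (continuousOn_const.sub hζc) fun t ht => ?_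
        rw [← neg_sub]; exact neg_ne_zero.2 (hne t ht).2
    have hsub2 : uIcc (J j).α t ⊆ Icc (J j).α (J j).β := by
      rw [uIcc_of_le ht.1]; exact Icc_subset_Icc_right ht.2
    rw [intervalIntegral.integral_congr fun x hx => e0 x (hsub2 hx)]
    exact congrArg ((l (K.γ ((J j).i, (J j).α))).im + ·)
      (Complex.imCLM.intervalIntegral_comp_comm (μ := MeasureTheory.volume)
        (hcint.mono hsub2).intervalIntegrable)
  have main := stokes s (fun j => (J j).i) (fun j => (J j).α) (fun j => (J j).β)
    (fun j => openDom (J j).i) (fun _ => ∅) Ψ (K.ang C) (fun _ _ => 0) (fun j => (J j).lt)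
    (fun j => isOpen_openDom _) (fun j => ordConnected_openDom _) (fun j t ht => h.mem_openDom ht)
    (fun j t ht => dom_of_openDom ht) hα hβ ?_ ?_ (by simp) hang
    (fun j t ht _ => by
      filter_upwards [(isOpen_openDom _).mem_nhds (h.mem_openDom ht)] with r hr using hΨd j r hr)
    (fun j t ht j' t' ht' hm => by
      rw [hΨl j t (Ioo_subset_Icc_self ht), hΨl j' t' (Ioo_subset_Icc_self ht'), hm.2.2.2]) (by simp)
  · simp only [Finset.sum_empty, Finset.sum_const_zero, Finset.sum_sub_distrib] at main
    rw [← sub_eq_zero, ← neg_eq_zero, ← main]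
    simp only [Finset.sum_sub_distrib]
    rw [neg_sub]
    congr 2
    · exact Finset.sum_congr rfl fun j _ => by rw [hΨl j _ ⟨(J j).lt.le, le_rfl⟩]
    · exact Finset.sum_congr rfl fun j _ => by rw [hΨl j _ ⟨le_rfl, (J j).lt.le⟩]
  -- The interior of an arc is mapped to the open disk, so the other point over a crossing is
  -- interior to an arc as well.
  · intro j t ht q hq
    have h1 : K.γ q ∈ openDisk φ := by
      rw [← hq.2.2.2, h.left_mem_int _ hq.1]
      exact ⟨j, t, ht, .refl _⟩
    obtain ⟨j', t', ht', hs⟩ := (h.left_mem_int q hq.2.1).1 h1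
    exact ⟨j', t', ht', hs.symm⟩
  · intro j t ht j' t' ht' hs
    obtain rfl := h.disjoint j j' _ ⟨t, Ioo_subset_Icc_self ht, .refl _⟩
      ⟨t', Ioo_subset_Icc_self ht', hs.symm⟩
    exact ⟨rfl, Arc.eq_of_samePoint (Ioo_subset_Icc_self ht) (Ioo_subset_Icc_self ht') hs⟩

theorem not_memInt_end (h : CoincideOutside K L J φ) {j : Fin n} {t : ℝ}
    (ht : t = (J j).α ∨ t = (J j).β) : ¬ ∃ j', (J j').MemInt ((J j).i, t) := by
  rintro ⟨j', hm⟩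
  have ht' : t ∈ Icc (J j).α (J j).β := by
    rcases ht with rfl | rfl
    · exact ⟨le_rfl, (J j).lt.le⟩
    · exact ⟨(J j).lt.le, le_rfl⟩
  obtain rfl := h.disjoint j j' _ (Arc.mem_of_mem_Icc ht') hm.mem
  obtain ⟨t', ht'', hs⟩ := hm
  obtain rfl := Arc.eq_of_samePoint (Ioo_subset_Icc_self ht'') ht' hs
  rcases ht with rfl | rfl
  · exact ht''.1.false
  · exact ht''.2.false

/-- Outside the arcs the diagrams have the same velocities. -/
theorem vel_eq (h : CoincideOutside K L J φ) {p : Param m} (hp : ∀ᶠ r in 𝓝 p.2, ¬ ∃ j, (J j).Mem (p.1, r))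
    (hd : p.2 ∈ openDom p.1) : vel K.γ p = vel L.γ p := by
  refine Filter.EventuallyEq.deriv_eq ?_
  filter_upwards [hp, (isOpen_openDom p.1).mem_nhds hd] with r hr ho
  exact h.eq_outside _ (dom_of_openDom ho) (not_memInt_of_not_mem hr)

/-- The winding number depends only on the cycle outside the disk. -/
theorem winding_eq (h : CoincideOutside K L J φ) {s : K.State} {s' : L.State} {C : Chart}
    (hK : K.Avoids C) (hL : L.Avoids C) (hN : C.N ∉ disk φ)
    (hev : ∀ p, (¬ ∃ j, (J j).Mem p) → ∀ᶠ r in 𝓝 p.2, ¬ ∃ j, (J j).Mem (p.1, r))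
    (hα : ∀ j, K.Regular ((J j).i, (J j).α)) (hβ : ∀ j, K.Regular ((J j).i, (J j).β))
    (hα' : ∀ j, L.Regular ((J j).i, (J j).α)) (hβ' : ∀ j, L.Regular ((J j).i, (J j).β))
    (hcoef : ∀ p, (¬ ∃ j, (J j).MemInt p) → K.coef s p = L.coef s' p) :
    winding s C = winding s' C := by
  classical
  have hg0 : ∀ y ∈ disk φ, y ≠ C.N ∧ C.st y ≠ C.st K.leg ∧ C.st y ≠ C.st K.head := by
    intro y hy
    have h1 : ‖y‖ = 1 := by
      obtain ⟨x, -, rfl⟩ := hy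
      exact mem_sphere_zero_iff_norm.1 (φ x).2
    have h2 : y ≠ C.N := fun e => hN (e ▸ hy)
    refine ⟨h2, fun e => h.leg_notMem ?_, fun e => h.head_notMem ?_⟩
    · have := C.st_injOn h1 h2 (K.mem_sphere _ K.regular_leg.1) (hK _ K.regular_leg.1) e
      rwa [this] at hy
    · have := C.st_injOn h1 h2 (K.mem_sphere _ K.regular_head.1) (hK _ K.regular_head.1) e
      rwa [this] at hy
  have hstc : ContinuousOn C.st (disk φ) := by
    have h1 : ∀ e : E3, Continuous fun y : E3 => ((dot3 e y : ℝ) : ℂ) := fun e => by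
      unfold dot3; fun_prop
    have h2 : Continuous fun y : E3 => ((1 - dot3 C.N y : ℝ) : ℂ) := by
      unfold dot3; fun_prop
    refine ContinuousOn.div ((h1 C.e).add ((h1 C.f).mul continuous_const)).continuousOn
      h2.continuousOn fun y hy => ?_
    have hy1 : ‖y‖ = 1 := by
      obtain ⟨x, -, rfl⟩ := hy
      exact mem_sphere_zero_iff_norm.1 (φ x).2
    exact_mod_cast (C.denom_pos hy1 (hg0 y hy).1).ne'
  obtain ⟨l, hlc, hl⟩ := exists_log_on_disk φ
    (g := fun y => (C.st y - C.st K.head) / (C.st y - C.st K.leg))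
    ((hstc.sub continuousOn_const).div (hstc.sub continuousOn_const) fun y hy =>
      sub_ne_zero.2 (hg0 y hy).2.1)
    (fun y hy => div_ne_zero (sub_ne_zero.2 (hg0 y hy).2.2) (sub_ne_zero.2 (hg0 y hy).2.1))
  have split : ∀ {M : Diagram m} (s : M.State), M.Avoids C → winding s C =
      ∑ i, (∫ t in (0 : ℝ)..1, if ∃ j, (J j).Mem (i, t) then 0 else
        (M.coef s (i, t) : ℝ) * M.ang C (i, t)) +
      ∑ j, ∫ t in (J j).α..(J j).β, (M.coef s ((J j).i, t) : ℝ) * M.ang C ((J j).i, t) := by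
    intro M s hM
    refine Arc.sum_integral_split J h.disjoint (f := fun p => (M.coef s p : ℝ) * M.ang C p) ?_ ?_
    · intro p q hs
      simp only [coef_congr hs, ang_congr hs]
    · intro i a b ha hb
      exact intervalIntegrable_coef_mul_ang s hM ha hb
  -- Both integrals over the arcs are now expressed by the same logarithm at the ends, which the two
  -- diagrams share.
  rw [split s hK, split s' hL, h.sum_integral_arc s hK hlc hl hα hβ,
    h.symm.sum_integral_arc s' hL hlc (by rw [← h.leg_eq, ← h.head_eq]; exact hl) hα' hβ']
  congr 1
  · refine Finset.sum_congr rfl fun i _ => ?_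
    refine intervalIntegral.integral_congr_Ioo_of_le zero_le_one fun t ht => ?_
    split_ifs with hm
    · rfl
    have ho : t ∈ openDom i := fun _ => ht
    have hd := dom_of_openDom ho
    rw [hcoef _ (not_memInt_of_not_mem hm), ang, ang, h.leg_eq, h.head_eq,
      h.eq_outside _ hd (not_memInt_of_not_mem hm), h.vel_eq (hev _ hm) ho]
  · refine Finset.sum_congr rfl fun j _ => ?_
    have e := fun t => h.not_memInt_end (j := j) (t := t)
    rw [hcoef _ (e _ (Or.inl rfl)), hcoef _ (e _ (Or.inr rfl)),
      h.eq_outside _ (J j).dom_left (e _ (Or.inl rfl)), h.eq_outside _ (J j).dom_right (e _ (Or.inr rfl))]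

end CoincideOutside

end

section

variable {m : ℕ}

open Diagram

/-! ## Diagrams that coincide outside a disk -/

/-- Disjoint arcs with directions as a family of arcs. -/
def ArcFamily.ofArcs {n : ℕ} (J : Fin n → Arc m)
    (hJ : ∀ j j' p, (J j).Mem p → (J j').Mem p → j = j') (o : Fin n → ℤˣ) : ArcFamily m n where
  i j := (J j).i
  o := o
  lo j := if o j = 1 then (J j).α else -(J j).β
  hi j := if o j = 1 then (J j).β else -(J j).α
  lt j := by
    have := (J j).lt
    split_ifs
    · exact this
    · exact neg_lt_neg this
  dom j t ht := by
    rcases Int.units_eq_one_or (o j) with h | h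
    · rw [if_pos h, if_pos h] at ht
      rw [h]
      simpa using Arc.dom_of_mem_Icc ht
    · have h' : o j ≠ 1 := by rw [h]; decide
      rw [if_neg h', if_neg h'] at ht
      rw [h]
      simpa using Arc.dom_of_mem_Icc (J := J j) (t := -t) ⟨by linarith [ht.2], by linarith [ht.1]⟩
  inj := by
    have key : ∀ j, ∀ t ∈ Icc (if o j = 1 then (J j).α else -(J j).β)
        (if o j = 1 then (J j).β else -(J j).α), ((o j : ℤ) : ℝ) * t ∈ Icc (J j).α (J j).β := by
      intro j t ht
      rcases Int.units_eq_one_or (o j) with h | h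
      · rw [if_pos h, if_pos h] at ht
        simpa [h] using ht
      · have h' : o j ≠ 1 := by rw [h]; decide
        rw [if_neg h', if_neg h'] at ht
        rw [h]
        simp only [Units.val_neg, Units.val_one, Int.cast_neg, Int.cast_one, neg_mul, one_mul]
        exact ⟨by linarith [ht.2], by linarith [ht.1]⟩
    intro j j' t ht t' ht' h
    have h1 := key j t ht
    have h2 := key j' t' ht'
    obtain rfl := hJ j j' _ ⟨_, h1, .refl _⟩ ⟨_, h2, h.symm⟩
    have h3 := Arc.eq_of_samePoint h1 h2 h
    refine ⟨rfl, ?_⟩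
    have := unit_mul_self (o j)
    calc t = ((o j : ℤ) : ℝ) * ((o j : ℤ) : ℝ) * t := by rw [this, one_mul]
      _ = ((o j : ℤ) : ℝ) * ((o j : ℤ) : ℝ) * t' := by rw [mul_assoc, h3, mul_assoc]
      _ = t' := by rw [this, one_mul]

namespace ArcFamily

variable {n : ℕ} {J : Fin n → Arc m} {hJ : ∀ j j' p, (J j).Mem p → (J j').Mem p → j = j'}
  {o : Fin n → ℤˣ}

theorem mem_Icc_ofArcs {j : Fin n} {t : ℝ} : t ∈ Icc ((ofArcs J hJ o).lo j) ((ofArcs J hJ o).hi j) ↔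
    ((o j : ℤ) : ℝ) * t ∈ Icc (J j).α (J j).β := by
  simp only [ofArcs]
  rcases Int.units_eq_one_or (o j) with h | h
  · simp [h]
  · have h' : o j ≠ 1 := by rw [h]; decide
    rw [if_neg h', if_neg h', h]
    simp only [Units.val_neg, Units.val_one, Int.cast_neg, Int.cast_one, neg_mul, one_mul, mem_Icc]
    rw [neg_le, le_neg, and_comm]

theorem mem_Ioo_ofArcs {j : Fin n} {t : ℝ} : t ∈ Ioo ((ofArcs J hJ o).lo j) ((ofArcs J hJ o).hi j) ↔
    ((o j : ℤ) : ℝ) * t ∈ Ioo (J j).α (J j).β := by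
  simp only [ofArcs]
  rcases Int.units_eq_one_or (o j) with h | h
  · simp [h]
  · have h' : o j ≠ 1 := by rw [h]; decide
    rw [if_neg h', if_neg h', h]
    simp only [Units.val_neg, Units.val_one, Int.cast_neg, Int.cast_one, neg_mul, one_mul, mem_Ioo]
    rw [neg_lt, lt_neg, and_comm]

theorem mul_mul_unit (ε : ℤˣ) (t : ℝ) : ((ε : ℤ) : ℝ) * (((ε : ℤ) : ℝ) * t) = t := by
  rw [← mul_assoc, unit_mul_self, one_mul]

theorem mem_ofArcs {p : Param m} : (ofArcs J hJ o).Mem p ↔ ∃ j, (J j).Mem p := by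
  refine exists_congr fun j => ⟨fun ⟨t, ht, hs⟩ => ⟨_, mem_Icc_ofArcs.1 ht, hs⟩, fun ⟨t, ht, hs⟩ =>
    ⟨((o j : ℤ) : ℝ) * t, mem_Icc_ofArcs.2 (by rwa [mul_mul_unit]), ?_⟩⟩
  simp only [pt, ofArcs, mul_mul_unit]
  exact hs

theorem memInt_ofArcs {p : Param m} : (ofArcs J hJ o).MemInt p ↔ ∃ j, (J j).MemInt p := by
  refine exists_congr fun j => ⟨fun ⟨t, ht, hs⟩ => ⟨_, mem_Ioo_ofArcs.1 ht, hs⟩, fun ⟨t, ht, hs⟩ =>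
    ⟨((o j : ℤ) : ℝ) * t, mem_Ioo_ofArcs.2 (by rwa [mul_mul_unit]), ?_⟩⟩
  simp only [pt, ofArcs, mul_mul_unit]
  exact hs

end ArcFamily

theorem Tangle.regular_of_mem {n N : ℕ} {F : ArcFamily m n} {K : Diagram m} (T : Tangle F K N)
    {p : Param m} (h : F.Mem p) (h' : ¬ F.MemInt p) : K.Regular p := by
  obtain ⟨a, ha⟩ := Tangle.exists_end h h'
  exact (regular_congr ha).1 (T.regular_endPt a)

theorem isClosed_disk (φ : S2 ≃ₜ S2) : IsClosed (disk φ) := by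
  have h1 : IsClosed {x : S2 | 0 ≤ (x : E3) 2} := isClosed_le continuous_const (by fun_prop)
  have h2 : disk φ = (fun x : S2 => ((φ x : S2) : E3)) '' {x : S2 | 0 ≤ (x : E3) 2} := by
    ext y; rfl
  rw [h2]
  exact (h1.isCompact.image (continuous_subtype_val.comp φ.continuous)).isClosed

/-- The passage of `k_s` is generated by directed steps but saturated under moves in both
directions, hence it is a class of the quotient without reversals. -/
theorem Diagram.segmentPasses_iff_mk {K : Diagram m} {s : K.State} (x : K.RPoint) :
    K.SegmentPasses s x.1.1 x.1.2 ↔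
      Quot.mk (Move false s) ⟨((none, 0), 1), K.regular_leg⟩ = Quot.mk _ x := by
  constructor
  · intro h
    have key : ∀ y : Param m × ℤˣ, Relation.ReflTransGen (K.Step s) ((none, 0), 1) y →
        ∃ hy : K.Regular y.1, Quot.mk (Move false s) ⟨((none, 0), 1), K.regular_leg⟩ =
          Quot.mk _ ⟨y, hy⟩ := by
      intro y hy
      induction hy with
      | refl => exact ⟨K.regular_leg, rfl⟩
      | tail _ h ih =>
        obtain ⟨hy, e⟩ := ih
        have h1 := SameEdge.of_step h
        have h2 : K.Regular _ := h1.elim (fun h => h.2.right) fun h => h.regular_right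
        exact ⟨h2, e.trans (Quot.sound (Or.inl h1))⟩
    exact (key _ h).2
  · intro h
    have h1 := congrArg (Quot.lift (fun x : K.RPoint => K.SegmentPasses s x.1.1 x.1.2)
      fun x y h => propext (segmentPasses_iff_of_eqvGen (.rel _ _ (h.resolve_right fun h' =>
        Bool.false_ne_true h'.1)))) h
    exact (show K.SegmentPasses s (none, 0) 1 = K.SegmentPasses s x.1.1 x.1.2 from h1).mp
      (segmentPasses_leg s)

/-! ### Comparison of smoothings and intersection numbers outside the disk -/

namespace CoincideOutside

variable {K L : Diagram m} {n : ℕ} {J : Fin n → Arc m} {φ : S2 ≃ₜ S2}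

theorem refl (h : CoincideOutside K L J φ) : CoincideOutside K K J φ where
  disjoint := h.disjoint
  leg_notMem := h.leg_notMem
  head_notMem := h.head_notMem
  left_mem := h.left_mem
  right_mem := h.left_mem
  left_mem_int := h.left_mem_int
  right_mem_int := h.left_mem_int
  eq_outside _ _ _ := rfl
  over_outside _ _ _ := Iff.rfl

theorem eventually_not_mem (h : CoincideOutside K L J φ) {p : Param m} (hp : ¬ ∃ j, (J j).Mem p) :
    ∀ᶠ r in 𝓝 p.2, ¬ ∃ j, (J j).Mem (p.1, r) := by
  have := ArcFamily.eventually_not_mem (F := .ofArcs J h.disjoint 1) (p := p)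
    (by rwa [ArcFamily.mem_ofArcs])
  simpa only [ArcFamily.mem_ofArcs] using this

theorem openDom_of_double {K : Diagram m} {p : Param m} (h : K.Double p) : p.2 ∈ openDom p.1 := by
  obtain ⟨i, t⟩ := p
  intro hi
  simp only at hi
  subst hi
  exact h.mem_Ioo

/-- Near a crossing outside the disk both branches avoid the arcs, and there the two diagrams have
the same values, velocities and over/under data. -/
theorem sign_eq (h : CoincideOutside K L J φ) {c : K.Crossing} {c' : L.Crossing} (e : c.1 = c'.1)
    (hc : c.1 ∉ disk φ) : K.sign c = L.sign c' := by
  have key : ∀ {K L : Diagram m} (_ : CoincideOutside K L J φ) {x : E3} (_ : x ∉ disk φ),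
      (∃ p q, Meet K.γ p q ∧ K.γ p = x ∧ K.isOver p ∧ 0 < det3 (K.γ p) (vel K.γ p) (vel K.γ q)) →
      ∃ p q, Meet L.γ p q ∧ L.γ p = x ∧ L.isOver p ∧ 0 < det3 (L.γ p) (vel L.γ p) (vel L.γ q) := by
    rintro K L h x hx ⟨p, q, hm, rfl, ho, hpos⟩
    have hp : ¬ ∃ j, (J j).Mem p := fun hp => hx ((h.left_mem p hm.1).2 hp)
    have hq : ¬ ∃ j, (J j).Mem q := fun hq => hx (by rw [hm.2.2.2]; exact (h.left_mem q hm.2.1).2 hq)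
    have e := h.eq_outside p hm.1 (not_memInt_of_not_mem hp)
    refine ⟨p, q, (h.meet_iff hp).1 hm, e.symm, (h.over_outside p hp ⟨q, hm⟩).1 ho, ?_⟩
    rwa [← e, ← h.vel_eq (h.eventually_not_mem hp) (openDom_of_double ⟨q, hm⟩),
      ← h.vel_eq (h.eventually_not_mem hq) (openDom_of_double ⟨p, meet_symm hm⟩)]
  have hiff := Iff.intro (key h hc) (key h.symm hc)
  classical
  unfold sign
  rw [← e]
  exact if_congr hiff rfl rfl

variable {N N' : ℕ} {o : Fin n → ℤˣ}

/-- Points of the arcs that are not interior are ends of arcs, and ends are regular in both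
diagrams; off the arcs the double points are the same. -/
theorem double_iff (h : CoincideOutside K L J φ) (T : Tangle (.ofArcs J h.disjoint o) K N)
    (T' : Tangle (.ofArcs J h.disjoint o) L N') {p : Param m} (hp : ¬ ∃ j, (J j).MemInt p) : K.Double p ↔ L.Double p := by
  by_cases hm : ∃ j, (J j).Mem p
  · rw [← ArcFamily.mem_ofArcs (hJ := h.disjoint) (o := o)] at hm
    rw [← ArcFamily.memInt_ofArcs (hJ := h.disjoint) (o := o)] at hp
    exact iff_of_false (T.regular_of_mem hm hp).2 (T'.regular_of_mem hm hp).2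
  · exact exists_congr fun q => h.meet_iff hm

theorem regular_iff (h : CoincideOutside K L J φ) (T : Tangle (.ofArcs J h.disjoint o) K N)
    (T' : Tangle (.ofArcs J h.disjoint o) L N') {p : Param m} :
    (K.Regular p ∧ ¬ (ArcFamily.ofArcs J h.disjoint o).MemInt p) ↔
    (L.Regular p ∧ ¬ (ArcFamily.ofArcs J h.disjoint o).MemInt p) := by
  refine and_congr_left fun hp => and_congr_right fun _ => not_congr ?_
  rw [ArcFamily.memInt_ofArcs] at hp
  exact h.double_iff T T' hp

/-- The points outside the arcs are the same for the two diagrams. -/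
def outPointEquiv (h : CoincideOutside K L J φ) (T : Tangle (.ofArcs J h.disjoint o) K N)
    (T' : Tangle (.ofArcs J h.disjoint o) L N') :
    OutPoint (.ofArcs J h.disjoint o) K ≃ OutPoint (.ofArcs J h.disjoint o) L :=
  Equiv.subtypeEquivRight fun _ => h.regular_iff T T'

/-- The states coincide at the crossings outside the disk. -/
def StatesAgree (φ : S2 ≃ₜ S2) (s : K.State) (s' : L.State) : Prop :=
  ∀ (c : K.Crossing) (c' : L.Crossing), c.1 = c'.1 → c.1 ∉ disk φ → s c = s' c'

theorem approach_iff (h : CoincideOutside K L J φ) (T : Tangle (.ofArcs J h.disjoint o) K N)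
    (T' : Tangle (.ofArcs J h.disjoint o) L N') {p p' : Param m} {ε : ℤˣ} (hp : K.Approach p' ε p)
    (hm : ∀ r ∈ uIcc p'.2 p.2, ¬ (ArcFamily.ofArcs J h.disjoint o).MemInt (p.1, r)) :
    L.Approach p' ε p := by
  obtain ⟨h1, h2, h3, h4⟩ := hp
  refine ⟨((h.regular_iff T T').1 ⟨h1, ?_⟩).1, h2, h3, fun t ht hne hd => h4 t ht hne ?_⟩
  · have := hm p'.2 left_mem_uIcc
    rwa [← h2] at this
  · have := hm t ht
    rw [ArcFamily.memInt_ofArcs] at this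
    exact (h.double_iff T T' this).2 hd

theorem outCross_of (h : CoincideOutside K L J φ) (T : Tangle (.ofArcs J h.disjoint o) K N)
    (T' : Tangle (.ofArcs J h.disjoint o) L N') {s : K.State} {s' : L.State}
    (hs : StatesAgree φ s s') {x y : Param m × ℤˣ}
    (hc : OutCross (.ofArcs J h.disjoint o) s x y) : OutCross (.ofArcs J h.disjoint o) s' x y := by
  obtain ⟨c, p, q, h1, h2, h3, h4, h5, h6, h7, h8, h9⟩ := hc
  have hp := h3
  rw [ArcFamily.mem_ofArcs] at hp
  have hm := (h.meet_iff hp).1 h1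
  have e : c.1 = L.γ p := by
    rw [← h2]; exact h.eq_outside p h1.1 (not_memInt_of_not_mem hp)
  have hcd : c.1 ∉ disk φ := by rw [← h2]; exact fun hd => hp ((h.left_mem p h1.1).1 hd)
  refine ⟨⟨L.γ p, p, q, hm, rfl⟩, p, q, hm, rfl, h3, h4, ?_, h.approach_iff T T' h6 h8,
    h.approach_iff T T' h7 h9, h8, h9⟩
  rw [h5, hs c ⟨L.γ p, p, q, hm, rfl⟩ e hcd, h.sign_eq (c' := ⟨L.γ p, p, q, hm, rfl⟩) e hcd]

theorem StatesAgree.symm {s : K.State} {s' : L.State} (hs : StatesAgree φ s s') :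
    StatesAgree φ s' s := fun c c' e hc => (hs c' c e.symm (e ▸ hc)).symm

theorem outMove_iff (h : CoincideOutside K L J φ) (T : Tangle (.ofArcs J h.disjoint o) K N)
    (T' : Tangle (.ofArcs J h.disjoint o) L N') {s : K.State} {s' : L.State}
    (hs : StatesAgree φ s s') {out : TEnd n → TEnd n} {b : Bool}
    (x y : OutPoint (.ofArcs J h.disjoint o) K) :
    OutMove (.ofArcs J h.disjoint o) s out b x y ↔
      OutMove (.ofArcs J h.disjoint o) s' out b (h.outPointEquiv T T' x) (h.outPointEquiv T T' y) := by
  refine or_congr (and_congr Iff.rfl ?_) (or_congr ⟨h.outCross_of T T' hs, h.symm.outCross_of T' T hs.symm⟩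
    Iff.rfl)
  exact exists_congr fun t => and_congr Iff.rfl (forall₂_congr fun r _ => h.regular_iff T T')

/-- The components outside the arcs are the same for the two diagrams. -/
def quotOutMoveEquiv (h : CoincideOutside K L J φ) (T : Tangle (.ofArcs J h.disjoint o) K N)
    (T' : Tangle (.ofArcs J h.disjoint o) L N') {s : K.State} {s' : L.State}
    (hs : StatesAgree φ s s') (out : TEnd n → TEnd n) (b : Bool) :
    Quot (OutMove (.ofArcs J h.disjoint o) s out b) ≃ Quot (OutMove (.ofArcs J h.disjoint o) s' out b) :=
  Quot.congr (h.outPointEquiv T T') fun x y => h.outMove_iff T T' hs x y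

theorem segmentPasses_iff_out (h : CoincideOutside K L J φ) (T : Tangle (.ofArcs J h.disjoint o) K N)
    {s : K.State} {tw lab} {out : TEnd n → TEnd n} (hE : Exits T.π tw lab out)
    (htw : ∀ x, sg (tw x) = s (T.crossing x) * K.sign (T.crossing x) * (o x.1 * o (T.π x).1))
    (x : OutPoint (.ofArcs J h.disjoint o) K) : K.SegmentPasses s x.1.1 x.1.2 ↔
      Quot.mk (OutMove (.ofArcs J h.disjoint o) s out false) ⟨((none, 0), 1), K.regular_leg, fun hm =>
        not_memInt_of_not_mem h.not_mem_leg (ArcFamily.memInt_ofArcs.1 hm)⟩ = Quot.mk _ x := by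
  rw [← Tangle.mk_move_eq_iff hE htw]
  exact segmentPasses_iff_mk (OutPoint.toRPoint x)

/-- On the outer points, `k_s` is the class of the leg for the outer moves. As the two smoothed
tangles join the ends in the same way `out`, these classes correspond to each other. -/
theorem coef_eq (h : CoincideOutside K L J φ) (T : Tangle (.ofArcs J h.disjoint o) K N)
    (T' : Tangle (.ofArcs J h.disjoint o) L N') {s : K.State} {s' : L.State}
    (hs : StatesAgree φ s s') {tw lab tw' lab'} {out : TEnd n → TEnd n} (hE : Exits T.π tw lab out)
    (htw : ∀ x, sg (tw x) = s (T.crossing x) * K.sign (T.crossing x) * (o x.1 * o (T.π x).1))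
    (hE' : Exits T'.π tw' lab' out)
    (htw' : ∀ x, sg (tw' x) = s' (T'.crossing x) * L.sign (T'.crossing x) * (o x.1 * o (T'.π x).1))
    {p : Param m} (hp : ¬ ∃ j, (J j).MemInt p) : K.coef s p = L.coef s' p := by
  rw [← ArcFamily.memInt_ofArcs (hJ := h.disjoint) (o := o)] at hp
  have key : ∀ ε, K.SegmentPasses s p ε ↔ L.SegmentPasses s' p ε := by
    intro ε
    by_cases hr : K.Regular p
    · have hr' := (h.regular_iff T T').1 ⟨hr, hp⟩
      rw [h.segmentPasses_iff_out T hE htw ⟨(p, ε), hr, hp⟩,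
        h.symm.segmentPasses_iff_out T' hE' htw' ⟨(p, ε), hr'⟩,
        ← (h.quotOutMoveEquiv T T' hs out false).apply_eq_iff_eq]
      rfl
    · have hr' : ¬ L.Regular p := fun hr' => hr ((h.regular_iff T T').2 ⟨hr', hp⟩).1
      exact iff_of_false (fun hh => hr (segmentPasses_regular hh)) fun hh => hr' (segmentPasses_regular hh)
  simp only [coef, mult, key]

theorem exists_chart (h : CoincideOutside K L J φ) (a : K.Shortcut) (b : L.Shortcut) : ∃ C : Chart,
    K.Avoids C ∧ L.Avoids C ∧ C.N ∉ disk φ ∧ (∀ t, a.a t ≠ C.N) ∧ ∀ t, b.a t ≠ C.N := by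
  obtain ⟨N, hN, hU, hc⟩ := exists_point_avoiding
    (fun i : (Option (Fin m) ⊕ Option (Fin m)) ⊕ Bool => Sum.elim (Sum.elim (fun i t => K.γ (i, t))
      (fun i t => L.γ (i, t))) (fun β => if β then a.a else b.a) i)
    (by rintro ((i | i) | β)
        · exact K.smooth i
        · exact L.smooth i
        · cases β
          · exact b.smooth
          · exact a.smooth) (isClosed_disk φ).isOpen_compl (K.mem_sphere _ K.regular_leg.1) h.leg_notMem
  obtain ⟨C, rfl⟩ := Knotoid.exists_chart hN
  exact ⟨C, fun p _ => hc (Sum.inl (Sum.inl p.1)) p.2, fun p _ => hc (Sum.inl (Sum.inr p.1)) p.2, hU,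
    hc (Sum.inr true), hc (Sum.inr false)⟩

/-- The intersection number with a shortcut depends only on the diagram outside the disk and on the
connections inside the disk. -/
theorem stateInter_eq (h : CoincideOutside K L J φ) (T : Tangle (.ofArcs J h.disjoint o) K N)
    (T' : Tangle (.ofArcs J h.disjoint o) L N') {s : K.State} {s' : L.State}
    (hs : StatesAgree φ s s') {tw lab tw' lab'} {out : TEnd n → TEnd n} (hE : Exits T.π tw lab out)
    (htw : ∀ x, sg (tw x) = s (T.crossing x) * K.sign (T.crossing x) * (o x.1 * o (T.π x).1))
    (hE' : Exits T'.π tw' lab' out)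
    (htw' : ∀ x, sg (tw' x) = s' (T'.crossing x) * L.sign (T'.crossing x) * (o x.1 * o (T'.π x).1))
    (a : K.Shortcut) (b : L.Shortcut) :
    a.stateInter s - a.diagramInter = b.stateInter s' - b.diagramInter := by
  obtain ⟨C, hK, hL, hN, ha, hb⟩ := h.exists_chart a b
  have hreg : ∀ {M : Diagram m} {N : ℕ} (_ : Tangle (.ofArcs J h.disjoint o) M N) j t,
      (t = (J j).α ∨ t = (J j).β) → M.Regular ((J j).i, t) := by
    intro M N T j t ht
    refine T.regular_of_mem ?_ ?_
    · rw [ArcFamily.mem_ofArcs]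
      refine ⟨j, Arc.mem_of_mem_Icc ?_⟩
      rcases ht with rfl | rfl
      · exact ⟨le_rfl, (J j).lt.le⟩
      · exact ⟨(J j).lt.le, le_rfl⟩
    · rw [ArcFamily.memInt_ofArcs]
      exact h.not_memInt_end ht
  have hw := h.winding_eq (s := s) (s' := s') hK hL hN (fun p hp => h.eventually_not_mem hp)
    (fun j => hreg T j _ (Or.inl rfl)) (fun j => hreg T j _ (Or.inr rfl))
    (fun j => hreg T' j _ (Or.inl rfl)) (fun j => hreg T' j _ (Or.inr rfl))
    (fun p hp => h.coef_eq T T' hs hE htw hE' htw' hp)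
  rw [Diagram.winding_eq a s hK fun t _ => ha t, Diagram.winding_eq b s' hL fun t _ => hb t] at hw
  have hw := mul_left_cancel₀ Real.two_pi_pos.ne' hw
  have : a.diagramInter - a.stateInter s = b.diagramInter - b.stateInter s' := by exact_mod_cast hw
  linarith

end CoincideOutside

end

section

variable {m : ℕ}

open Diagram

/-! ## The state sum -/

/-- The combinatorial structure of a tangle with `r` crossings, and the components of its
smoothings. The smoothing `t` respects the directions of the arcs at the crossing `k` iff `t k`. -/
structure Scheme (n N r : ℕ) where
  π : Slot n N → Slot n N
  rep : Fin r → Slot n N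
  idx : Slot n N → Fin r
  lab : (Fin r → Bool) → Node n N → Option (TEnd n)
  out : (Fin r → Bool) → TEnd n → TEnd n
  π_π : ∀ w, π (π w) = w
  idx_rep : ∀ k, idx (rep k) = k
  idx_π : ∀ w, idx (π w) = idx w
  rep_idx : ∀ w, w = rep (idx w) ∨ w = π (rep (idx w))
  exits : ∀ t, Exits π (fun w => t (idx w)) (lab t) (out t)

open Classical in
/-- The number of closed components of a smoothing. -/
def Scheme.loops {n N r : ℕ} (S : Scheme n N r) (t : Fin r → Bool) : ℕ :=
  if ∃ v, S.lab t v = none then 1 else 0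

/-- The value of a closed component. -/
def loopValue : LaurentAU :=
  -((A ^ (2 : ℤ) : LaurentAUˣ) : LaurentAU) - ((A ^ (-2 : ℤ) : LaurentAUˣ) : LaurentAU)

/-- The state sum of a tangle; `η k` is the sign of the crossing `k` with respect to the directions of
the arcs. -/
def Scheme.stateSum {n N r : ℕ} (S : Scheme n N r) (η : Fin r → ℤˣ)
    (v : (TEnd n → TEnd n) → LaurentAU) : LaurentAU :=
  ∑ t : Fin r → Bool, ((A ^ (∑ k, ((sg (t k) * η k : ℤˣ) : ℤ)) : LaurentAUˣ) : LaurentAU) *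
    (loopValue ^ S.loops t * v (S.out t))

/-- Booleans as signs. -/
def signEquiv (η : ℤˣ) : Bool ≃ ℤˣ := Equiv.ofBijective (fun b => sg b * η)
  ⟨fun a b h => sg_eq_iff.1 (mul_right_cancel h), fun ε => by
    obtain ⟨e, he⟩ := exists_sg_mul ε η; exact ⟨e, he.symm⟩⟩

namespace Tangle

variable {n N r : ℕ} {F : ArcFamily m n} {K : Diagram m}

theorem crossing_π (T : Tangle F K N) (w : Slot n N) : T.crossing (T.π w) = T.crossing w :=
  Subtype.ext (T.meet w).2.2.2.symm

theorem eq_or_eq_of_crossing_eq (T : Tangle F K N) {w w' : Slot n N}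
    (h : T.crossing w = T.crossing w') : w' = w ∨ w' = T.π w := by
  have key : ∀ {w w' : Slot n N}, SamePoint (F.pt w.1 (T.br w)) (F.pt w'.1 (T.br w')) → w' = w := by
    rintro ⟨j, k⟩ ⟨j', k'⟩ h
    obtain ⟨rfl, h2⟩ := F.inj _ _ _ (b_mem (T := T) _ _) _ (b_mem (T := T) _ _) h
    have := (T.mono j).injective h2
    simp only [Fin.castSucc_inj, Fin.succ_inj] at this
    rw [this]
  have h1 : K.γ (F.pt w.1 (T.br w)) = K.γ (F.pt w'.1 (T.br w')) := congrArg Subtype.val h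
  rcases samePoint_or_of_γ_eq (T.meet w) (F.dom _ _ (b_mem (T := T) _ _)) h1.symm with h2 | h2
  · exact Or.inl (key h2)
  · exact Or.inr (key h2)

/-- The sign of a crossing with respect to the directions of the arcs. -/
def relSign (T : Tangle F K N) (w : Slot n N) : ℤˣ :=
  K.sign (T.crossing w) * (F.o w.1 * F.o (T.π w).1)

end Tangle

/-- The crossings outside a disk. -/
abbrev OuterCrossing (K : Diagram m) (φ : S2 ≃ₜ S2) : Type := {c : K.Crossing // c.1 ∉ disk φ}

instance (K : Diagram m) (φ : S2 ≃ₜ S2) : Fintype (OuterCrossing K φ) := Fintype.ofFinite _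

instance (K : Diagram m) (φ : S2 ≃ₜ S2) : DecidableEq (OuterCrossing K φ) := Classical.decEq _

/-! ### Separation of the state sum into the outside and the inside of the disk -/

namespace CoincideOutside

variable {K L M : Diagram m} {n : ℕ} {J : Fin n → Arc m} {φ : S2 ≃ₜ S2} {N r : ℕ} {o : Fin n → ℤˣ}

theorem crossing_mem (h : CoincideOutside K M J φ) (T : Tangle (.ofArcs J h.disjoint o) M N)
    (w : Slot n N) : (T.crossing w).1 ∈ disk φ := by
  refine (h.right_mem _ ((ArcFamily.ofArcs J h.disjoint o).dom _ _ (Tangle.b_mem (T := T) _ _))).2 ?_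
  rw [← ArcFamily.mem_ofArcs (hJ := h.disjoint) (o := o)]
  exact ⟨_, _, Tangle.b_mem (T := T) _ _, .refl _⟩

/-- The crossing of `M` at a crossing of `K` outside the disk. -/
def outerCrossing (h : CoincideOutside K M J φ) (c : OuterCrossing K φ) : M.Crossing :=
  ⟨c.1.1, by
    obtain ⟨⟨_, p, q, hm, rfl⟩, hd⟩ := c
    have hp : ¬ ∃ j, (J j).Mem p := fun hp => hd ((h.left_mem p hm.1).2 hp)
    exact ⟨p, q, (h.meet_iff hp).1 hm, (h.eq_outside p hm.1 (not_memInt_of_not_mem hp)).symm⟩⟩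

/-- The crossings outside and inside the disk. -/
def crossingEquiv (h : CoincideOutside K M J φ) (T : Tangle (.ofArcs J h.disjoint o) M N)
    (S : Scheme n N r) (hS : T.π = S.π) : OuterCrossing K φ ⊕ Fin r ≃ M.Crossing :=
  Equiv.ofBijective (Sum.elim h.outerCrossing fun k => T.crossing (S.rep k)) (by
    constructor
    · rintro (c | k) (c' | k') e
      · exact congrArg _ (Subtype.ext (Subtype.ext (congrArg (fun c : M.Crossing => c.1) e)))
      · have e : h.outerCrossing c = T.crossing (S.rep k') := e
        have h1 := h.crossing_mem T (S.rep k')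
        rw [← e] at h1
        exact absurd h1 c.2
      · have e : T.crossing (S.rep k) = h.outerCrossing c' := e
        have h1 := h.crossing_mem T (S.rep k)
        rw [e] at h1
        exact absurd h1 c'.2
      · have h1 := T.eq_or_eq_of_crossing_eq (w := S.rep k) (w' := S.rep k') e
        rw [hS] at h1
        have h2 : S.idx (S.rep k') = S.idx (S.rep k) := by
          rcases h1 with h1 | h1
          · rw [h1]
          · rw [h1, S.idx_π]
        rw [S.idx_rep, S.idx_rep] at h2
        rw [h2]
    · intro c
      by_cases hc : c.1 ∈ disk φ
      · obtain ⟨_, p, q, hm, rfl⟩ := c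
        have hp := (h.right_mem p hm.1).1 hc
        rw [← ArcFamily.mem_ofArcs (hJ := h.disjoint) (o := o)] at hp
        obtain ⟨w, -, -, e⟩ := Tangle.exists_slot (T := T) hm hp
        refine ⟨Sum.inr (S.idx w), Subtype.ext ?_⟩
        change (T.crossing (S.rep (S.idx w))).1 = M.γ p
        rw [e]
        rcases S.rep_idx w with h1 | h1
        · rw [← h1]
        · conv_rhs => rw [h1]
          rw [← hS, T.crossing_π]
      · obtain ⟨_, p, q, hm, rfl⟩ := c
        have hp : ¬ ∃ j, (J j).Mem p := fun hp => hc ((h.right_mem p hm.1).2 hp)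
        exact ⟨Sum.inl ⟨⟨M.γ p, p, q, (h.meet_iff hp).2 hm,
          h.eq_outside p hm.1 (not_memInt_of_not_mem hp)⟩, hc⟩, rfl⟩)

theorem crossingEquiv_inl (h : CoincideOutside K M J φ) (T : Tangle (.ofArcs J h.disjoint o) M N)
    (S : Scheme n N r) (hS : T.π = S.π) (c : OuterCrossing K φ) :
    h.crossingEquiv T S hS (.inl c) = h.outerCrossing c := rfl

theorem crossingEquiv_inr (h : CoincideOutside K M J φ) (T : Tangle (.ofArcs J h.disjoint o) M N)
    (S : Scheme n N r) (hS : T.π = S.π) (k : Fin r) :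
    h.crossingEquiv T S hS (.inr k) = T.crossing (S.rep k) := rfl

/-- States as pairs of states outside and inside the disk. -/
def stateEquiv (h : CoincideOutside K M J φ) (T : Tangle (.ofArcs J h.disjoint o) M N)
    (S : Scheme n N r) (hS : T.π = S.π) :
    (OuterCrossing K φ → ℤˣ) × (Fin r → Bool) ≃ M.State :=
  ((Equiv.refl _).prodCongr (Equiv.piCongrRight fun k => signEquiv (T.relSign (S.rep k)))).trans
    ((Equiv.sumArrowEquivProdArrow _ _ _).symm.trans
      (Equiv.arrowCongr (h.crossingEquiv T S hS) (Equiv.refl _)))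

theorem stateEquiv_outer (h : CoincideOutside K M J φ) (T : Tangle (.ofArcs J h.disjoint o) M N)
    (S : Scheme n N r) (hS : T.π = S.π) (x) (c : OuterCrossing K φ) :
    h.stateEquiv T S hS x (h.outerCrossing c) = x.1 c := by
  rw [← h.crossingEquiv_inl T S hS]
  simp [stateEquiv, Equiv.arrowCongr, Equiv.sumArrowEquivProdArrow]

theorem stateEquiv_crossing (h : CoincideOutside K M J φ) (T : Tangle (.ofArcs J h.disjoint o) M N)
    (S : Scheme n N r) (hS : T.π = S.π) (x) (k : Fin r) :
    h.stateEquiv T S hS x (T.crossing (S.rep k)) = sg (x.2 k) * T.relSign (S.rep k) := by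
  rw [← h.crossingEquiv_inr T S hS]
  simp [stateEquiv, Equiv.arrowCongr, Equiv.sumArrowEquivProdArrow]
  rfl

/-- Both places of a crossing see the same twist, because the product of the directions of the two
arcs is symmetric; so the representative place suffices. -/
theorem sg_eq_stateEquiv (h : CoincideOutside K M J φ) (T : Tangle (.ofArcs J h.disjoint o) M N)
    (S : Scheme n N r) (hS : T.π = S.π) (x) (w : Slot n N) :
    sg (x.2 (S.idx w)) = h.stateEquiv T S hS x (T.crossing w) * M.sign (T.crossing w) *
      (o w.1 * o (T.π w).1) := by
  have h1 : sg (x.2 (S.idx w)) = h.stateEquiv T S hS x (T.crossing (S.rep (S.idx w))) *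
      T.relSign (S.rep (S.idx w)) := by
    rw [stateEquiv_crossing, mul_assoc, Int.units_mul_self, mul_one]
  rw [h1, mul_assoc]
  rcases S.rep_idx w with e | e
  · rw [← e]; rfl
  · have e1 : T.crossing w = T.crossing (S.rep (S.idx w)) := by
      conv_lhs => rw [e]
      rw [← hS, T.crossing_π]
    have e2 : T.π w = S.rep (S.idx w) := by
      conv_lhs => rw [e]
      rw [hS, S.π_π]
    rw [e1, e2, Tangle.relSign]
    have e3 : T.π (S.rep (S.idx w)) = w := by rw [hS]; exact e.symm
    rw [e3, mul_comm (o w.1)]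
    rfl

theorem sum_crossing (h : CoincideOutside K M J φ) (T : Tangle (.ofArcs J h.disjoint o) M N)
    (S : Scheme n N r) (hS : T.π = S.π) (f : M.Crossing → ℤ) :
    ∑ c, f c = ∑ c : OuterCrossing K φ, f (h.outerCrossing c) +
      ∑ k, f (T.crossing (S.rep k)) := by
  rw [← Equiv.sum_comp (h.crossingEquiv T S hS), Fintype.sum_sum_type]
  rfl

theorem statesAgree_stateEquiv {N' r' : ℕ} {L M : Diagram m} (hL : CoincideOutside K L J φ)
    (T : Tangle (.ofArcs J hL.disjoint o) L N) (S : Scheme n N r) (hS : T.π = S.π)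
    (hM : CoincideOutside K M J φ) (T' : Tangle (.ofArcs J hM.disjoint o) M N') (S' : Scheme n N' r')
    (hS' : T'.π = S'.π) {x y} (hxy : x.1 = y.1) :
    StatesAgree φ (hL.stateEquiv T S hS x) (hM.stateEquiv T' S' hS' y) := by
  intro c c' e hc
  obtain ⟨c0, rfl⟩ : ∃ c0, c = hL.outerCrossing c0 := by
    obtain ⟨c0 | k, rfl⟩ := (hL.crossingEquiv T S hS).surjective c
    · exact ⟨c0, rfl⟩
    · exact absurd (hL.crossing_mem T _) hc
  obtain rfl : c' = hM.outerCrossing c0 := Subtype.ext e.symm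
  rw [stateEquiv_outer, stateEquiv_outer, hxy]

/-- The contribution of the components outside the disk. -/
def outerValue (h : CoincideOutside K M J φ) (T : Tangle (.ofArcs J h.disjoint o) M N)
    (S : Scheme n N r) (hS : T.π = S.π) (a : M.Shortcut)
    (x : (OuterCrossing K φ → ℤˣ) × (Fin r → Bool)) : LaurentAU :=
  ((u ^ (a.stateInter (h.stateEquiv T S hS x) - a.diagramInter) : LaurentAUˣ) : LaurentAU) *
    loopValue ^ (Nat.card (Quot (OutMove (.ofArcs J h.disjoint o) (h.stateEquiv T S hS x)
      (S.out x.2) true)) - 1)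

theorem exits_of_scheme {T : Tangle (.ofArcs J h o) M N} {S : Scheme n N r} (hS : T.π = S.π)
    (t : Fin r → Bool) : Exits T.π (fun w => t (S.idx w)) (S.lab t) (S.out t) := hS ▸ S.exits t

/-- The inner state enters only through `out`: the power of `u` by `stateInter_eq`, the number of
outer components by the identification of the outer moves. -/
theorem outerValue_eq {N' r' : ℕ} {L M : Diagram m} (hL : CoincideOutside K L J φ)
    (T : Tangle (.ofArcs J hL.disjoint o) L N) (S : Scheme n N r) (hS : T.π = S.π)
    (hM : CoincideOutside K M J φ) (T' : Tangle (.ofArcs J hM.disjoint o) M N') (S' : Scheme n N' r')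
    (hS' : T'.π = S'.π) (hLM : CoincideOutside L M J φ) (a : L.Shortcut) (b : M.Shortcut) {x y}
    (hxy : x.1 = y.1) (hout : S.out x.2 = S'.out y.2) :
    hL.outerValue T S hS a x = hM.outerValue T' S' hS' b y := by
  have hs := statesAgree_stateEquiv hL T S hS hM T' S' hS' hxy
  have hE' := exits_of_scheme hS' y.2
  rw [← hout] at hE'
  rw [outerValue, outerValue, ← hout, hLM.stateInter_eq T T' hs (exits_of_scheme hS x.2)
    (hL.sg_eq_stateEquiv T S hS x) hE' (hM.sg_eq_stateEquiv T' S' hS' y) a b,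
    Nat.card_congr (hLM.quotOutMoveEquiv T T' hs (S.out x.2) true)]

/-- The writhe, the sum `σ_s` and the number of components each split into an outer and an inner
contribution, so the factors multiply. -/
theorem extendedBracket_eq_outerValue (h : CoincideOutside K M J φ)
    (T : Tangle (.ofArcs J h.disjoint o) M N) (S : Scheme n N r) (hS : T.π = S.π) (a : M.Shortcut) :
    extendedBracket M a = (((-(A ^ 3)) ^ (-∑ c : OuterCrossing K φ, (K.sign c.1 : ℤ)) : LaurentAUˣ) : LaurentAU) *
      ∑ so : OuterCrossing K φ → ℤˣ,
        ((A ^ ∑ c, (so c : ℤ) : LaurentAUˣ) : LaurentAU) *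
        ((((-(A ^ 3)) ^ (-∑ k, (M.sign (T.crossing (S.rep k)) : ℤ)) : LaurentAUˣ) : LaurentAU) *
        ∑ t : Fin r → Bool, ((A ^ (∑ k, ((sg (t k) * T.relSign (S.rep k) : ℤˣ) : ℤ)) : LaurentAUˣ) :
          LaurentAU) * (loopValue ^ S.loops t * h.outerValue T S hS a (so, t))) := by
  have hw : M.writhe = ∑ c : OuterCrossing K φ, (K.sign c.1 : ℤ) +
      ∑ k, (M.sign (T.crossing (S.rep k)) : ℤ) := by
    rw [Diagram.writhe, h.sum_crossing T S hS]
    congr 1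
    refine Finset.sum_congr rfl fun c _ => ?_
    rw [h.sign_eq (c := c.1) (c' := h.outerCrossing c) rfl c.2]
  have h1 : ∀ f : M.State → LaurentAU, ∑ s, f s = ∑ so : OuterCrossing K φ → ℤˣ,
      ∑ t : Fin r → Bool, f (h.stateEquiv T S hS (so, t)) := fun f => by
    rw [← Equiv.sum_comp (h.stateEquiv T S hS), Fintype.sum_prod_type]
  rw [Knotoid.extendedBracket_eq, hw, neg_add, zpow_add, Units.val_mul, mul_assoc, h1, Finset.mul_sum]
  congr 1
  refine Finset.sum_congr rfl fun so _ => ?_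
  simp only [Finset.mul_sum]
  refine Finset.sum_congr rfl fun t _ => ?_
  have hσ : M.sigma (h.stateEquiv T S hS (so, t)) = ∑ c, (so c : ℤ) +
      ∑ k, ((sg (t k) * T.relSign (S.rep k) : ℤˣ) : ℤ) := by
    rw [Diagram.sigma, h.sum_crossing T S hS]
    simp only [stateEquiv_outer, stateEquiv_crossing]
  have hE := exits_of_scheme (T := T) hS t
  have htw := h.sg_eq_stateEquiv T S hS (so, t)
  have hfin := Tangle.finite_quot_outMove (b := true) hE htw
  -- The class of the leg is an outer component, so the truncated subtraction of `1` can be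
  -- performed on the outer count.
  have hpos : 0 < Nat.card (Quot (OutMove (.ofArcs J h.disjoint o) (h.stateEquiv T S hS (so, t))
      (S.out t) true)) := by
    have : Nonempty (Quot (OutMove (.ofArcs J h.disjoint o) (h.stateEquiv T S hS (so, t))
      (S.out t) true)) := ⟨Quot.mk _ ⟨((none, 0), 1), M.regular_leg, fun hm =>
        not_memInt_of_not_mem h.not_mem_leg (ArcFamily.memInt_ofArcs.1 hm)⟩⟩
    exact Nat.card_pos
  have hN : M.numComponents (h.stateEquiv T S hS (so, t)) - 1 = S.loops t +
      (Nat.card (Quot (OutMove (.ofArcs J h.disjoint o) (h.stateEquiv T S hS (so, t))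
      (S.out t) true)) - 1) := by
    rw [numComponents_eq, Tangle.card_quot_move hE htw, Scheme.loops]
    omega
  rw [hσ, hN, outerValue, zpow_add, Units.val_mul, Units.val_mul, ← loopValue, pow_add]
  ring

/-- Diagrams that coincide outside a disk and have the same state sums inside the disk have the same
bracket. -/
theorem extendedBracket_eq {N' r' : ℕ} (h : CoincideOutside K L J φ)
    (T : Tangle (.ofArcs J h.disjoint o) K N) (S : Scheme n N r) (hS : T.π = S.π)
    (T' : Tangle (.ofArcs J h.disjoint o) L N') (S' : Scheme n N' r') (hS' : T'.π = S'.π)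
    (hsum : ∀ v, (((-(A ^ 3)) ^ (-∑ k, (K.sign (T.crossing (S.rep k)) : ℤ)) : LaurentAUˣ) : LaurentAU) *
      S.stateSum (fun k => T.relSign (S.rep k)) v =
      (((-(A ^ 3)) ^ (-∑ k, (L.sign (T'.crossing (S'.rep k)) : ℤ)) : LaurentAUˣ) : LaurentAU) *
      S'.stateSum (fun k => T'.relSign (S'.rep k)) v)
    (a : K.Shortcut) (b : L.Shortcut) : extendedBracket K a = extendedBracket L b := by
  rw [h.refl.extendedBracket_eq_outerValue T S hS, h.extendedBracket_eq_outerValue T' S' hS']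
  congr 1
  refine Finset.sum_congr rfl fun so _ => ?_
  congr 1
  set f : (Fin r → Bool) ⊕ (Fin r' → Bool) → TEnd n → TEnd n := Sum.elim S.out S'.out with hf
  set g : (Fin r → Bool) ⊕ (Fin r' → Bool) → LaurentAU :=
    Sum.elim (fun t => h.refl.outerValue T S hS a (so, t)) (fun t => h.outerValue T' S' hS' b (so, t))
    with hg
  -- The outer values of both diagrams depend on the joining of ends only. Extended by `0` to the
  -- joinings that do not occur, they form one weight `v`, to which the local identity `hsum`
  -- applies.
  have hfg : Function.FactorsThrough g f := by
    rintro (t | t) (t' | t') e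
    · exact outerValue_eq h.refl T S hS h.refl T S hS h.refl a a rfl e
    · exact outerValue_eq h.refl T S hS h T' S' hS' h a b rfl e
    · exact (outerValue_eq h.refl T S hS h T' S' hS' h a b (x := (so, t')) (y := (so, t)) rfl
        e.symm).symm
    · exact outerValue_eq h T' S' hS' h T' S' hS' h.symm.refl b b rfl e
  have h1 : ∀ t, h.refl.outerValue T S hS a (so, t) = Function.extend f g 0 (S.out t) := fun t =>
    (hfg.extend_apply 0 (Sum.inl t)).symm
  have h2 : ∀ t, h.outerValue T' S' hS' b (so, t) = Function.extend f g 0 (S'.out t) := fun t =>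
    (hfg.extend_apply 0 (Sum.inr t)).symm
  simp only [h1, h2]
  exact hsum _

end CoincideOutside

end

section

variable {m : ℕ}

open Diagram

/-! ## Computation of state sums -/

namespace Node

variable {n N : ℕ}

/-- The piece following the given piece in a smoothed tangle, if there is one. -/
def next (π : Slot n N → Slot n N) (tw : Slot n N → Bool) (x : Node n N) : Option (Node n N) :=
  if x.2.2 then
    if h : x.2.1.1 < N then
      some (leave (π (x.1, ⟨x.2.1.1, h⟩)) (true == tw (x.1, ⟨x.2.1.1, h⟩)))
    else none
  else
    -- Moving backwards from the piece `k` one meets the place `k - 1`; the condition `0 < k` guards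
    -- the truncated subtraction.
    if h : x.2.1.1 - 1 < N ∧ 0 < x.2.1.1 then
      some (leave (π (x.1, ⟨x.2.1.1 - 1, h.1⟩)) (false == tw (x.1, ⟨x.2.1.1 - 1, h.1⟩)))
    else none

/-- The end reached from the given piece by at most `f` steps. -/
def exitEnd (π : Slot n N → Slot n N) (tw : Slot n N → Bool) : ℕ → Node n N → Option (TEnd n)
  | 0, _ => none
  | f + 1, x => match next π tw x with
    | none => some (x.1, x.2.2)
    | some y => exitEnd π tw f y

/-- The piece `y` or its reverse is reached from `x` by at most `f` steps. -/
def reaches (π : Slot n N → Slot n N) (tw : Slot n N → Bool) : ℕ → Node n N → Node n N → Bool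
  | 0, _, _ => false
  | f + 1, x, y => decide (x = y) || decide (x.flip = y) || match next π tw x with
    | none => false
    | some z => reaches π tw f z y

variable {π : Slot n N → Slot n N} {tw : Slot n N → Bool}

theorem exists_of_next {x y : Node n N} (h : next π tw x = some y) :
    ∃ w e, x = arrive w e ∧ y = leave (π w) (e == tw w) := by
  obtain ⟨j, k, e⟩ := x
  cases e
  · simp only [next, Bool.false_eq_true, if_false] at h
    split_ifs at h with hk
    refine ⟨(j, ⟨k.1 - 1, hk.1⟩), false, ?_, (Option.some.inj h).symm⟩
    simp only [arrive, Bool.false_eq_true, if_false, Prod.mk.injEq, true_and, and_true]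
    apply Fin.ext
    simp only [Fin.val_succ]
    omega
  · simp only [next, if_true] at h
    split_ifs at h with hk
    exact ⟨(j, ⟨k.1, hk⟩), true, rfl, (Option.some.inj h).symm⟩

theorem eq_out_of_next {x : Node n N} (h : next π tw x = none) : x = out (x.1, x.2.2) := by
  obtain ⟨j, k, e⟩ := x
  cases e
  · simp only [next, Bool.false_eq_true, if_false] at h
    split_ifs at h with hk
    simp only [out, Bool.false_eq_true, if_false, Prod.mk.injEq, true_and, and_true]
    have := k.2
    apply Fin.ext
    simp only [Fin.val_zero]
    omega
  · simp only [next, if_true] at h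
    split_ifs at h with hk
    simp only [out, if_true, Prod.mk.injEq, true_and, and_true]
    have := k.2
    apply Fin.ext
    simp only [Fin.val_last]
    omega

theorem eqvGen_of_exitEnd (f : ℕ) {x : Node n N} {a : TEnd n} (h : exitEnd π tw f x = some a) :
    Relation.EqvGen (fun y z => ∃ w e, y = arrive w e ∧ z = leave (π w) (e == tw w)) x (out a) := by
  induction f generalizing x with
  | zero => cases h
  | succ f ih =>
    rw [exitEnd] at h
    cases hx : next π tw x with
    | none =>
      rw [hx] at h
      obtain rfl := Option.some.inj h
      rw [← eq_out_of_next hx]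
      exact .refl _
    | some y =>
      rw [hx] at h
      exact .trans _ _ _ (.rel _ _ (exists_of_next hx)) (ih h)

theorem eqvGen_of_reaches (f : ℕ) {x y : Node n N} (h : reaches π tw f x y = true) :
    Relation.EqvGen (fun y z => (∃ w e, y = arrive w e ∧ z = leave (π w) (e == tw w)) ∨ z = y.flip)
      x y := by
  induction f generalizing x with
  | zero => cases h
  | succ f ih =>
    rw [reaches, Bool.or_eq_true, Bool.or_eq_true, decide_eq_true_eq, decide_eq_true_eq] at h
    rcases h with (rfl | rfl) | h
    · exact .refl _
    · exact .rel _ _ (Or.inr rfl)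
    · cases hx : next π tw x with
      | none => rw [hx] at h; cases h
      | some z =>
        rw [hx] at h
        exact .trans _ _ _ (.rel _ _ (Or.inl (exists_of_next hx))) (ih h)

end Node

/-! ### The local pictures of the moves and their state sums -/

namespace Scheme

/-- The end joined to the end `a` in a smoothed tangle. -/
def joined {n N : ℕ} (π : Slot n N → Slot n N) (tw : Slot n N → Bool) (f : ℕ) (a : TEnd n) : TEnd n :=
  (Node.exitEnd π tw f (Node.out a).flip).getD a

/-- The scheme given by a pairing of places. -/
def ofPairing {n N r : ℕ} (f : ℕ) (π : Slot n N → Slot n N) (rep : Fin r → Slot n N)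
    (idx : Slot n N → Fin r) (π_π : ∀ w, π (π w) = w) (idx_rep : ∀ k, idx (rep k) = k)
    (idx_π : ∀ w, idx (π w) = idx w) (rep_idx : ∀ w, w = rep (idx w) ∨ w = π (rep (idx w)))
    (cross : ∀ t : Fin r → Bool, ∀ x e, Node.exitEnd π (fun w => t (idx w)) f (.arrive x e) =
      Node.exitEnd π (fun w => t (idx w)) f (.leave (π x) (e == t (idx x))))
    (exit : ∀ t : Fin r → Bool, ∀ a, Node.exitEnd π (fun w => t (idx w)) f (.out a) = some a)
    (flip : ∀ t : Fin r → Bool, ∀ x a, Node.exitEnd π (fun w => t (idx w)) f x = some a →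
      Node.exitEnd π (fun w => t (idx w)) f x.flip = some (joined π (fun w => t (idx w)) f a))
    (loop : ∀ t : Fin r → Bool, ∀ x y, Node.exitEnd π (fun w => t (idx w)) f x = none →
      Node.exitEnd π (fun w => t (idx w)) f y = none →
      Node.reaches π (fun w => t (idx w)) f x y = true) : Scheme n N r where
  π := π
  rep := rep
  idx := idx
  lab t := Node.exitEnd π (fun w => t (idx w)) f
  out t := joined π (fun w => t (idx w)) f
  π_π := π_π
  idx_rep := idx_rep
  idx_π := idx_π
  rep_idx := rep_idx
  exits t :=
    { cross := cross t
      exit := exit t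
      flip := flip t
      path := fun _ _ h => Node.eqvGen_of_exitEnd f h
      loop := fun x y hx hy => Node.eqvGen_of_reaches f (loop t x y hx hy) }

theorem loops_eq_one {n N r : ℕ} {S : Scheme n N r} {t : Fin r → Bool}
    (h : ∃ v, S.lab t v = none) : S.loops t = 1 := if_pos h

theorem loops_eq_zero {n N r : ℕ} {S : Scheme n N r} {t : Fin r → Bool}
    (h : ∀ v, S.lab t v ≠ none) : S.loops t = 0 := if_neg (not_exists.2 h)

/-- `n` arcs without crossings. -/
def trivial (n : ℕ) : Scheme n 0 0 where
  π := id
  rep k := k.elim0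
  idx w := w.2
  lab _ x := some (x.1, x.2.2)
  out _ a := (a.1, !a.2)
  π_π _ := rfl
  idx_rep k := k.elim0
  idx_π _ := rfl
  rep_idx w := w.2.elim0
  exits t :=
    { cross := fun x => x.2.elim0
      exit := fun _ => rfl
      flip := by
        rintro x a h
        obtain rfl := Option.some.inj h
        rfl
      path := by
        rintro ⟨j, k, e⟩ a h
        obtain rfl := Option.some.inj h
        have : k = 0 := Fin.fin_one_eq_zero k
        subst this
        have : (Node.out (j, e) : Node n 0) = (j, 0, e) := by cases e <;> rfl
        rw [this]
        exact .refl _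
      loop := fun x y h => by cases h }

/-- An arc with a self-crossing. -/
def curl : Scheme 1 2 1 :=
  -- There are `1 * 3 * 2 = 6` oriented pieces; with one step more than that, a path that has not
  -- left the tangle is closed. The bounds `13` and `19` of the schemes below arise in the same way.
  ofPairing 7 (fun w => (w.1, w.2.rev)) (fun _ => (0, 0)) (fun _ => 0) (by decide +kernel)
    (by decide +kernel) (by decide +kernel) (by decide +kernel) (by decide +kernel) (by decide +kernel)
    (by decide +kernel) (by decide +kernel)

/-- Two arcs with two crossings in the same order. -/
def clasp : Scheme 2 2 2 :=
  ofPairing 13 (fun w => (w.1.rev, w.2)) (fun k => (0, k)) (fun w => w.2) (by decide +kernel)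
    (by decide +kernel) (by decide +kernel) (by decide +kernel) (by decide +kernel) (by decide +kernel)
    (by decide +kernel) (by decide +kernel)

/-- Three arcs that meet pairwise in one crossing, each of them meeting the two other ones in the order
of their numbers. -/
def triangle : Scheme 3 2 3 :=
  ofPairing 19 (fun w => ![![(1, 0), (2, 0)], ![(0, 0), (2, 1)], ![(0, 1), (1, 1)]] w.1 w.2)
    ![(0, 0), (0, 1), (1, 1)] (fun w => ![![0, 1], ![0, 2], ![1, 2]] w.1 w.2) (by decide +kernel)
    (by decide +kernel) (by decide +kernel) (by decide +kernel) (by decide +kernel) (by decide +kernel)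
    (by decide +kernel) (by decide +kernel)

/-- Three arcs that meet pairwise in one crossing, each of them meeting the two other ones in the order
opposite to that of their numbers. -/
def oppositeTriangle : Scheme 3 2 3 :=
  ofPairing 19 (fun w => ![![(2, 1), (1, 1)], ![(2, 0), (0, 1)], ![(1, 0), (0, 0)]] w.1 w.2)
    ![(0, 1), (0, 0), (1, 0)] (fun w => ![![1, 0], ![2, 0], ![2, 1]] w.1 w.2) (by decide +kernel)
    (by decide +kernel) (by decide +kernel) (by decide +kernel) (by decide +kernel) (by decide +kernel)
    (by decide +kernel) (by decide +kernel)

theorem sum_fin_succ_bool {k : ℕ} (f : (Fin (k + 1) → Bool) → LaurentAU) :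
    ∑ t, f t = ∑ t : Fin k → Bool, f (Fin.cons true t) + ∑ t : Fin k → Bool, f (Fin.cons false t) := by
  rw [← Equiv.sum_comp (Fin.consEquiv fun _ => Bool), Fintype.sum_prod_type, Fintype.sum_bool]
  rfl

theorem sum_fin_zero_bool (f : (Fin 0 → Bool) → LaurentAU) : ∑ t, f t = f ![] := by
  rw [Fintype.sum_subsingleton _ ![]]

theorem stateSum_trivial {n : ℕ} (η v) : (trivial n).stateSum η v = v fun a => (a.1, !a.2) := by
  have h : (trivial n).loops ![] = 0 := loops_eq_zero fun v h => by cases h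
  rw [stateSum, sum_fin_zero_bool, h]
  simp [trivial]

/-- The contribution of a smoothing to the state sum. -/
def stateTerm {n N r : ℕ} (S : Scheme n N r) (η : Fin r → ℤˣ) (v : (TEnd n → TEnd n) → LaurentAU)
    (t : Fin r → Bool) : LaurentAU :=
  ((A ^ (∑ k, ((sg (t k) * η k : ℤˣ) : ℤ)) : LaurentAUˣ) : LaurentAU) *
    (loopValue ^ S.loops t * v (S.out t))

theorem stateTerm_eq {n N r l : ℕ} {S : Scheme n N r} {η : Fin r → ℤˣ}
    {v : (TEnd n → TEnd n) → LaurentAU} {t : Fin r → Bool} {σ : ℤ} {o : TEnd n → TEnd n}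
    (hσ : ∑ k, ((sg (t k) * η k : ℤˣ) : ℤ) = σ) (hl : S.loops t = l) (ho : S.out t = o) :
    S.stateTerm η v t = ((A ^ σ : LaurentAUˣ) : LaurentAU) * (loopValue ^ l * v o) := by
  rw [stateTerm, hσ, hl, ho]

theorem stateSum_one {n N : ℕ} (S : Scheme n N 1) (η v) :
    S.stateSum η v = S.stateTerm η v ![true] + S.stateTerm η v ![false] := by
  rw [stateSum, sum_fin_succ_bool, sum_fin_zero_bool, sum_fin_zero_bool]
  rfl

theorem stateSum_two {n N : ℕ} (S : Scheme n N 2) (η v) :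
    S.stateSum η v = S.stateTerm η v ![true, true] + S.stateTerm η v ![true, false] +
      (S.stateTerm η v ![false, true] + S.stateTerm η v ![false, false]) := by
  simp only [stateSum, sum_fin_succ_bool, sum_fin_zero_bool]
  rfl

theorem stateSum_three {n N : ℕ} (S : Scheme n N 3) (η v) :
    S.stateSum η v = S.stateTerm η v ![true, true, true] + S.stateTerm η v ![true, true, false] +
      (S.stateTerm η v ![true, false, true] + S.stateTerm η v ![true, false, false]) +
      (S.stateTerm η v ![false, true, true] + S.stateTerm η v ![false, true, false] +
      (S.stateTerm η v ![false, false, true] + S.stateTerm η v ![false, false, false])) := by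
  simp only [stateSum, sum_fin_succ_bool, sum_fin_zero_bool]
  rfl

theorem A_zpow_one : ((A ^ (1 : ℤ) : LaurentAUˣ) : LaurentAU) = (A : LaurentAU) := by rw [zpow_one]

theorem A_zpow_three : ((A ^ (3 : ℤ) : LaurentAUˣ) : LaurentAU) = (A : LaurentAU) ^ 3 := rfl

theorem A_zpow_neg_one : ((A ^ (-1 : ℤ) : LaurentAUˣ) : LaurentAU) = ((A⁻¹ : LaurentAUˣ) : LaurentAU) := by
  rw [zpow_neg_one]

theorem A_zpow_neg_three :
    ((A ^ (-3 : ℤ) : LaurentAUˣ) : LaurentAU) = ((A⁻¹ : LaurentAUˣ) : LaurentAU) ^ 3 := by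
  rw [zpow_neg, ← inv_zpow]; rfl

theorem loopValue_eq : loopValue = -(A : LaurentAU) ^ 2 - ((A⁻¹ : LaurentAUˣ) : LaurentAU) ^ 2 := by
  rw [loopValue, zpow_neg, ← inv_zpow]; rfl

/-- The smoothing that respects the direction splits off a closed component, the other one does not,
and both join the ends as the uncrossed arc does. The identity is `A^η (-A² - A⁻²) + A^{-η} =
-A^{3η}`. -/
theorem stateSum_curl (η : ℤˣ) (v) : curl.stateSum (fun _ => η) v =
    (((-(A ^ 3)) ^ (η : ℤ) : LaurentAUˣ) : LaurentAU) * v fun a => (a.1, !a.2) := by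
  have h0 : curl.loops ![true] = 1 := loops_eq_one (by decide +kernel)
  have h1 : curl.loops ![false] = 0 := loops_eq_zero (by decide +kernel)
  have e0 : curl.out ![true] = fun a => (a.1, !a.2) := by decide +kernel
  have e1 : curl.out ![false] = fun a => (a.1, !a.2) := by decide +kernel
  have hA := A.mul_inv
  rw [stateSum_one]
  rcases Int.units_eq_one_or η with rfl | rfl
  · rw [stateTerm_eq (σ := 1) (by decide) h0 e0, stateTerm_eq (σ := -1) (by decide) h1 e1, loopValue_eq,
      A_zpow_one, A_zpow_neg_one, Units.val_one, zpow_one, Units.val_neg, Units.val_pow_eq_pow_val]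
    generalize ((A⁻¹ : LaurentAUˣ) : LaurentAU) = Y at *
    linear_combination (-Y * v fun a => (a.1, !a.2)) * hA
  · have h3 : (((-(A ^ 3)) ^ (((-1 : ℤˣ) : ℤ)) : LaurentAUˣ) : LaurentAU) =
        -((A⁻¹ : LaurentAUˣ) : LaurentAU) ^ 3 := by
      rw [Units.val_neg, Units.val_one, zpow_neg_one, inv_neg, Units.val_neg, ← inv_pow,
        Units.val_pow_eq_pow_val]
    rw [stateTerm_eq (σ := -1) (by decide) h0 e0, stateTerm_eq (σ := 1) (by decide) h1 e1, loopValue_eq,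
      A_zpow_one, A_zpow_neg_one, h3]
    generalize ((A⁻¹ : LaurentAUˣ) : LaurentAU) = Y at *
    linear_combination (-(A : LaurentAU) * v fun a => (a.1, !a.2)) * hA

/-- Three of the four smoothings join the ends in the same way, with the weights `A²`, `A⁻²` and
`-A² - A⁻²`, the last one from a closed component; these cancel. The fourth joins the ends as two
uncrossed arcs do, with weight `1`. -/
theorem stateSum_clasp {η : Fin 2 → ℤˣ} (hη : η 1 = -η 0) (v) :
    clasp.stateSum η v = v fun a => (a.1, !a.2) := by
  obtain ⟨ε, rfl⟩ : ∃ ε, η = ![ε, -ε] := ⟨η 0, by ext k; fin_cases k <;> simp [hη]⟩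
  have h0 : clasp.loops ![true, true] = 0 := loops_eq_zero (by decide +kernel)
  have h1 : clasp.loops ![true, false] = 0 := loops_eq_zero (by decide +kernel)
  have h2 : clasp.loops ![false, true] = 0 := loops_eq_zero (by decide +kernel)
  have h3 : clasp.loops ![false, false] = 1 := loops_eq_one (by decide +kernel)
  have e0 : clasp.out ![true, true] = fun a => (a.1, !a.2) := by decide +kernel
  have e1 : clasp.out ![true, false] = fun a => (a.1.rev, a.2) := by decide +kernel
  have e2 : clasp.out ![false, true] = fun a => (a.1.rev, a.2) := by decide +kernel
  have e3 : clasp.out ![false, false] = fun a => (a.1.rev, a.2) := by decide +kernel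
  have hA := A.mul_inv
  rw [stateSum_two]
  rcases Int.units_eq_one_or ε with rfl | rfl
  · rw [stateTerm_eq (σ := 0) (by decide) h0 e0, stateTerm_eq (σ := 2) (by decide) h1 e1,
      stateTerm_eq (σ := -2) (by decide) h2 e2, stateTerm_eq (σ := 0) (by decide) h3 e3, zpow_zero,
      Units.val_one, loopValue]
    ring
  · rw [stateTerm_eq (σ := 0) (by decide) h0 e0, stateTerm_eq (σ := -2) (by decide) h1 e1,
      stateTerm_eq (σ := 2) (by decide) h2 e2, stateTerm_eq (σ := 0) (by decide) h3 e3, zpow_zero,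
      Units.val_one, loopValue]
    ring

/-- The states `ttt`, `tff`, `fft` have the same joinings and weights in both triangles. The states
`ttf`, `ftt`, `ftf`, `fff` of one triangle all join the ends as the single state `tft` of the other
one, which has weight `A^η`, and their weights add up to the same: `2 A^η + A^{-η} (-A² - A⁻²) +
A^{-3η} = A^η`. -/
theorem stateSum_triangle (η : ℤˣ) (v) :
    triangle.stateSum (fun _ => η) v = oppositeTriangle.stateSum (fun _ => η) v := by
  have lt0 : triangle.loops ![true, true, true] = 0 := loops_eq_zero (by decide +kernel)
  have lt1 : triangle.loops ![true, true, false] = 0 := loops_eq_zero (by decide +kernel)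
  have lt2 : triangle.loops ![true, false, true] = 0 := loops_eq_zero (by decide +kernel)
  have lt3 : triangle.loops ![true, false, false] = 0 := loops_eq_zero (by decide +kernel)
  have lt4 : triangle.loops ![false, true, true] = 0 := loops_eq_zero (by decide +kernel)
  have lt5 : triangle.loops ![false, true, false] = 1 := loops_eq_one (by decide +kernel)
  have lt6 : triangle.loops ![false, false, true] = 0 := loops_eq_zero (by decide +kernel)
  have lt7 : triangle.loops ![false, false, false] = 0 := loops_eq_zero (by decide +kernel)
  have lo0 : oppositeTriangle.loops ![true, true, true] = 0 := loops_eq_zero (by decide +kernel)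
  have lo1 : oppositeTriangle.loops ![true, true, false] = 0 := loops_eq_zero (by decide +kernel)
  have lo2 : oppositeTriangle.loops ![true, false, true] = 0 := loops_eq_zero (by decide +kernel)
  have lo3 : oppositeTriangle.loops ![true, false, false] = 0 := loops_eq_zero (by decide +kernel)
  have lo4 : oppositeTriangle.loops ![false, true, true] = 0 := loops_eq_zero (by decide +kernel)
  have lo5 : oppositeTriangle.loops ![false, true, false] = 1 := loops_eq_one (by decide +kernel)
  have lo6 : oppositeTriangle.loops ![false, false, true] = 0 := loops_eq_zero (by decide +kernel)
  have lo7 : oppositeTriangle.loops ![false, false, false] = 0 := loops_eq_zero (by decide +kernel)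
  have eo0 : oppositeTriangle.out ![true, true, true] = triangle.out ![true, true, true] := by decide +kernel
  have et2 : triangle.out ![true, false, true] = oppositeTriangle.out ![true, true, false] := by decide +kernel
  have eo2 : oppositeTriangle.out ![true, false, true] = triangle.out ![true, true, false] := by decide +kernel
  have eo3 : oppositeTriangle.out ![true, false, false] = triangle.out ![true, false, false] := by decide +kernel
  have et4 : triangle.out ![false, true, true] = triangle.out ![true, true, false] := by decide +kernel
  have eo4 : oppositeTriangle.out ![false, true, true] = oppositeTriangle.out ![true, true, false] := by decide +kernel
  have et5 : triangle.out ![false, true, false] = triangle.out ![true, true, false] := by decide +kernel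
  have eo5 : oppositeTriangle.out ![false, true, false] = oppositeTriangle.out ![true, true, false] := by decide +kernel
  have eo6 : oppositeTriangle.out ![false, false, true] = triangle.out ![false, false, true] := by decide +kernel
  have et7 : triangle.out ![false, false, false] = triangle.out ![true, true, false] := by decide +kernel
  have eo7 : oppositeTriangle.out ![false, false, false] = oppositeTriangle.out ![true, true, false] := by decide +kernel
  have hA := A.mul_inv
  rw [stateSum_three, stateSum_three]
  rcases Int.units_eq_one_or η with rfl | rfl
  · rw [stateTerm_eq (σ := 3) (by decide) lt0 rfl, stateTerm_eq (σ := 1) (by decide) lt1 rfl, stateTerm_eq (σ := 1) (by decide) lt2 et2, stateTerm_eq (σ := -1) (by decide) lt3 rfl, stateTerm_eq (σ := 1) (by decide) lt4 et4, stateTerm_eq (σ := -1) (by decide) lt5 et5, stateTerm_eq (σ := -1) (by decide) lt6 rfl, stateTerm_eq (σ := -3) (by decide) lt7 et7, stateTerm_eq (σ := 3) (by decide) lo0 eo0, stateTerm_eq (σ := 1) (by decide) lo1 rfl, stateTerm_eq (σ := 1) (by decide) lo2 eo2, stateTerm_eq (σ := -1) (by decide) lo3 eo3, stateTerm_eq (σ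 := 1) (by decide) lo4 eo4, stateTerm_eq (σ := -1) (by decide) lo5 eo5, stateTerm_eq (σ := -1) (by decide) lo6 eo6, stateTerm_eq (σ := -3) (by decide) lo7 eo7,
      A_zpow_three, A_zpow_one, A_zpow_neg_one, A_zpow_neg_three, loopValue_eq]
    generalize ((A⁻¹ : LaurentAUˣ) : LaurentAU) = Y at *
    generalize (A : LaurentAU) = X at *
    linear_combination (X * (v (oppositeTriangle.out ![true, true, false]) - v (triangle.out ![true, true, false]))) * hA
  · rw [stateTerm_eq (σ := -3) (by decide) lt0 rfl, stateTerm_eq (σ := -1) (by decide) lt1 rfl, stateTerm_eq (σ := -1) (by decide) lt2 et2, stateTerm_eq (σ := 1) (by decide) lt3 rfl, stateTerm_eq (σ := -1) (by decide) lt4 et4, stateTerm_eq (σ := 1) (by decide) lt5 et5, stateTerm_eq (σ := 1) (by decide) lt6 rfl, stateTerm_eq (σ := 3) (by decide) lt7 et7, stateTerm_eq (σ := -3) (by decide) lo0 eo0, stateTerm_eq (σ := -1) (by decide) lo1 rfl, stateTerm_eq (σ := -1) (by decide) lo2 eo2, stateTerm_eq (σ := 1) (by decide) lo3 eo3, stateTerm_eq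 (σ := -1) (by decide) lo4 eo4, stateTerm_eq (σ := 1) (by decide) lo5 eo5, stateTerm_eq (σ := 1) (by decide) lo6 eo6, stateTerm_eq (σ := 3) (by decide) lo7 eo7,
      A_zpow_three, A_zpow_one, A_zpow_neg_one, A_zpow_neg_three, loopValue_eq]
    generalize ((A⁻¹ : LaurentAUˣ) : LaurentAU) = Y at *
    generalize (A : LaurentAU) = X at *
    linear_combination (Y * (v (oppositeTriangle.out ![true, true, false]) - v (triangle.out ![true, true, false]))) * hA

end Scheme

end

section

variable {m : ℕ}

open Diagram

/-! ## Signs of crossings -/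

open Classical in
/-- The sign of a nonzero real number. -/
def unitSign (x : ℝ) : ℤˣ := if 0 < x then 1 else -1

theorem unitSign_congr {x y : ℝ} (h : 0 < x * y) : unitSign x = unitSign y := by
  unfold unitSign
  rcases pos_and_pos_or_neg_and_neg_of_mul_pos h with h | h
  · rw [if_pos h.1, if_pos h.2]
  · rw [if_neg h.1.not_gt, if_neg h.2.not_gt]

theorem unitSign_eq_neg {x y : ℝ} (h : x * y < 0) : unitSign y = -unitSign x := by
  unfold unitSign
  rcases mul_neg_iff.1 h with h | h
  · rw [if_pos h.1, if_neg h.2.not_gt]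
  · rw [if_neg h.1.not_gt, if_pos h.2, neg_neg]

theorem unitSign_mul (ε : ℤˣ) {x : ℝ} (hx : x ≠ 0) :
    unitSign (((ε : ℤ) : ℝ) * x) = unitSign x * ε := by
  rcases Int.units_eq_one_or ε with rfl | rfl
  · simp
  · rw [unitSign_eq_neg (x := x)]
    · simp
    · simpa using hx

theorem det3_swap (x v w : E3) : det3 x w v = -det3 x v w := by
  rw [det3_eq, det3_eq]; ring

/-- Up to the period only one ordered pair of parameters over a crossing has its overpassing branch
first, so the existential in `sign` is decided by the given pair. -/
theorem Diagram.sign_eq_unitSign {K : Diagram m} {p q : Param m} (h : Meet K.γ p q)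
    (ho : K.isOver p) {c : K.Crossing} (hc : K.γ p = c.1) :
    K.sign c = unitSign (det3 (K.γ p) (vel K.γ p) (vel K.γ q)) := by
  unfold sign unitSign
  congr 1
  refine propext ⟨?_, fun hd => ⟨p, q, h, hc, ho, hd⟩⟩
  rintro ⟨p', q', h', hc', ho', hd⟩
  have e : K.γ p' = K.γ p := hc'.trans hc.symm
  rcases samePoint_or_of_γ_eq h h'.1 e with hp | hp
  · have hq : SamePoint q q' := by
      rcases samePoint_or_of_γ_eq h h'.2.1 (h'.2.2.2.symm.trans e) with hq | hq
      · exact absurd (hp.symm.trans hq) h'.2.2.1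
      · exact hq
    rwa [vel_eq hp, vel_eq hq, ← e]
  · exact absurd ho' fun ho' => (K.over_iff p q h).1 ho ((isOver_iff hp).2 ho')

/-! ## Tangles in a disk -/

namespace Tangle

variable {K : Diagram m} {n : ℕ} {J : Fin n → Arc m}
  {hJ : ∀ j j' p, (J j).Mem p → (J j').Mem p → j = j'} {o : Fin n → ℤˣ}

/-- Arcs without crossings. -/
def uncrossed (hJ : ∀ j j' p, (J j).Mem p → (J j').Mem p → j = j') (o : Fin n → ℤˣ)
    (h : ∀ j p, (J j).Mem p → ¬ K.Double p) : Tangle (.ofArcs J hJ o) K 0 where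
  b j := ![(ArcFamily.ofArcs J hJ o).lo j, (ArcFamily.ofArcs J hJ o).hi j]
  mono j := by
    rw [Fin.strictMono_iff_lt_succ]
    intro k
    fin_cases k
    exact (ArcFamily.ofArcs J hJ o).lt j
  b_zero _ := rfl
  b_last _ := rfl
  π := id
  meet w := w.2.elim0
  only j t ht hd := by
    refine absurd hd (h j _ ⟨_, ArcFamily.mem_Icc_ofArcs.1 ht, ?_⟩)
    exact .refl _

/-- Arcs with two crossings each; `z j` are the parameters of the crossings on the arc `j`. -/
def ofArcs (z : Fin n → Fin 2 → ℝ) (hz : ∀ j k, z j k ∈ Ioo (J j).α (J j).β)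
    (hlt : ∀ j, ((o j : ℤ) : ℝ) * z j 0 < ((o j : ℤ) : ℝ) * z j 1) (π : Slot n 2 → Slot n 2)
    (meet : ∀ w, Meet K.γ ((J w.1).i, z w.1 w.2) ((J (π w).1).i, z (π w).1 (π w).2))
    (only : ∀ j p, (J j).Mem p → K.Double p → ∃ k, SamePoint ((J j).i, z j k) p) :
    Tangle (.ofArcs J hJ o) K 2 where
  b j := ![(ArcFamily.ofArcs J hJ o).lo j, ((o j : ℤ) : ℝ) * z j 0, ((o j : ℤ) : ℝ) * z j 1,
    (ArcFamily.ofArcs J hJ o).hi j]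
  mono j := by
    have hm : ∀ k, ((o j : ℤ) : ℝ) * z j k ∈
        Ioo ((ArcFamily.ofArcs J hJ o).lo j) ((ArcFamily.ofArcs J hJ o).hi j) := fun k => by
      rw [ArcFamily.mem_Ioo_ofArcs, ArcFamily.mul_mul_unit]
      exact hz j k
    rw [Fin.strictMono_iff_lt_succ]
    intro k
    fin_cases k
    · exact (hm 0).1
    · exact hlt j
    · exact (hm 1).2
  b_zero _ := rfl
  b_last _ := rfl
  π := π
  meet := by
    have e : ∀ w : Slot n 2, (ArcFamily.ofArcs J hJ o).pt w.1
        ((![(ArcFamily.ofArcs J hJ o).lo w.1, ((o w.1 : ℤ) : ℝ) * z w.1 0, ((o w.1 : ℤ) : ℝ) * z w.1 1,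
          (ArcFamily.ofArcs J hJ o).hi w.1] : Fin 4 → ℝ) w.2.succ.castSucc) =
        ((J w.1).i, z w.1 w.2) := by
      rintro ⟨j, k⟩
      refine Prod.ext rfl ?_
      fin_cases k
      · exact ArcFamily.mul_mul_unit _ _
      · exact ArcFamily.mul_mul_unit _ _
    intro w
    rw [e, e]
    exact meet w
  only j t ht hd := by
    have ht' := ArcFamily.mem_Icc_ofArcs.1 ht
    obtain ⟨k, hk⟩ := only j _ ⟨_, ht', .refl _⟩ hd
    have h1 : z j k = ((o j : ℤ) : ℝ) * t :=
      Arc.eq_of_samePoint (Ioo_subset_Icc_self (hz j k)) ht' hk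
    refine ⟨k, ?_⟩
    have h2 : t = ((o j : ℤ) : ℝ) * z j k := by rw [h1, ArcFamily.mul_mul_unit]
    fin_cases k
    · exact h2
    · exact h2

variable {z : Fin n → Fin 2 → ℝ} {hz : ∀ j k, z j k ∈ Ioo (J j).α (J j).β}
  {hlt : ∀ j, ((o j : ℤ) : ℝ) * z j 0 < ((o j : ℤ) : ℝ) * z j 1} {π : Slot n 2 → Slot n 2}
  {meet : ∀ w, Meet K.γ ((J w.1).i, z w.1 w.2) ((J (π w).1).i, z (π w).1 (π w).2)}
  {only : ∀ j p, (J j).Mem p → K.Double p → ∃ k, SamePoint ((J j).i, z j k) p}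

theorem sign_crossing_ofArcs (w : Slot n 2) (ho : K.isOver ((J w.1).i, z w.1 w.2)) :
    K.sign ((ofArcs (hJ := hJ) z hz hlt π meet only).crossing w) =
      unitSign (det3 (K.γ ((J w.1).i, z w.1 w.2)) (vel K.γ ((J w.1).i, z w.1 w.2))
        (vel K.γ ((J (π w).1).i, z (π w).1 (π w).2))) := by
  refine sign_eq_unitSign (meet w) ho (congrArg K.γ ?_)
  obtain ⟨j, k⟩ := w
  refine Prod.ext rfl ?_
  fin_cases k
  · exact (ArcFamily.mul_mul_unit _ _).symm
  · exact (ArcFamily.mul_mul_unit _ _).symm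

end Tangle

/-! ## Reidemeister moves -/

variable {K L : Diagram m}

/-- The factor `(-A³)^η` of the curl is cancelled by the contribution `η` of its crossing to the
writhe. -/
theorem extendedBracket_eq_of_omega1 (h : Omega1 K L) (a : K.Shortcut) (b : L.Shortcut) :
    extendedBracket K a = extendedBracket L b := by
  obtain ⟨J, φ, h, hK, x, y, hx, hy, hxy, hm, hL⟩ := h
  have hj : ∀ j : Fin 1, j = 0 := fun j => Fin.fin_one_eq_zero j
  let T : Tangle (.ofArcs J h.disjoint 1) K 0 := .uncrossed h.disjoint 1 fun j => by rw [hj j]; exact hK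
  let T' : Tangle (.ofArcs J h.disjoint 1) L 2 := .ofArcs (fun _ => ![x, y])
    (by intro j k; rw [hj j]; fin_cases k; exacts [hx, hy]) (by intro j; simpa using hxy) Scheme.curl.π
    (by
      rintro ⟨j, k⟩
      obtain rfl := hj j
      fin_cases k
      exacts [hm, meet_symm hm])
    (by
      intro j p hp hd
      obtain rfl := hj j
      rcases hL p hp hd with h | h
      exacts [⟨0, h⟩, ⟨1, h⟩])
  refine h.extendedBracket_eq (o := 1) T (Scheme.trivial 1) rfl T' Scheme.curl rfl (fun v => ?_) a b
  have h1 : (fun k => T'.relSign (Scheme.curl.rep k)) = fun _ => L.sign (T'.crossing (0, 0)) := by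
    funext k
    exact mul_one _
  have h2 : ∑ k, (L.sign (T'.crossing (Scheme.curl.rep k)) : ℤ) = L.sign (T'.crossing (0, 0)) :=
    Fin.sum_univ_one _
  rw [h1, h2, Scheme.stateSum_trivial, Scheme.stateSum_curl, ← mul_assoc, ← Units.val_mul,
    ← zpow_add]
  simp

theorem exists_unit_lt {x y : ℝ} (h : x ≠ y) : ∃ ε : ℤˣ, ((ε : ℤ) : ℝ) * x < ((ε : ℤ) : ℝ) * y := by
  rcases h.lt_or_gt with h | h
  · exact ⟨1, by simpa using h⟩
  · exact ⟨-1, by simpa using h⟩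

theorem extendedBracket_eq_of_omega2 (h : Omega2 K L) (a : K.Shortcut) (b : L.Shortcut) :
    extendedBracket K a = extendedBracket L b := by
  obtain ⟨J, φ, h, hK, x, y, hxy, hmx, hmy, hL, hox, hoy, hd⟩ := h
  -- Each arc is directed so that it meets the crossing `x` before `y`. Thus the same scheme serves
  -- for parallel and for opposite strands.
  choose o ho using fun j => exists_unit_lt (hxy j).2.2
  let T : Tangle (.ofArcs J h.disjoint o) K 0 := .uncrossed h.disjoint o hK
  let T' : Tangle (.ofArcs J h.disjoint o) L 2 := .ofArcs (fun j => ![x j, y j])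
    (by intro j k; fin_cases k; exacts [(hxy j).1, (hxy j).2.1]) ho Scheme.clasp.π
    (by
      rintro ⟨j, k⟩
      fin_cases j <;> fin_cases k
      exacts [hmx, hmy, meet_symm hmx, meet_symm hmy])
    (by
      intro j p hp hd
      rcases hL j p hp hd with h | h
      exacts [⟨0, h⟩, ⟨1, h⟩])
  refine h.extendedBracket_eq T (Scheme.trivial 2) rfl T' Scheme.clasp rfl (fun v => ?_) a b
  have h0 : L.sign (T'.crossing (0, 0)) = _ := Tangle.sign_crossing_ofArcs (0, 0) hox
  have h1 : L.sign (T'.crossing (0, 1)) = _ := Tangle.sign_crossing_ofArcs (0, 1) hoy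
  have h2 : L.sign (T'.crossing (0, 1)) = -L.sign (T'.crossing (0, 0)) := by
    rw [h0, h1]
    exact unitSign_eq_neg hd
  have h3 : ∑ k, (L.sign (T'.crossing (Scheme.clasp.rep k)) : ℤ) = 0 := by
    rw [Fin.sum_univ_two]
    change ((L.sign (T'.crossing (0, 0)) : ℤˣ) : ℤ) + ((L.sign (T'.crossing (0, 1)) : ℤˣ) : ℤ) = 0
    rw [h2, Units.val_neg, add_neg_cancel]
  rw [h3, Scheme.stateSum_trivial, Scheme.stateSum_clasp]
  · simp
  · change L.sign (T'.crossing (0, 1)) * (o 0 * o 1) = -(L.sign (T'.crossing (0, 0)) * (o 0 * o 1))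
    rw [h2, neg_mul]

/-- The two numbers different from the given one. -/
def others : Fin 3 → Fin 2 → Fin 3 := ![![1, 2], ![0, 2], ![0, 1]]

theorem others_ne (j k) : j ≠ others j k := by revert j k; decide

theorem others_zero_ne_one (j) : others j 0 ≠ others j 1 := by revert j; decide

theorem exists_others {j k : Fin 3} (h : k ≠ j) : ∃ l, k = others j l := by revert j k; decide

/-- The determinant of the directions at the crossing of two arcs. -/
def arcDet (K : Diagram m) (J : Fin 3 → Arc m) (x : Fin 3 → Fin 3 → ℝ) (j k : Fin 3) : ℝ :=
  det3 (K.γ ((J j).i, x j k)) (vel K.γ ((J j).i, x j k)) (vel K.γ ((J k).i, x k j))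

theorem TripleOfArcs.arcDet_ne_zero {J : Fin 3 → Arc m} {x : Fin 3 → Fin 3 → ℝ}
    (h : TripleOfArcs K J x) {j k : Fin 3} (hjk : j ≠ k) : arcDet K J x j k ≠ 0 :=
  K.transverse _ _ (h.meet j k hjk)

theorem TripleOfArcs.arcDet_swap {J : Fin 3 → Arc m} {x : Fin 3 → Fin 3 → ℝ} (h : TripleOfArcs K J x)
    {j k : Fin 3} (hjk : j ≠ k) : arcDet K J x k j = -arcDet K J x j k := by
  rw [arcDet, arcDet, ← (h.meet j k hjk).2.2.2, det3_swap]

theorem extendedBracket_eq_of_omega3 (h : Omega3 K L) (a : K.Shortcut) (b : L.Shortcut) :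
    extendedBracket K a = extendedBracket L b := by
  obtain ⟨J, φ, h, x, y, hK, hL, hxy, hd, ht1, ht2⟩ := h
  have hne : ∀ j, x j (others j 0) ≠ x j (others j 1) := by
    intro j e
    have := (hK.meet j (others j 0) (others_ne j 0))
    have h2 := (hK.meet j (others j 1) (others_ne j 1))
    rw [← e] at h2
    have h3 := K.no_triple _ _ _ this h2
    have h4 := h.disjoint (others j 0) (others j 1) _
      ⟨_, Ioo_subset_Icc_self (hK.mem _ _ (others_ne j 0).symm), h3⟩
      ⟨_, Ioo_subset_Icc_self (hK.mem _ _ (others_ne j 1).symm), .refl _⟩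
    exact others_zero_ne_one j h4
  -- Each arc is directed so that in `K` it meets the other two in the order of their numbers; in
  -- `L` it then meets them in the opposite order.
  choose o ho using fun j => exists_unit_lt (hne j)
  have ho' : ∀ j, ((o j : ℤ) : ℝ) * y j (others j 1) < ((o j : ℤ) : ℝ) * y j (others j 0) := by
    intro j
    have h1 := hxy j (others j 0) (others j 1) (others_ne j 0) (others_zero_ne_one j)
      (others_ne j 1).symm
    have h2 := hxy j (others j 1) (others j 0) (others_ne j 1) (others_zero_ne_one j).symm
      (others_ne j 0).symm
    have h3 := ho j
    rcases Int.units_eq_one_or (o j) with e | e <;> rw [e] at h3 ⊢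
    · simpa using h1.1 (by simpa using h3)
    · simpa using h2.1 (by simpa using h3)
  let T : Tangle (.ofArcs J h.disjoint o) K 2 := .ofArcs (fun j k => x j (others j k))
    (fun j k => hK.mem _ _ (others_ne j k)) ho Scheme.triangle.π
    (by
      rintro ⟨j, k⟩
      fin_cases j <;> fin_cases k
      exacts [hK.meet 0 1 (by decide), hK.meet 0 2 (by decide), hK.meet 1 0 (by decide),
        hK.meet 1 2 (by decide), hK.meet 2 0 (by decide), hK.meet 2 1 (by decide)])
    (by
      intro j p hp hd
      obtain ⟨k, hk, hs⟩ := hK.only j p hp hd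
      obtain ⟨l, rfl⟩ := exists_others hk
      exact ⟨l, hs⟩)
  let T' : Tangle (.ofArcs J h.disjoint o) L 2 := .ofArcs (fun j k => y j (others j k.rev))
    (fun j k => hL.mem _ _ (others_ne j _)) ho' Scheme.oppositeTriangle.π
    (by
      rintro ⟨j, k⟩
      fin_cases j <;> fin_cases k
      exacts [hL.meet 0 2 (by decide), hL.meet 0 1 (by decide), hL.meet 1 2 (by decide),
        hL.meet 1 0 (by decide), hL.meet 2 1 (by decide), hL.meet 2 0 (by decide)])
    (by
      intro j p hp hd
      obtain ⟨k, hk, hs⟩ := hL.only j p hp hd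
      obtain ⟨l, rfl⟩ := exists_others hk
      exact ⟨l.rev, by rwa [Fin.rev_rev]⟩)
  refine h.extendedBracket_eq T Scheme.triangle rfl T' Scheme.oppositeTriangle rfl (fun v => ?_) a b
  have k0 : K.sign (T.crossing (0, 0)) = unitSign (arcDet K J x 0 1) :=
    Tangle.sign_crossing_ofArcs (0, 0) (hK.isOver 0 1 (by decide))
  have k1 : K.sign (T.crossing (0, 1)) = unitSign (arcDet K J x 0 2) :=
    Tangle.sign_crossing_ofArcs (0, 1) (hK.isOver 0 2 (by decide))
  have k2 : K.sign (T.crossing (1, 1)) = unitSign (arcDet K J x 1 2) :=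
    Tangle.sign_crossing_ofArcs (1, 1) (hK.isOver 1 2 (by decide))
  have l0 : L.sign (T'.crossing (0, 1)) = unitSign (arcDet L J y 0 1) :=
    Tangle.sign_crossing_ofArcs (0, 1) (hL.isOver 0 1 (by decide))
  have l1 : L.sign (T'.crossing (0, 0)) = unitSign (arcDet L J y 0 2) :=
    Tangle.sign_crossing_ofArcs (0, 0) (hL.isOver 0 2 (by decide))
  have l2 : L.sign (T'.crossing (1, 0)) = unitSign (arcDet L J y 1 2) :=
    Tangle.sign_crossing_ofArcs (1, 0) (hL.isOver 1 2 (by decide))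
  have e0 : L.sign (T'.crossing (0, 1)) = K.sign (T.crossing (0, 0)) := by
    rw [k0, l0]; exact (unitSign_congr (hd 0 1 (by decide))).symm
  have e1 : L.sign (T'.crossing (0, 0)) = K.sign (T.crossing (0, 1)) := by
    rw [k1, l1]; exact (unitSign_congr (hd 0 2 (by decide))).symm
  have e2 : L.sign (T'.crossing (1, 0)) = K.sign (T.crossing (1, 1)) := by
    rw [k2, l2]; exact (unitSign_congr (hd 1 2 (by decide))).symm
  have hO := fun j => unit_mul_self (o j)
  have ha : ∀ j, 0 < ((o j : ℤ) : ℝ) * (x j (others j 1) - x j (others j 0)) := fun j => by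
    rw [mul_sub]; exact sub_pos.2 (ho j)
  have ha0 : 0 < ((o 0 : ℤ) : ℝ) * (x 0 2 - x 0 1) := ha 0
  have ha1 : 0 < ((o 1 : ℤ) : ℝ) * (x 1 2 - x 1 0) := ha 1
  have ha2 : 0 < ((o 2 : ℤ) : ℝ) * (x 2 1 - x 2 0) := ha 2
  have t1 : turn K J x 0 1 2 = (x 0 2 - x 0 1) * (x 2 1 - x 2 0) * arcDet K J x 0 2 := rfl
  have t2 : turn K J x 2 0 1 = (x 2 1 - x 2 0) * (x 1 0 - x 1 2) * arcDet K J x 2 1 := rfl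
  have t3 : turn K J x 1 2 0 = (x 1 0 - x 1 2) * (x 0 2 - x 0 1) * arcDet K J x 1 0 := rfl
  rw [t1, t2, hK.arcDet_swap (by decide : (1 : Fin 3) ≠ 2)] at ht1
  rw [t1, t3, hK.arcDet_swap (by decide : (0 : Fin 3) ≠ 1)] at ht2
  -- The condition that the triangle turns to the same side at all corners says that, relative to
  -- the chosen directions, its three crossings have equal signs. A single sign `η` therefore covers
  -- all versions of the move.
  have s1 : K.sign (T.crossing (0, 1)) * (o 0 * o 2) = K.sign (T.crossing (0, 0)) * (o 0 * o 1) := by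
    rw [k0, k1, ← unitSign_mul _ (hK.arcDet_ne_zero (by decide)),
      ← unitSign_mul _ (hK.arcDet_ne_zero (by decide))]
    refine unitSign_congr ((mul_pos_iff_of_pos_left (mul_pos (mul_pos ha0 ha0) (mul_pos ha1 ha2))).1 ?_)
    refine ht2.trans_eq (Eq.symm ?_)
    have h0 := hO 0
    have h1 := hO 1
    have h2 := hO 2
    push_cast
    generalize ((o 0 : ℤ) : ℝ) = O0 at *
    generalize ((o 1 : ℤ) : ℝ) = O1 at *
    generalize ((o 2 : ℤ) : ℝ) = O2 at *
    calc _ = (x 0 2 - x 0 1) ^ 2 * (x 1 2 - x 1 0) * (x 2 1 - x 2 0) * arcDet K J x 0 2 *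
          arcDet K J x 0 1 * ((O0 * O0) ^ 2 * (O1 * O1) * (O2 * O2)) := by ring
      _ = _ := by rw [h0, h1, h2]; ring
  have s2 : K.sign (T.crossing (1, 1)) * (o 1 * o 2) = K.sign (T.crossing (0, 1)) * (o 0 * o 2) := by
    rw [k1, k2, ← unitSign_mul _ (hK.arcDet_ne_zero (by decide)),
      ← unitSign_mul _ (hK.arcDet_ne_zero (by decide))]
    refine unitSign_congr ((mul_pos_iff_of_pos_left (mul_pos (mul_pos ha0 ha1) (mul_pos ha2 ha2))).1 ?_)
    refine ht1.trans_eq (Eq.symm ?_)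
    have h0 := hO 0
    have h1 := hO 1
    have h2 := hO 2
    push_cast
    generalize ((o 0 : ℤ) : ℝ) = O0 at *
    generalize ((o 1 : ℤ) : ℝ) = O1 at *
    generalize ((o 2 : ℤ) : ℝ) = O2 at *
    calc _ = (x 2 1 - x 2 0) ^ 2 * (x 1 2 - x 1 0) * (x 0 2 - x 0 1) * arcDet K J x 0 2 *
          arcDet K J x 1 2 * ((O2 * O2) ^ 2 * (O0 * O0) * (O1 * O1)) := by ring
      _ = _ := by rw [h0, h1, h2]; ring
  have r1 : (fun k => T.relSign (Scheme.triangle.rep k)) =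
      fun _ => K.sign (T.crossing (0, 0)) * (o 0 * o 1) := by
    funext k
    fin_cases k
    exacts [rfl, s1, s2.trans s1]
  have r2 : (fun k => T'.relSign (Scheme.oppositeTriangle.rep k)) =
      fun _ => K.sign (T.crossing (0, 0)) * (o 0 * o 1) := by
    funext k
    fin_cases k
    exacts [congrArg (· * (o 0 * o 1)) e0, (congrArg (· * (o 0 * o 2)) e1).trans s1,
      (congrArg (· * (o 1 * o 2)) e2).trans (s2.trans s1)]
  have r3 : ∑ k, (L.sign (T'.crossing (Scheme.oppositeTriangle.rep k)) : ℤ) =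
      ∑ k, (K.sign (T.crossing (Scheme.triangle.rep k)) : ℤ) := by
    refine Finset.sum_congr rfl fun k _ => congrArg Units.val ?_
    fin_cases k
    exacts [e0, e1, e2]
  rw [r1, r2, r3, Scheme.stateSum_triangle]

theorem extendedBracket_eq_of_equivalent (h : Equivalent K L) (a : K.Shortcut) (b : L.Shortcut) :
    extendedBracket K a = extendedBracket L b := by
  induction h with
  | rel K L h =>
    rcases h with h | h | h | h
    · exact extendedBracket_eq_of_isotopic h a b
    · exact extendedBracket_eq_of_omega1 h a b
    · exact extendedBracket_eq_of_omega2 h a b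
    · exact extendedBracket_eq_of_omega3 h a b
  | refl K => exact extendedBracket_congr K a b
  | symm K L _ ih => exact (ih b a).symm
  | trans K M L _ _ ih1 ih2 =>
    -- The intermediate diagram comes without a shortcut, and one is needed in order to speak of its
    -- bracket.
    obtain ⟨c⟩ := M.nonempty_shortcut
    exact (ih1 a c).trans (ih2 c b)

end

end Knotoid

end

theorem lemma7p1 (m : ℕ) :
    -- independence of the shortcut
    (∀ (K : Knotoid.Diagram m) (a b : K.Shortcut),
      Knotoid.extendedBracket K a = Knotoid.extendedBracket K b) ∧
    -- invariance under the Reidemeister moves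
    (∀ K L : Knotoid.Diagram m, Knotoid.ReidemeisterMove K L →
      ∀ (a : K.Shortcut) (b : L.Shortcut),
        Knotoid.extendedBracket K a = Knotoid.extendedBracket L b) ∧
    -- invariance of (multi-)knotoids
    (∀ K L : Knotoid.Diagram m, Knotoid.Equivalent K L →
      ∀ (a : K.Shortcut) (b : L.Shortcut),
        Knotoid.extendedBracket K a = Knotoid.extendedBracket L b) :=
  ⟨Knotoid.extendedBracket_congr,
    fun _ _ h => Knotoid.extendedBracket_eq_of_equivalent (.rel _ _ (.inr h)),
    fun _ _ h => Knotoid.extendedBracket_eq_of_equivalent h⟩
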